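/- **Conventions.** 2-categories are small and strict; composition is written in diagrammatic order as $f;g$. A *strict semi-monoidal 2-category* is a 2-category $C$ with a strict 2-functor $\otimes\colon C\times C\to C$ that is strictly associative (no unit is assumed); a *strict semi-monoidal 2-functor* is a strict 2-functor preserving $\otimes$ strictly. An *equiarrow* is an arrow with a pseudo-inverse; an *equi-2-functor* is a strict 2-functor that is surjective on objects up to equivalence and induces equivalences on all hom categories; a 2-category is *contractible* if its 2-functor to the terminal 2-category is an equi-2-functor. A *fair monoid in $\mathbf{2Cat}$* is a strict semi-monoidal 2-functor $J\colon U\to C$ with $U$ contractible and such that the multiplication maps $U\times C\to C\leftarrow C\times U$ are equi-2-functors. Two fair monoids are *equivalent* if they are connected by a zigzag of equimorphisms, i.e. of commutative squares of strict semi-monoidal 2-functors $U\to U'$, $C\to C'$ that are both equi-2-functors. A *weak unit* in $C$ (in the sense of Gordon–Power–Street) is $(I,\lambda,\rho,K)$: an object $I$; pseudo-natural families of equiarrows $\lambda_X\colon I\otimes X\to X$ and $\rho_X\colon X\otimes I\to X$; and an invertible modification $K_{X,Y}\colon\rho_X\otimes Y\Rightarrow X\otimes\lambda_Y$ satisfying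 the left and right normalised 4-cocycle conditions: there are invertible modifications $\Lambda_{Y,Z}\colon\lambda_{Y\otimes Z}\Rightarrow\lambda_Y\otimes Z$ and $P_{X,Y}\colon\rho_{X\otimes Y}\Rightarrow X\otimes\rho_Y$ such that $K_{X,Y\otimes Z}$ followed by $X\otimes\Lambda_{Y,Z}$ is $K_{X,Y}\otimes Z$, and $P_{X,Y}\otimes Z$ followed by $X\otimes K_{Y,Z}$ is $K_{X\otimes Y,Z}$. A monoidal equi-2-functor $(C,I,\lambda,\rho,K)\to(C',I',\lambda',\rho',K')$ is a strict semi-monoidal equi-2-functor $F\colon C\to C'$ with an equiarrow $\varphi\colon I'\to FI$ and invertible modifications $\gamma_X\colon\lambda'_{FX}\Rightarrow(\varphi\otimes FX);F\lambda_X$ and $\delta_X\colon\rho'_{FX}\Rightarrow(FX\otimes\varphi);F\rho_X$ such that $\delta_X\otimes FY$ followed by $(FX\otimes\varphi\otimes FY);FK_{X,Y}$ equals $K'_{FX,FY}$ followed by $FX\otimes\gamma_Y$. Two strict 2-categories with strict tensor product and weak unit are *equivalent* if they are connected by a zigzag of these. An *associator* for $\alpha\colon I\otimes I\to I$ is an invertible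 2-cell $A\colon I\otimes\alpha\Rightarrow\alpha\otimes I$ satisfying the pentagon equation, i.e. $A;\alpha\colon(I\otimes\alpha);\alpha\Rightarrow(\alpha\otimes I);\alpha$ satisfies the usual pentagon for the multiplication $\alpha$. A *left constraint* for $(I,\alpha)$ is a pseudo-natural $\lambda_X\colon I\otimes X\to X$ with an invertible modification $L_X\colon I\otimes\lambda_X\Rightarrow\alpha\otimes X$; a *right constraint* is a pseudo-natural $\rho_X\colon X\otimes I\to X$ with an invertible modification $R_X\colon\rho_X\otimes I\Rightarrow X\otimes\alpha$. A fair monoid $(U\to C)$ *induces* a weak unit $(I,\lambda,\rho,K)$ on $C$ if there are an object of $U$ with image $I$ and an arrow $\alpha\colon I\otimes I\to I$ in $U$ such that, for their images in $C$, $\lambda$ underlies a left constraint and $\rho$ a right constraint. **Proposition.** Fair monoids in $\mathbf{2Cat}$ correspond to strict 2-categories with a strict tensor product and a weak unit, in the following sense. 1. Let $(U\to C)$ be a fair monoid and $I$ an object of $U$. There is an arrow $\alpha\colon I\otimes I\to I$ in $U$. Every such $\alpha$ is an equiarrow, any two such are connected by a unique 2-cell and it is invertible, and $\alpha$ has a unique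 associator in $U$. For the images of $I$ and $\alpha$ in $C$: for each $X$ there are an arrow $\lambda_X\colon I\otimes X\to X$ and an invertible 2-cell $L_X\colon I\otimes\lambda_X\Rightarrow\alpha\otimes X$; for each choice of such $\lambda_X,L_X$ (all $X$), the $\lambda_X$ are equiarrows and there is a unique choice of naturality 2-cells making $(\lambda,L)$ a left constraint; and for two left constraints $(\lambda,L),(\lambda',L')$ there is a unique invertible modification $m\colon\lambda\Rightarrow\lambda'$ with $I\otimes m_X$ followed by $L'_X$ equal to $L_X$. The same holds, symmetrically, for right constraints. For every left constraint $(\lambda,L)$ and right constraint $(\rho,R)$ there is $K$ such that $(I,\lambda,\rho,K)$ is a weak unit on $C$. 2. Every fair monoid $(U\to C)$ induces a weak unit on $C$, and any two weak units that it induces are equivalent, by an equivalence with underlying 2-functor the identity of $C$. 3. There is a free strictly semi-monoidal 2-category $\mathbb F$ on an object $I$, an arrow $\alpha\colon I\otimes I\to I$ with a right adjoint $\beta$ with invertible unit $\eta$ and counit $\varepsilon$, and an associator $A$ for $\alpha$; it is contractible. Let $(I,\lambda,\rho,K)$ be a weak unit on a strict semi-monoidal 2-category $C$. Then $I\otimes-$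 and $-\otimes I$ are equi-2-functors, $\alpha:=\lambda_I$ has a unique associator $A$ in $C$, and $\alpha$ has a right adjoint $\beta$ with invertible unit and counit. For every choice of such $(I,\alpha,\beta,A,\eta,\varepsilon)$ in $C$, the strict semi-monoidal 2-functor $\mathbb F\to C$ interpreting the generators is a fair monoid; it induces the given weak unit, and it is equivalent to every fair monoid $(U\to C)$ that induces the given weak unit. 4. If the fair monoids $(U\to C)$ and $(U'\to C')$ induce weak units $W$ on $C$ and $W'$ on $C'$, then $(U\to C)$ and $(U'\to C')$ are equivalent if and only if $(C,W)$ and $(C',W')$ are equivalent. -/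

import Mathlib

set_option linter.unusedVariables false

universe u

/-! ## Strict 2-categories

A strict 2-category is presented by its sets of objects, arrows and 2-cells, so that strict
associativity of a tensor product is an honest equation between cells. All composites are written
in diagrammatic order. The three compositions are total functions for convenience only: every law,
and the preservation of composites by 2-functors, concerns composable cells only, so the values at
non-composable pairs carry no information. -/

/-- A (small) strict 2-category. `src`, `tgt` are the source and target objects of an arrow, `dom`
and `cod` the source and target arrows of a 2-cell; `one x` is the identity arrow of `x` and `two f`
the identity 2-cell of `f`; `vcomp` and `hcomp` are vertical and horizontal composition. -/
structure TwoCat : Type (u + 1) where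
  Ob : Type u
  Ar : Type u
  Cell : Type u
  src : Ar → Ob
  tgt : Ar → Ob
  dom : Cell → Ar
  cod : Cell → Ar
  one : Ob → Ar
  two : Ar → Cell
  comp : Ar → Ar → Ar
  vcomp : Cell → Cell → Cell
  hcomp : Cell → Cell → Cell
  src_cod : ∀ a, src (cod a) = src (dom a)
  tgt_cod : ∀ a, tgt (cod a) = tgt (dom a)
  src_one : ∀ x, src (one x) = x
  tgt_one : ∀ x, tgt (one x) = x
  src_comp : ∀ f g, tgt f = src g → src (comp f g) = src f
  tgt_comp : ∀ f g, tgt f = src g → tgt (comp f g) = tgt g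
  one_comp : ∀ f, comp (one (src f)) f = f
  comp_one : ∀ f, comp f (one (tgt f)) = f
  comp_assoc : ∀ f g h, tgt f = src g → tgt g = src h →
    comp (comp f g) h = comp f (comp g h)
  dom_two : ∀ f, dom (two f) = f
  cod_two : ∀ f, cod (two f) = f
  dom_vcomp : ∀ a b, cod a = dom b → dom (vcomp a b) = dom a
  cod_vcomp : ∀ a b, cod a = dom b → cod (vcomp a b) = cod b
  two_vcomp : ∀ a, vcomp (two (dom a)) a = a
  vcomp_two : ∀ a, vcomp a (two (cod a)) = a
  vcomp_assoc : ∀ a b c, cod a = dom b → cod b = dom c →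
    vcomp (vcomp a b) c = vcomp a (vcomp b c)
  dom_hcomp : ∀ a b, tgt (dom a) = src (dom b) → dom (hcomp a b) = comp (dom a) (dom b)
  cod_hcomp : ∀ a b, tgt (dom a) = src (dom b) → cod (hcomp a b) = comp (cod a) (cod b)
  one_hcomp : ∀ a, hcomp (two (one (src (dom a)))) a = a
  hcomp_one : ∀ a, hcomp a (two (one (tgt (dom a)))) = a
  hcomp_assoc : ∀ a b c, tgt (dom a) = src (dom b) → tgt (dom b) = src (dom c) →
    hcomp (hcomp a b) c = hcomp a (hcomp b c)
  hcomp_two : ∀ f g, tgt f = src g → hcomp (two f) (two g) = two (comp f g)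
  interchange : ∀ a a' b b', cod a = dom a' → cod b = dom b' → tgt (dom a) = src (dom b) →
    hcomp (vcomp a a') (vcomp b b') = vcomp (hcomp a b) (hcomp a' b')

namespace TwoCat

/-- `f` is an arrow from `x` to `y`. -/
def IsAr (C : TwoCat.{u}) (f : C.Ar) (x y : C.Ob) : Prop :=
  C.src f = x ∧ C.tgt f = y

/-- `a` is a 2-cell from `f` to `g`. -/
def IsCell (C : TwoCat.{u}) (a : C.Cell) (f g : C.Ar) : Prop :=
  C.dom a = f ∧ C.cod a = g

/-- The 2-cell `a` is invertible (for vertical composition). -/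
def IsInv (C : TwoCat.{u}) (a : C.Cell) : Prop :=
  ∃ b, C.IsCell b (C.cod a) (C.dom a) ∧
    C.vcomp a b = C.two (C.dom a) ∧ C.vcomp b a = C.two (C.cod a)

/-- The arrow `f` is an equiarrow: it admits a pseudo-inverse. -/
def IsEqui (C : TwoCat.{u}) (f : C.Ar) : Prop :=
  ∃ g, C.IsAr g (C.tgt f) (C.src f) ∧
    (∃ a, C.IsCell a (C.comp f g) (C.one (C.src f)) ∧ C.IsInv a) ∧
    (∃ b, C.IsCell b (C.comp g f) (C.one (C.tgt f)) ∧ C.IsInv b)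

/-- `α ⊣ β` with unit `η : 1 ⇒ α;β` and counit `ε : β;α ⇒ 1`. -/
structure IsAdjunction (C : TwoCat.{u}) (α β : C.Ar) (η ε : C.Cell) : Prop where
  right_ar : C.IsAr β (C.tgt α) (C.src α)
  unit_cell : C.IsCell η (C.one (C.src α)) (C.comp α β)
  counit_cell : C.IsCell ε (C.comp β α) (C.one (C.tgt α))
  left_triangle : C.vcomp (C.hcomp η (C.two α)) (C.hcomp (C.two α) ε) = C.two α
  right_triangle : C.vcomp (C.hcomp (C.two β) η) (C.hcomp ε (C.two β)) = C.two β

/-- The terminal 2-category. -/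
def point : TwoCat.{u} where
  Ob := PUnit
  Ar := PUnit
  Cell := PUnit
  src _ := ⟨⟩
  tgt _ := ⟨⟩
  dom _ := ⟨⟩
  cod _ := ⟨⟩
  one _ := ⟨⟩
  two _ := ⟨⟩
  comp _ _ := ⟨⟩
  vcomp _ _ := ⟨⟩
  hcomp _ _ := ⟨⟩
  src_cod _ := rfl
  tgt_cod _ := rfl
  src_one _ := rfl
  tgt_one _ := rfl
  src_comp _ _ _ := rfl
  tgt_comp _ _ _ := rfl
  one_comp _ := rfl
  comp_one _ := rfl
  comp_assoc _ _ _ _ _ := rfl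
  dom_two _ := rfl
  cod_two _ := rfl
  dom_vcomp _ _ _ := rfl
  cod_vcomp _ _ _ := rfl
  two_vcomp _ := rfl
  vcomp_two _ := rfl
  vcomp_assoc _ _ _ _ _ := rfl
  dom_hcomp _ _ _ := rfl
  cod_hcomp _ _ _ := rfl
  one_hcomp _ := rfl
  hcomp_one _ := rfl
  hcomp_assoc _ _ _ _ _ := rfl
  hcomp_two _ _ _ := rfl
  interchange _ _ _ _ _ _ _ := rfl

/-- The cartesian product of two 2-categories. -/
def prod (C D : TwoCat.{u}) : TwoCat.{u} where
  Ob := C.Ob × D.Ob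
  Ar := C.Ar × D.Ar
  Cell := C.Cell × D.Cell
  src f := (C.src f.1, D.src f.2)
  tgt f := (C.tgt f.1, D.tgt f.2)
  dom a := (C.dom a.1, D.dom a.2)
  cod a := (C.cod a.1, D.cod a.2)
  one x := (C.one x.1, D.one x.2)
  two f := (C.two f.1, D.two f.2)
  comp f g := (C.comp f.1 g.1, D.comp f.2 g.2)
  vcomp a b := (C.vcomp a.1 b.1, D.vcomp a.2 b.2)
  hcomp a b := (C.hcomp a.1 b.1, D.hcomp a.2 b.2)
  src_cod a := Prod.ext (C.src_cod _) (D.src_cod _)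
  tgt_cod a := Prod.ext (C.tgt_cod _) (D.tgt_cod _)
  src_one x := Prod.ext (C.src_one _) (D.src_one _)
  tgt_one x := Prod.ext (C.tgt_one _) (D.tgt_one _)
  src_comp f g h := Prod.ext (C.src_comp _ _ (congrArg Prod.fst h))
    (D.src_comp _ _ (congrArg Prod.snd h))
  tgt_comp f g h := Prod.ext (C.tgt_comp _ _ (congrArg Prod.fst h))
    (D.tgt_comp _ _ (congrArg Prod.snd h))
  one_comp f := Prod.ext (C.one_comp _) (D.one_comp _)
  comp_one f := Prod.ext (C.comp_one _) (D.comp_one _)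
  comp_assoc f g h p q :=
    Prod.ext (C.comp_assoc _ _ _ (congrArg Prod.fst p) (congrArg Prod.fst q))
      (D.comp_assoc _ _ _ (congrArg Prod.snd p) (congrArg Prod.snd q))
  dom_two f := Prod.ext (C.dom_two _) (D.dom_two _)
  cod_two f := Prod.ext (C.cod_two _) (D.cod_two _)
  dom_vcomp a b h := Prod.ext (C.dom_vcomp _ _ (congrArg Prod.fst h))
    (D.dom_vcomp _ _ (congrArg Prod.snd h))
  cod_vcomp a b h := Prod.ext (C.cod_vcomp _ _ (congrArg Prod.fst h))
    (D.cod_vcomp _ _ (congrArg Prod.snd h))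
  two_vcomp a := Prod.ext (C.two_vcomp _) (D.two_vcomp _)
  vcomp_two a := Prod.ext (C.vcomp_two _) (D.vcomp_two _)
  vcomp_assoc a b c p q :=
    Prod.ext (C.vcomp_assoc _ _ _ (congrArg Prod.fst p) (congrArg Prod.fst q))
      (D.vcomp_assoc _ _ _ (congrArg Prod.snd p) (congrArg Prod.snd q))
  dom_hcomp a b h := Prod.ext (C.dom_hcomp _ _ (congrArg Prod.fst h))
    (D.dom_hcomp _ _ (congrArg Prod.snd h))
  cod_hcomp a b h := Prod.ext (C.cod_hcomp _ _ (congrArg Prod.fst h))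
    (D.cod_hcomp _ _ (congrArg Prod.snd h))
  one_hcomp a := Prod.ext (C.one_hcomp _) (D.one_hcomp _)
  hcomp_one a := Prod.ext (C.hcomp_one _) (D.hcomp_one _)
  hcomp_assoc a b c p q :=
    Prod.ext (C.hcomp_assoc _ _ _ (congrArg Prod.fst p) (congrArg Prod.fst q))
      (D.hcomp_assoc _ _ _ (congrArg Prod.snd p) (congrArg Prod.snd q))
  hcomp_two f g h := Prod.ext (C.hcomp_two _ _ (congrArg Prod.fst h))
    (D.hcomp_two _ _ (congrArg Prod.snd h))
  interchange a a' b b' p q r :=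
    Prod.ext
      (C.interchange _ _ _ _ (congrArg Prod.fst p) (congrArg Prod.fst q) (congrArg Prod.fst r))
      (D.interchange _ _ _ _ (congrArg Prod.snd p) (congrArg Prod.snd q) (congrArg Prod.snd r))

end TwoCat

/-- A (strict) 2-functor. -/
@[ext]
structure TwoFunctor (C D : TwoCat.{u}) : Type u where
  ob : C.Ob → D.Ob
  ar : C.Ar → D.Ar
  cell : C.Cell → D.Cell
  map_src : ∀ f, D.src (ar f) = ob (C.src f)
  map_tgt : ∀ f, D.tgt (ar f) = ob (C.tgt f)
  map_dom : ∀ a, D.dom (cell a) = ar (C.dom a)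
  map_cod : ∀ a, D.cod (cell a) = ar (C.cod a)
  map_one : ∀ x, ar (C.one x) = D.one (ob x)
  map_two : ∀ f, cell (C.two f) = D.two (ar f)
  map_comp : ∀ f g, C.tgt f = C.src g → ar (C.comp f g) = D.comp (ar f) (ar g)
  map_vcomp : ∀ a b, C.cod a = C.dom b → cell (C.vcomp a b) = D.vcomp (cell a) (cell b)
  map_hcomp : ∀ a b, C.tgt (C.dom a) = C.src (C.dom b) →
    cell (C.hcomp a b) = D.hcomp (cell a) (cell b)

namespace TwoFunctor

/-- The identity 2-functor. -/
def id (C : TwoCat.{u}) : TwoFunctor C C where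
  ob x := x
  ar f := f
  cell a := a
  map_src _ := rfl
  map_tgt _ := rfl
  map_dom _ := rfl
  map_cod _ := rfl
  map_one _ := rfl
  map_two _ := rfl
  map_comp _ _ _ := rfl
  map_vcomp _ _ _ := rfl
  map_hcomp _ _ _ := rfl

/-- Composition of 2-functors: first `F`, then `G`. -/
def comp {C D E : TwoCat.{u}} (F : TwoFunctor C D) (G : TwoFunctor D E) : TwoFunctor C E where
  ob x := G.ob (F.ob x)
  ar f := G.ar (F.ar f)
  cell a := G.cell (F.cell a)
  map_src f := by rw [G.map_src, F.map_src]
  map_tgt f := by rw [G.map_tgt, F.map_tgt]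
  map_dom a := by rw [G.map_dom, F.map_dom]
  map_cod a := by rw [G.map_cod, F.map_cod]
  map_one x := by rw [F.map_one, G.map_one]
  map_two f := by rw [F.map_two, G.map_two]
  map_comp f g h := by rw [F.map_comp f g h, G.map_comp _ _ (by rw [F.map_tgt, F.map_src, h])]
  map_vcomp a b h := by rw [F.map_vcomp a b h, G.map_vcomp _ _ (by rw [F.map_cod, F.map_dom, h])]
  map_hcomp a b h := by
    rw [F.map_hcomp a b h,
      G.map_hcomp _ _ (by rw [F.map_dom, F.map_dom, F.map_tgt, F.map_src, h])]

/-- The 2-functor `(F, G)` into a product. -/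
def pair {B C D : TwoCat.{u}} (F : TwoFunctor B C) (G : TwoFunctor B D) :
    TwoFunctor B (C.prod D) where
  ob x := (F.ob x, G.ob x)
  ar f := (F.ar f, G.ar f)
  cell a := (F.cell a, G.cell a)
  map_src f := Prod.ext (F.map_src f) (G.map_src f)
  map_tgt f := Prod.ext (F.map_tgt f) (G.map_tgt f)
  map_dom a := Prod.ext (F.map_dom a) (G.map_dom a)
  map_cod a := Prod.ext (F.map_cod a) (G.map_cod a)
  map_one x := Prod.ext (F.map_one x) (G.map_one x)
  map_two f := Prod.ext (F.map_two f) (G.map_two f)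
  map_comp f g h := Prod.ext (F.map_comp f g h) (G.map_comp f g h)
  map_vcomp a b h := Prod.ext (F.map_vcomp a b h) (G.map_vcomp a b h)
  map_hcomp a b h := Prod.ext (F.map_hcomp a b h) (G.map_hcomp a b h)

/-- The product `F × G` of two 2-functors. -/
def prodMap {A B C D : TwoCat.{u}} (F : TwoFunctor A C) (G : TwoFunctor B D) :
    TwoFunctor (A.prod B) (C.prod D) where
  ob x := (F.ob x.1, G.ob x.2)
  ar f := (F.ar f.1, G.ar f.2)
  cell a := (F.cell a.1, G.cell a.2)
  map_src f := Prod.ext (F.map_src _) (G.map_src _)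
  map_tgt f := Prod.ext (F.map_tgt _) (G.map_tgt _)
  map_dom a := Prod.ext (F.map_dom _) (G.map_dom _)
  map_cod a := Prod.ext (F.map_cod _) (G.map_cod _)
  map_one x := Prod.ext (F.map_one _) (G.map_one _)
  map_two f := Prod.ext (F.map_two _) (G.map_two _)
  map_comp f g h := Prod.ext (F.map_comp _ _ (congrArg Prod.fst h))
    (G.map_comp _ _ (congrArg Prod.snd h))
  map_vcomp a b h := Prod.ext (F.map_vcomp _ _ (congrArg Prod.fst h))
    (G.map_vcomp _ _ (congrArg Prod.snd h))
  map_hcomp a b h := Prod.ext (F.map_hcomp _ _ (congrArg Prod.fst h))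
    (G.map_hcomp _ _ (congrArg Prod.snd h))

/-- The constant 2-functor at the object `x`. -/
def const (C : TwoCat.{u}) {D : TwoCat.{u}} (x : D.Ob) : TwoFunctor C D where
  ob _ := x
  ar _ := D.one x
  cell _ := D.two (D.one x)
  map_src _ := D.src_one x
  map_tgt _ := D.tgt_one x
  map_dom _ := D.dom_two _
  map_cod _ := D.cod_two _
  map_one _ := rfl
  map_two _ := rfl
  map_comp _ _ _ := by
    have h := D.one_comp (D.one x)
    rw [D.src_one] at h
    exact h.symm
  map_vcomp _ _ _ := by
    have h := D.two_vcomp (D.two (D.one x))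
    rw [D.dom_two] at h
    exact h.symm
  map_hcomp _ _ _ := by
    have h := D.one_hcomp (D.two (D.one x))
    rw [D.dom_two, D.src_one] at h
    exact h.symm

/-- The unique 2-functor to the terminal 2-category. -/
def toPoint (C : TwoCat.{u}) : TwoFunctor C TwoCat.point.{u} :=
  const C (D := TwoCat.point.{u}) ⟨⟩

/-- Equi-2-functors, i.e. the equimorphisms of 2-categories: essentially surjective (every object is
equivalent to one in the image) and inducing equivalences on all hom categories. -/
structure IsEqui2 {C D : TwoCat.{u}} (F : TwoFunctor C D) : Prop where
  ess_surj : ∀ y : D.Ob, ∃ (x : C.Ob) (f : D.Ar), D.IsAr f (F.ob x) y ∧ D.IsEqui f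
  hom_ess_surj : ∀ (x x' : C.Ob) (g : D.Ar), D.IsAr g (F.ob x) (F.ob x') →
    ∃ f, C.IsAr f x x' ∧ ∃ a, D.IsCell a (F.ar f) g ∧ D.IsInv a
  hom_fully_faithful : ∀ f f' : C.Ar, C.src f = C.src f' → C.tgt f = C.tgt f' →
    ∀ b, D.IsCell b (F.ar f) (F.ar f') → ∃! a, C.IsCell a f f' ∧ F.cell a = b

end TwoFunctor

/-- A 2-category is contractible if its 2-functor to the terminal 2-category is an
equi-2-functor. -/
def TwoCat.IsContractible (C : TwoCat.{u}) : Prop :=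
  (TwoFunctor.toPoint C).IsEqui2

/-! ## Pseudo-natural transformations and modifications -/

/-- The data of a pseudo-natural transformation: its components at objects, and its naturality
2-cells at arrows. -/
@[ext]
structure TransfData (C D : TwoCat.{u}) : Type u where
  app : C.Ob → D.Ar
  nat : C.Ar → D.Cell

namespace TransfData

/-- `t` is a pseudo-natural transformation `F ⇒ G`: for `f : x ⟶ y` the naturality 2-cell is an
invertible 2-cell `F f ; t_y ⇒ t_x ; G f`. -/
structure IsPseudonatural {C D : TwoCat.{u}} (F G : TwoFunctor C D) (t : TransfData C D) :
    Prop where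
  app_ar : ∀ x, D.IsAr (t.app x) (F.ob x) (G.ob x)
  nat_cell : ∀ f, D.IsCell (t.nat f) (D.comp (F.ar f) (t.app (C.tgt f)))
    (D.comp (t.app (C.src f)) (G.ar f))
  nat_inv : ∀ f, D.IsInv (t.nat f)
  nat_one : ∀ x, t.nat (C.one x) = D.two (t.app x)
  nat_comp : ∀ f g, C.tgt f = C.src g → t.nat (C.comp f g) =
    D.vcomp (D.hcomp (D.two (F.ar f)) (t.nat g)) (D.hcomp (t.nat f) (D.two (G.ar g)))
  nat_nat : ∀ a,
    D.vcomp (D.hcomp (F.cell a) (D.two (t.app (C.tgt (C.dom a))))) (t.nat (C.cod a)) =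
      D.vcomp (t.nat (C.dom a)) (D.hcomp (D.two (t.app (C.src (C.dom a)))) (G.cell a))

/-- `m` is an invertible modification `s ⇛ t` between pseudo-natural transformations `F ⇒ G`. -/
structure IsInvModification {C D : TwoCat.{u}} (F G : TwoFunctor C D) (s t : TransfData C D)
    (m : C.Ob → D.Cell) : Prop where
  cell : ∀ x, D.IsCell (m x) (s.app x) (t.app x)
  inv : ∀ x, D.IsInv (m x)
  natural : ∀ f, D.vcomp (s.nat f) (D.hcomp (m (C.src f)) (D.two (G.ar f))) =
    D.vcomp (D.hcomp (D.two (F.ar f)) (m (C.tgt f))) (t.nat f)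

/-- The identity transformation of `F`. -/
def ident {C D : TwoCat.{u}} (F : TwoFunctor C D) : TransfData C D where
  app x := D.one (F.ob x)
  nat f := D.two (F.ar f)

/-- The composite of two transformations: first `s`, then `t`. -/
def comp {C D : TwoCat.{u}} (s t : TransfData C D) : TransfData C D where
  app x := D.comp (s.app x) (t.app x)
  nat f := D.vcomp (D.hcomp (s.nat f) (D.two (t.app (C.tgt f))))
    (D.hcomp (D.two (s.app (C.src f))) (t.nat f))

/-- The restriction of the transformation `t` along the 2-functor `F`. -/
def precomp {B C D : TwoCat.{u}} (F : TwoFunctor B C) (t : TransfData C D) : TransfData B D where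
  app x := t.app (F.ob x)
  nat f := t.nat (F.ar f)

/-- The image of the transformation `t` under the 2-functor `F`. -/
def postcomp {C D E : TwoCat.{u}} (t : TransfData C D) (F : TwoFunctor D E) : TransfData C E where
  app x := F.ar (t.app x)
  nat f := F.cell (t.nat f)

end TransfData

/-! ## Strict semi-monoidal 2-categories -/

/-- A strict semi-monoidal 2-category, i.e. a semi-monoid in the cartesian monoidal category of
2-categories: a 2-category with a strictly associative tensor product `C × C ⟶ C`, which is a strict
2-functor; no unit is required. -/
structure SMon2Cat : Type (u + 1) extends TwoCat.{u} where
  tensor : TwoFunctor (toTwoCat.prod toTwoCat) toTwoCat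
  assoc_ob : ∀ x y z, tensor.ob (tensor.ob (x, y), z) = tensor.ob (x, tensor.ob (y, z))
  assoc_ar : ∀ f g h, tensor.ar (tensor.ar (f, g), h) = tensor.ar (f, tensor.ar (g, h))
  assoc_cell : ∀ a b c,
    tensor.cell (tensor.cell (a, b), c) = tensor.cell (a, tensor.cell (b, c))

namespace SMon2Cat

/-- Tensor product of objects. -/
def tOb (C : SMon2Cat.{u}) (x y : C.Ob) : C.Ob := C.tensor.ob (x, y)

/-- Tensor product of arrows. -/
def tAr (C : SMon2Cat.{u}) (f g : C.Ar) : C.Ar := C.tensor.ar (f, g)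

/-- Tensor product of 2-cells. -/
def tCell (C : SMon2Cat.{u}) (a b : C.Cell) : C.Cell := C.tensor.cell (a, b)

/-- `x ⊗ f`. -/
def obAr (C : SMon2Cat.{u}) (x : C.Ob) (f : C.Ar) : C.Ar := C.tAr (C.one x) f

/-- `f ⊗ x`. -/
def arOb (C : SMon2Cat.{u}) (f : C.Ar) (x : C.Ob) : C.Ar := C.tAr f (C.one x)

/-- `x ⊗ a`. -/
def obCell (C : SMon2Cat.{u}) (x : C.Ob) (a : C.Cell) : C.Cell := C.tCell (C.two (C.one x)) a

/-- `a ⊗ x`. -/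
def cellOb (C : SMon2Cat.{u}) (a : C.Cell) (x : C.Ob) : C.Cell := C.tCell a (C.two (C.one x))

/-- The 2-functor `I ⊗ -`. -/
def tensorLeft (C : SMon2Cat.{u}) (I : C.Ob) : TwoFunctor C.toTwoCat C.toTwoCat :=
  (TwoFunctor.pair (TwoFunctor.const _ I) (TwoFunctor.id _)).comp C.tensor

/-- The 2-functor `- ⊗ I`. -/
def tensorRight (C : SMon2Cat.{u}) (I : C.Ob) : TwoFunctor C.toTwoCat C.toTwoCat :=
  (TwoFunctor.pair (TwoFunctor.id _) (TwoFunctor.const _ I)).comp C.tensor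

/-- The tensor product of two transformations, as a transformation in two variables. -/
def tensorTransf (D : SMon2Cat.{u}) {A B : TwoCat.{u}} (s : TransfData A D.toTwoCat)
    (t : TransfData B D.toTwoCat) : TransfData (A.prod B) D.toTwoCat where
  app x := D.tAr (s.app x.1) (t.app x.2)
  nat f := D.tCell (s.nat f.1) (t.nat f.2)

/-- For an arrow `φ : I ⟶ J`, the (strictly natural) transformation `φ ⊗ F - : I ⊗ F - ⇒ J ⊗ F -`. -/
def arLeft (D : SMon2Cat.{u}) {C : TwoCat.{u}} (φ : D.Ar) (F : TwoFunctor C D.toTwoCat) :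
    TransfData C D.toTwoCat where
  app x := D.arOb φ (F.ob x)
  nat f := D.two (D.tAr φ (F.ar f))

/-- For an arrow `φ : I ⟶ J`, the (strictly natural) transformation `F - ⊗ φ : F - ⊗ I ⇒ F - ⊗ J`. -/
def arRight (D : SMon2Cat.{u}) {C : TwoCat.{u}} (F : TwoFunctor C D.toTwoCat) (φ : D.Ar) :
    TransfData C D.toTwoCat where
  app x := D.obAr (F.ob x) φ
  nat f := D.two (D.tAr (F.ar f) φ)

end SMon2Cat

/-- A strict semi-monoidal 2-functor. -/
@[ext]
structure SMonFunctor (C D : SMon2Cat.{u}) : Type u extends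
    TwoFunctor C.toTwoCat D.toTwoCat where
  map_tOb : ∀ x y, ob (C.tOb x y) = D.tOb (ob x) (ob y)
  map_tAr : ∀ f g, ar (C.tAr f g) = D.tAr (ar f) (ar g)
  map_tCell : ∀ a b, cell (C.tCell a b) = D.tCell (cell a) (cell b)

/-- The identity semi-monoidal 2-functor. -/
def SMonFunctor.id (C : SMon2Cat.{u}) : SMonFunctor C C where
  toTwoFunctor := TwoFunctor.id C.toTwoCat
  map_tOb _ _ := rfl
  map_tAr _ _ := rfl
  map_tCell _ _ := rfl

/-! ## Fair monoids in the category of 2-categories -/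

/-- A strict semi-monoidal 2-functor `J : U ⟶ C` is a fair monoid if `U` is contractible and the
multiplication maps `U × C ⟶ C ⟵ C × U` are equi-2-functors. -/
structure IsFairMonoid {U C : SMon2Cat.{u}} (J : SMonFunctor U C) : Prop where
  contractible : U.IsContractible
  left_equi : ((J.toTwoFunctor.prodMap (TwoFunctor.id C.toTwoCat)).comp C.tensor).IsEqui2
  right_equi : (((TwoFunctor.id C.toTwoCat).prodMap J.toTwoFunctor).comp C.tensor).IsEqui2

/-- Fair monoids `(U ⟶ C)` in the category of 2-categories. -/
structure FairMonoid : Type (u + 1) where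
  U : SMon2Cat.{u}
  C : SMon2Cat.{u}
  J : SMonFunctor U C
  isFair : IsFairMonoid J

namespace FairMonoid

/-- There is an equimorphism of fair monoids from `X` to `Y`: a commutative square of strict
semi-monoidal 2-functors, both components of which are equi-2-functors. -/
def Equimorphic (X Y : FairMonoid.{u}) : Prop :=
  ∃ (e : SMonFunctor X.U Y.U) (F : SMonFunctor X.C Y.C),
    X.J.toTwoFunctor.comp F.toTwoFunctor = e.toTwoFunctor.comp Y.J.toTwoFunctor ∧
      e.IsEqui2 ∧ F.IsEqui2

/-- Two fair monoids are equivalent if they are connected by a zigzag of equimorphisms. -/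
def Equivalent (X Y : FairMonoid.{u}) : Prop := Relation.EqvGen Equimorphic X Y

end FairMonoid

/-! ## Weak units in the sense of Gordon, Power and Street -/

/-- A weak unit `(I, λ, ρ, K)` in a strict semi-monoidal 2-category: an object `I`, pseudo-natural
families of equiarrows `λ_X : I ⊗ X ⟶ X` and `ρ_X : X ⊗ I ⟶ X`, and an invertible modification
`K_{X,Y} : ρ_X ⊗ Y ⇒ X ⊗ λ_Y` subject to the left and right normalised 4-cocycle conditions. These
involve two further invertible modifications `Λ_{Y,Z} : λ_{Y ⊗ Z} ⇒ λ_Y ⊗ Z` and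
`P_{X,Y} : ρ_{X ⊗ Y} ⇒ X ⊗ ρ_Y`, which are determined by the rest. -/
structure WeakUnit (C : SMon2Cat.{u}) : Type u where
  I : C.Ob
  lam : TransfData C.toTwoCat C.toTwoCat
  rho : TransfData C.toTwoCat C.toTwoCat
  K : C.Ob × C.Ob → C.Cell
  lam_nat : lam.IsPseudonatural (C.tensorLeft I) (TwoFunctor.id _)
  lam_equi : ∀ x, C.IsEqui (lam.app x)
  rho_nat : rho.IsPseudonatural (C.tensorRight I) (TwoFunctor.id _)
  rho_equi : ∀ x, C.IsEqui (rho.app x)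
  K_mod : TransfData.IsInvModification
    (((C.tensorRight I).prodMap (TwoFunctor.id _)).comp C.tensor) C.tensor
    (C.tensorTransf rho (TransfData.ident (TwoFunctor.id _)))
    (C.tensorTransf (TransfData.ident (TwoFunctor.id _)) lam) K
  left_cocycle : ∃ Λ : C.Ob × C.Ob → C.Cell,
    TransfData.IsInvModification (C.tensor.comp (C.tensorLeft I)) C.tensor
      (lam.precomp C.tensor)
      (C.tensorTransf lam (TransfData.ident (TwoFunctor.id _))) Λ ∧
    ∀ x y z, C.vcomp (K (x, C.tOb y z)) (C.obCell x (Λ (y, z))) = C.cellOb (K (x, y)) z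
  right_cocycle : ∃ P : C.Ob × C.Ob → C.Cell,
    TransfData.IsInvModification (C.tensor.comp (C.tensorRight I)) C.tensor
      (rho.precomp C.tensor)
      (C.tensorTransf (TransfData.ident (TwoFunctor.id _)) rho) P ∧
    ∀ x y z, C.vcomp (C.cellOb (P (x, y)) z) (C.obCell x (K (y, z))) = K (C.tOb x y, z)

/-- The structure on a strict semi-monoidal 2-functor `F : C ⟶ D` that makes it a monoidal 2-functor
`(C, W) ⟶ (D, V)` (a trihomomorphism preserving composition and tensor product strictly): an
equiarrow `φ : I' ⟶ F I` and invertible modifications `γ_X : λ'_{F X} ⇒ (φ ⊗ F X) ; F λ_X` and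
`δ_X : ρ'_{F X} ⇒ (F X ⊗ φ) ; F ρ_X`, compatible with `K` and `K'`. -/
structure UnitComparison {C D : SMon2Cat.{u}} (F : SMonFunctor C D) (W : WeakUnit C)
    (V : WeakUnit D) : Type u where
  φ : D.Ar
  γ : C.Ob → D.Cell
  δ : C.Ob → D.Cell
  φ_ar : D.IsAr φ V.I (F.ob W.I)
  φ_equi : D.IsEqui φ
  γ_mod : TransfData.IsInvModification
    (F.toTwoFunctor.comp (D.tensorLeft V.I)) F.toTwoFunctor
    (V.lam.precomp F.toTwoFunctor)
    ((D.arLeft φ F.toTwoFunctor).comp (W.lam.postcomp F.toTwoFunctor)) γ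
  δ_mod : TransfData.IsInvModification
    (F.toTwoFunctor.comp (D.tensorRight V.I)) F.toTwoFunctor
    (V.rho.precomp F.toTwoFunctor)
    ((D.arRight F.toTwoFunctor φ).comp (W.rho.postcomp F.toTwoFunctor)) δ
  compat : ∀ x y,
    D.vcomp (D.cellOb (δ x) (F.ob y))
      (D.hcomp (D.two (D.arOb (D.obAr (F.ob x) φ) (F.ob y))) (F.cell (W.K (x, y)))) =
    D.vcomp (V.K (F.ob x, F.ob y)) (D.obCell (F.ob x) (γ y))

/-- Strict 2-categories with a strict tensor product and a weak unit. -/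
structure Mon2Cat : Type (u + 1) where
  C : SMon2Cat.{u}
  unit : WeakUnit C

namespace Mon2Cat

/-- There is a monoidal equi-2-functor from `M` to `N`. -/
def Equimorphic (M N : Mon2Cat.{u}) : Prop :=
  ∃ F : SMonFunctor M.C N.C, F.IsEqui2 ∧ Nonempty (UnitComparison F M.unit N.unit)

/-- Two monoidal 2-categories are equivalent if they are connected by a zigzag of monoidal
equi-2-functors. -/
def Equivalent (M N : Mon2Cat.{u}) : Prop := Relation.EqvGen Equimorphic M N

end Mon2Cat

/-! ## Associators, and the constraints induced by `α : I ⊗ I ⟶ I` -/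

namespace SMon2Cat

/-- The pentagon equation for `A : I ⊗ α ⇒ α ⊗ I`, where `α : I ⊗ I ⟶ I`: an equation between
2-cells from `(I ⊗ I ⊗ α) ; (I ⊗ α) ; α` to `(α ⊗ I ⊗ I) ; (α ⊗ I) ; α`. -/
def Pentagon (C : SMon2Cat.{u}) (I : C.Ob) (α : C.Ar) (A : C.Cell) : Prop :=
  C.vcomp
    (C.hcomp (C.two (C.obAr (C.tOb I I) α)) (C.hcomp A (C.two α)))
    (C.hcomp (C.two (C.arOb α (C.tOb I I))) (C.hcomp A (C.two α))) =
  C.vcomp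
    (C.hcomp (C.obCell I A) (C.two (C.comp (C.obAr I α) α)))
    (C.vcomp
      (C.hcomp (C.two (C.obAr I (C.arOb α I))) (C.hcomp A (C.two α)))
      (C.hcomp (C.cellOb A I) (C.two (C.comp (C.arOb α I) α))))

/-- `A` is an associator for `α : I ⊗ I ⟶ I`: an invertible 2-cell `I ⊗ α ⇒ α ⊗ I` satisfying the
pentagon equation. -/
structure IsAssociator (C : SMon2Cat.{u}) (I : C.Ob) (α : C.Ar) (A : C.Cell) : Prop where
  cell : C.IsCell A (C.obAr I α) (C.arOb α I)
  inv : C.IsInv A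
  pentagon : C.Pentagon I α A

/-- `lam` is a pseudo-natural transformation with components `λ_X : I ⊗ X ⟶ X` and `L` is an
invertible modification `L_X : I ⊗ λ_X ⇒ α ⊗ X`. -/
structure IsLeftConstraint (C : SMon2Cat.{u}) (I : C.Ob) (α : C.Ar)
    (lam : TransfData C.toTwoCat C.toTwoCat) (L : C.Ob → C.Cell) : Prop where
  pseudonatural : lam.IsPseudonatural (C.tensorLeft I) (TwoFunctor.id _)
  modification : TransfData.IsInvModification
    ((C.tensorLeft I).comp (C.tensorLeft I)) (C.tensorLeft I)
    (lam.postcomp (C.tensorLeft I)) (C.arLeft α (TwoFunctor.id _)) L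

/-- `rho` is a pseudo-natural transformation with components `ρ_X : X ⊗ I ⟶ X` and `R` is an
invertible modification `R_X : ρ_X ⊗ I ⇒ X ⊗ α`. -/
structure IsRightConstraint (C : SMon2Cat.{u}) (I : C.Ob) (α : C.Ar)
    (rho : TransfData C.toTwoCat C.toTwoCat) (R : C.Ob → C.Cell) : Prop where
  pseudonatural : rho.IsPseudonatural (C.tensorRight I) (TwoFunctor.id _)
  modification : TransfData.IsInvModification
    ((C.tensorRight I).comp (C.tensorRight I)) (C.tensorRight I)
    (rho.postcomp (C.tensorRight I)) (C.arRight (TwoFunctor.id _) α) R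

end SMon2Cat

/-- The weak unit `W` on `C` comes from the object `I` and the arrow `α : I ⊗ I ⟶ I` of `C`: its
underlying object is `I`, and its left and right constraints are related to `α` by some
`L_X : I ⊗ λ_X ⇒ α ⊗ X` and `R_X : ρ_X ⊗ I ⇒ X ⊗ α`. -/
def WeakUnit.ComesFrom {C : SMon2Cat.{u}} (W : WeakUnit C) (I : C.Ob) (α : C.Ar) : Prop :=
  W.I = I ∧ (∃ L, C.IsLeftConstraint I α W.lam L) ∧ (∃ R, C.IsRightConstraint I α W.rho R)

/-- The weak unit `W` on `C` is induced by the fair monoid `(U ⟶ C)`: it comes from the images of an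
object `I` and an arrow `α : I ⊗ I ⟶ I` of `U`. -/
def FairMonoid.Induces (X : FairMonoid.{u}) (W : WeakUnit X.C) : Prop :=
  ∃ (I : X.U.Ob) (α : X.U.Ar), X.U.IsAr α (X.U.tOb I I) I ∧
    W.ComesFrom (X.J.ob I) (X.J.ar α)

/-! ## The free strictly semi-monoidal 2-category on `I`, `α ⊣ β` and `A` -/

/-- An object `I`, an arrow `α : I ⊗ I ⟶ I` with right adjoint `β`, invertible unit `η` and counit
`ε`, and an associator `A` for `α`. -/
structure UnitData (D : SMon2Cat.{u}) : Type u where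
  I : D.Ob
  α : D.Ar
  β : D.Ar
  A : D.Cell
  η : D.Cell
  ε : D.Cell
  α_ar : D.IsAr α (D.tOb I I) I
  adj : D.IsAdjunction α β η ε
  η_inv : D.IsInv η
  ε_inv : D.IsInv ε
  assoc : D.IsAssociator I α A

/-- The semi-monoidal 2-functor `J` carries the data `g` to the data `d`. -/
structure SMonFunctor.Carries {U D : SMon2Cat.{u}} (J : SMonFunctor U D) (g : UnitData U)
    (d : UnitData D) : Prop where
  map_I : J.ob g.I = d.I
  map_α : J.ar g.α = d.α
  map_β : J.ar g.β = d.β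
  map_A : J.cell g.A = d.A
  map_η : J.cell g.η = d.η
  map_ε : J.cell g.ε = d.ε

/-- `U` is the free strictly semi-monoidal 2-category on the data `g`. -/
def UnitData.IsFree {U : SMon2Cat.{u}} (g : UnitData U) : Prop :=
  ∀ (D : SMon2Cat.{u}) (d : UnitData D), ∃! J : SMonFunctor U D, J.Carries g d

/-- The data `d` is a choice of associator, right adjoint, unit and counit for `α := λ_I`, where
`(I, λ, ρ, K)` is the weak unit `W`. -/
def UnitData.IsFor {C : SMon2Cat.{u}} (d : UnitData C) (W : WeakUnit C) : Prop :=
  d.I = W.I ∧ d.α = W.lam.app W.I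

/-! The two notions meet in a pair `(I, α)` with `α : I ⊗ I ⟶ I`, called idempotent here
(`IsIdempotent`): `I ⊗ -` and `- ⊗ I` are equi-2-functors, `α` is an equiarrow and `I ⊗ α ≅ α ⊗ I`.
An object of `U` with any `α`, both taken to `C`, is idempotent because `U` is contractible and a
slice of the multiplication map is tensoring with `I`. A weak unit gives an idempotent with `α =
λ_I`. All other structure is forced by the idempotent.

Constraints. Since `I ⊗ -` is an equi-2-functor, `α ⊗ X` lifts up to isomorphism to an arrow `λ_X`,
and pseudo-naturality and comparisons lift uniquely with it (`existsUnique_nat`,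
`existsUnique_modification`). Reversing the tensor product gives `ρ`. The isomorphisms `ρ_X ⊗ I ⊗ Y
≅ X ⊗ α ⊗ Y ≅ X ⊗ I ⊗ λ_Y` compose to a 2-cell `middle`, and `K` results from cancelling the
equiarrow `ρ_X ⊗ I ⊗ Y` (`exists_isMiddle`). The cocycle conditions hold because `Λ` and `P` are the
unique comparisons between two lifts of one transformation.

Associator. Invertible endomorphisms of an equiarrow out of `I ⊗ X` are scalars, that is, 2-cells of
`1_I`, when `- ⊗ X` is an equi-2-functor. Scalars slide through `α` by an Eckmann–Hilton argument.
Any isomorphism `I ⊗ α ≅ α ⊗ I` therefore satisfies the pentagon up to a scalar. Rescaling it by `w`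
multiplies the two sides by `w²` and `w³`, so exactly one rescaling is an associator.

The free object. It is built from well formed terms, two terms being identified if all
interpretations agree; the laws and the universal property are then formal. Contractibility needs no
normal forms. The generators lift to the pseudo-inserter of `- ⊗ I` and the identity, with `α` as
the action on `I` and the pentagon as the only condition. By freeness this is a section, so `- ⊗ I`
is equivalent to the identity. Consequently the pseudo-inserter of `- ⊗ I` and the constant `I`,
whose objects are the `x` with an equiarrow `x ⊗ I ⟶ I`, is contractible. The generators lift to it
as well, which makes the free object a retract of it.

Equivalence. Suppose two unit data in `C` are related by an equiarrow `φ` with `α ; φ ≅ (φ ⊗ φ) ;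
α'`. They are the source and target of unit data in the 2-category of equiarrows of `C`, where
compatibility with the associators is automatic by their uniqueness (`exists_path`). This yields a
zigzag of fair monoids. On the side of weak units, such a `φ` extends to a monoidal 2-functor
structure (`nonempty_unitComparison`): `δ` is forced by cancelling the unit and `γ` by `K`.
Conversely, `γ_I` together with naturality of `λ'` at `φ` returns the relation between `φ` and `α`
(`UnitComparison.iso`). Zigzags are thus translated step by step in both directions. -/

set_option linter.unnecessarySeqFocus false

/-! ### Whiskering, invertible 2-cells and equiarrows in a strict 2-category -/

namespace TwoCat

attribute [grind =] src_cod tgt_cod src_one tgt_one src_comp tgt_comp one_comp comp_one dom_two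
  cod_two dom_vcomp cod_vcomp two_vcomp vcomp_two dom_hcomp cod_hcomp one_hcomp hcomp_one hcomp_two
attribute [grind =] comp_assoc IsAr IsCell

variable (C : TwoCat.{u})

@[grind =]
theorem one_comp_of {f : C.Ar} {x : C.Ob} (h : C.src f = x) : C.comp (C.one x) f = f := by
  rw [← h, C.one_comp]

@[grind =]
theorem comp_one_of {f : C.Ar} {x : C.Ob} (h : C.tgt f = x) : C.comp f (C.one x) = f := by
  rw [← h, C.comp_one]

@[grind =]
theorem two_vcomp_of {a : C.Cell} {f : C.Ar} (h : C.dom a = f) : C.vcomp (C.two f) a = a := by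
  rw [← h, C.two_vcomp]

@[grind =]
theorem vcomp_two_of {a : C.Cell} {f : C.Ar} (h : C.cod a = f) : C.vcomp a (C.two f) = a := by
  rw [← h, C.vcomp_two]

@[grind =]
theorem one_hcomp_of {a : C.Cell} {x : C.Ob} (h : C.src (C.dom a) = x) :
    C.hcomp (C.two (C.one x)) a = a := by
  rw [← h, C.one_hcomp]

@[grind =]
theorem hcomp_one_of {a : C.Cell} {x : C.Ob} (h : C.tgt (C.dom a) = x) :
    C.hcomp a (C.two (C.one x)) = a := by
  rw [← h, C.hcomp_one]

theorem two_hcomp_vcomp {f : C.Ar} {a b : C.Cell} (h : C.cod a = C.dom b)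
    (hf : C.tgt f = C.src (C.dom a)) :
    C.hcomp (C.two f) (C.vcomp a b) = C.vcomp (C.hcomp (C.two f) a) (C.hcomp (C.two f) b) := by
  have := C.interchange (C.two f) (C.two f) a b (by grind) h (by grind)
  grind

theorem vcomp_hcomp_two {f : C.Ar} {a b : C.Cell} (h : C.cod a = C.dom b)
    (hf : C.tgt (C.dom a) = C.src f) :
    C.hcomp (C.vcomp a b) (C.two f) = C.vcomp (C.hcomp a (C.two f)) (C.hcomp b (C.two f)) := by
  have := C.interchange a b (C.two f) (C.two f) h (by grind) (by grind)
  grind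

/-- Horizontal composition is whiskering on the right followed by whiskering on the left. -/
theorem hcomp_eq_right_left {a b : C.Cell} {f g : C.Ar} (hb : C.dom b = f) (ha : C.cod a = g)
    (h : C.tgt (C.dom a) = C.src (C.dom b)) :
    C.vcomp (C.hcomp a (C.two f)) (C.hcomp (C.two g) b) = C.hcomp a b := by
  have := C.interchange a (C.two g) (C.two f) b (by grind) (by grind) (by grind)
  grind

/-- Horizontal composition is whiskering on the left followed by whiskering on the right. -/
theorem hcomp_eq_left_right {a b : C.Cell} {f g : C.Ar} (ha : C.dom a = f) (hb : C.cod b = g)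
    (h : C.tgt (C.dom a) = C.src (C.dom b)) :
    C.vcomp (C.hcomp (C.two f) b) (C.hcomp a (C.two g)) = C.hcomp a b := by
  have := C.interchange (C.two f) a b (C.two g) (by grind) (by grind) (by grind)
  grind

theorem two_comp_hcomp {f g : C.Ar} {a : C.Cell} (h : C.tgt f = C.src g)
    (h' : C.tgt g = C.src (C.dom a)) :
    C.hcomp (C.two (C.comp f g)) a = C.hcomp (C.two f) (C.hcomp (C.two g) a) := by
  rw [← C.hcomp_assoc, C.hcomp_two] <;> grind

theorem hcomp_two_comp {f g : C.Ar} {a : C.Cell} (h : C.tgt (C.dom a) = C.src f)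
    (h' : C.tgt f = C.src g) :
    C.hcomp a (C.two (C.comp f g)) = C.hcomp (C.hcomp a (C.two f)) (C.two g) := by
  rw [C.hcomp_assoc, C.hcomp_two] <;> grind

/-! ### Invertible 2-cells -/

open Classical in
/-- The inverse of an invertible 2-cell. -/
noncomputable def inv (a : C.Cell) : C.Cell :=
  if h : C.IsInv a then h.choose else a

variable {C}

@[grind →]
theorem IsInv.inv_spec {a : C.Cell} (h : C.IsInv a) : C.dom (C.inv a) = C.cod a ∧
    C.cod (C.inv a) = C.dom a ∧ C.vcomp a (C.inv a) = C.two (C.dom a) ∧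
    C.vcomp (C.inv a) a = C.two (C.cod a) := by
  have := h.choose_spec
  simp only [inv, h, dif_pos]
  exact ⟨this.1.1, this.1.2, this.2⟩

theorem isInv_of {a b : C.Cell} (h₁ : C.dom b = C.cod a) (h₂ : C.cod b = C.dom a)
    (h₃ : C.vcomp a b = C.two (C.dom a)) (h₄ : C.vcomp b a = C.two (C.cod a)) : C.IsInv a :=
  ⟨b, ⟨h₁, h₂⟩, h₃, h₄⟩

theorem IsInv.inv {a : C.Cell} (h : C.IsInv a) : C.IsInv (C.inv a) :=
  isInv_of (b := a) (by grind) (by grind) (by grind) (by grind)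

variable (C) in
theorem isInv_two (f : C.Ar) : C.IsInv (C.two f) :=
  isInv_of (b := C.two f) (by grind) (by grind) (by grind) (by grind)

theorem vcomp_inv_cancel {a b : C.Cell} (h : C.IsInv a) (hb : C.dom b = C.dom a) :
    C.vcomp a (C.vcomp (C.inv a) b) = b := by
  rw [← C.vcomp_assoc] <;> grind

theorem inv_vcomp_cancel {a b : C.Cell} (h : C.IsInv a) (hb : C.dom b = C.cod a) :
    C.vcomp (C.inv a) (C.vcomp a b) = b := by
  rw [← C.vcomp_assoc] <;> grind

theorem IsInv.cancel_left {a b c : C.Cell} (h : C.IsInv a) (hb : C.dom b = C.cod a)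
    (hc : C.dom c = C.cod a) (e : C.vcomp a b = C.vcomp a c) : b = c := by
  rw [← inv_vcomp_cancel h hb, e, inv_vcomp_cancel h hc]

theorem IsInv.cancel_right {a b c : C.Cell} (h : C.IsInv a) (hb : C.cod b = C.dom a)
    (hc : C.cod c = C.dom a) (e : C.vcomp b a = C.vcomp c a) : b = c := by
  have hb' : C.vcomp (C.vcomp b a) (C.inv a) = b := by rw [C.vcomp_assoc] <;> grind
  have hc' : C.vcomp (C.vcomp c a) (C.inv a) = c := by rw [C.vcomp_assoc] <;> grind
  rw [← hb', e, hc']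

theorem IsInv.vcomp {a b : C.Cell} (ha : C.IsInv a) (hb : C.IsInv b) (h : C.cod a = C.dom b) :
    C.IsInv (C.vcomp a b) := by
  refine isInv_of (b := C.vcomp (C.inv b) (C.inv a)) (by grind) (by grind) ?_ ?_
  · rw [C.vcomp_assoc, vcomp_inv_cancel] <;> grind
  · rw [C.vcomp_assoc, inv_vcomp_cancel] <;> grind

theorem IsInv.hcomp {a b : C.Cell} (ha : C.IsInv a) (hb : C.IsInv b)
    (h : C.tgt (C.dom a) = C.src (C.dom b)) : C.IsInv (C.hcomp a b) := by
  have h' : C.tgt (C.cod a) = C.src (C.cod b) := by grind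
  refine isInv_of (b := C.hcomp (C.inv a) (C.inv b)) (by grind) (by grind) ?_ ?_
  · rw [← C.interchange] <;> grind
  · rw [← C.interchange] <;> grind

theorem inv_eq_of {a b : C.Cell} (h₂ : C.cod b = C.dom a) (h₁ : C.dom b = C.cod a)
    (h₃ : C.vcomp a b = C.two (C.dom a)) (ha : C.IsInv a) : C.inv a = b :=
  ha.cancel_left (by grind) h₁ (by grind)

theorem inv_hcomp {a b : C.Cell} (ha : C.IsInv a) (hb : C.IsInv b)
    (h : C.tgt (C.dom a) = C.src (C.dom b)) :
    C.inv (C.hcomp a b) = C.hcomp (C.inv a) (C.inv b) := by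
  have h' : C.tgt (C.cod a) = C.src (C.cod b) := by grind
  refine inv_eq_of (by grind) (by grind) ?_ (ha.hcomp hb h)
  rw [← C.interchange] <;> grind

theorem inv_vcomp {a b : C.Cell} (ha : C.IsInv a) (hb : C.IsInv b) (h : C.cod a = C.dom b) :
    C.inv (C.vcomp a b) = C.vcomp (C.inv b) (C.inv a) := by
  refine inv_eq_of (by grind) (by grind) ?_ (ha.vcomp hb h)
  rw [C.vcomp_assoc, vcomp_inv_cancel] <;> grind

theorem inv_two (f : C.Ar) : C.inv (C.two f) = C.two f :=
  inv_eq_of (by grind) (by grind) (by grind) (C.isInv_two f)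

theorem inv_inv {a : C.Cell} (ha : C.IsInv a) : C.inv (C.inv a) = a :=
  inv_eq_of (by grind) (by grind) (by grind) ha.inv

/-! ### Isomorphic arrows -/

/-- Two arrows are isomorphic if they are connected by an invertible 2-cell. -/
def Iso (C : TwoCat.{u}) (f g : C.Ar) : Prop := ∃ a, C.IsCell a f g ∧ C.IsInv a

theorem Iso.refl (f : C.Ar) : C.Iso f f := ⟨C.two f, by grind, C.isInv_two f⟩

theorem Iso.symm {f g : C.Ar} : C.Iso f g → C.Iso g f :=
  fun ⟨a, h, hi⟩ => ⟨C.inv a, by grind, hi.inv⟩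

theorem Iso.trans {f g h : C.Ar} : C.Iso f g → C.Iso g h → C.Iso f h :=
  fun ⟨a, h, hi⟩ ⟨b, h', hi'⟩ => ⟨C.vcomp a b, by grind, hi.vcomp hi' (by grind)⟩

theorem Iso.src_eq {f g : C.Ar} : C.Iso f g → C.src f = C.src g := by
  rintro ⟨a, h, -⟩; grind

theorem Iso.tgt_eq {f g : C.Ar} : C.Iso f g → C.tgt f = C.tgt g := by
  rintro ⟨a, h, -⟩; grind

theorem Iso.comp {f f' g g' : C.Ar} (h : C.tgt f = C.src g) :
    C.Iso f f' → C.Iso g g' → C.Iso (C.comp f g) (C.comp f' g') :=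
  fun ⟨a, ha, hi⟩ ⟨b, hb, hi'⟩ => ⟨C.hcomp a b, by grind, hi.hcomp hi' (by grind)⟩

/-! ### The opposite 2-category -/

variable (C) in
/-- The 2-category with the direction of the arrows reversed. -/
def op : TwoCat.{u} where
  Ob := C.Ob
  Ar := C.Ar
  Cell := C.Cell
  src := C.tgt
  tgt := C.src
  dom := C.dom
  cod := C.cod
  one := C.one
  two := C.two
  comp f g := C.comp g f
  vcomp := C.vcomp
  hcomp a b := C.hcomp b a
  src_cod := C.tgt_cod
  tgt_cod := C.src_cod
  src_one := C.tgt_one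
  tgt_one := C.src_one
  src_comp _ _ h := C.tgt_comp _ _ h.symm
  tgt_comp _ _ h := C.src_comp _ _ h.symm
  one_comp := C.comp_one
  comp_one := C.one_comp
  comp_assoc _ _ _ h h' := (C.comp_assoc _ _ _ h'.symm h.symm).symm
  dom_two := C.dom_two
  cod_two := C.cod_two
  dom_vcomp := C.dom_vcomp
  cod_vcomp := C.cod_vcomp
  two_vcomp := C.two_vcomp
  vcomp_two := C.vcomp_two
  vcomp_assoc := C.vcomp_assoc
  dom_hcomp _ _ h := C.dom_hcomp _ _ h.symm
  cod_hcomp _ _ h := C.cod_hcomp _ _ h.symm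
  one_hcomp := C.hcomp_one
  hcomp_one := C.one_hcomp
  hcomp_assoc _ _ _ h h' := (C.hcomp_assoc _ _ _ h'.symm h.symm).symm
  hcomp_two _ _ h := C.hcomp_two _ _ h.symm
  interchange _ _ _ _ h h' h'' := C.interchange _ _ _ _ h' h h''.symm

/-! ### Equiarrows -/

theorem isEqui_iff {f : C.Ar} : C.IsEqui f ↔ ∃ g, C.IsAr g (C.tgt f) (C.src f) ∧
    C.Iso (C.comp f g) (C.one (C.src f)) ∧ C.Iso (C.comp g f) (C.one (C.tgt f)) := Iff.rfl

theorem IsEqui.op {f : C.Ar} (h : C.IsEqui f) : C.op.IsEqui f :=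
  let ⟨g, hg, h₁, h₂⟩ := h
  ⟨g, ⟨hg.2, hg.1⟩, h₂, h₁⟩

variable (C) in
theorem isEqui_one (x : C.Ob) : C.IsEqui (C.one x) := by
  refine isEqui_iff.2 ⟨C.one x, by grind, ?_, ?_⟩
  · rw [C.one_comp_of] <;> grind [Iso.refl]
  · rw [C.one_comp_of] <;> grind [Iso.refl]

theorem IsEqui.exists_inverse {f : C.Ar} (h : C.IsEqui f) : ∃ g, C.IsAr g (C.tgt f) (C.src f) ∧
    C.Iso (C.comp f g) (C.one (C.src f)) ∧ C.Iso (C.comp g f) (C.one (C.tgt f)) ∧ C.IsEqui g :=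
  let ⟨g, hg, h₁, h₂⟩ := h
  ⟨g, hg, h₁, h₂, f, by grind, by rwa [hg.1], by rwa [hg.2]⟩

theorem IsEqui.of_iso {f f' : C.Ar} (h : C.IsEqui f) (e : C.Iso f f') : C.IsEqui f' := by
  obtain ⟨g, hg, h₁, h₂⟩ := isEqui_iff.1 h
  have := e.src_eq
  have := e.tgt_eq
  refine isEqui_iff.2 ⟨g, by grind, ?_, ?_⟩
  · rw [← e.src_eq]; exact (e.symm.comp (by grind) (.refl g)).trans h₁
  · rw [← e.tgt_eq]; exact (Iso.comp (by grind) (.refl g) e.symm).trans h₂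

theorem IsEqui.comp {f g : C.Ar} (hf : C.IsEqui f) (hg : C.IsEqui g) (h : C.tgt f = C.src g) :
    C.IsEqui (C.comp f g) := by
  obtain ⟨f', hf', h₁, h₂⟩ := isEqui_iff.1 hf
  obtain ⟨g', hg', h₃, h₄⟩ := isEqui_iff.1 hg
  refine isEqui_iff.2 ⟨C.comp g' f', by grind, ?_, ?_⟩
  · have : C.comp (C.comp f g) (C.comp g' f') = C.comp f (C.comp (C.comp g g') f') := by
      rw [C.comp_assoc, C.comp_assoc] <;> grind
    rw [this]
    have e := Iso.comp (f := C.comp g g') (g := f') (by grind) h₃ (.refl f')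
    have e' := Iso.comp (f := f) (by grind) (.refl f) e
    have : C.comp f (C.comp (C.one (C.src g)) f') = C.comp f f' := by grind
    rw [this] at e'
    have := e'.trans h₁
    grind
  · have : C.comp (C.comp g' f') (C.comp f g) = C.comp g' (C.comp (C.comp f' f) g) := by
      rw [C.comp_assoc, C.comp_assoc] <;> grind
    rw [this]
    have e := Iso.comp (f := C.comp f' f) (g := g) (by grind) h₂ (.refl g)
    have e' := Iso.comp (f := g') (by grind) (.refl g') e
    have : C.comp g' (C.comp (C.one (C.tgt f)) g) = C.comp g' g := by grind
    rw [this] at e'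
    have := e'.trans h₄
    grind

/-- Whiskering with an equiarrow is faithful. -/
theorem IsEqui.whisker_right_cancel {k : C.Ar} (hk : C.IsEqui k) {a b : C.Cell}
    (hd : C.dom a = C.dom b) (hc : C.cod a = C.cod b) (h : C.tgt (C.dom a) = C.src k)
    (e : C.hcomp a (C.two k) = C.hcomp b (C.two k)) : a = b := by
  obtain ⟨l, hl, ⟨u, hu, hui⟩, -⟩ := hk
  -- Naturality of `u : k ; l ⇒ 1`: whiskering `c` with `k` and then with `l` is conjugate to `c`
  -- itself.
  have key : ∀ c, C.tgt (C.dom c) = C.src k →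
      C.vcomp (C.hcomp (C.hcomp c (C.two k)) (C.two l)) (C.hcomp (C.two (C.cod c)) u) =
        C.vcomp (C.hcomp (C.two (C.dom c)) u) c := by
    intro c hc
    rw [C.hcomp_assoc, C.hcomp_two, C.hcomp_eq_right_left] <;> try grind
    have := C.hcomp_eq_left_right (a := c) (b := u) rfl rfl (by grind)
    rw [← this]
    rw [hu.2, C.hcomp_one_of] <;> grind
  refine (IsInv.hcomp (C.isInv_two (C.dom a)) hui (by grind)).cancel_left (by grind) (by grind) ?_
  rw [← key a h, e, hc, key b (by grind), hd]

/-- Whiskering with an equiarrow is full. -/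
theorem IsEqui.whisker_right_full {k : C.Ar} (hk : C.IsEqui k) {f f' : C.Ar} {c : C.Cell}
    (hs : C.src f = C.src f') (ht : C.tgt f = C.tgt f') (h : C.tgt f = C.src k)
    (hc : C.IsCell c (C.comp f k) (C.comp f' k)) :
    ∃ a, C.IsCell a f f' ∧ C.hcomp a (C.two k) = c := by
  obtain ⟨l, hl, ⟨u, hu, hui⟩, -, hle⟩ := hk.exists_inverse
  have hfu : C.IsInv (C.hcomp (C.two f) u) := IsInv.hcomp (C.isInv_two f) hui (by grind)
  have hfu' : C.IsInv (C.hcomp (C.two f') u) := IsInv.hcomp (C.isInv_two f') hui (by grind)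
  have e₁ : C.comp (C.comp f k) l = C.comp f (C.comp k l) := C.comp_assoc _ _ _ (by grind) (by grind)
  have e₂ : C.comp (C.comp f' k) l = C.comp f' (C.comp k l) :=
    C.comp_assoc _ _ _ (by grind) (by grind)
  -- Whiskering `c` with the pseudo-inverse `l` and conjugating with `u` gives a 2-cell `f ⇒ f'`.
  -- Its whiskering with `k` is `c`, because whiskering with `l`, again an equiarrow, is faithful.
  obtain ⟨a, ha⟩ : ∃ a, a = C.vcomp (C.inv (C.hcomp (C.two f) u))
    (C.vcomp (C.hcomp c (C.two l)) (C.hcomp (C.two f') u)) := ⟨_, rfl⟩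
  have hac : C.IsCell a f f' := by grind
  refine ⟨a, hac, hle.whisker_right_cancel (by grind) (by grind) (by grind) ?_⟩
  refine hfu'.cancel_right (by grind) (by grind) ?_
  have h₁ : C.vcomp (C.hcomp (C.hcomp a (C.two k)) (C.two l)) (C.hcomp (C.two f') u) =
      C.vcomp (C.hcomp (C.two f) u) a := by
    rw [C.hcomp_assoc, C.hcomp_two, C.hcomp_eq_right_left] <;> try grind
    rw [← C.hcomp_eq_left_right (a := a) (b := u) rfl rfl (by grind)]
    rw [hu.2, C.hcomp_one_of] <;> grind
  rw [h₁, ha, vcomp_inv_cancel hfu] <;> grind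

theorem IsEqui.whisker_right_isInv {k : C.Ar} (hk : C.IsEqui k) {a : C.Cell}
    (h : C.tgt (C.dom a) = C.src k) (hi : C.IsInv (C.hcomp a (C.two k))) : C.IsInv a := by
  obtain ⟨b, hb, hb'⟩ := hk.whisker_right_full (f := C.cod a) (f' := C.dom a)
    (c := C.inv (C.hcomp a (C.two k))) (by grind) (by grind) (by grind) (by grind)
  refine isInv_of (b := b) hb.1 hb.2 ?_ ?_
  · refine hk.whisker_right_cancel (by grind) (by grind) (by grind) ?_
    rw [C.vcomp_hcomp_two] <;> grind
  · refine hk.whisker_right_cancel (by grind) (by grind) (by grind) ?_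
    rw [C.vcomp_hcomp_two] <;> grind

theorem IsEqui.whisker_left_cancel {k : C.Ar} (hk : C.IsEqui k) {a b : C.Cell}
    (hd : C.dom a = C.dom b) (hc : C.cod a = C.cod b) (h : C.tgt k = C.src (C.dom a))
    (e : C.hcomp (C.two k) a = C.hcomp (C.two k) b) : a = b :=
  hk.op.whisker_right_cancel (C := C.op) hd hc h.symm e

theorem IsEqui.whisker_left_full {k : C.Ar} (hk : C.IsEqui k) {f f' : C.Ar} {c : C.Cell}
    (hs : C.src f = C.src f') (ht : C.tgt f = C.tgt f') (h : C.tgt k = C.src f)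
    (hc : C.IsCell c (C.comp k f) (C.comp k f')) :
    ∃ a, C.IsCell a f f' ∧ C.hcomp (C.two k) a = c :=
  hk.op.whisker_right_full (C := C.op) ht hs h.symm hc

theorem IsEqui.whisker_left_isInv {k : C.Ar} (hk : C.IsEqui k) {a : C.Cell}
    (h : C.tgt k = C.src (C.dom a)) (hi : C.IsInv (C.hcomp (C.two k) a)) : C.IsInv a :=
  hk.op.whisker_right_isInv (C := C.op) h.symm hi

theorem IsEqui.iso_of_comp_right {k : C.Ar} (hk : C.IsEqui k) {f f' : C.Ar}
    (hs : C.src f = C.src f') (ht : C.tgt f = C.tgt f') (h : C.tgt f = C.src k) :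
    C.Iso (C.comp f k) (C.comp f' k) → C.Iso f f' := by
  rintro ⟨c, hc, hi⟩
  obtain ⟨a, ha, rfl⟩ := hk.whisker_right_full hs ht h hc
  exact ⟨a, ha, hk.whisker_right_isInv (by grind) hi⟩

/-- An equiarrow is part of an adjoint equivalence. -/
theorem IsEqui.exists_adjunction {f : C.Ar} (hf : C.IsEqui f) :
    ∃ g η ε, C.IsAdjunction f g η ε ∧ C.IsInv η ∧ C.IsInv ε := by
  obtain ⟨g, hg, h₁, -⟩ := isEqui_iff.1 hf
  obtain ⟨η, hη, hηi⟩ := h₁.symm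
  have hηf : C.IsInv (C.hcomp η (C.two f)) := hηi.hcomp (C.isInv_two f) (by grind)
  have e₁ : C.comp (C.comp f g) f = C.comp f (C.comp g f) := C.comp_assoc _ _ _ (by grind) (by grind)
  -- The counit is defined by the left triangle identity. Only the right triangle then needs an
  -- argument.
  obtain ⟨ε, hε, hε'⟩ := hf.whisker_left_full (f := C.comp g f) (f' := C.one (C.tgt f))
    (c := C.inv (C.hcomp η (C.two f))) (by grind) (by grind) (by grind) (by grind)
  have hεi : C.IsInv ε := hf.whisker_left_isInv (by grind) (by rw [hε']; exact hηf.inv)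
  refine ⟨g, η, ε, ⟨hg, hη, hε, by grind, ?_⟩, hηi, hεi⟩
  have e₂ : C.comp (C.comp g f) g = C.comp g (C.comp f g) := C.comp_assoc _ _ _ (by grind) (by grind)
  -- Both sides, preceded by the invertible `η`, are the horizontal composite of `η` with itself.
  have hηη : C.hcomp (C.two (C.comp f g)) η = C.hcomp η (C.two (C.comp f g)) := by
    refine hηi.cancel_left (by grind) (by grind) ?_
    have h₁ := C.hcomp_eq_right_left (a := η) (b := η) rfl rfl (by grind)
    have h₂ := C.hcomp_eq_left_right (a := η) (b := η) rfl rfl (by grind)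
    rw [hη.1, hη.2, C.hcomp_one_of (by grind)] at h₁
    rw [hη.1, hη.2, C.one_hcomp_of (by grind)] at h₂
    rw [h₁, h₂]
  refine hf.whisker_left_cancel (by grind) (by grind) (by grind) ?_
  rw [C.two_hcomp_vcomp, ← C.two_comp_hcomp, hηη, ← C.hcomp_assoc, hε', C.hcomp_two_comp,
    ← C.vcomp_hcomp_two, hηf.inv_spec.2.2.1] <;> grind

end TwoCat

/-! ### 2-functors and equi-2-functors: preservation and reflection -/

namespace TwoFunctor

section Projections

variable {B C D E : TwoCat.{u}}

@[simp, grind =] theorem id_ar (f : C.Ar) : (TwoFunctor.id C).ar f = f := rfl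
@[simp, grind =] theorem id_cell (a : C.Cell) : (TwoFunctor.id C).cell a = a := rfl

variable (F : TwoFunctor C D) (G : TwoFunctor D E)

@[simp, grind =] theorem comp_ob (x : C.Ob) : (F.comp G).ob x = G.ob (F.ob x) := rfl
@[simp, grind =] theorem comp_ar (f : C.Ar) : (F.comp G).ar f = G.ar (F.ar f) := rfl
@[simp, grind =] theorem comp_cell (a : C.Cell) : (F.comp G).cell a = G.cell (F.cell a) := rfl

end Projections

attribute [grind =] map_src map_tgt map_dom map_cod map_one map_two map_comp map_vcomp map_hcomp

variable {B C D E : TwoCat.{u}} (F : TwoFunctor C D)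

theorem map_isInv {a : C.Cell} (h : C.IsInv a) : D.IsInv (F.cell a) :=
  TwoCat.isInv_of (b := F.cell (C.inv a)) (by grind) (by grind)
    (by rw [← F.map_vcomp] <;> grind) (by rw [← F.map_vcomp] <;> grind)

theorem map_inv {a : C.Cell} (h : C.IsInv a) : F.cell (C.inv a) = D.inv (F.cell a) :=
  (TwoCat.inv_eq_of (by grind) (by grind) (by rw [← F.map_vcomp] <;> grind) (F.map_isInv h)).symm

theorem map_iso {f g : C.Ar} : C.Iso f g → D.Iso (F.ar f) (F.ar g) :=
  fun ⟨a, h, hi⟩ => ⟨F.cell a, by grind, F.map_isInv hi⟩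

theorem map_isEqui {f : C.Ar} (h : C.IsEqui f) : D.IsEqui (F.ar f) := by
  obtain ⟨g, hg, h₁, h₂⟩ := TwoCat.isEqui_iff.1 h
  refine TwoCat.isEqui_iff.2 ⟨F.ar g, by grind, ?_, ?_⟩
  · have := F.map_iso h₁
    grind
  · have := F.map_iso h₂
    grind

variable {F}

theorem IsEqui2.cell_ext (hF : F.IsEqui2) {a b : C.Cell} (hd : C.dom a = C.dom b)
    (hc : C.cod a = C.cod b) (e : F.cell a = F.cell b) : a = b :=
  (hF.hom_fully_faithful (C.dom a) (C.cod a) (by grind) (by grind) (F.cell b)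
    (by grind)).unique ⟨⟨rfl, rfl⟩, e⟩ ⟨⟨hd.symm, hc.symm⟩, rfl⟩

theorem IsEqui2.exists_cell (hF : F.IsEqui2) {f f' : C.Ar} (hs : C.src f = C.src f')
    (ht : C.tgt f = C.tgt f') {b : D.Cell} (hb : D.IsCell b (F.ar f) (F.ar f')) :
    ∃ a, C.IsCell a f f' ∧ F.cell a = b :=
  (hF.hom_fully_faithful f f' hs ht b hb).exists

theorem IsEqui2.isInv_reflect (hF : F.IsEqui2) {a : C.Cell} (h : D.IsInv (F.cell a)) :
    C.IsInv a := by
  obtain ⟨b, hb, hb'⟩ := hF.exists_cell (f := C.cod a) (f' := C.dom a) (b := D.inv (F.cell a))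
    (by grind) (by grind) (by grind)
  exact TwoCat.isInv_of (b := b) hb.1 hb.2 (hF.cell_ext (by grind) (by grind) (by grind))
    (hF.cell_ext (by grind) (by grind) (by grind))

theorem IsEqui2.exists_inv_cell (hF : F.IsEqui2) {f f' : C.Ar} (hs : C.src f = C.src f')
    (ht : C.tgt f = C.tgt f') {b : D.Cell} (hb : D.IsCell b (F.ar f) (F.ar f'))
    (hi : D.IsInv b) : ∃ a, C.IsCell a f f' ∧ C.IsInv a ∧ F.cell a = b := by
  obtain ⟨a, ha, rfl⟩ := hF.exists_cell hs ht hb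
  exact ⟨a, ha, hF.isInv_reflect hi, rfl⟩

theorem IsEqui2.iso_reflect (hF : F.IsEqui2) {f f' : C.Ar} (hs : C.src f = C.src f')
    (ht : C.tgt f = C.tgt f') : D.Iso (F.ar f) (F.ar f') → C.Iso f f' := by
  rintro ⟨b, hb, hi⟩
  obtain ⟨a, ha, hai, -⟩ := hF.exists_inv_cell hs ht hb hi
  exact ⟨a, ha, hai⟩

theorem IsEqui2.exists_iso (hF : F.IsEqui2) {x x' : C.Ob} {g : D.Ar}
    (hg : D.IsAr g (F.ob x) (F.ob x')) : ∃ f, C.IsAr f x x' ∧ D.Iso (F.ar f) g :=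
  hF.hom_ess_surj x x' g hg

/-- The pseudo-inverse lifts up to isomorphism by essential surjectivity on hom categories, and the
two isomorphisms lift by full faithfulness. -/
theorem IsEqui2.isEqui_reflect (hF : F.IsEqui2) {f : C.Ar} (h : D.IsEqui (F.ar f)) :
    C.IsEqui f := by
  obtain ⟨g', hg', h₁, h₂⟩ := TwoCat.isEqui_iff.1 h
  obtain ⟨g, hg, e⟩ := hF.exists_iso (x := C.tgt f) (x' := C.src f) (g := g') (by grind)
  refine TwoCat.isEqui_iff.2 ⟨g, hg, ?_, ?_⟩
  · refine hF.iso_reflect (by grind) (by grind) ?_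
    have := (TwoCat.Iso.comp (f := F.ar f) (by grind) (.refl _) e).trans h₁
    grind
  · refine hF.iso_reflect (by grind) (by grind) ?_
    have := (TwoCat.Iso.comp (g := F.ar f) (by grind) e (.refl _)).trans h₂
    grind

variable (C) in
theorem isEqui2_id : (TwoFunctor.id C).IsEqui2 where
  ess_surj y := ⟨y, C.one y, by simp [TwoFunctor.id]; grind, C.isEqui_one y⟩
  hom_ess_surj x x' g hg := ⟨g, hg, TwoCat.Iso.refl (C := C) g⟩
  hom_fully_faithful f f' hs ht b hb := ⟨b, ⟨hb, rfl⟩, fun _ h => h.2⟩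

theorem IsEqui2.comp {G : TwoFunctor D E} (hF : F.IsEqui2) (hG : G.IsEqui2) :
    (F.comp G).IsEqui2 where
  ess_surj y := by
    obtain ⟨d, g, hg, hge⟩ := hG.ess_surj y
    obtain ⟨c, f, hf, hfe⟩ := hF.ess_surj d
    exact ⟨c, E.comp (G.ar f) g, by simp only [TwoFunctor.comp]; grind,
      (G.map_isEqui hfe).comp hge (by grind)⟩
  hom_ess_surj x x' g hg := by
    obtain ⟨d, hd, e⟩ := hG.exists_iso hg
    obtain ⟨c, hc, e'⟩ := hF.exists_iso hd
    exact ⟨c, hc, (G.map_iso e').trans e⟩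
  hom_fully_faithful f f' hs ht b hb := by
    obtain ⟨a', ha', rfl⟩ := hG.exists_cell (f := F.ar f) (f' := F.ar f') (by grind) (by grind) hb
    obtain ⟨a, ha, rfl⟩ := hF.exists_cell hs ht ha'
    refine ⟨a, ⟨ha, rfl⟩, fun c hc => hF.cell_ext (by grind) (by grind) ?_⟩
    exact hG.cell_ext (by grind) (by grind) hc.2

theorem IsEqui2.of_comp {G : TwoFunctor D E} (hFG : (F.comp G).IsEqui2) (hG : G.IsEqui2) :
    F.IsEqui2 where
  ess_surj y := by
    obtain ⟨c, f, hf, hfe⟩ := hFG.ess_surj (G.ob y)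
    obtain ⟨d, hd, e⟩ := hG.exists_iso hf
    exact ⟨c, d, hd, hG.isEqui_reflect (hfe.of_iso e.symm)⟩
  hom_ess_surj x x' g hg := by
    obtain ⟨c, hc, e⟩ := hFG.exists_iso (x := x) (x' := x') (g := G.ar g)
      (by simp only [TwoFunctor.comp]; grind)
    exact ⟨c, hc, hG.iso_reflect (by grind) (by grind) e⟩
  hom_fully_faithful f f' hs ht b hb := by
    obtain ⟨a, ha, e⟩ := hFG.exists_cell (f := f) (f' := f') (b := G.cell b) hs ht
      (by simp only [TwoFunctor.comp]; grind)
    refine ⟨a, ⟨ha, hG.cell_ext (by grind) (by grind) e⟩, fun c hc => ?_⟩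
    exact hFG.cell_ext (by grind) (by grind) (by rw [e, ← hc.2]; rfl)

end TwoFunctor

/-! ### Invariance of equi-2-functors under pseudo-natural equivalence -/

namespace TransfData

section Projections

variable {B C D E : TwoCat.{u}} (s t : TransfData C D)

@[simp, grind =] theorem comp_app (x : C.Ob) :
    (s.comp t).app x = D.comp (s.app x) (t.app x) := rfl
@[simp, grind =] theorem postcomp_app (F : TwoFunctor D E) (x : C.Ob) :
    (t.postcomp F).app x = F.ar (t.app x) := rfl
@[simp, grind =] theorem ident_app (F : TwoFunctor C D) (x : C.Ob) :
    (ident F).app x = D.one (F.ob x) := rfl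
@[simp, grind =] theorem ident_nat (F : TwoFunctor C D) (f : C.Ar) :
    (ident F).nat f = D.two (F.ar f) := rfl

end Projections

variable {C D : TwoCat.{u}} {F G : TwoFunctor C D} {t : TransfData C D}

/-- A 2-functor that is pseudo-naturally equivalent to an equi-2-functor is an equi-2-functor. -/
theorem IsPseudonatural.isEqui2 (ht : t.IsPseudonatural F G) (he : ∀ x, D.IsEqui (t.app x))
    (hG : G.IsEqui2) : F.IsEqui2 where
  ess_surj y := by
    obtain ⟨c, f, hf, hfe⟩ := hG.ess_surj y
    have := ht.app_ar c
    exact ⟨c, D.comp (t.app c) f, by grind, (he c).comp hfe (by grind)⟩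
  hom_ess_surj x x' g hg := by
    have h₁ := ht.app_ar x
    have h₂ := ht.app_ar x'
    obtain ⟨s, hs, hs', -⟩ := (he x).exists_inverse
    -- The arrow `g` is conjugated by the components of `t` into an arrow between objects in the
    -- image of `G`.
    obtain ⟨f, hf, e⟩ := hG.exists_iso (x := x) (x' := x')
      (g := D.comp s (D.comp g (t.app x'))) (by grind)
    have hn := ht.nat_cell f
    refine ⟨f, hf, (he x').iso_of_comp_right (by grind) (by grind) (by grind) ?_⟩
    have e₁ : D.Iso (D.comp (F.ar f) (t.app x')) (D.comp (t.app x) (G.ar f)) :=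
      ⟨t.nat f, by grind, ht.nat_inv f⟩
    have e₂ := TwoCat.Iso.comp (f := t.app x) (by grind) (.refl _) e
    have e₃ := TwoCat.Iso.comp (g := D.comp g (t.app x')) (by grind) hs' (.refl _)
    rw [D.comp_assoc] at e₃ <;> try grind
    rw [D.one_comp_of] at e₃ <;> try grind
    exact (e₁.trans e₂).trans e₃
  hom_fully_faithful f f' hs ht' b hb := by
    have h₁ := ht.app_ar (C.src f)
    have h₂ := ht.app_ar (C.tgt f)
    have n₁ := ht.nat_cell f
    have n₂ := ht.nat_cell f'
    have i₁ := ht.nat_inv f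
    have i₂ := ht.nat_inv f'
    -- The naturality squares turn `b` into a 2-cell between the composites `t ; G f` and `t ; G
    -- f'`, from which `t` is cancelled.
    obtain ⟨c, hc, hc'⟩ := (he (C.src f)).whisker_left_full (f := G.ar f) (f' := G.ar f')
      (c := D.vcomp (D.inv (t.nat f)) (D.vcomp (D.hcomp b (D.two (t.app (C.tgt f)))) (t.nat f')))
      (by grind) (by grind) (by grind) (by grind)
    obtain ⟨a, ha, rfl⟩ := hG.exists_cell hs ht' hc
    refine ⟨a, ⟨ha, ?_⟩, ?_⟩
    · have := ht.nat_nat a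
      refine (he (C.tgt f)).whisker_right_cancel (by grind) (by grind) (by grind) ?_
      refine i₂.cancel_right (by grind) (by grind) ?_
      rw [ha.1, ha.2, hc', TwoCat.vcomp_inv_cancel] at this <;> grind
    · rintro a' ⟨ha', rfl⟩
      refine hG.cell_ext (by grind) (by grind) ?_
      refine (he (C.src f)).whisker_left_cancel (by grind) (by grind) (by grind) ?_
      have := ht.nat_nat a'
      rw [hc']
      refine i₁.cancel_left (by grind) (by grind) ?_
      rw [TwoCat.vcomp_inv_cancel] <;> grind

end TransfData

/-! ### Contractible 2-categories and products -/

namespace TwoCat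

theorem isContractible_of {C : TwoCat.{u}} (h₀ : Nonempty C.Ob)
    (h₁ : ∀ x y, ∃ f, C.IsAr f x y)
    (h₂ : ∀ f g, C.src f = C.src g → C.tgt f = C.tgt g → ∃! a, C.IsCell a f g) :
    C.IsContractible where
  ess_surj y := ⟨h₀.some, (⟨⟩ : PUnit), ⟨rfl, rfl⟩, point.isEqui_one ⟨⟩⟩
  hom_ess_surj x x' g hg := by
    obtain ⟨f, hf⟩ := h₁ x x'
    exact ⟨f, hf, ⟨⟩, ⟨rfl, rfl⟩, ⟨⟩, ⟨rfl, rfl⟩, rfl, rfl⟩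
  hom_fully_faithful f f' hs ht b hb := by
    obtain ⟨a, ha, hu⟩ := h₂ f f' hs ht
    exact ⟨a, ⟨ha, rfl⟩, fun c hc => hu c hc.1⟩

namespace IsContractible

variable {C D : TwoCat.{u}}

theorem nonempty (hC : C.IsContractible) : Nonempty C.Ob := ⟨(hC.ess_surj ⟨⟩).choose⟩

theorem exists_ar (hC : C.IsContractible) (x y : C.Ob) : ∃ f, C.IsAr f x y := by
  obtain ⟨f, hf, -⟩ := hC.hom_ess_surj x y (⟨⟩ : PUnit) ⟨rfl, rfl⟩
  exact ⟨f, hf⟩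

theorem exists_cell (hC : C.IsContractible) {f g : C.Ar} (hs : C.src f = C.src g) (ht : C.tgt f = C.tgt g) :
    ∃ a, C.IsCell a f g :=
  let ⟨a, ha, _⟩ := (hC.hom_fully_faithful f g hs ht (⟨⟩ : PUnit) ⟨rfl, rfl⟩).exists
  ⟨a, ha⟩

theorem cell_ext (hC : C.IsContractible) {a b : C.Cell} (hd : C.dom a = C.dom b) (hc : C.cod a = C.cod b) : a = b :=
  TwoFunctor.IsEqui2.cell_ext hC hd hc rfl

theorem isInv (hC : C.IsContractible) (a : C.Cell) : C.IsInv a := by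
  obtain ⟨b, hb⟩ := hC.exists_cell (f := C.cod a) (g := C.dom a) (by grind) (by grind)
  exact isInv_of hb.1 hb.2 (hC.cell_ext (by grind) (by grind)) (hC.cell_ext (by grind) (by grind))

theorem iso (hC : C.IsContractible) {f g : C.Ar} (hs : C.src f = C.src g) (ht : C.tgt f = C.tgt g) : C.Iso f g :=
  let ⟨a, ha⟩ := hC.exists_cell hs ht
  ⟨a, ha, hC.isInv a⟩

theorem isEqui (hC : C.IsContractible) (f : C.Ar) : C.IsEqui f := by
  obtain ⟨g, hg⟩ := hC.exists_ar (C.tgt f) (C.src f)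
  exact isEqui_iff.2 ⟨g, hg, hC.iso (by grind) (by grind), hC.iso (by grind) (by grind)⟩

/-- Any 2-functor between contractible 2-categories is an equi-2-functor. -/
theorem isEqui2 (hC : C.IsContractible) (hD : D.IsContractible) (F : TwoFunctor C D) : F.IsEqui2 where
  ess_surj y := by
    obtain ⟨x⟩ := hC.nonempty
    obtain ⟨f, hf⟩ := hD.exists_ar (F.ob x) y
    exact ⟨x, f, hf, hD.isEqui f⟩
  hom_ess_surj x x' g hg := by
    obtain ⟨f, hf⟩ := hC.exists_ar x x'
    exact ⟨f, hf, hD.iso (by grind) (by grind)⟩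
  hom_fully_faithful f f' hs ht b hb := by
    obtain ⟨a, ha⟩ := hC.exists_cell hs ht
    exact ⟨a, ⟨ha, hD.cell_ext (by grind) (by grind)⟩,
      fun c hc => hC.cell_ext (by grind) (by grind)⟩

end IsContractible

section Product

variable {C D : TwoCat.{u}}

theorem isInv_prod {a : (C.prod D).Cell} (h₁ : C.IsInv a.1) (h₂ : D.IsInv a.2) :
    (C.prod D).IsInv a :=
  isInv_of (C := C.prod D) (b := (C.inv a.1, D.inv a.2))
    (Prod.ext h₁.inv_spec.1 h₂.inv_spec.1) (Prod.ext h₁.inv_spec.2.1 h₂.inv_spec.2.1)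
    (Prod.ext h₁.inv_spec.2.2.1 h₂.inv_spec.2.2.1) (Prod.ext h₁.inv_spec.2.2.2 h₂.inv_spec.2.2.2)

theorem isCell_prod {a : (C.prod D).Cell} {f g : (C.prod D).Ar} (h₁ : C.IsCell a.1 f.1 g.1)
    (h₂ : D.IsCell a.2 f.2 g.2) : (C.prod D).IsCell a f g :=
  ⟨Prod.ext h₁.1 h₂.1, Prod.ext h₁.2 h₂.2⟩

theorem iso_prod {f g : (C.prod D).Ar} : C.Iso f.1 g.1 → D.Iso f.2 g.2 → (C.prod D).Iso f g :=
  fun ⟨a, ha, hi⟩ ⟨b, hb, hi'⟩ => ⟨(a, b), isCell_prod ha hb, isInv_prod hi hi'⟩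

theorem isEqui_prod {f : (C.prod D).Ar} (h₁ : C.IsEqui f.1) (h₂ : D.IsEqui f.2) :
    (C.prod D).IsEqui f := by
  obtain ⟨g, hg, a, b⟩ := isEqui_iff.1 h₁
  obtain ⟨g', hg', a', b'⟩ := isEqui_iff.1 h₂
  exact isEqui_iff.2 ⟨(g, g'), ⟨Prod.ext hg.1 hg'.1, Prod.ext hg.2 hg'.2⟩,
    iso_prod a a', iso_prod b b'⟩

theorem isAr_prod_iff {f : (C.prod D).Ar} {x y : (C.prod D).Ob} :
    (C.prod D).IsAr f x y ↔ C.IsAr f.1 x.1 y.1 ∧ D.IsAr f.2 x.2 y.2 := by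
  obtain ⟨x, x'⟩ := x
  obtain ⟨y, y'⟩ := y
  simp only [IsAr, prod, Prod.mk.injEq]
  tauto

theorem isCell_prod_iff {a : (C.prod D).Cell} {f g : (C.prod D).Ar} :
    (C.prod D).IsCell a f g ↔ C.IsCell a.1 f.1 g.1 ∧ D.IsCell a.2 f.2 g.2 := by
  obtain ⟨f, f'⟩ := f
  obtain ⟨g, g'⟩ := g
  simp only [IsCell, prod, Prod.mk.injEq]
  tauto

/-- The inclusion of a slice of a product with a contractible 2-category is an equi-2-functor. -/
theorem IsContractible.isEqui2_pair_const (hC : C.IsContractible) (x : C.Ob) :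
    (TwoFunctor.pair (TwoFunctor.const D x) (TwoFunctor.id D)).IsEqui2 where
  ess_surj y := by
    obtain ⟨f, hf⟩ := hC.exists_ar x y.1
    exact ⟨y.2, (f, D.one y.2), isAr_prod_iff.2 ⟨hf, by simp [TwoFunctor.pair, TwoFunctor.id]; grind⟩,
      isEqui_prod (hC.isEqui f) (D.isEqui_one _)⟩
  hom_ess_surj z z' g hg := by
    have hg := isAr_prod_iff.1 hg
    refine ⟨g.2, hg.2, iso_prod (hC.iso ?_ ?_) (.refl _)⟩
    · exact (C.src_one x).trans hg.1.1.symm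
    · exact (C.tgt_one x).trans hg.1.2.symm
  hom_fully_faithful f f' hs ht b hb := by
    have hb := isCell_prod_iff.1 hb
    refine ⟨b.2, ⟨hb.2, Prod.ext (hC.cell_ext ?_ ?_) rfl⟩, fun c hc => by rw [← hc.2]; rfl⟩
    · exact (C.dom_two _).trans hb.1.1.symm
    · exact (C.cod_two _).trans hb.1.2.symm

/-- The second projection of the product. -/
def snd (C D : TwoCat.{u}) : TwoFunctor (C.prod D) D where
  ob x := x.2
  ar f := f.2
  cell a := a.2
  map_src _ := rfl
  map_tgt _ := rfl
  map_dom _ := rfl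
  map_cod _ := rfl
  map_one _ := rfl
  map_two _ := rfl
  map_comp _ _ _ := rfl
  map_vcomp _ _ _ := rfl
  map_hcomp _ _ _ := rfl

theorem IsContractible.isEqui2_snd (hC : C.IsContractible) : (snd C D).IsEqui2 where
  ess_surj y := by
    obtain ⟨x⟩ := hC.nonempty
    exact ⟨(x, y), D.one y, by simp [snd]; grind, D.isEqui_one y⟩
  hom_ess_surj z z' g hg := by
    obtain ⟨f, hf⟩ := hC.exists_ar z.1 z'.1
    exact ⟨(f, g), isAr_prod_iff.2 ⟨hf, hg⟩, Iso.refl (C := D) g⟩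
  hom_fully_faithful f f' hs ht b hb := by
    obtain ⟨a, ha⟩ := hC.exists_cell (f := f.1) (g := f'.1) (congrArg Prod.fst hs)
      (congrArg Prod.fst ht)
    refine ⟨(a, b), ⟨isCell_prod_iff.2 ⟨ha, hb⟩, rfl⟩, fun c hc => Prod.ext ?_ hc.2⟩
    have := (isCell_prod_iff.1 hc.1).1
    exact hC.cell_ext (by grind) (by grind)

end Product

end TwoCat

/-! ### Operations on pseudo-natural transformations and modifications -/

namespace TransfData

variable {B C D E : TwoCat.{u}} {F G H : TwoFunctor C D} {s s' s'' t t' : TransfData C D}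
  {m n : C.Ob → D.Cell}

theorem IsInvModification.trans (hm : IsInvModification F G s s' m)
    (hn : IsInvModification F G s' s'' n) (hs : s.IsPseudonatural F G)
    (hs' : s'.IsPseudonatural F G) (hs'' : s''.IsPseudonatural F G) :
    IsInvModification F G s s'' (fun x => D.vcomp (m x) (n x)) where
  cell x := by
    have := hm.cell x
    have := hn.cell x
    grind
  inv x := by
    have := hm.cell x
    have := hn.cell x
    exact (hm.inv x).vcomp (hn.inv x) (by grind)
  natural f := by
    have h₁ := hm.natural f
    have h₂ := hn.natural f
    have := hm.cell (C.src f)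
    have := hn.cell (C.src f)
    have := hm.cell (C.tgt f)
    have := hn.cell (C.tgt f)
    have := hs.nat_cell f
    have := hs'.nat_cell f
    have := hs''.nat_cell f
    have := hs.app_ar (C.src f)
    have := hs.app_ar (C.tgt f)
    rw [D.vcomp_hcomp_two, ← D.vcomp_assoc, h₁, D.vcomp_assoc, h₂, D.two_hcomp_vcomp,
      D.vcomp_assoc] <;> grind

theorem IsInvModification.symm (hm : IsInvModification F G s s' m)
    (hs : s.IsPseudonatural F G) (hs' : s'.IsPseudonatural F G) :
    IsInvModification F G s' s (fun x => D.inv (m x)) where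
  cell x := by
    have := hm.cell x
    have := hm.inv x
    grind
  inv x := (hm.inv x).inv
  natural f := by
    have h₁ := hm.natural f
    have c₁ := hm.cell (C.src f)
    have c₂ := hm.cell (C.tgt f)
    have i₁ := hm.inv (C.src f)
    have i₂ := hm.inv (C.tgt f)
    have := hs.nat_cell f
    have := hs'.nat_cell f
    have := hs.app_ar (C.src f)
    have := hs.app_ar (C.tgt f)
    have j₁ : D.IsInv (D.hcomp (m (C.src f)) (D.two (G.ar f))) := i₁.hcomp (D.isInv_two _) (by grind)
    have j₂ : D.IsInv (D.hcomp (D.two (F.ar f)) (m (C.tgt f))) :=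
      (D.isInv_two _).hcomp i₂ (by grind)
    have e₁ : D.hcomp (D.inv (m (C.src f))) (D.two (G.ar f)) =
        D.inv (D.hcomp (m (C.src f)) (D.two (G.ar f))) := by
      rw [TwoCat.inv_hcomp i₁ (D.isInv_two _) (by grind), TwoCat.inv_two]
    have e₂ : D.hcomp (D.two (F.ar f)) (D.inv (m (C.tgt f))) =
        D.inv (D.hcomp (D.two (F.ar f)) (m (C.tgt f))) := by
      rw [TwoCat.inv_hcomp (D.isInv_two _) i₂ (by grind), TwoCat.inv_two]
    rw [e₁, e₂]
    refine j₂.cancel_left (by grind) (by grind) ?_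
    rw [← D.vcomp_assoc, ← h₁, D.vcomp_assoc, TwoCat.vcomp_inv_cancel] <;> grind

theorem IsInvModification.postcomp (hm : IsInvModification F G s s' m)
    (hs : s.IsPseudonatural F G) (hs' : s'.IsPseudonatural F G) (K : TwoFunctor D E) :
    IsInvModification (F.comp K) (G.comp K) (s.postcomp K) (s'.postcomp K)
      (fun x => K.cell (m x)) where
  cell x := by
    have := hm.cell x
    simp only [TransfData.postcomp]
    grind
  inv x := K.map_isInv (hm.inv x)
  natural f := by
    have h₁ := congrArg K.cell (hm.natural f)
    have c₁ := hm.cell (C.src f)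
    have c₂ := hm.cell (C.tgt f)
    have := hs.nat_cell f
    have := hs'.nat_cell f
    have := hs.app_ar (C.src f)
    have := hs.app_ar (C.tgt f)
    simp only [TransfData.postcomp, TwoFunctor.comp]
    rw [K.map_vcomp, K.map_vcomp, K.map_hcomp, K.map_hcomp, K.map_two, K.map_two] at h₁ <;> grind

/-- Modifications are reflected by locally faithful 2-functors. -/
theorem IsInvModification.of_postcomp {K : TwoFunctor D E} (hK : K.IsEqui2)
    (hs : s.IsPseudonatural F G) (hs' : s'.IsPseudonatural F G)
    (hc : ∀ x, D.IsCell (m x) (s.app x) (s'.app x))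
    (hm : IsInvModification (F.comp K) (G.comp K) (s.postcomp K) (s'.postcomp K)
      (fun x => K.cell (m x))) :
    IsInvModification F G s s' m where
  cell := hc
  inv x := hK.isInv_reflect (hm.inv x)
  natural f := by
    have h₁ := hm.natural f
    have c₁ := hc (C.src f)
    have c₂ := hc (C.tgt f)
    have := hs.nat_cell f
    have := hs'.nat_cell f
    have := hs.app_ar (C.src f)
    have := hs.app_ar (C.tgt f)
    simp only [TransfData.postcomp, TwoFunctor.comp] at h₁
    refine hK.cell_ext (by grind) (by grind) ?_
    rw [K.map_vcomp, K.map_vcomp, K.map_hcomp, K.map_hcomp, K.map_two, K.map_two] <;> grind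

theorem IsInvModification.precomp (hm : IsInvModification F G s s' m) (K : TwoFunctor B C) :
    IsInvModification (K.comp F) (K.comp G) (s.precomp K) (s'.precomp K)
      (fun x => m (K.ob x)) where
  cell x := hm.cell _
  inv x := hm.inv _
  natural f := by
    have := hm.natural (K.ar f)
    rwa [K.map_src, K.map_tgt] at this

theorem IsPseudonatural.precomp (hs : s.IsPseudonatural F G) (K : TwoFunctor B C) :
    (s.precomp K).IsPseudonatural (K.comp F) (K.comp G) where
  app_ar x := hs.app_ar _
  nat_cell f := by
    have := hs.nat_cell (K.ar f)
    rwa [K.map_src, K.map_tgt] at this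
  nat_inv f := hs.nat_inv _
  nat_one x := by
    have := hs.nat_one (K.ob x)
    simp only [TransfData.precomp]
    rwa [K.map_one]
  nat_comp f g h := by
    simp only [TransfData.precomp]
    rw [K.map_comp f g h, hs.nat_comp _ _ (by grind)]
    rfl
  nat_nat a := by
    have := hs.nat_nat (K.cell a)
    simp only [TransfData.precomp, TwoFunctor.comp]
    grind

theorem IsPseudonatural.postcomp (hs : s.IsPseudonatural F G) (K : TwoFunctor D E) :
    (s.postcomp K).IsPseudonatural (F.comp K) (G.comp K) where
  app_ar x := by
    have := hs.app_ar x
    simp only [TransfData.postcomp, TwoFunctor.comp]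
    grind
  nat_cell f := by
    have := hs.nat_cell f
    have := hs.app_ar (C.src f)
    have := hs.app_ar (C.tgt f)
    simp only [TransfData.postcomp, TwoFunctor.comp]
    grind
  nat_inv f := K.map_isInv (hs.nat_inv _)
  nat_one x := by
    simp only [TransfData.postcomp]
    rw [hs.nat_one, K.map_two]
  nat_comp f g h := by
    have := hs.nat_cell f
    have := hs.nat_cell g
    have := hs.app_ar (C.src f)
    have := hs.app_ar (C.tgt f)
    have := hs.app_ar (C.tgt g)
    simp only [TransfData.postcomp, TwoFunctor.comp]
    rw [hs.nat_comp f g h, K.map_vcomp, K.map_hcomp, K.map_hcomp, K.map_two, K.map_two]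
      <;> grind
  nat_nat a := by
    have h := congrArg K.cell (hs.nat_nat a)
    have := hs.nat_cell (C.dom a)
    have := hs.nat_cell (C.cod a)
    have := hs.app_ar (C.src (C.dom a))
    have := hs.app_ar (C.tgt (C.dom a))
    simp only [TransfData.postcomp, TwoFunctor.comp]
    rw [K.map_vcomp, K.map_vcomp, K.map_hcomp, K.map_hcomp, K.map_two, K.map_two] at h <;> grind

theorem IsPseudonatural.comp (hs : s.IsPseudonatural F G) (ht : t.IsPseudonatural G H) :
    (s.comp t).IsPseudonatural F H where
  app_ar x := by
    have := hs.app_ar x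
    have := ht.app_ar x
    simp only [TransfData.comp]
    grind
  nat_cell f := by
    have := hs.nat_cell f
    have := hs.app_ar (C.src f)
    have := hs.app_ar (C.tgt f)
    have := ht.nat_cell f
    have := ht.app_ar (C.src f)
    have := ht.app_ar (C.tgt f)
    simp only [TransfData.comp]
    grind
  nat_inv f := by
    have := hs.nat_cell f
    have := hs.app_ar (C.src f)
    have := hs.app_ar (C.tgt f)
    have := ht.nat_cell f
    have := ht.app_ar (C.src f)
    have := ht.app_ar (C.tgt f)
    exact ((hs.nat_inv f).hcomp (D.isInv_two _) (by grind)).vcomp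
      ((D.isInv_two _).hcomp (ht.nat_inv f) (by grind)) (by grind)
  nat_one x := by
    have := hs.app_ar x
    have := ht.app_ar x
    simp only [TransfData.comp]
    rw [hs.nat_one, ht.nat_one]
    grind
  nat_comp f g h := by
    have a₁ := hs.nat_cell f
    have a₂ := hs.nat_cell g
    have b₁ := hs.app_ar (C.src f)
    have b₂ := hs.app_ar (C.tgt f)
    have b₃ := hs.app_ar (C.tgt g)
    have c₁ := ht.nat_cell f
    have c₂ := ht.nat_cell g
    have d₁ := ht.app_ar (C.src f)
    have d₂ := ht.app_ar (C.tgt f)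
    have d₃ := ht.app_ar (C.tgt g)
    -- The cell of `s` at `f` and the cell of `t` at `g` sit in different factors of the composite,
    -- so they interchange.
    have key : D.vcomp (D.hcomp (D.hcomp (s.nat f) (D.two (G.ar g))) (D.two (t.app (C.tgt g))))
        (D.hcomp (D.two (s.app (C.src f))) (D.hcomp (D.two (G.ar f)) (t.nat g))) =
      D.vcomp (D.hcomp (D.two (F.ar f)) (D.hcomp (D.two (s.app (C.tgt f))) (t.nat g)))
        (D.hcomp (D.hcomp (s.nat f) (D.two (t.app (C.tgt f)))) (D.two (H.ar g))) := by
      rw [← D.hcomp_two_comp, ← D.two_comp_hcomp, ← D.hcomp_two_comp, ← D.two_comp_hcomp,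
        D.hcomp_eq_right_left, D.hcomp_eq_left_right] <;> grind
    simp only [TransfData.comp]
    rw [hs.nat_comp f g h, ht.nat_comp f g h, C.tgt_comp f g h, C.src_comp f g h]
    rw [D.two_hcomp_vcomp, D.vcomp_hcomp_two, D.two_hcomp_vcomp, D.vcomp_hcomp_two, D.vcomp_assoc,
      ← D.vcomp_assoc (D.hcomp (D.hcomp (s.nat f) (D.two (G.ar g))) (D.two (t.app (C.tgt g)))),
      key, D.vcomp_assoc, D.vcomp_assoc, D.hcomp_assoc, D.hcomp_assoc (D.two (s.app (C.src f)))]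
      <;> grind (ematch := 12)
  nat_nat a := by
    have h₁ := hs.nat_nat a
    have h₂ := ht.nat_nat a
    have a₁ := hs.nat_cell (C.dom a)
    have a₂ := hs.nat_cell (C.cod a)
    have b₁ := hs.app_ar (C.src (C.dom a))
    have b₂ := hs.app_ar (C.tgt (C.dom a))
    have c₁ := ht.nat_cell (C.dom a)
    have c₂ := ht.nat_cell (C.cod a)
    have d₁ := ht.app_ar (C.src (C.dom a))
    have d₂ := ht.app_ar (C.tgt (C.dom a))
    simp only [TransfData.comp]
    rw [C.src_cod, C.tgt_cod, D.hcomp_two_comp, ← D.vcomp_assoc, ← D.vcomp_hcomp_two, h₁,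
      D.vcomp_hcomp_two, D.vcomp_assoc, D.hcomp_assoc, ← D.two_hcomp_vcomp, h₂,
      D.two_hcomp_vcomp, D.two_comp_hcomp, ← D.vcomp_assoc] <;> grind

end TransfData

/-! ### Detecting modifications by whiskering, and lifting along equi-2-functors -/

namespace TransfData

variable {B C D E : TwoCat.{u}} {F G H : TwoFunctor C D} {s s' s'' t t' : TransfData C D}
  {m n : C.Ob → D.Cell}

theorem IsInvModification.whisker_right (hm : IsInvModification F G s s' m)
    (hs : s.IsPseudonatural F G) (hs' : s'.IsPseudonatural F G) (ht : t.IsPseudonatural G H) :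
    IsInvModification F H (s.comp t) (s'.comp t)
      (fun x => D.hcomp (m x) (D.two (t.app x))) where
  cell x := by
    have := hm.cell x
    have := hs.app_ar x
    have := ht.app_ar x
    simp only [TransfData.comp]
    grind
  inv x := by
    have := hm.cell x
    have := hs.app_ar x
    have := ht.app_ar x
    exact (hm.inv x).hcomp (D.isInv_two _) (by grind)
  natural f := by
    have h₁ := hm.natural f
    have c₁ := hm.cell (C.src f)
    have c₂ := hm.cell (C.tgt f)
    have := hs.nat_cell f
    have := hs'.nat_cell f
    have := ht.nat_cell f
    have := hs.app_ar (C.src f)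
    have := hs.app_ar (C.tgt f)
    have := ht.app_ar (C.src f)
    have := ht.app_ar (C.tgt f)
    have key : D.vcomp (D.hcomp (D.two (s.app (C.src f))) (t.nat f))
        (D.hcomp (D.hcomp (m (C.src f)) (D.two (t.app (C.src f)))) (D.two (H.ar f))) =
      D.vcomp (D.hcomp (D.hcomp (m (C.src f)) (D.two (G.ar f))) (D.two (t.app (C.tgt f))))
        (D.hcomp (D.two (s'.app (C.src f))) (t.nat f)) := by
      rw [← D.hcomp_two_comp, ← D.hcomp_two_comp, D.hcomp_eq_right_left, D.hcomp_eq_left_right]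
        <;> grind
    simp only [TransfData.comp]
    rw [D.vcomp_assoc, key, ← D.vcomp_assoc, ← D.vcomp_hcomp_two, h₁, D.vcomp_hcomp_two,
      D.vcomp_assoc, D.hcomp_assoc] <;> grind (ematch := 12)

/-- A family of 2-cells is a modification if it is so after whiskering on the left with a
pseudo-natural family of equiarrows. -/
theorem IsInvModification.of_whisker_left (hs : s.IsPseudonatural F G)
    (he : ∀ x, D.IsEqui (s.app x)) (ht : t.IsPseudonatural G H) (ht' : t'.IsPseudonatural G H)
    (hc : ∀ x, D.IsCell (m x) (t.app x) (t'.app x))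
    (hm : IsInvModification F H (s.comp t) (s.comp t')
      (fun x => D.hcomp (D.two (s.app x)) (m x))) :
    IsInvModification G H t t' m where
  cell := hc
  inv x := by
    have := hc x
    have := hs.app_ar x
    have := ht.app_ar x
    exact (he x).whisker_left_isInv (by grind) (hm.inv x)
  natural f := by
    have h₁ := hm.natural f
    have c₁ := hc (C.src f)
    have c₂ := hc (C.tgt f)
    have := hs.nat_cell f
    have i := hs.nat_inv f
    have := ht.nat_cell f
    have := ht'.nat_cell f
    have := hs.app_ar (C.src f)
    have := hs.app_ar (C.tgt f)
    have := ht.app_ar (C.src f)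
    have := ht.app_ar (C.tgt f)
    refine (he (C.src f)).whisker_left_cancel (by grind (ematch := 12)) (by grind (ematch := 12)) (by grind (ematch := 12)) ?_
    have j : D.IsInv (D.hcomp (s.nat f) (D.two (t.app (C.tgt f)))) :=
      i.hcomp (D.isInv_two _) (by grind)
    refine j.cancel_left (by grind (ematch := 12)) (by grind (ematch := 12)) ?_
    -- Moving the naturality cell of `s` past `m` turns the hypothesis on `s ; t` into the required
    -- equation whiskered with `s`.
    have key : D.vcomp (D.hcomp (D.two (F.ar f)) (D.hcomp (D.two (s.app (C.tgt f))) (m (C.tgt f))))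
        (D.hcomp (s.nat f) (D.two (t'.app (C.tgt f)))) =
      D.vcomp (D.hcomp (s.nat f) (D.two (t.app (C.tgt f))))
        (D.hcomp (D.two (s.app (C.src f))) (D.hcomp (D.two (G.ar f)) (m (C.tgt f)))) := by
      rw [← D.two_comp_hcomp, ← D.two_comp_hcomp, D.hcomp_eq_right_left, D.hcomp_eq_left_right]
        <;> grind
    simp only [TransfData.comp] at h₁
    rw [D.two_hcomp_vcomp, D.two_hcomp_vcomp, ← D.vcomp_assoc, ← D.vcomp_assoc, ← key,
      D.vcomp_assoc (D.hcomp (D.two (F.ar f)) _), ← h₁, D.hcomp_assoc] <;> grind (ematch := 12)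

/-- A family of 2-cells is a modification if it is so after whiskering on the right with a
pseudo-natural family of equiarrows. -/
theorem IsInvModification.of_whisker_right (hs : s.IsPseudonatural F G)
    (hs' : s'.IsPseudonatural F G) (ht : t.IsPseudonatural G H) (he : ∀ x, D.IsEqui (t.app x))
    (hc : ∀ x, D.IsCell (m x) (s.app x) (s'.app x))
    (hm : IsInvModification F H (s.comp t) (s'.comp t)
      (fun x => D.hcomp (m x) (D.two (t.app x)))) :
    IsInvModification F G s s' m where
  cell := hc
  inv x := by
    have := hc x
    have := hs.app_ar x
    have := ht.app_ar x
    exact (he x).whisker_right_isInv (by grind) (hm.inv x)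
  natural f := by
    have h₁ := hm.natural f
    have c₁ := hc (C.src f)
    have c₂ := hc (C.tgt f)
    have := hs.nat_cell f
    have := hs'.nat_cell f
    have := ht.nat_cell f
    have i := ht.nat_inv f
    have := hs.app_ar (C.src f)
    have := hs.app_ar (C.tgt f)
    have := ht.app_ar (C.src f)
    have := ht.app_ar (C.tgt f)
    have j : D.IsInv (D.hcomp (D.two (s'.app (C.src f))) (t.nat f)) :=
      (D.isInv_two _).hcomp i (by grind)
    refine (he (C.tgt f)).whisker_right_cancel (by grind (ematch := 12)) (by grind (ematch := 12)) (by grind (ematch := 12)) ?_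
    refine j.cancel_right (by grind (ematch := 12)) (by grind (ematch := 12)) ?_
    have key : D.vcomp (D.hcomp (D.two (s.app (C.src f))) (t.nat f))
        (D.hcomp (D.hcomp (m (C.src f)) (D.two (t.app (C.src f)))) (D.two (H.ar f))) =
      D.vcomp (D.hcomp (D.hcomp (m (C.src f)) (D.two (G.ar f))) (D.two (t.app (C.tgt f))))
        (D.hcomp (D.two (s'.app (C.src f))) (t.nat f)) := by
      rw [← D.hcomp_two_comp, ← D.hcomp_two_comp, D.hcomp_eq_right_left, D.hcomp_eq_left_right]
        <;> grind
    simp only [TransfData.comp] at h₁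
    rw [D.vcomp_hcomp_two, D.vcomp_hcomp_two, D.vcomp_assoc, ← key, ← D.vcomp_assoc, h₁,
      D.hcomp_assoc, D.vcomp_assoc] <;> grind (ematch := 12)

/-- If the images of arrows `l_x : F x ⟶ G x` under an equi-2-functor are isomorphic to the
components of a pseudo-natural transformation, then there is a unique way to make `l` pseudo-natural
and the isomorphisms a modification. -/
theorem existsUnique_nat {K : TwoFunctor D E} (hK : K.IsEqui2) {t : TransfData C E}
    (ht : t.IsPseudonatural (F.comp K) (G.comp K)) {l : C.Ob → D.Ar} {L : C.Ob → E.Cell}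
    (hl : ∀ x, D.IsAr (l x) (F.ob x) (G.ob x)) (hL : ∀ x, E.IsCell (L x) (K.ar (l x)) (t.app x))
    (hLi : ∀ x, E.IsInv (L x)) :
    ∃! n : C.Ar → D.Cell, IsPseudonatural F G ⟨l, n⟩ ∧
      IsInvModification (F.comp K) (G.comp K) (postcomp ⟨l, n⟩ K) t L := by
  have hi : ∀ f, E.IsInv (E.hcomp (L (C.src f)) (E.two (K.ar (G.ar f)))) := fun f =>
    (hLi _).hcomp (E.isInv_two _) (by have := hl (C.src f); have := hL (C.src f); grind)
  have hi' : ∀ f, E.IsInv (E.hcomp (E.two (K.ar (F.ar f))) (L (C.tgt f))) := fun f =>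
    (E.isInv_two _).hcomp (hLi _) (by have := hl (C.tgt f); have := hL (C.tgt f); grind)
  -- The modification axiom at `f` can be solved for the image under `K` of the naturality cell,
  -- since `L` is invertible. Full faithfulness of `K` on hom categories then gives the cell.
  have hex : ∀ f : C.Ar, ∃ n, D.IsCell n (D.comp (F.ar f) (l (C.tgt f)))
      (D.comp (l (C.src f)) (G.ar f)) ∧ D.IsInv n ∧
      E.vcomp (K.cell n) (E.hcomp (L (C.src f)) (E.two (K.ar (G.ar f)))) =
        E.vcomp (E.hcomp (E.two (K.ar (F.ar f))) (L (C.tgt f))) (t.nat f) := by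
    intro f
    have := hl (C.src f)
    have := hl (C.tgt f)
    have := hL (C.src f)
    have := hL (C.tgt f)
    have := ht.nat_cell f
    have j := ht.nat_inv f
    have h₁ := hi f
    have h₂ := hi' f
    obtain ⟨n, hn, hni, hn'⟩ := hK.exists_inv_cell (f := D.comp (F.ar f) (l (C.tgt f)))
      (f' := D.comp (l (C.src f)) (G.ar f))
      (b := E.vcomp (E.vcomp (E.hcomp (E.two (K.ar (F.ar f))) (L (C.tgt f))) (t.nat f))
        (E.inv (E.hcomp (L (C.src f)) (E.two (K.ar (G.ar f))))))
      (by grind) (by grind) (by grind (ematch := 12))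
      ((h₂.vcomp j (by grind)).vcomp h₁.inv (by grind))
    refine ⟨n, hn, hni, ?_⟩
    rw [hn', E.vcomp_assoc, h₁.inv_spec.2.2.2] <;> grind
  choose n hn hni hn' using hex
  -- The axioms for identities and composites follow from this uniqueness: the candidate on each
  -- side solves the same equation.
  have uniq : ∀ f c, D.dom c = D.comp (F.ar f) (l (C.tgt f)) →
      D.cod c = D.comp (l (C.src f)) (G.ar f) →
      E.vcomp (K.cell c) (E.hcomp (L (C.src f)) (E.two (K.ar (G.ar f)))) =
        E.vcomp (E.hcomp (E.two (K.ar (F.ar f))) (L (C.tgt f))) (t.nat f) → c = n f := by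
    intro f c h₁ h₂ h₃
    have := hn f
    have := hl (C.src f)
    have := hL (C.src f)
    refine hK.cell_ext (by grind) (by grind) ((hi f).cancel_right (by grind) (by grind) ?_)
    rw [h₃, hn' f]
  refine ⟨n, ⟨⟨hl, hn, hni, ?_, ?_, ?_⟩, hL, hLi, hn'⟩, ?_⟩
  · intro x
    have := hl x
    have := hL x
    have := ht.nat_one x
    refine (uniq _ _ ?_ ?_ ?_).symm <;> grind
  · intro f g h
    have := hl (C.src f)
    have := hl (C.tgt f)
    have := hl (C.tgt g)
    have := hL (C.src f)
    have := hL (C.tgt f)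
    have := hL (C.tgt g)
    have := hn f
    have := hn g
    have := ht.nat_cell f
    have := ht.nat_cell g
    have hc := ht.nat_comp f g h
    simp only [TwoFunctor.comp_ar] at hc
    refine (uniq _ _ ?_ ?_ ?_).symm
    · grind (ematch := 12)
    · grind (ematch := 12)
    · have k₁ := hn' f
      have k₂ := hn' g
      rw [C.src_comp f g h, C.tgt_comp f g h, hc, F.map_comp f g h, G.map_comp f g h,
        K.map_comp _ _ (by grind), K.map_comp _ _ (by grind),
        K.map_vcomp _ _ (by grind), K.map_hcomp _ _ (by grind), K.map_hcomp _ _ (by grind),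
        K.map_two, K.map_two]
      rw [E.hcomp_two_comp, E.vcomp_assoc, ← E.vcomp_hcomp_two, k₁, E.vcomp_hcomp_two,
        E.hcomp_assoc, h, ← E.vcomp_assoc, ← E.two_hcomp_vcomp, k₂, E.two_hcomp_vcomp,
        E.two_comp_hcomp, E.vcomp_assoc] <;> grind (ematch := 12)
  · intro a
    have := hl (C.src (C.dom a))
    have := hl (C.tgt (C.dom a))
    have := hL (C.src (C.dom a))
    have := hL (C.tgt (C.dom a))
    have := hn (C.dom a)
    have := hn (C.cod a)
    have := ht.nat_cell (C.dom a)
    have := ht.nat_cell (C.cod a)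
    have hc := ht.nat_nat a
    simp only [TwoFunctor.comp_cell] at hc
    have k₁ := hn' (C.dom a)
    have k₂ := hn' (C.cod a)
    refine hK.cell_ext (by grind) (by grind) ((hi (C.cod a)).cancel_right (by grind) (by grind) ?_)
    have key₁ : E.vcomp (E.hcomp (K.cell (F.cell a)) (E.two (K.ar (l (C.tgt (C.dom a))))))
        (E.hcomp (E.two (K.ar (F.ar (C.cod a)))) (L (C.tgt (C.dom a)))) =
      E.vcomp (E.hcomp (E.two (K.ar (F.ar (C.dom a)))) (L (C.tgt (C.dom a))))
        (E.hcomp (K.cell (F.cell a)) (E.two (t.app (C.tgt (C.dom a))))) := by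
      rw [E.hcomp_eq_right_left, E.hcomp_eq_left_right] <;> grind
    have key₂ : E.vcomp (E.hcomp (E.two (K.ar (l (C.src (C.dom a))))) (K.cell (G.cell a)))
        (E.hcomp (L (C.src (C.dom a))) (E.two (K.ar (G.ar (C.cod a))))) =
      E.vcomp (E.hcomp (L (C.src (C.dom a))) (E.two (K.ar (G.ar (C.dom a)))))
        (E.hcomp (E.two (t.app (C.src (C.dom a)))) (K.cell (G.cell a))) := by
      rw [E.hcomp_eq_right_left, E.hcomp_eq_left_right] <;> grind
    rw [C.src_cod, C.tgt_cod] at k₂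
    rw [K.map_vcomp _ _ (by grind), K.map_vcomp _ _ (by grind), K.map_hcomp _ _ (by grind),
      K.map_hcomp _ _ (by grind), K.map_two, K.map_two]
    rw [C.src_cod, E.vcomp_assoc, k₂, ← E.vcomp_assoc, key₁, E.vcomp_assoc, hc, E.vcomp_assoc,
      key₂, ← E.vcomp_assoc, ← E.vcomp_assoc, k₁] <;> grind (ematch := 12)
  · rintro n' ⟨hp, hm⟩
    funext f
    exact uniq f _ (hp.nat_cell f).1 (hp.nat_cell f).2 (hm.natural f)

/-- Two lifts of a pseudo-natural transformation along an equi-2-functor are related by a unique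
invertible modification. -/
theorem existsUnique_modification {K : TwoFunctor D E} (hK : K.IsEqui2) {t : TransfData C E}
    (ht : t.IsPseudonatural (F.comp K) (G.comp K)) {L L' : C.Ob → E.Cell}
    (hs : s.IsPseudonatural F G) (hs' : s'.IsPseudonatural F G)
    (hL : IsInvModification (F.comp K) (G.comp K) (s.postcomp K) t L)
    (hL' : IsInvModification (F.comp K) (G.comp K) (s'.postcomp K) t L') :
    ∃! m : C.Ob → D.Cell, IsInvModification F G s s' m ∧
      ∀ x, E.vcomp (K.cell (m x)) (L' x) = L x := by
  -- The condition `K m ; L' = L` forces the image of `m` to be `L ; L'⁻¹`.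
  have hex : ∀ x, ∃ m, D.IsCell m (s.app x) (s'.app x) ∧
      K.cell m = E.vcomp (L x) (E.inv (L' x)) := by
    intro x
    have h₁ := hs.app_ar x
    have h₂ := hs'.app_ar x
    have c₁ := hL.cell x
    have c₂ := hL'.cell x
    have := hL'.inv x
    exact hK.exists_cell (by grind) (by grind) (by grind)
  choose m hm hm' using hex
  refine ⟨m, ⟨.of_postcomp hK hs hs' hm ?_, ?_⟩, ?_⟩
  · have := hL.trans (hL'.symm (hs'.postcomp K) ht) (hs.postcomp K) ht (hs'.postcomp K)
    simpa only [hm'] using this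
  · intro x
    have c₁ := hL.cell x
    have c₂ := hL'.cell x
    have := hL'.inv x
    rw [hm', E.vcomp_assoc, this.inv_spec.2.2.2] <;> grind
  · rintro n ⟨hn, hn'⟩
    funext x
    have c₁ := hL.cell x
    have c₂ := hL'.cell x
    have i := hL'.inv x
    have := hm x
    have := hn.cell x
    refine hK.cell_ext (by grind) (by grind) ?_
    rw [hm', ← hn' x, E.vcomp_assoc, i.inv_spec.2.2.1] <;> grind

end TransfData

/-! ### The calculus of the tensor product and its reversal -/

namespace SMon2Cat

variable (C : SMon2Cat.{u})

@[grind =] theorem src_tAr (f g : C.Ar) : C.src (C.tAr f g) = C.tOb (C.src f) (C.src g) :=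
  C.tensor.map_src (f, g)
@[grind =] theorem tgt_tAr (f g : C.Ar) : C.tgt (C.tAr f g) = C.tOb (C.tgt f) (C.tgt g) :=
  C.tensor.map_tgt (f, g)
@[grind =] theorem dom_tCell (a b : C.Cell) : C.dom (C.tCell a b) = C.tAr (C.dom a) (C.dom b) :=
  C.tensor.map_dom (a, b)
@[grind =] theorem cod_tCell (a b : C.Cell) : C.cod (C.tCell a b) = C.tAr (C.cod a) (C.cod b) :=
  C.tensor.map_cod (a, b)
@[grind =] theorem tAr_one (x y : C.Ob) : C.tAr (C.one x) (C.one y) = C.one (C.tOb x y) :=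
  C.tensor.map_one (x, y)
@[grind =] theorem tCell_two (f g : C.Ar) : C.tCell (C.two f) (C.two g) = C.two (C.tAr f g) :=
  C.tensor.map_two (f, g)
@[grind =] theorem tAr_comp {f f' g g' : C.Ar} (h : C.tgt f = C.src f') (h' : C.tgt g = C.src g') :
    C.comp (C.tAr f g) (C.tAr f' g') = C.tAr (C.comp f f') (C.comp g g') :=
  (C.tensor.map_comp (f, g) (f', g') (Prod.ext h h')).symm
theorem tCell_vcomp {a a' b b' : C.Cell} (h : C.cod a = C.dom a') (h' : C.cod b = C.dom b') :
    C.vcomp (C.tCell a b) (C.tCell a' b') = C.tCell (C.vcomp a a') (C.vcomp b b') :=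
  (C.tensor.map_vcomp (a, b) (a', b') (Prod.ext h h')).symm
theorem tCell_hcomp {a a' b b' : C.Cell} (h : C.tgt (C.dom a) = C.src (C.dom a'))
    (h' : C.tgt (C.dom b) = C.src (C.dom b')) :
    C.hcomp (C.tCell a b) (C.tCell a' b') = C.tCell (C.hcomp a a') (C.hcomp b b') :=
  (C.tensor.map_hcomp (a, b) (a', b') (Prod.ext h h')).symm

@[grind =] theorem tOb_assoc (x y z : C.Ob) : C.tOb (C.tOb x y) z = C.tOb x (C.tOb y z) :=
  C.assoc_ob x y z
@[grind =] theorem tAr_assoc (f g h : C.Ar) : C.tAr (C.tAr f g) h = C.tAr f (C.tAr g h) :=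
  C.assoc_ar f g h
@[grind =] theorem tCell_assoc (a b c : C.Cell) :
    C.tCell (C.tCell a b) c = C.tCell a (C.tCell b c) :=
  C.assoc_cell a b c

attribute [grind =] obAr arOb obCell cellOb

@[grind =] theorem one_tOb_tAr (x y : C.Ob) (f : C.Ar) :
    C.tAr (C.one (C.tOb x y)) f = C.tAr (C.one x) (C.tAr (C.one y) f) := by
  rw [← C.tAr_one, C.tAr_assoc]

@[simp, grind =] theorem tensorLeft_ob (I x : C.Ob) : (C.tensorLeft I).ob x = C.tOb I x := rfl
@[simp, grind =] theorem tensorLeft_ar (I : C.Ob) (f : C.Ar) :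
    (C.tensorLeft I).ar f = C.tAr (C.one I) f := rfl
@[simp, grind =] theorem tensorLeft_cell (I : C.Ob) (a : C.Cell) :
    (C.tensorLeft I).cell a = C.tCell (C.two (C.one I)) a := rfl
@[simp, grind =] theorem tensorRight_ob (I x : C.Ob) : (C.tensorRight I).ob x = C.tOb x I := rfl
@[simp, grind =] theorem tensorRight_ar (I : C.Ob) (f : C.Ar) :
    (C.tensorRight I).ar f = C.tAr f (C.one I) := rfl
@[simp, grind =] theorem tensorRight_cell (I : C.Ob) (a : C.Cell) :
    (C.tensorRight I).cell a = C.tCell a (C.two (C.one I)) := rfl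

variable {C}

theorem isInv_tCell {a b : C.Cell} (ha : C.IsInv a) (hb : C.IsInv b) : C.IsInv (C.tCell a b) :=
  C.tensor.map_isInv (a := (a, b)) (TwoCat.isInv_prod ha hb)

theorem inv_tCell {a b : C.Cell} (ha : C.IsInv a) (hb : C.IsInv b) :
    C.inv (C.tCell a b) = C.tCell (C.inv a) (C.inv b) := by
  refine TwoCat.inv_eq_of (by grind) (by grind) ?_ (isInv_tCell ha hb)
  rw [C.tCell_vcomp] <;> grind

theorem isEqui_tAr {f g : C.Ar} (h : C.IsEqui f) (h' : C.IsEqui g) : C.IsEqui (C.tAr f g) :=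
  C.tensor.map_isEqui (f := (f, g)) (TwoCat.isEqui_prod h h')

variable (C) in
/-- The semi-monoidal 2-category with the reversed tensor product. -/
def rev : SMon2Cat.{u} where
  toTwoCat := C.toTwoCat
  tensor :=
    { ob := fun x => C.tensor.ob (x.2, x.1)
      ar := fun f => C.tensor.ar (f.2, f.1)
      cell := fun a => C.tensor.cell (a.2, a.1)
      map_src := fun f => C.tensor.map_src (f.2, f.1)
      map_tgt := fun f => C.tensor.map_tgt (f.2, f.1)
      map_dom := fun a => C.tensor.map_dom (a.2, a.1)
      map_cod := fun a => C.tensor.map_cod (a.2, a.1)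
      map_one := fun x => C.tensor.map_one (x.2, x.1)
      map_two := fun f => C.tensor.map_two (f.2, f.1)
      map_comp := fun f g h => C.tensor.map_comp (f.2, f.1) (g.2, g.1)
        (Prod.ext (congrArg Prod.snd h) (congrArg Prod.fst h))
      map_vcomp := fun a b h => C.tensor.map_vcomp (a.2, a.1) (b.2, b.1)
        (Prod.ext (congrArg Prod.snd h) (congrArg Prod.fst h))
      map_hcomp := fun a b h => C.tensor.map_hcomp (a.2, a.1) (b.2, b.1)
        (Prod.ext (congrArg Prod.snd h) (congrArg Prod.fst h)) }
  assoc_ob x y z := (C.assoc_ob z y x).symm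
  assoc_ar x y z := (C.assoc_ar z y x).symm
  assoc_cell x y z := (C.assoc_cell z y x).symm

/-- Reversal exchanges `I ⊗ -` and `- ⊗ I`, so both sides unfold to the same data. Results on left
constraints thereby yield their mirror images. -/
theorem isLeftConstraint_rev {I : C.Ob} {α : C.Ar} {rho : TransfData C.toTwoCat C.toTwoCat}
    {R : C.Ob → C.Cell} :
    C.rev.IsLeftConstraint I α rho R ↔ C.IsRightConstraint I α rho R :=
  ⟨fun h => ⟨h.1, h.2⟩, fun h => ⟨h.1, h.2⟩⟩

/-! ### Transformations and modifications in semi-monoidal 2-categories -/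

section Projections

variable (D : SMon2Cat.{u}) {A B : TwoCat.{u}} (s : TransfData A D.toTwoCat)
  (t : TransfData B D.toTwoCat)

@[simp, grind =] theorem arLeft_app (φ : D.Ar) (F : TwoFunctor A D.toTwoCat) (x : A.Ob) :
    (D.arLeft φ F).app x = D.tAr φ (D.one (F.ob x)) := rfl
@[simp, grind =] theorem arLeft_nat (φ : D.Ar) (F : TwoFunctor A D.toTwoCat) (f : A.Ar) :
    (D.arLeft φ F).nat f = D.two (D.tAr φ (F.ar f)) := rfl
@[simp, grind =] theorem arRight_app (φ : D.Ar) (F : TwoFunctor A D.toTwoCat) (x : A.Ob) :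
    (D.arRight F φ).app x = D.tAr (D.one (F.ob x)) φ := rfl

end Projections

theorem isPseudonatural_ident {A : TwoCat.{u}} {D : TwoCat.{u}} (F : TwoFunctor A D) :
    (TransfData.ident F).IsPseudonatural F F where
  app_ar x := by grind
  nat_cell f := by grind
  nat_inv f := D.isInv_two _
  nat_one x := by grind
  nat_comp f g h := by grind
  nat_nat a := by grind

variable {D : SMon2Cat.{u}} {A B : TwoCat.{u}} {F F' : TwoFunctor A D.toTwoCat}
  {G G' : TwoFunctor B D.toTwoCat} {s s' : TransfData A D.toTwoCat}
  {t t' : TransfData B D.toTwoCat}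

theorem isPseudonatural_arLeft {I J : D.Ob} {φ : D.Ar} (hφ : D.IsAr φ I J) :
    (D.arLeft φ F).IsPseudonatural (F.comp (D.tensorLeft I)) (F.comp (D.tensorLeft J)) where
  app_ar x := by grind
  nat_cell f := by grind
  nat_inv f := D.isInv_two _
  nat_one x := by grind
  nat_comp f g h := by grind (ematch := 12)
  nat_nat a := by
    simp only [arLeft_app, arLeft_nat, TwoFunctor.comp_cell, tensorLeft_cell, ← D.tCell_two]
    simp (disch := grind) only [D.tCell_hcomp, D.tCell_vcomp]
    congr 1 <;> grind

theorem isPseudonatural_arRight {I J : D.Ob} {φ : D.Ar} (hφ : D.IsAr φ I J) :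
    (D.arRight F φ).IsPseudonatural (F.comp (D.tensorRight I)) (F.comp (D.tensorRight J)) :=
  isPseudonatural_arLeft (D := D.rev) hφ

theorem isPseudonatural_tensorTransf (hs : s.IsPseudonatural F F')
    (ht : t.IsPseudonatural G G') :
    (D.tensorTransf s t).IsPseudonatural ((F.prodMap G).comp D.tensor)
      ((F'.prodMap G').comp D.tensor) where
  app_ar := by
    rintro ⟨x, y⟩
    have := hs.app_ar x
    have := ht.app_ar y
    change D.IsAr (D.tAr (s.app x) (t.app y)) (D.tOb (F.ob x) (G.ob y)) (D.tOb (F'.ob x) (G'.ob y))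
    grind
  nat_cell := by
    rintro ⟨f, g⟩
    have := hs.nat_cell f
    have := hs.app_ar (A.src f)
    have := hs.app_ar (A.tgt f)
    have := ht.nat_cell g
    have := ht.app_ar (B.src g)
    have := ht.app_ar (B.tgt g)
    change D.IsCell (D.tCell (s.nat f) (t.nat g))
      (D.comp (D.tAr (F.ar f) (G.ar g)) (D.tAr (s.app (A.tgt f)) (t.app (B.tgt g))))
      (D.comp (D.tAr (s.app (A.src f)) (t.app (B.src g))) (D.tAr (F'.ar f) (G'.ar g)))
    grind
  nat_inv f := isInv_tCell (hs.nat_inv _) (ht.nat_inv _)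
  nat_one := by
    rintro ⟨x, y⟩
    change D.tCell (s.nat (A.one x)) (t.nat (B.one y)) = D.two (D.tAr (s.app x) (t.app y))
    rw [hs.nat_one, ht.nat_one, D.tCell_two]
  nat_comp := by
    rintro ⟨f, f'⟩ ⟨g, g'⟩ h
    have h₁ : A.tgt f = A.src g := congrArg Prod.fst h
    have h₂ : B.tgt f' = B.src g' := congrArg Prod.snd h
    have := hs.nat_cell f
    have := hs.app_ar (A.src f)
    have := hs.app_ar (A.tgt f)
    have := ht.nat_cell f'
    have := ht.app_ar (B.src f')
    have := ht.app_ar (B.tgt f')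
    have := hs.nat_cell g
    have := hs.app_ar (A.tgt g)
    have := ht.nat_cell g'
    have := ht.app_ar (B.tgt g')
    change D.tCell (s.nat (A.comp f g)) (t.nat (B.comp f' g')) =
      D.vcomp (D.hcomp (D.two (D.tAr (F.ar f) (G.ar f'))) (D.tCell (s.nat g) (t.nat g')))
        (D.hcomp (D.tCell (s.nat f) (t.nat f')) (D.two (D.tAr (F'.ar g) (G'.ar g'))))
    rw [hs.nat_comp _ _ h₁, ht.nat_comp _ _ h₂, ← D.tCell_two, ← D.tCell_two, D.tCell_hcomp,
      D.tCell_hcomp, D.tCell_vcomp] <;> grind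
  nat_nat := by
    rintro ⟨a, b⟩
    have h₁ := hs.nat_nat a
    have h₂ := ht.nat_nat b
    have := hs.nat_cell (A.dom a)
    have := hs.nat_cell (A.cod a)
    have := hs.app_ar (A.src (A.dom a))
    have := hs.app_ar (A.tgt (A.dom a))
    have := ht.nat_cell (B.dom b)
    have := ht.nat_cell (B.cod b)
    have := ht.app_ar (B.src (B.dom b))
    have := ht.app_ar (B.tgt (B.dom b))
    change D.vcomp (D.hcomp (D.tCell (F.cell a) (G.cell b))
        (D.two (D.tAr (s.app (A.tgt (A.dom a))) (t.app (B.tgt (B.dom b))))))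
        (D.tCell (s.nat (A.cod a)) (t.nat (B.cod b))) =
      D.vcomp (D.tCell (s.nat (A.dom a)) (t.nat (B.dom b)))
        (D.hcomp (D.two (D.tAr (s.app (A.src (A.dom a))) (t.app (B.src (B.dom b)))))
          (D.tCell (F'.cell a) (G'.cell b)))
    rw [← D.tCell_two, ← D.tCell_two, D.tCell_hcomp, D.tCell_hcomp, D.tCell_vcomp, D.tCell_vcomp,
      h₁, h₂] <;> grind

theorem isInvModification_tensor {m : A.Ob → D.Cell} {n : B.Ob → D.Cell}
    (hm : TransfData.IsInvModification F F' s s' m)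
    (hn : TransfData.IsInvModification G G' t t' n)
    (hs : s.IsPseudonatural F F') (ht : t.IsPseudonatural G G')
    (hs' : s'.IsPseudonatural F F') (ht' : t'.IsPseudonatural G G') :
    TransfData.IsInvModification ((F.prodMap G).comp D.tensor) ((F'.prodMap G').comp D.tensor)
      (D.tensorTransf s t) (D.tensorTransf s' t') (fun x => D.tCell (m x.1) (n x.2)) where
  cell := by
    rintro ⟨x, y⟩
    have := hm.cell x
    have := hn.cell y
    change D.IsCell (D.tCell (m x) (n y)) (D.tAr (s.app x) (t.app y)) (D.tAr (s'.app x) (t'.app y))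
    grind
  inv x := isInv_tCell (hm.inv _) (hn.inv _)
  natural := by
    rintro ⟨f, g⟩
    have h₁ := hm.natural f
    have h₂ := hn.natural g
    have := hs.nat_cell f
    have := hs.app_ar (A.src f)
    have := hs.app_ar (A.tgt f)
    have := ht.nat_cell g
    have := ht.app_ar (B.src g)
    have := ht.app_ar (B.tgt g)
    have := hs'.nat_cell f
    have := ht'.nat_cell g
    have := hm.cell (A.src f)
    have := hn.cell (B.src g)
    have := hm.cell (A.tgt f)
    have := hn.cell (B.tgt g)
    change D.vcomp (D.tCell (s.nat f) (t.nat g)) (D.hcomp (D.tCell (m (A.src f)) (n (B.src g)))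
        (D.two (D.tAr (F'.ar f) (G'.ar g)))) =
      D.vcomp (D.hcomp (D.two (D.tAr (F.ar f) (G.ar g))) (D.tCell (m (A.tgt f)) (n (B.tgt g))))
        (D.tCell (s'.nat f) (t'.nat g))
    rw [← D.tCell_two, ← D.tCell_two, D.tCell_hcomp, D.tCell_hcomp, D.tCell_vcomp, D.tCell_vcomp,
      h₁, h₂] <;> grind

theorem isInvModification_refl {A D : TwoCat.{u}} {F F' : TwoFunctor A D} {s : TransfData A D}
    (hs : s.IsPseudonatural F F') :
    TransfData.IsInvModification F F' s s (fun x => D.two (s.app x)) where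
  cell x := by grind
  inv x := D.isInv_two _
  natural f := by
    have := hs.nat_cell f
    have := hs.app_ar (A.src f)
    have := hs.app_ar (A.tgt f)
    grind

end SMon2Cat

/-! ### The action of 2-cells of identity arrows -/

namespace TwoCat

variable {C : TwoCat.{u}} {x : C.Ob} {T c : C.Cell}

/-- By interchange, a 2-cell of `1_x` acts on a 2-cell out of `x` equally well through its domain
or, as in `vcomp_scalar`, through its codomain. A scalar can therefore be pulled out of any factor
of a vertical composite. -/
theorem scalar_vcomp (hT : C.IsCell T (C.one x) (C.one x)) (h : C.src (C.dom c) = x) :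
    C.vcomp (C.hcomp T (C.two (C.dom c))) c = C.hcomp T c := by
  rw [← C.hcomp_eq_right_left (a := T) (b := c) rfl hT.2 (by grind), C.one_hcomp_of h]

theorem vcomp_scalar (hT : C.IsCell T (C.one x) (C.one x)) (h : C.src (C.dom c) = x) :
    C.vcomp c (C.hcomp T (C.two (C.cod c))) = C.hcomp T c := by
  rw [← C.hcomp_eq_left_right (a := T) (b := c) hT.1 rfl (by grind), C.one_hcomp_of h]

theorem hcomp_scalar_vcomp {a b : C.Cell} (hT : C.IsCell T (C.one x) (C.one x))
    (h : C.src (C.dom a) = x) (hab : C.cod a = C.dom b) :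
    C.vcomp (C.hcomp T a) b = C.hcomp T (C.vcomp a b) := by
  rw [← scalar_vcomp hT h, ← scalar_vcomp (c := C.vcomp a b) hT, C.vcomp_assoc, C.dom_vcomp] <;> grind

theorem vcomp_hcomp_scalar {a b : C.Cell} (hT : C.IsCell T (C.one x) (C.one x))
    (h : C.src (C.dom a) = x) (hab : C.cod a = C.dom b) :
    C.vcomp a (C.hcomp T b) = C.hcomp T (C.vcomp a b) := by
  rw [← vcomp_scalar hT, ← vcomp_scalar (c := C.vcomp a b) hT, C.vcomp_assoc, C.cod_vcomp] <;> grind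

end TwoCat

/-! ### Cancellable idempotents and their unique associator -/

namespace SMon2Cat

/-- `I` is cancellable and `α : I ⊗ I ⟶ I` is an equiarrow with `I ⊗ α ≅ α ⊗ I`. -/
structure IsIdempotent (C : SMon2Cat.{u}) (I : C.Ob) (α : C.Ar) : Prop where
  left : (C.tensorLeft I).IsEqui2
  right : (C.tensorRight I).IsEqui2
  ar : C.IsAr α (C.tOb I I) I
  equi : C.IsEqui α
  iso : C.Iso (C.obAr I α) (C.arOb α I)

variable {C : SMon2Cat.{u}} {I : C.Ob} {α : C.Ar}

theorem IsIdempotent.rev (h : C.IsIdempotent I α) : C.rev.IsIdempotent I α :=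
  ⟨h.right, h.left, h.ar, h.equi, h.iso.symm⟩

/-- The automorphisms of an equiarrow with source `I ⊗ x` are scalars. -/
theorem exists_scalar {x : C.Ob} (hx : (C.tensorRight x).IsEqui2)
    {f : C.Ar} (hf : C.src f = C.tOb I x) (hfe : C.IsEqui f) {c : C.Cell} (hc : C.IsCell c f f)
    (hci : C.IsInv c) : ∃ z, C.IsCell z (C.one I) (C.one I) ∧ C.IsInv z ∧
      C.hcomp (C.tCell z (C.two (C.one x))) (C.two f) = c := by
  obtain ⟨d, hd, rfl⟩ := hfe.whisker_right_full (f := C.one (C.tOb I x))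
    (f' := C.one (C.tOb I x)) (by grind) (by grind) (by grind) (c := c) (by grind)
  have hdi := hfe.whisker_right_isInv (by grind) hci
  obtain ⟨z, hz, hzi, rfl⟩ := hx.exists_inv_cell (f := C.one I) (f' := C.one I) (by grind)
    (by grind) (b := d) (by grind) hdi
  exact ⟨z, hz, hzi, rfl⟩

namespace IsIdempotent

/-- An Eckmann–Hilton argument. Let `z'` be defined by `(z ⊗ I) ; α = α ; z'`. The scalar `z ⊗ I ⊗
I` passes through `I ⊗ α` as `z ⊗ I` and through `α ⊗ I` as `z' ⊗ I`. An isomorphism `I ⊗ α ≅ α ⊗ I`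
commutes with scalars on both sides, and cancelling `α ⊗ I` and then `- ⊗ I` gives `z' = z`. -/
theorem scalar_left (h : C.IsIdempotent I α) {z : C.Cell} (hz : C.IsCell z (C.one I) (C.one I)) :
    C.hcomp (C.tCell z (C.two (C.one I))) (C.two α) = C.hcomp (C.two α) z := by
  have hα := h.ar
  obtain ⟨A, hA, hAi⟩ := h.iso
  obtain ⟨z', hz', e⟩ := h.equi.whisker_left_full (f := C.one I) (f' := C.one I)
    (c := C.hcomp (C.tCell z (C.two (C.one I))) (C.two α)) (by grind) (by grind) (by grind)
    (by grind)
  have e₁ : C.hcomp (C.tCell z (C.two (C.one (C.tOb I I)))) (C.two (C.obAr I α)) =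
      C.hcomp (C.two (C.obAr I α)) (C.tCell z (C.two (C.one I))) := by
    rw [obAr, ← C.tCell_two, C.tCell_hcomp, C.tCell_hcomp] <;> grind
  have e₂ : C.hcomp (C.tCell z (C.two (C.one (C.tOb I I)))) (C.two (C.arOb α I)) =
      C.hcomp (C.two (C.arOb α I)) (C.tCell z' (C.two (C.one I))) := by
    rw [arOb, ← C.tAr_one, ← C.tCell_two, ← C.tCell_two, ← C.tCell_assoc, C.tCell_hcomp,
      C.tCell_hcomp, e] <;> grind
  have hzII : C.IsCell (C.tCell z (C.two (C.one (C.tOb I I)))) (C.one (C.tOb I (C.tOb I I)))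
    (C.one (C.tOb I (C.tOb I I))) := by grind
  have k₁ := TwoCat.scalar_vcomp (c := A) hzII (by grind)
  have k₂ := TwoCat.vcomp_scalar (c := A) hzII (by grind)
  have k₃ : C.vcomp (C.hcomp (C.two (C.obAr I α)) (C.tCell z (C.two (C.one I)))) A =
      C.vcomp A (C.hcomp (C.two (C.arOb α I)) (C.tCell z (C.two (C.one I)))) := by
    have h₁ := C.hcomp_eq_right_left (a := A) (b := C.tCell z (C.two (C.one I)))
      (f := C.one (C.tOb I I)) (by grind) hA.2 (by grind)
    have h₂ := C.hcomp_eq_left_right (a := A) (b := C.tCell z (C.two (C.one I)))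
      (g := C.one (C.tOb I I)) hA.1 (by grind) (by grind)
    rw [C.hcomp_one_of (by grind)] at h₁ h₂
    rw [h₁, h₂]
  rw [hA.1, e₁, k₃] at k₁
  rw [hA.2, e₂, ← k₁] at k₂
  have k := hAi.cancel_left (by grind) (by grind) k₂
  have k' := (isEqui_tAr h.equi (C.isEqui_one I)).whisker_left_cancel (by grind) (by grind)
    (by grind) k
  have k'' : z' = z := by
    have := h.right.cell_ext (by grind) (by grind) k'
    grind
  rw [← e, k'']

theorem scalar_right (h : C.IsIdempotent I α) {z : C.Cell} (hz : C.IsCell z (C.one I) (C.one I)) :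
    C.hcomp (C.tCell (C.two (C.one I)) z) (C.two α) = C.hcomp (C.two α) z :=
  h.rev.scalar_left hz

/-- Both sides become `α ; z` after whiskering with the equiarrow `α`. -/
theorem scalar_comm (h : C.IsIdempotent I α) {z : C.Cell} (hz : C.IsCell z (C.one I) (C.one I)) :
    C.tCell (C.two (C.one I)) z = C.tCell z (C.two (C.one I)) := by
  have := h.ar
  refine h.equi.whisker_right_cancel (by grind) (by grind) (by grind) ?_
  rw [h.scalar_left hz, h.scalar_right hz]

theorem isEqui2_right_two (h : C.IsIdempotent I α) : (C.tensorRight (C.tOb I I)).IsEqui2 := by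
  have : (C.tensorRight I).comp (C.tensorRight I) = C.tensorRight (C.tOb I I) := by
    apply TwoFunctor.ext <;> funext x <;> simp only [TwoFunctor.comp_ob, TwoFunctor.comp_ar,
      TwoFunctor.comp_cell, tensorRight_ob, tensorRight_ar, tensorRight_cell] <;> grind
  rw [← this]
  exact h.right.comp h.right

theorem isEqui2_right_three (h : C.IsIdempotent I α) :
    (C.tensorRight (C.tOb I (C.tOb I I))).IsEqui2 := by
  have : (C.tensorRight I).comp (C.tensorRight (C.tOb I I)) =
      C.tensorRight (C.tOb I (C.tOb I I)) := by
    apply TwoFunctor.ext <;> funext x <;> simp only [TwoFunctor.comp_ob, TwoFunctor.comp_ar,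
      TwoFunctor.comp_cell, tensorRight_ob, tensorRight_ar, tensorRight_cell] <;> grind
  rw [← this]
  exact h.right.comp h.isEqui2_right_two

end IsIdempotent

variable (C) in
/-- The left hand side of the pentagon equation. -/
def pentagonLeft (I : C.Ob) (α : C.Ar) (A : C.Cell) : C.Cell :=
  C.vcomp
    (C.hcomp (C.two (C.obAr (C.tOb I I) α)) (C.hcomp A (C.two α)))
    (C.hcomp (C.two (C.arOb α (C.tOb I I))) (C.hcomp A (C.two α)))

variable (C) in
/-- The right hand side of the pentagon equation. -/
def pentagonRight (I : C.Ob) (α : C.Ar) (A : C.Cell) : C.Cell :=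
  C.vcomp
    (C.hcomp (C.obCell I A) (C.two (C.comp (C.obAr I α) α)))
    (C.vcomp
      (C.hcomp (C.two (C.obAr I (C.arOb α I))) (C.hcomp A (C.two α)))
      (C.hcomp (C.cellOb A I) (C.two (C.comp (C.arOb α I) α))))

theorem pentagon_iff {A : C.Cell} :
    C.Pentagon I α A ↔ C.pentagonLeft I α A = C.pentagonRight I α A := Iff.rfl

theorem isCell_pentagonLeft (hα : C.IsAr α (C.tOb I I) I) {A : C.Cell}
    (hA : C.IsCell A (C.obAr I α) (C.arOb α I)) :
    C.IsCell (C.pentagonLeft I α A) (C.comp (C.obAr (C.tOb I I) α) (C.comp (C.obAr I α) α))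
      (C.comp (C.arOb α (C.tOb I I)) (C.comp (C.arOb α I) α)) := by
  -- The two occurrences of `A` are composable because applying `α` to the last two factors commutes
  -- strictly with applying it to the first two.
  have e : C.comp (C.obAr (C.tOb I I) α) (C.arOb α I) =
    C.comp (C.arOb α (C.tOb I I)) (C.obAr I α) := by grind
  have e₁ := C.comp_assoc (C.obAr (C.tOb I I) α) (C.arOb α I) α (by grind) (by grind)
  have e₂ := C.comp_assoc (C.arOb α (C.tOb I I)) (C.obAr I α) α (by grind) (by grind)
  have h₁ : C.IsCell (C.hcomp (C.two (C.obAr (C.tOb I I) α)) (C.hcomp A (C.two α)))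
    (C.comp (C.obAr (C.tOb I I) α) (C.comp (C.obAr I α) α))
    (C.comp (C.obAr (C.tOb I I) α) (C.comp (C.arOb α I) α)) := by grind
  have h₂ : C.IsCell (C.hcomp (C.two (C.arOb α (C.tOb I I))) (C.hcomp A (C.two α)))
    (C.comp (C.arOb α (C.tOb I I)) (C.comp (C.obAr I α) α))
    (C.comp (C.arOb α (C.tOb I I)) (C.comp (C.arOb α I) α)) := by grind
  have e₃ : C.comp (C.obAr (C.tOb I I) α) (C.comp (C.arOb α I) α) =
    C.comp (C.arOb α (C.tOb I I)) (C.comp (C.obAr I α) α) := by rw [← e₁, e, e₂]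
  rw [pentagonLeft]
  exact ⟨by rw [C.dom_vcomp, h₁.1]; rw [h₁.2, h₂.1, e₃],
    by rw [C.cod_vcomp, h₂.2]; rw [h₁.2, h₂.1, e₃]⟩

theorem isCell_pentagonRight (hα : C.IsAr α (C.tOb I I) I) {A : C.Cell}
    (hA : C.IsCell A (C.obAr I α) (C.arOb α I)) :
    C.IsCell (C.pentagonRight I α A) (C.comp (C.obAr (C.tOb I I) α) (C.comp (C.obAr I α) α))
      (C.comp (C.arOb α (C.tOb I I)) (C.comp (C.arOb α I) α)) := by
  have h₁ : C.IsCell (C.hcomp (C.obCell I A) (C.two (C.comp (C.obAr I α) α)))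
    (C.comp (C.obAr (C.tOb I I) α) (C.comp (C.obAr I α) α))
    (C.comp (C.obAr I (C.arOb α I)) (C.comp (C.obAr I α) α)) := by grind
  have h₂ : C.IsCell (C.hcomp (C.two (C.obAr I (C.arOb α I))) (C.hcomp A (C.two α)))
    (C.comp (C.obAr I (C.arOb α I)) (C.comp (C.obAr I α) α))
    (C.comp (C.obAr I (C.arOb α I)) (C.comp (C.arOb α I) α)) := by grind
  have h₃ : C.IsCell (C.hcomp (C.cellOb A I) (C.two (C.comp (C.arOb α I) α)))
    (C.comp (C.obAr I (C.arOb α I)) (C.comp (C.arOb α I) α))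
    (C.comp (C.arOb α (C.tOb I I)) (C.comp (C.arOb α I) α)) := by grind
  rw [pentagonRight]
  refine ⟨by rw [C.dom_vcomp, h₁.1]; rw [h₁.2, C.dom_vcomp, h₂.1]; rw [h₂.2, h₃.1], ?_⟩
  rw [C.cod_vcomp, C.cod_vcomp, h₃.2]
  · rw [h₂.2, h₃.1]
  · rw [h₁.2, C.dom_vcomp, h₂.1]; rw [h₂.2, h₃.1]

theorem isInv_pentagon (hα : C.IsAr α (C.tOb I I) I) {A : C.Cell}
    (hA : C.IsCell A (C.obAr I α) (C.arOb α I)) (hi : C.IsInv A) :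
    C.IsInv (C.pentagonRight I α A) ∧ C.IsInv (C.pentagonLeft I α A) := by
  have i₁ : C.IsInv (C.hcomp A (C.two α)) := hi.hcomp (C.isInv_two _) (by grind)
  have e : C.comp (C.obAr (C.tOb I I) α) (C.arOb α I) =
    C.comp (C.arOb α (C.tOb I I)) (C.obAr I α) := by grind
  have e₁ := C.comp_assoc (C.obAr (C.tOb I I) α) (C.arOb α I) α (by grind) (by grind)
  have e₂ := C.comp_assoc (C.arOb α (C.tOb I I)) (C.obAr I α) α (by grind) (by grind)
  refine ⟨?_, ?_⟩
  · refine ((isInv_tCell (C.isInv_two _) hi).hcomp (C.isInv_two _) (by grind)).vcomp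
      (((C.isInv_two _).hcomp i₁ (by grind)).vcomp
        ((isInv_tCell hi (C.isInv_two _)).hcomp (C.isInv_two _) (by grind)) (by grind)) (by grind)
  · refine ((C.isInv_two _).hcomp i₁ (by grind)).vcomp ((C.isInv_two _).hcomp i₁ (by grind)) ?_
    rw [C.cod_hcomp, C.dom_hcomp, C.cod_hcomp, C.dom_hcomp, hA.1, hA.2] <;> grind

namespace IsIdempotent

/-- `A` occurs twice on the left of the pentagon and three times on the right, and each scalar can
be brought to the front: past `α ⊗ I ⊗ I` by `scalar_left`, out of `I ⊗ A` by `scalar_comm`, and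
otherwise by interchange. Rescaling `A` by `z` hence acts by `z²` on one side and by `z³` on the
other. -/
theorem pentagon_scale (h : C.IsIdempotent I α) {A z : C.Cell}
    (hA : C.IsCell A (C.obAr I α) (C.arOb α I)) (hz : C.IsCell z (C.one I) (C.one I))
    {T : C.Cell} (hT : T = C.tCell z (C.two (C.one (C.tOb I (C.tOb I I))))) :
    C.pentagonLeft I α (C.hcomp (C.tCell z (C.two (C.one (C.tOb I I)))) A) =
      C.hcomp T (C.hcomp T (C.pentagonLeft I α A)) ∧
    C.pentagonRight I α (C.hcomp (C.tCell z (C.two (C.one (C.tOb I I)))) A) =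
      C.hcomp T (C.hcomp T (C.hcomp T (C.pentagonRight I α A))) := by
  have hα := h.ar
  have hTc : C.IsCell T (C.one (C.tOb I (C.tOb I (C.tOb I I))))
      (C.one (C.tOb I (C.tOb I (C.tOb I I)))) := by grind
  -- The common shape of the three factors `f ; A ; α`: it suffices to move the scalar past `f`.
  have w : ∀ f, C.IsAr f (C.tOb I (C.tOb I (C.tOb I I))) (C.tOb I (C.tOb I I)) →
      C.hcomp (C.two f) (C.tCell z (C.two (C.one (C.tOb I I)))) = C.hcomp T (C.two f) →
      C.hcomp (C.two f) (C.hcomp (C.hcomp (C.tCell z (C.two (C.one (C.tOb I I)))) A) (C.two α)) =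
        C.hcomp T (C.hcomp (C.two f) (C.hcomp A (C.two α))) := by
    intro f hf e
    rw [C.hcomp_assoc (C.tCell z _), ← C.hcomp_assoc (C.two f), e, C.hcomp_assoc] <;>
      grind (ematch := 12)
  have l₁ := w (C.obAr (C.tOb I I) α) (by grind) (by
    rw [hT, obAr, ← C.tAr_one, C.tAr_assoc, ← C.tCell_two, C.tCell_hcomp, C.tCell_hcomp] <;> grind)
  have l₂ := w (C.arOb α (C.tOb I I)) (by grind) (by
    have hT' : T = C.tCell (C.tCell z (C.two (C.one I))) (C.two (C.one (C.tOb I I))) := by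
      rw [hT, C.tCell_assoc, C.tCell_two, C.tAr_one]
    rw [hT', arOb, ← C.tCell_two, C.tCell_hcomp, C.tCell_hcomp, h.scalar_left hz] <;> grind)
  have r₂ := w (C.obAr I (C.arOb α I)) (by grind) (by
    rw [hT, obAr, ← C.tCell_two, C.tCell_hcomp, C.tCell_hcomp] <;> grind)
  have r₁ : C.hcomp (C.obCell I (C.hcomp (C.tCell z (C.two (C.one (C.tOb I I)))) A))
      (C.two (C.comp (C.obAr I α) α)) =
      C.hcomp T (C.hcomp (C.obCell I A) (C.two (C.comp (C.obAr I α) α))) := by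
    have : C.obCell I (C.hcomp (C.tCell z (C.two (C.one (C.tOb I I)))) A) =
        C.hcomp T (C.obCell I A) := by
      have e₁ : C.two (C.one I) = C.hcomp (C.two (C.one I)) (C.two (C.one I)) := by grind
      rw [obCell, e₁, ← C.tCell_hcomp, ← C.tCell_assoc, h.scalar_comm hz, C.tCell_assoc,
        C.tCell_two, C.tAr_one, hT, obCell] <;> grind
    rw [this, C.hcomp_assoc] <;> grind
  have r₃ : C.hcomp (C.cellOb (C.hcomp (C.tCell z (C.two (C.one (C.tOb I I)))) A) I)
      (C.two (C.comp (C.arOb α I) α)) =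
      C.hcomp T (C.hcomp (C.cellOb A I) (C.two (C.comp (C.arOb α I) α))) := by
    have : C.cellOb (C.hcomp (C.tCell z (C.two (C.one (C.tOb I I)))) A) I =
        C.hcomp T (C.cellOb A I) := by
      have e₁ : C.two (C.one I) = C.hcomp (C.two (C.one I)) (C.two (C.one I)) := by grind
      rw [cellOb, e₁, ← C.tCell_hcomp, C.tCell_assoc, C.tCell_two, C.tAr_one, hT, cellOb] <;> grind
    rw [this, C.hcomp_assoc] <;> grind
  have h₁ : C.IsCell (C.hcomp (C.obCell I A) (C.two (C.comp (C.obAr I α) α)))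
    (C.comp (C.obAr (C.tOb I I) α) (C.comp (C.obAr I α) α))
    (C.comp (C.obAr I (C.arOb α I)) (C.comp (C.obAr I α) α)) := by grind
  have h₂ : C.IsCell (C.hcomp (C.two (C.obAr I (C.arOb α I))) (C.hcomp A (C.two α)))
    (C.comp (C.obAr I (C.arOb α I)) (C.comp (C.obAr I α) α))
    (C.comp (C.obAr I (C.arOb α I)) (C.comp (C.arOb α I) α)) := by grind
  have h₃ : C.IsCell (C.hcomp (C.cellOb A I) (C.two (C.comp (C.arOb α I) α)))
    (C.comp (C.obAr I (C.arOb α I)) (C.comp (C.arOb α I) α))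
    (C.comp (C.arOb α (C.tOb I I)) (C.comp (C.arOb α I) α)) := by grind
  constructor
  · have e : C.comp (C.obAr (C.tOb I I) α) (C.arOb α I) =
      C.comp (C.arOb α (C.tOb I I)) (C.obAr I α) := by grind
    have e₁ := C.comp_assoc (C.obAr (C.tOb I I) α) (C.arOb α I) α (by grind) (by grind)
    have e₂ := C.comp_assoc (C.arOb α (C.tOb I I)) (C.obAr I α) α (by grind) (by grind)
    have e₃ : C.cod (C.hcomp (C.two (C.obAr (C.tOb I I) α)) (C.hcomp A (C.two α))) =
        C.dom (C.hcomp (C.two (C.arOb α (C.tOb I I))) (C.hcomp A (C.two α))) := by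
      rw [C.cod_hcomp, C.dom_hcomp, C.cod_hcomp, C.dom_hcomp, hA.1, hA.2] <;> grind
    rw [pentagonLeft, l₁, l₂, TwoCat.vcomp_hcomp_scalar hTc, TwoCat.hcomp_scalar_vcomp hTc,
      pentagonLeft] <;> grind
  · have t₂ : C.src (C.dom (C.hcomp (C.two (C.obAr I (C.arOb α I))) (C.hcomp A (C.two α)))) =
      C.tOb I (C.tOb I (C.tOb I I)) := by rw [h₂.1]; grind
    have t₁ : C.src (C.dom (C.hcomp (C.obCell I A) (C.two (C.comp (C.obAr I α) α)))) =
      C.tOb I (C.tOb I (C.tOb I I)) := by rw [h₁.1]; grind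
    have t₃ : C.dom (C.vcomp (C.hcomp (C.two (C.obAr I (C.arOb α I))) (C.hcomp A (C.two α)))
        (C.hcomp (C.cellOb A I) (C.two (C.comp (C.arOb α I) α)))) =
        (C.comp (C.obAr I (C.arOb α I)) (C.comp (C.obAr I α) α)) := by
      rw [C.dom_vcomp, h₂.1]; rw [h₂.2, h₃.1]
    rw [pentagonRight, r₁, r₂, r₃, pentagonRight]
    generalize C.hcomp (C.two (C.obAr I (C.arOb α I))) (C.hcomp A (C.two α)) = X at *
    generalize C.hcomp (C.cellOb A I) (C.two (C.comp (C.arOb α I) α)) = Y at *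
    generalize C.hcomp (C.obCell I A) (C.two (C.comp (C.obAr I α) α)) = Z at *
    rw [TwoCat.vcomp_hcomp_scalar hTc, TwoCat.hcomp_scalar_vcomp hTc,
      TwoCat.vcomp_hcomp_scalar hTc, TwoCat.hcomp_scalar_vcomp hTc,
      TwoCat.vcomp_hcomp_scalar hTc] <;> grind

theorem isCell_scalar {z : C.Cell} (x : C.Ob) (hz : C.IsCell z (C.one I) (C.one I)) :
    C.IsCell (C.tCell z (C.two (C.one x))) (C.one (C.tOb I x)) (C.one (C.tOb I x)) := by
  grind

theorem scalar_cancel {x : C.Ob} {z c c' : C.Cell} (hz : C.IsCell z (C.one I) (C.one I))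
    (hzi : C.IsInv z) (hc : C.dom c = C.dom c') (hs : C.src (C.dom c) = C.tOb I x)
    (e : C.hcomp (C.tCell z (C.two (C.one x))) c = C.hcomp (C.tCell z (C.two (C.one x))) c') :
    c = c' := by
  have h := isCell_scalar x hz
  rw [← TwoCat.scalar_vcomp (c := c) h hs, ← TwoCat.scalar_vcomp (c := c') h (hc ▸ hs), hc] at e
  exact ((isInv_tCell hzi (C.isInv_two _)).hcomp (C.isInv_two _) (by grind)).cancel_left
    (by grind) (by grind) e

theorem scalar_eq_one {x : C.Ob} {z : C.Cell} (hx : (C.tensorRight x).IsEqui2)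
    (hz : C.IsCell z (C.one I) (C.one I)) {c : C.Cell} (hci : C.IsInv c)
    (hs : C.src (C.dom c) = C.tOb I x) (hf : C.IsEqui (C.dom c))
    (e : C.hcomp (C.tCell z (C.two (C.one x))) c = c) : z = C.two (C.one I) := by
  have h := isCell_scalar x hz
  rw [← TwoCat.scalar_vcomp (c := c) h hs] at e
  have e₁ : C.hcomp (C.tCell z (C.two (C.one x))) (C.two (C.dom c)) = C.two (C.dom c) :=
    hci.cancel_right (by grind) (by grind) (by rw [e]; grind)
  have e₂ : C.tCell z (C.two (C.one x)) = C.tCell (C.two (C.one I)) (C.two (C.one x)) :=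
    hf.whisker_right_cancel (by grind) (by grind) (by grind) (by rw [e₁]; grind)
  exact hx.cell_ext (by grind) (by grind) e₂

theorem isEqui_pentagon_dom (h : C.IsIdempotent I α) :
    C.IsEqui (C.comp (C.obAr (C.tOb I I) α) (C.comp (C.obAr I α) α)) := by
  have hα := h.ar
  exact (isEqui_tAr (C.isEqui_one _) h.equi).comp
    ((isEqui_tAr (C.isEqui_one I) h.equi).comp h.equi (by grind)) (by grind)

theorem src_pentagon_dom (h : C.IsIdempotent I α) :
    C.src (C.comp (C.obAr (C.tOb I I) α) (C.comp (C.obAr I α) α)) =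
      C.tOb I (C.tOb I (C.tOb I I)) := by
  have hα := h.ar
  grind

/-- For an arbitrary isomorphism the sides of the pentagon satisfy `left = z · right` for a scalar
`z`. Rescaling by this same `z` turns the pentagon into `z² · left = z³ · right`, which holds. -/
theorem exists_associator (h : C.IsIdempotent I α) : ∃ A, C.IsAssociator I α A := by
  have hα := h.ar
  obtain ⟨A, hA, hAi⟩ := h.iso
  have hL := isCell_pentagonLeft hα hA
  have hR := isCell_pentagonRight hα hA
  have hs := h.src_pentagon_dom
  obtain ⟨iR, iL⟩ := isInv_pentagon hα hA hAi
  obtain ⟨z, hz, hzi, hz'⟩ := exists_scalar h.isEqui2_right_three hs h.isEqui_pentagon_dom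
    (c := C.vcomp (C.pentagonLeft I α A) (C.inv (C.pentagonRight I α A))) (by grind)
    (iL.vcomp iR.inv (by grind))
  refine ⟨C.hcomp (C.tCell z (C.two (C.one (C.tOb I I)))) A,
    by grind (ematch := 12), (isInv_tCell hzi (C.isInv_two _)).hcomp hAi (by grind), ?_⟩
  rw [pentagon_iff, (h.pentagon_scale hA hz rfl).1, (h.pentagon_scale hA hz rfl).2]
  congr 2
  rw [← TwoCat.scalar_vcomp (isCell_scalar _ hz) (by grind), hR.1, hz', C.vcomp_assoc,
    iR.inv_spec.2.2.2] <;> grind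

/-- Two associators differ by an invertible scalar `w`. Comparing their pentagons gives `w² · X = w³
· X` with `X` invertible, so `w = 1`. -/
theorem associator_unique (h : C.IsIdempotent I α) {A₁ A₂ : C.Cell} (h₁ : C.IsAssociator I α A₁)
    (h₂ : C.IsAssociator I α A₂) : A₁ = A₂ := by
  have hα := h.ar
  have hA₁ := h₁.cell
  have hA₂ := h₂.cell
  have i₁ := h₁.inv
  obtain ⟨w, hw, hwi, hw'⟩ := exists_scalar (I := I) (f := C.obAr I α) h.isEqui2_right_two
    (by grind) (isEqui_tAr (C.isEqui_one I) h.equi)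
    (c := C.vcomp A₂ (C.inv A₁)) (by grind) (h₂.inv.vcomp i₁.inv (by grind))
  have e : A₂ = C.hcomp (C.tCell w (C.two (C.one (C.tOb I I)))) A₁ := by
    rw [← TwoCat.scalar_vcomp (x := C.tOb I (C.tOb I I)) (by grind) (by grind), hA₁.1, hw',
      C.vcomp_assoc, i₁.inv_spec.2.2.2] <;> grind
  have p₁ := pentagon_iff.1 h₁.pentagon
  have p₂ := pentagon_iff.1 h₂.pentagon
  rw [e, (h.pentagon_scale hA₁ hw rfl).1, (h.pentagon_scale hA₁ hw rfl).2, p₁] at p₂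
  have hR := isCell_pentagonRight hα hA₁
  have hs := h.src_pentagon_dom
  have hsc := isCell_scalar (C.tOb I (C.tOb I I)) hw
  have hw₁ : w = C.two (C.one I) := by
    refine scalar_eq_one h.isEqui2_right_three hw (isInv_pentagon hα hA₁ i₁).1
      (by rw [hR.1, hs]) (hR.1 ▸ h.isEqui_pentagon_dom) ?_
    generalize C.pentagonRight I α A₁ = X at *
    -- Two of the factors `w` are cancelled, which leaves `X = w · X`.
    refine (scalar_cancel hw hwi ?_ (by rw [hR.1, hs]) (scalar_cancel hw hwi ?_ ?_ p₂)).symm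
    · clear p₂ p₁ e hw' h₁ h₂
      grind
    · clear p₂ p₁ e hw' h₁ h₂
      grind
    · clear p₂ p₁ e hw' h₁ h₂
      grind
  rw [e, hw₁]
  clear * - hA₁ hα
  grind

/-- The associator exists and is unique. -/
theorem existsUnique_associator (h : C.IsIdempotent I α) : ∃! A, C.IsAssociator I α A :=
  existsUnique_of_exists_of_unique h.exists_associator fun _ _ => h.associator_unique

end IsIdempotent

end SMon2Cat

namespace SMon2Cat

variable {C : SMon2Cat.{u}} {I : C.Ob} {α : C.Ar}

variable (C) in
theorem tensorLeft_comp_tensorLeft (I J : C.Ob) :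
    (C.tensorLeft J).comp (C.tensorLeft I) = C.tensorLeft (C.tOb I J) := by
  apply TwoFunctor.ext <;> funext x <;> simp only [TwoFunctor.comp_ob, TwoFunctor.comp_ar,
    TwoFunctor.comp_cell, tensorLeft_ob, tensorLeft_ar, tensorLeft_cell, ← C.tOb_assoc,
    ← C.tAr_assoc, ← C.tCell_assoc, ← C.tAr_one, ← C.tCell_two]

/-! ### Left and right constraints -/

/-- By strict associativity `I ⊗ (I ⊗ -)` is `(I ⊗ I) ⊗ -`, so `α ⊗ -` has the boundary of the image
under `I ⊗ -` of a transformation from `I ⊗ -` to the identity. A left constraint is a lift of it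
along `I ⊗ -`, so the general results on lifting apply. -/
theorem isPseudonatural_arLeft_id (hα : C.IsAr α (C.tOb I I) I) :
    (C.arLeft α (TwoFunctor.id _)).IsPseudonatural
      ((C.tensorLeft I).comp (C.tensorLeft I))
      ((TwoFunctor.id C.toTwoCat).comp (C.tensorLeft I)) := by
  rw [tensorLeft_comp_tensorLeft]
  exact isPseudonatural_arLeft (F := TwoFunctor.id C.toTwoCat) hα

theorem exists_left (hI : (C.tensorLeft I).IsEqui2) (hα : C.IsAr α (C.tOb I I) I) (x : C.Ob) :
    ∃ l L, C.IsAr l (C.tOb I x) x ∧ C.IsCell L (C.obAr I l) (C.arOb α x) ∧ C.IsInv L := by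
  obtain ⟨l, hl, L, hL, hLi⟩ := hI.hom_ess_surj (C.tOb I x) x (C.arOb α x) (by grind)
  exact ⟨l, L, hl, hL, hLi⟩

theorem isEqui_left (hI : (C.tensorLeft I).IsEqui2) (he : C.IsEqui α) {x : C.Ob} {l : C.Ar}
    {L : C.Cell} (hL : C.IsCell L (C.obAr I l) (C.arOb α x)) (hLi : C.IsInv L) : C.IsEqui l :=
  hI.isEqui_reflect ((isEqui_tAr he (C.isEqui_one x)).of_iso (TwoCat.Iso.symm ⟨L, hL, hLi⟩))

theorem IsLeftConstraint.isEqui {lam : TransfData C.toTwoCat C.toTwoCat} {L : C.Ob → C.Cell}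
    (h : C.IsLeftConstraint I α lam L) (hI : (C.tensorLeft I).IsEqui2) (he : C.IsEqui α)
    (x : C.Ob) : C.IsEqui (lam.app x) :=
  isEqui_left hI he (h.modification.cell x) (h.modification.inv x)

theorem existsUnique_leftConstraint (hI : (C.tensorLeft I).IsEqui2)
    (hα : C.IsAr α (C.tOb I I) I) {l : C.Ob → C.Ar} {L : C.Ob → C.Cell}
    (h : ∀ x, C.IsAr (l x) (C.tOb I x) x ∧ C.IsCell (L x) (C.obAr I (l x)) (C.arOb α x) ∧
      C.IsInv (L x)) :
    ∃! n : C.Ar → C.Cell, C.IsLeftConstraint I α ⟨l, n⟩ L := by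
  obtain ⟨n, ⟨hn, hn'⟩, hu⟩ := TransfData.existsUnique_nat (F := C.tensorLeft I)
    (G := TwoFunctor.id C.toTwoCat) hI (isPseudonatural_arLeft_id hα) (l := l) (L := L)
    (fun x => (h x).1) (fun x => (h x).2.1) (fun x => (h x).2.2)
  exact ⟨n, ⟨hn, hn'⟩, fun n' hn => hu n' ⟨hn.1, hn.2⟩⟩

theorem existsUnique_leftModification (hI : (C.tensorLeft I).IsEqui2)
    (hα : C.IsAr α (C.tOb I I) I) {lam lam' : TransfData C.toTwoCat C.toTwoCat}
    {L L' : C.Ob → C.Cell} (h : C.IsLeftConstraint I α lam L)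
    (h' : C.IsLeftConstraint I α lam' L') :
    ∃! m : C.Ob → C.Cell,
      TransfData.IsInvModification (C.tensorLeft I) (TwoFunctor.id _) lam lam' m ∧
      ∀ x, C.vcomp (C.obCell I (m x)) (L' x) = L x :=
  TransfData.existsUnique_modification hI (isPseudonatural_arLeft_id hα) h.1 h'.1 h.2 h'.2

end SMon2Cat

/-! ### Fair monoids and cancellable objects -/

/-- Arrows and 2-cells with any compatible boundary exist in `U`, and parallel 2-cells are equal, so
every choice of components and cells satisfies the axioms. -/
theorem TwoCat.IsContractible.exists_pseudonatural {B U : TwoCat.{u}} (hU : U.IsContractible)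
    (F G : TwoFunctor B U) : ∃ t : TransfData B U, t.IsPseudonatural F G := by
  choose p hp using fun x => hU.exists_ar (F.ob x) (G.ob x)
  have h : ∀ f, ∃ a, U.IsCell a (U.comp (F.ar f) (p (B.tgt f))) (U.comp (p (B.src f)) (G.ar f)) :=
    fun f => hU.exists_cell (by have := hp (B.src f); have := hp (B.tgt f); grind)
      (by have := hp (B.src f); have := hp (B.tgt f); grind)
  choose n hn using h
  refine ⟨⟨p, n⟩, hp, hn, fun f => hU.isInv _, fun x => ?_, fun f g h => ?_, fun a => ?_⟩
  · have := hp x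
    have := hn (B.one x)
    exact hU.cell_ext (by grind) (by grind)
  · have := hp (B.src f)
    have := hp (B.src g)
    have := hp (B.tgt g)
    have := hn f
    have := hn g
    have := hn (B.comp f g)
    exact hU.cell_ext (by grind) (by grind)
  · have := hp (B.src (B.dom a))
    have := hp (B.tgt (B.dom a))
    have := hn (B.dom a)
    have := hn (B.cod a)
    exact hU.cell_ext (by grind) (by grind)

section Fair

variable {U C : SMon2Cat.{u}}

/-- The reversal of a strict semi-monoidal 2-functor. -/
def SMonFunctor.rev (J : SMonFunctor U C) : SMonFunctor U.rev C.rev where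
  toTwoFunctor := J.toTwoFunctor
  map_tOb x y := J.map_tOb y x
  map_tAr f g := J.map_tAr g f
  map_tCell a b := J.map_tCell b a

/-- The 2-functor exchanging the factors of a product. -/
def TwoCat.swap (C D : TwoCat.{u}) : TwoFunctor (C.prod D) (D.prod C) where
  ob x := (x.2, x.1)
  ar f := (f.2, f.1)
  cell a := (a.2, a.1)
  map_src _ := rfl
  map_tgt _ := rfl
  map_dom _ := rfl
  map_cod _ := rfl
  map_one _ := rfl
  map_two _ := rfl
  map_comp _ _ _ := rfl
  map_vcomp _ _ _ := rfl
  map_hcomp _ _ _ := rfl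

theorem TwoCat.isEqui2_swap (C D : TwoCat.{u}) : (TwoCat.swap C D).IsEqui2 where
  ess_surj y := ⟨(y.2, y.1), (D.prod C).one y,
    ⟨(D.prod C).src_one y, (D.prod C).tgt_one y⟩, (D.prod C).isEqui_one y⟩
  hom_ess_surj x x' g hg := ⟨(g.2, g.1), isAr_prod_iff.2 (isAr_prod_iff.1 hg).symm,
    TwoCat.Iso.refl (C := D.prod C) g⟩
  hom_fully_faithful f f' hs ht b hb :=
    ⟨(b.2, b.1), ⟨isCell_prod_iff.2 (isCell_prod_iff.1 hb).symm, rfl⟩,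
      fun c hc => by rw [← hc.2]; rfl⟩

theorem IsFairMonoid.rev {J : SMonFunctor U C} (h : IsFairMonoid J) : IsFairMonoid J.rev where
  contractible := h.contractible
  left_equi := (TwoCat.isEqui2_swap _ _).comp h.right_equi
  right_equi := (TwoCat.isEqui2_swap _ _).comp h.left_equi

/-- Tensoring with the image of `I` is the multiplication map restricted to the slice of `U × C` at
`I`, and the inclusion of that slice is an equi-2-functor because `U` is contractible. -/
theorem IsFairMonoid.tensorLeft_isEqui2 {J : SMonFunctor U C} (h : IsFairMonoid J) (I : U.Ob) :
    (C.tensorLeft (J.ob I)).IsEqui2 := by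
  have : (TwoFunctor.pair (TwoFunctor.const _ I) (TwoFunctor.id _)).comp
      ((J.toTwoFunctor.prodMap (TwoFunctor.id C.toTwoCat)).comp C.tensor) =
      C.tensorLeft (J.ob I) := by
    apply TwoFunctor.ext
    · rfl
    · funext f
      change C.tAr (J.ar (U.one I)) f = C.tAr (C.one (J.ob I)) f
      rw [J.map_one]
    · funext f
      change C.tCell (J.cell (U.two (U.one I))) f = C.tCell (C.two (C.one (J.ob I))) f
      rw [J.map_two, J.map_one]
  rw [← this]
  exact (h.contractible.isEqui2_pair_const I).comp h.left_equi

theorem IsFairMonoid.tensorRight_isEqui2 {J : SMonFunctor U C} (h : IsFairMonoid J) (I : U.Ob) :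
    (C.tensorRight (J.ob I)).IsEqui2 :=
  h.rev.tensorLeft_isEqui2 I

/-- The identity of `U` is pseudo-naturally equivalent to the constant 2-functor at `I`. The
multiplication map is therefore equivalent to the projection `U × C ⟶ C`, an equi-2-functor,
followed by tensoring with the image of `I`. -/
theorem isEqui2_mul_of_tensorLeft (hU : U.IsContractible) (J : SMonFunctor U C) (I : U.Ob)
    (hI : (C.tensorLeft (J.ob I)).IsEqui2) :
    ((J.toTwoFunctor.prodMap (TwoFunctor.id C.toTwoCat)).comp C.tensor).IsEqui2 := by
  obtain ⟨t, ht⟩ := hU.exists_pseudonatural (TwoFunctor.id _) (TwoFunctor.const _ I)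
  have h₁ := SMon2Cat.isPseudonatural_tensorTransf (ht.postcomp J.toTwoFunctor)
    (SMon2Cat.isPseudonatural_ident (TwoFunctor.id C.toTwoCat))
  refine h₁.isEqui2 (fun x => SMon2Cat.isEqui_tAr (J.map_isEqui (hU.isEqui _)) (C.isEqui_one _)) ?_
  have : ((((TwoFunctor.const U.toTwoCat I).comp J.toTwoFunctor).prodMap
      (TwoFunctor.id C.toTwoCat)).comp C.tensor) =
      (TwoCat.snd _ _).comp (C.tensorLeft (J.ob I)) := by
    apply TwoFunctor.ext
    · rfl
    · funext f
      change C.tAr (J.ar (U.one I)) f.2 = C.tAr (C.one (J.ob I)) f.2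
      rw [J.map_one]
    · funext f
      change C.tCell (J.cell (U.two (U.one I))) f.2 = C.tCell (C.two (C.one (J.ob I))) f.2
      rw [J.map_two, J.map_one]
  rw [this]
  exact hU.isEqui2_snd.comp hI

/-- A semi-monoidal 2-functor with contractible source is a fair monoid as soon as one object in its
image is cancellable. -/
theorem isFairMonoid_of_cancellable (hU : U.IsContractible) (J : SMonFunctor U C) (I : U.Ob)
    (hl : (C.tensorLeft (J.ob I)).IsEqui2) (hr : (C.tensorRight (J.ob I)).IsEqui2) :
    IsFairMonoid J where
  contractible := hU
  left_equi := isEqui2_mul_of_tensorLeft hU J I hl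
  right_equi := (TwoCat.isEqui2_swap _ _).comp
    (isEqui2_mul_of_tensorLeft (U := U.rev) (C := C.rev) hU J.rev I hr)

theorem SMon2Cat.isIdempotent_of_contractible (hU : U.IsContractible) {I : U.Ob} {α : U.Ar}
    (hα : U.IsAr α (U.tOb I I) I) : U.IsIdempotent I α where
  left := hU.isEqui2 hU _
  right := hU.isEqui2 hU _
  ar := hα
  equi := hU.isEqui α
  iso := hU.iso (by grind) (by grind)

attribute [grind =] SMonFunctor.map_tOb SMonFunctor.map_tAr SMonFunctor.map_tCell

theorem IsFairMonoid.isIdempotent {J : SMonFunctor U C} (h : IsFairMonoid J) {I : U.Ob} {α : U.Ar}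
    (hα : U.IsAr α (U.tOb I I) I) : C.IsIdempotent (J.ob I) (J.ar α) where
  left := h.tensorLeft_isEqui2 I
  right := h.tensorRight_isEqui2 I
  ar := by grind
  equi := J.map_isEqui (h.contractible.isEqui α)
  iso := by
    have := J.map_iso (SMon2Cat.isIdempotent_of_contractible h.contractible hα).iso
    grind

end Fair

/-- Only these values enter the axioms. This serves to replace 2-functors and transformations by
others that agree with them through strict associativity but are presented differently. -/
theorem TransfData.IsInvModification.congr {C D : TwoCat.{u}} {F G F' G' : TwoFunctor C D}
    {s t s' t' : TransfData C D} {m m' : C.Ob → D.Cell} (h : IsInvModification F G s t m)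
    (hF : ∀ f, F.ar f = F'.ar f) (hG : ∀ f, G.ar f = G'.ar f)
    (hs : ∀ x, s.app x = s'.app x) (hs' : ∀ f, s.nat f = s'.nat f)
    (ht : ∀ x, t.app x = t'.app x) (ht' : ∀ f, t.nat f = t'.nat f) (hm : ∀ x, m x = m' x) :
    IsInvModification F' G' s' t' m' where
  cell x := by rw [← hm, ← hs, ← ht]; exact h.cell x
  inv x := by rw [← hm]; exact h.inv x
  natural f := by rw [← hs', ← ht', ← hF, ← hG, ← hm, ← hm]; exact h.natural f

/-! ### From left and right constraints to a weak unit: `K` and the cocycle conditions -/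

namespace SMon2Cat

variable {C : SMon2Cat.{u}} {I : C.Ob} {α : C.Ar} {lam rho : TransfData C.toTwoCat C.toTwoCat}
  {L R : C.Ob → C.Cell}

theorem IsLeftConstraint.app_ar (h : C.IsLeftConstraint I α lam L) (x : C.Ob) :
    C.IsAr (lam.app x) (C.tOb I x) x := h.pseudonatural.app_ar x

theorem IsRightConstraint.app_ar (h : C.IsRightConstraint I α rho R) (x : C.Ob) :
    C.IsAr (rho.app x) (C.tOb x I) x := h.pseudonatural.app_ar x

theorem IsLeftConstraint.cell (h : C.IsLeftConstraint I α lam L) (x : C.Ob) :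
    C.IsCell (L x) (C.tAr (C.one I) (lam.app x)) (C.tAr α (C.one x)) := h.modification.cell x

theorem IsRightConstraint.cell (h : C.IsRightConstraint I α rho R) (x : C.Ob) :
    C.IsCell (R x) (C.tAr (rho.app x) (C.one I)) (C.tAr (C.one x) α) := h.modification.cell x

variable (C) in
/-- The 2-cell `ρ_X ⊗ I ⊗ Y ⇒ X ⊗ α ⊗ Y ⇒ X ⊗ I ⊗ λ_Y`. -/
noncomputable def middle (L R : C.Ob → C.Cell) (x y : C.Ob) : C.Cell :=
  C.vcomp (C.tCell (R x) (C.two (C.one y))) (C.tCell (C.two (C.one x)) (C.inv (L y)))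

theorem isCell_middle (hl : C.IsLeftConstraint I α lam L) (hr : C.IsRightConstraint I α rho R)
    (x y : C.Ob) : C.IsCell (C.middle L R x y) (C.tAr (rho.app x) (C.one (C.tOb I y)))
      (C.tAr (C.one (C.tOb x I)) (lam.app y)) ∧ C.IsInv (C.middle L R x y) := by
  have h₁ := hl.cell y
  have h₂ := hr.cell x
  have h₃ := hl.modification.inv y
  have h₄ := hr.modification.inv x
  have e : C.tAr (C.tAr (C.one x) α) (C.one y) = C.tAr (C.one x) (C.tAr α (C.one y)) := by grind
  refine ⟨?_, (isInv_tCell h₄ (C.isInv_two _)).vcomp (isInv_tCell (C.isInv_two _) h₃.inv)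
    (by grind)⟩
  rw [middle]
  grind

/-- The arrows `ρ_X` and `λ_Y` act on different tensor factors, so both composites are `ρ_X ⊗ λ_Y`.
-/
theorem middle_exchange (hl : C.IsLeftConstraint I α lam L) (hr : C.IsRightConstraint I α rho R)
    (x y : C.Ob) : C.comp (C.tAr (C.one (C.tOb x I)) (lam.app y)) (C.tAr (rho.app x) (C.one y)) =
    C.comp (C.tAr (rho.app x) (C.one (C.tOb I y))) (C.tAr (C.one x) (lam.app y)) := by
  have h₁ := hl.app_ar y
  have h₂ := hr.app_ar x
  rw [C.tAr_comp, C.tAr_comp] <;> grind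

/-- `K` is obtained by cancelling `ρ_X ⊗ I ⊗ Y` from `ρ_X ⊗ I ⊗ Y ⇒ X ⊗ I ⊗ λ_Y`. -/
structure IsMiddle (C : SMon2Cat.{u}) (I : C.Ob) (lam rho : TransfData C.toTwoCat C.toTwoCat)
    (L R : C.Ob → C.Cell) (K : C.Ob × C.Ob → C.Cell) : Prop where
  cell : ∀ x y, C.IsCell (K (x, y)) (C.tAr (rho.app x) (C.one y)) (C.tAr (C.one x) (lam.app y))
  inv : ∀ x y, C.IsInv (K (x, y))
  eq : ∀ x y, C.hcomp (C.two (C.tAr (rho.app x) (C.one (C.tOb I y)))) (K (x, y)) =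
    C.hcomp (C.middle L R x y) (C.two (C.tAr (rho.app x) (C.one y)))

/-- Both `λ_{Y ⊗ Z}` and `λ_Y ⊗ Z` are lifts of `α ⊗ Y ⊗ Z` along `I ⊗ -`, by `L_{Y ⊗ Z}` and `L_Y ⊗
Z`, and `Λ` is the unique comparison of these lifts. The cocycle condition may be tested after
whiskering with the equiarrow `ρ_X ⊗ I ⊗ Y ⊗ Z`. There `K` is replaced by `middle`, and the
condition becomes the equation that defines `Λ`. -/
theorem IsMiddle.left_cocycle (h : C.IsIdempotent I α) (hl : C.IsLeftConstraint I α lam L)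
    (hr : C.IsRightConstraint I α rho R) (hre : ∀ x, C.IsEqui (rho.app x))
    {K : C.Ob × C.Ob → C.Cell} (hK : C.IsMiddle I lam rho L R K) :
    ∃ Λ : C.Ob × C.Ob → C.Cell,
    TransfData.IsInvModification (C.tensor.comp (C.tensorLeft I)) C.tensor
      (lam.precomp C.tensor)
      (C.tensorTransf lam (TransfData.ident (TwoFunctor.id _))) Λ ∧
    ∀ x y z, C.vcomp (K (x, C.tOb y z)) (C.obCell x (Λ (y, z))) = C.cellOb (K (x, y)) z := by
  have e : ((C.tensorLeft I).prodMap (TwoFunctor.id C.toTwoCat)).comp C.tensor =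
      C.tensor.comp (C.tensorLeft I) := by
    apply TwoFunctor.ext <;> funext x
    · exact C.assoc_ob _ _ _
    · exact C.assoc_ar _ _ _
    · exact C.assoc_cell _ _ _
  have hs' : (C.tensorTransf lam (TransfData.ident (TwoFunctor.id _))).IsPseudonatural
      (C.tensor.comp (C.tensorLeft I)) C.tensor := by
    rw [← e]
    exact isPseudonatural_tensorTransf hl.pseudonatural (isPseudonatural_ident _)
  have ht : (C.arLeft α C.tensor).IsPseudonatural
      ((C.tensor.comp (C.tensorLeft I)).comp (C.tensorLeft I))
      (C.tensor.comp (C.tensorLeft I)) := by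
    have := isPseudonatural_arLeft (F := C.tensor) h.ar
    rwa [← tensorLeft_comp_tensorLeft] at this
  have hα' : (C.arLeft α (TwoFunctor.id _)).IsPseudonatural
      ((C.tensorLeft I).comp (C.tensorLeft I)) (C.tensorLeft I) := isPseudonatural_arLeft_id h.ar
  have hL' := isInvModification_tensor hl.modification
    (isInvModification_refl (isPseudonatural_ident (TwoFunctor.id C.toTwoCat)))
    (hl.pseudonatural.postcomp (C.tensorLeft I)) (isPseudonatural_ident _)
    hα' (isPseudonatural_ident _)
  obtain ⟨Λ, ⟨hΛ, hΛ'⟩, -⟩ := TransfData.existsUnique_modification (F := C.tensor.comp (C.tensorLeft I))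
    (G := C.tensor) h.left ht (s := lam.precomp C.tensor)
    (L := fun x => L (C.tensor.ob x)) (L' := fun x => C.tCell (L x.1) (C.two (C.one x.2)))
    (hl.pseudonatural.precomp C.tensor) hs' (hl.modification.precomp C.tensor)
    (hL'.congr (fun f => by
        change C.tAr (C.tAr (C.one I) (C.tAr (C.one I) f.1)) f.2 =
          C.tAr (C.one I) (C.tAr (C.one I) (C.tAr f.1 f.2))
        grind) (fun f => C.assoc_ar _ _ _)
      (fun x => C.assoc_ar _ _ _) (fun f => C.assoc_cell _ _ _) (fun x => by
        change C.tAr (C.tAr α (C.one x.1)) (C.one x.2) = C.tAr α (C.one (C.tOb x.1 x.2))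
        grind)
      (fun f => by
        change C.tCell (C.two (C.tAr α f.1)) (C.two f.2) = C.two (C.tAr α (C.tAr f.1 f.2))
        grind) (fun x => rfl))
  refine ⟨Λ, hΛ, fun x y z => ?_⟩
  have k₁ := hK.cell x (C.tOb y z)
  have k₂ := hK.cell x y
  have q₁ := hK.eq x (C.tOb y z)
  have q₂ := hK.eq x y
  have c : C.IsCell (Λ (y, z)) (lam.app (C.tOb y z)) (C.tAr (lam.app y) (C.one z)) :=
    hΛ.cell (y, z)
  have c' : C.vcomp (C.tCell (C.two (C.one I)) (Λ (y, z))) (C.tCell (L y) (C.two (C.one z))) =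
    L (C.tOb y z) := hΛ' (y, z)
  have l₁ := hl.app_ar (C.tOb y z)
  have l₂ := hl.app_ar y
  have r₁ := hr.app_ar x
  have m₁ := (isCell_middle hl hr x (C.tOb y z)).1
  have m₂ := (isCell_middle hl hr x y).1
  have key₁ : C.hcomp (C.two (C.tAr (rho.app x) (C.one (C.tOb I (C.tOb y z)))))
      (C.obCell x (Λ (y, z))) =
      C.hcomp (C.tCell (C.two (C.one (C.tOb x I))) (Λ (y, z)))
        (C.two (C.tAr (rho.app x) (C.one (C.tOb y z)))) := by
    rw [obCell, ← C.tCell_two, C.tCell_hcomp, ← C.tCell_two, C.tCell_hcomp] <;> grind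
  -- The factor `R_X` is common to both sides. What remains is the defining equation of `Λ` with the
  -- cells `L` inverted.
  have key₂ : C.vcomp (C.middle L R x (C.tOb y z)) (C.tCell (C.two (C.one (C.tOb x I))) (Λ (y, z))) =
      C.tCell (C.middle L R x y) (C.two (C.one z)) := by
    have i₁ := hl.modification.inv (C.tOb y z)
    have i₂ := hl.modification.inv y
    have n₁ := hl.cell (C.tOb y z)
    have n₂ := hl.cell y
    have n₃ := hr.cell x
    have t₁ : C.vcomp (C.inv (L (C.tOb y z))) (C.tCell (C.two (C.one I)) (Λ (y, z))) =
        C.tCell (C.inv (L y)) (C.two (C.one z)) := by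
      have i₃ : C.IsInv (C.tCell (L y) (C.two (C.one z))) := isInv_tCell i₂ (C.isInv_two _)
      refine i₁.cancel_left (by grind) (by grind) ?_
      rw [TwoCat.vcomp_inv_cancel i₁ (by grind), ← c', C.vcomp_assoc, C.tCell_vcomp,
        i₂.inv_spec.2.2.1] <;> grind
    have t₂ : C.tCell (C.two (C.one (C.tOb x I))) (Λ (y, z)) =
        C.tCell (C.two (C.one x)) (C.tCell (C.two (C.one I)) (Λ (y, z))) := by
      rw [← C.tCell_assoc, C.tCell_two, C.tAr_one]
    rw [middle, middle, t₂, C.vcomp_assoc, C.tCell_vcomp, t₁, C.two_vcomp_of (by grind),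
      ← C.tAr_one, ← C.tCell_two, ← C.tCell_assoc, ← C.tCell_assoc, C.tCell_vcomp] <;> grind
  refine (isEqui_tAr (hre x) (C.isEqui_one (C.tOb I (C.tOb y z)))).whisker_left_cancel
    (by grind) (by grind) (by grind) ?_
  have t₁ : C.two (C.tAr (rho.app x) (C.one (C.tOb I (C.tOb y z)))) =
      C.tCell (C.two (C.tAr (rho.app x) (C.one (C.tOb I y)))) (C.two (C.one z)) := by grind
  have t₂ : C.two (C.tAr (rho.app x) (C.one (C.tOb y z))) =
      C.tCell (C.two (C.tAr (rho.app x) (C.one y))) (C.two (C.one z)) := by grind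
  have t₃ : C.hcomp (C.tCell (C.middle L R x y) (C.two (C.one z)))
      (C.two (C.tAr (rho.app x) (C.one (C.tOb y z)))) =
      C.hcomp (C.two (C.tAr (rho.app x) (C.one (C.tOb I (C.tOb y z)))))
        (C.tCell (K (x, y)) (C.two (C.one z))) := by
    rw [t₁, t₂, C.tCell_hcomp, C.tCell_hcomp, q₂] <;> grind
  rw [C.two_hcomp_vcomp, q₁, key₁, ← C.vcomp_hcomp_two, key₂, cellOb, t₃] <;> grind

section Reassociation

variable (C I)

theorem prodMap_tensorLeft_id : ((TwoFunctor.id _).prodMap (C.tensorLeft I)).comp C.tensor =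
    ((C.tensorRight I).prodMap (TwoFunctor.id _)).comp C.tensor := by
  apply TwoFunctor.ext <;> funext x
  · exact (C.assoc_ob _ _ _).symm
  · exact (C.assoc_ar _ _ _).symm
  · exact (C.assoc_cell _ _ _).symm

theorem prodMap_tensorRight_tensorRight :
    (((C.tensorRight I).comp (C.tensorRight I)).prodMap (TwoFunctor.id _)).comp C.tensor =
    ((C.tensorRight I).prodMap (C.tensorLeft I)).comp C.tensor := by
  apply TwoFunctor.ext <;> funext x
  · exact C.assoc_ob _ _ _
  · exact C.assoc_ar _ _ _
  · exact C.assoc_cell _ _ _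

theorem prodMap_tensorLeft_tensorLeft :
    ((TwoFunctor.id _).prodMap ((C.tensorLeft I).comp (C.tensorLeft I))).comp C.tensor =
    ((C.tensorRight I).prodMap (C.tensorLeft I)).comp C.tensor := by
  apply TwoFunctor.ext <;> funext x
  · exact (C.assoc_ob _ _ _).symm
  · exact (C.assoc_ar _ _ _).symm
  · exact (C.assoc_cell _ _ _).symm

theorem tensorTransf_postcomp_right (rho : TransfData C.toTwoCat C.toTwoCat) :
    C.tensorTransf (rho.postcomp (C.tensorRight I)) (TransfData.ident (TwoFunctor.id _)) =
    C.tensorTransf rho (TransfData.ident (C.tensorLeft I)) := by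
  ext x
  · change C.tAr (C.tAr _ (C.one I)) (C.one _) = C.tAr _ (C.one (C.tOb I _))
    grind
  · change C.tCell (C.tCell _ (C.two (C.one I))) (C.two _) = C.tCell _ (C.two (C.tAr (C.one I) _))
    grind

theorem tensorTransf_postcomp_left (lam : TransfData C.toTwoCat C.toTwoCat) :
    C.tensorTransf (TransfData.ident (TwoFunctor.id _)) (lam.postcomp (C.tensorLeft I)) =
    C.tensorTransf (TransfData.ident (C.tensorRight I)) lam := by
  ext x
  · change C.tAr (C.one _) (C.tAr (C.one I) _) = C.tAr (C.one (C.tOb _ I)) _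
    grind
  · change C.tCell (C.two _) (C.tCell (C.two (C.one I)) _) = C.tCell (C.two (C.tAr _ (C.one I))) _
    rw [← C.tCell_two, C.tCell_assoc]
    rfl

theorem tensorTransf_arRight (α : C.Ar) :
    C.tensorTransf (C.arRight (TwoFunctor.id _) α) (TransfData.ident (TwoFunctor.id _)) =
    C.tensorTransf (TransfData.ident (TwoFunctor.id _)) (C.arLeft α (TwoFunctor.id _)) := by
  ext x
  · exact C.assoc_ar _ _ _
  · change C.tCell (C.two (C.tAr _ _)) (C.two _) = C.tCell (C.two _) (C.two (C.tAr _ _))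
    grind

end Reassociation

theorem isInvModification_middle (h : C.IsIdempotent I α) (hl : C.IsLeftConstraint I α lam L)
    (hr : C.IsRightConstraint I α rho R) :
    TransfData.IsInvModification (((C.tensorRight I).prodMap (C.tensorLeft I)).comp C.tensor)
      (((C.tensorRight I).prodMap (TwoFunctor.id _)).comp C.tensor)
      (C.tensorTransf rho (TransfData.ident (C.tensorLeft I)))
      (C.tensorTransf (TransfData.ident (C.tensorRight I)) lam)
      (fun x => C.middle L R x.1 x.2) := by
  have hid := isPseudonatural_ident (TwoFunctor.id C.toTwoCat)
  have hα : (C.arLeft α (TwoFunctor.id _)).IsPseudonatural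
      ((C.tensorLeft I).comp (C.tensorLeft I)) (C.tensorLeft I) := isPseudonatural_arLeft_id h.ar
  have hα' : (C.arRight (TwoFunctor.id _) α).IsPseudonatural
      ((C.tensorRight I).comp (C.tensorRight I)) (C.tensorRight I) :=
    isPseudonatural_arLeft_id (C := C.rev) h.ar
  have m₁ := isInvModification_tensor hr.modification (isInvModification_refl hid)
    (hr.pseudonatural.postcomp _) hid hα' hid
  have m₂ := isInvModification_tensor (isInvModification_refl hid)
    (hl.modification.symm (hl.pseudonatural.postcomp _) hα) hid hα hid
    (hl.pseudonatural.postcomp _)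
  have p₁ := isPseudonatural_tensorTransf hr.pseudonatural
    (isPseudonatural_ident (C.tensorLeft I))
  have p₂ := isPseudonatural_tensorTransf (isPseudonatural_ident (C.tensorRight I))
    hl.pseudonatural
  have p₃ := isPseudonatural_tensorTransf hid hα
  rw [prodMap_tensorRight_tensorRight, tensorTransf_postcomp_right, tensorTransf_arRight] at m₁
  rw [prodMap_tensorLeft_tensorLeft, tensorTransf_postcomp_left, prodMap_tensorLeft_id] at m₂
  rw [prodMap_tensorLeft_id] at p₁
  rw [prodMap_tensorLeft_tensorLeft, prodMap_tensorLeft_id] at p₃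
  exact m₁.trans m₂ p₁ p₃ p₂

/-- By `middle_exchange`, the cell `middle` whiskered with `ρ_X ⊗ Y` has a codomain that starts with
`ρ_X ⊗ I ⊗ Y`, as its domain does; this equiarrow can be cancelled. The result is a modification
because `middle` is one and whiskering with a pseudo-natural equivalence detects modifications. -/
theorem exists_isMiddle (h : C.IsIdempotent I α) (hl : C.IsLeftConstraint I α lam L)
    (hr : C.IsRightConstraint I α rho R) (hre : ∀ x, C.IsEqui (rho.app x)) :
    ∃ K, C.IsMiddle I lam rho L R K ∧ TransfData.IsInvModification
      (((C.tensorRight I).prodMap (TwoFunctor.id _)).comp C.tensor) C.tensor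
      (C.tensorTransf rho (TransfData.ident (TwoFunctor.id _)))
      (C.tensorTransf (TransfData.ident (TwoFunctor.id _)) lam) K := by
  have hid := isPseudonatural_ident (TwoFunctor.id C.toTwoCat)
  have p₁ := isPseudonatural_tensorTransf hr.pseudonatural
    (isPseudonatural_ident (C.tensorLeft I))
  have p₂ := isPseudonatural_tensorTransf (isPseudonatural_ident (C.tensorRight I))
    hl.pseudonatural
  have p₃ : (C.tensorTransf rho (TransfData.ident (TwoFunctor.id _))).IsPseudonatural
    (((C.tensorRight I).prodMap (TwoFunctor.id _)).comp C.tensor) C.tensor :=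
    isPseudonatural_tensorTransf hr.pseudonatural hid
  have p₄ : (C.tensorTransf (TransfData.ident (TwoFunctor.id _)) lam).IsPseudonatural
    (((TwoFunctor.id _).prodMap (C.tensorLeft I)).comp C.tensor) C.tensor :=
    isPseudonatural_tensorTransf hid hl.pseudonatural
  rw [prodMap_tensorLeft_id] at p₁ p₄
  have he : ∀ x y, C.IsEqui (C.tAr (rho.app x) (C.one (C.tOb I y))) := fun x y =>
    isEqui_tAr (hre x) (C.isEqui_one _)
  have key : ∀ x : C.Ob × C.Ob, ∃ k, (C.IsCell k (C.tAr (rho.app x.1) (C.one x.2))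
      (C.tAr (C.one x.1) (lam.app x.2))) ∧ C.IsInv k ∧
      C.hcomp (C.two (C.tAr (rho.app x.1) (C.one (C.tOb I x.2)))) k =
        C.hcomp (C.middle L R x.1 x.2) (C.two (C.tAr (rho.app x.1) (C.one x.2))) := by
    rintro ⟨x, y⟩
    have r := hr.app_ar x
    have l := hl.app_ar y
    obtain ⟨m, mi⟩ := isCell_middle hl hr x y
    have ex := middle_exchange hl hr x y
    obtain ⟨k, hk, e⟩ := (he x y).whisker_left_full (f := C.tAr (rho.app x) (C.one y))
      (f' := C.tAr (C.one x) (lam.app y))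
      (c := C.hcomp (C.middle L R x y) (C.two (C.tAr (rho.app x) (C.one y))))
      (by grind) (by grind) (by grind) (by grind)
    refine ⟨k, hk, ?_, e⟩
    refine (he x y).whisker_left_isInv (by grind) ?_
    rw [e]
    exact mi.hcomp (C.isInv_two _) (by grind)
  choose K hK₁ hK₂ hK₃ using key
  refine ⟨K, ⟨fun x y => hK₁ (x, y), fun x y => hK₂ (x, y),
    fun x y => hK₃ (x, y)⟩, ?_⟩
  refine TransfData.IsInvModification.of_whisker_left p₁ (fun x => he _ _) p₃ p₄ (fun x => hK₁ _) ?_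
  refine ((isInvModification_middle h hl hr).whisker_right p₁ p₂ p₃).congr (fun _ => rfl)
    (fun _ => rfl) (fun _ => rfl) (fun _ => rfl) (fun x => middle_exchange hl hr x.1 x.2) ?_
    (fun x => (hK₃ x).symm)
  -- The naturality cells of the two composites agree: each is `ρ_f ⊗ λ_g`.
  rintro ⟨f, g⟩
  change C.vcomp (C.hcomp (C.tCell (C.two (C.tAr f (C.one I))) (lam.nat g))
      (C.two (C.tAr (rho.app (C.tgt f)) (C.one (C.tgt g)))))
    (C.hcomp (C.two (C.tAr (C.one (C.tOb (C.src f) I)) (lam.app (C.src g))))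
      (C.tCell (rho.nat f) (C.two g))) =
    C.vcomp (C.hcomp (C.tCell (rho.nat f) (C.two (C.tAr (C.one I) g)))
      (C.two (C.tAr (C.one (C.tgt f)) (lam.app (C.tgt g)))))
    (C.hcomp (C.two (C.tAr (rho.app (C.src f)) (C.one (C.tOb I (C.src g)))))
      (C.tCell (C.two f) (lam.nat g)))
  have r₁ := hr.app_ar (C.src f)
  have r₂ := hr.app_ar (C.tgt f)
  have l₁ := hl.app_ar (C.src g)
  have l₂ := hl.app_ar (C.tgt g)
  have n₁ : C.IsCell (rho.nat f) (C.comp (C.tAr f (C.one I)) (rho.app (C.tgt f)))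
    (C.comp (rho.app (C.src f)) f) := hr.pseudonatural.nat_cell f
  have n₂ : C.IsCell (lam.nat g) (C.comp (C.tAr (C.one I) g) (lam.app (C.tgt g)))
    (C.comp (lam.app (C.src g)) g) := hl.pseudonatural.nat_cell g
  have t₁ : C.two (C.tAr (C.one (C.tOb (C.src f) I)) (lam.app (C.src g))) =
    C.tCell (C.two (C.one (C.tOb (C.src f) I))) (C.two (lam.app (C.src g))) := by grind
  have t₂ : C.two (C.tAr (rho.app (C.src f)) (C.one (C.tOb I (C.src g)))) =
    C.tCell (C.two (rho.app (C.src f))) (C.two (C.one (C.tOb I (C.src g)))) := by grind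
  have t₃ : C.two (C.tAr (rho.app (C.tgt f)) (C.one (C.tgt g))) =
    C.tCell (C.two (rho.app (C.tgt f))) (C.two (C.one (C.tgt g))) := by grind
  have t₄ : C.two (C.tAr (C.one (C.tgt f)) (lam.app (C.tgt g))) =
    C.tCell (C.two (C.one (C.tgt f))) (C.two (lam.app (C.tgt g))) := by grind
  rw [t₁, t₂, t₃, t₄]
  clear t₁ t₂ t₃ t₄
  have e₁ : C.hcomp (lam.nat g) (C.two (C.one (C.tgt g))) = lam.nat g := C.hcomp_one_of (by grind)
  have e₂ : C.hcomp (rho.nat f) (C.two (C.one (C.tgt f))) = rho.nat f := C.hcomp_one_of (by grind)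
  have e₃ : C.hcomp (C.two (C.one (C.tOb (C.src f) I))) (rho.nat f) = rho.nat f :=
    C.one_hcomp_of (by grind)
  have e₄ : C.hcomp (C.two (C.one (C.tOb I (C.src g)))) (lam.nat g) = lam.nat g :=
    C.one_hcomp_of (by grind)
  rw [C.tCell_hcomp (by grind) (by grind), C.tCell_hcomp (by grind) (by grind),
    C.tCell_hcomp (by grind) (by grind), C.tCell_hcomp (by grind) (by grind), e₁, e₂, e₃, e₄,
    C.hcomp_two _ _ (by grind), C.hcomp_two _ _ (by grind), C.hcomp_two _ _ (by grind),
    C.hcomp_two _ _ (by grind), C.tCell_vcomp (by grind) (by grind),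
    C.tCell_vcomp (by grind) (by grind), C.two_vcomp_of (by grind), C.two_vcomp_of (by grind),
    C.vcomp_two_of (by grind), C.vcomp_two_of (by grind)]

/-- The horizontal composite of `middle` and `K` has two factorisations. Their first factors agree
by the defining equation of `K` and are invertible, so the second factors agree. This is the mirror
image of the defining equation, needed for passing to the reversed tensor product. -/
theorem IsMiddle.eq' (hl : C.IsLeftConstraint I α lam L) (hr : C.IsRightConstraint I α rho R)
    {K : C.Ob × C.Ob → C.Cell} (hK : C.IsMiddle I lam rho L R K) (x y : C.Ob) :
    C.hcomp (C.two (C.tAr (C.one (C.tOb x I)) (lam.app y))) (K (x, y)) =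
      C.hcomp (C.middle L R x y) (C.two (C.tAr (C.one x) (lam.app y))) := by
  have r := hr.app_ar x
  have l := hl.app_ar y
  obtain ⟨m, mi⟩ := isCell_middle hl hr x y
  have ex := middle_exchange hl hr x y
  have k := hK.cell x y
  have ki := hK.inv x y
  have q := hK.eq x y
  have h₁ := C.hcomp_eq_right_left k.1 m.2 (by grind)
  have h₂ := C.hcomp_eq_left_right m.1 k.2 (by grind)
  have i : C.IsInv (C.hcomp (C.middle L R x y) (C.two (C.tAr (rho.app x) (C.one y)))) :=
    mi.hcomp (C.isInv_two _) (by grind)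
  refine i.cancel_left (by grind) (by grind) ?_
  rw [h₁, ← q, h₂]

/-- Reversal exchanges the two constraints and inverts `middle`, so the inverse of `K` solves the
reversed problem; its equation is the inverse of `IsMiddle.eq'`. -/
theorem IsMiddle.rev (hl : C.IsLeftConstraint I α lam L) (hr : C.IsRightConstraint I α rho R)
    {K : C.Ob × C.Ob → C.Cell} (hK : C.IsMiddle I lam rho L R K) :
    C.rev.IsMiddle I rho lam R L (fun x => C.inv (K (x.2, x.1))) where
  cell x y := by
    have k := hK.cell y x
    have ki := hK.inv y x
    change C.IsCell (C.inv (K (y, x))) (C.tAr (C.one y) (lam.app x)) (C.tAr (rho.app y) (C.one x))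
    grind
  inv x y := (hK.inv y x).inv
  eq x y := by
    have r := hr.app_ar y
    have l := hl.app_ar x
    have k := hK.cell y x
    have ki := hK.inv y x
    obtain ⟨m, mi⟩ := isCell_middle hl hr y x
    have e := hK.eq' hl hr y x
    have h₁ := hl.cell x
    have h₂ := hr.cell y
    have h₃ := hl.modification.inv x
    have h₄ := hr.modification.inv y
    have h₅ : C.tAr (C.tAr (C.one y) α) (C.one x) = C.tAr (C.one y) (C.tAr α (C.one x)) := by
      grind
    have e' : C.rev.middle R L x y = C.inv (C.middle L R y x) := by
      have i₁ : C.IsInv (C.tCell (R y) (C.two (C.one x))) := isInv_tCell h₄ (C.isInv_two _)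
      have i₂ : C.IsInv (C.tCell (C.two (C.one y)) (C.inv (L x))) :=
        isInv_tCell (C.isInv_two _) h₃.inv
      rw [show C.middle L R y x = C.vcomp (C.tCell (R y) (C.two (C.one x)))
        (C.tCell (C.two (C.one y)) (C.inv (L x))) from rfl, TwoCat.inv_vcomp i₁ i₂ (by grind), inv_tCell h₄ (C.isInv_two _),
        inv_tCell (C.isInv_two _) h₃.inv, TwoCat.inv_two, TwoCat.inv_two, TwoCat.inv_inv h₃]
      rfl
    rw [e']
    change C.hcomp (C.two (C.tAr (C.one (C.tOb y I)) (lam.app x))) (C.inv (K (y, x))) =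
      C.hcomp (C.inv (C.middle L R y x)) (C.two (C.tAr (C.one y) (lam.app x)))
    rw [← C.inv_two, ← TwoCat.inv_hcomp (C.isInv_two _) ki (by grind), e,
      TwoCat.inv_hcomp mi (C.isInv_two _) (by grind), C.inv_two]

/-- This is the left cocycle condition for the inverse of `K` and the reversed tensor product; `P`
is the resulting `Λ` with its arguments exchanged. -/
theorem IsMiddle.right_cocycle (h : C.IsIdempotent I α) (hl : C.IsLeftConstraint I α lam L)
    (hr : C.IsRightConstraint I α rho R) (hle : ∀ x, C.IsEqui (lam.app x))
    {K : C.Ob × C.Ob → C.Cell} (hK : C.IsMiddle I lam rho L R K) :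
    ∃ P : C.Ob × C.Ob → C.Cell,
    TransfData.IsInvModification (C.tensor.comp (C.tensorRight I)) C.tensor
      (rho.precomp C.tensor)
      (C.tensorTransf (TransfData.ident (TwoFunctor.id _)) rho) P ∧
    ∀ x y z, C.vcomp (C.cellOb (P (x, y)) z) (C.obCell x (K (y, z))) = K (C.tOb x y, z) := by
  obtain ⟨Λ, hΛ, e⟩ := (hK.rev hl hr).left_cocycle h.rev (isLeftConstraint_rev.2 hr)
    ⟨hl.1, hl.2⟩ hle
  refine ⟨fun x => Λ (x.2, x.1), hΛ.precomp (TwoCat.swap _ _), fun x y z => ?_⟩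
  have e' : C.vcomp (C.inv (K (C.tOb x y, z))) (C.tCell (Λ (y, x)) (C.two (C.one z))) =
    C.tCell (C.two (C.one x)) (C.inv (K (y, z))) := e z y x
  have c : C.IsCell (Λ (y, x)) (rho.app (C.tOb x y)) (C.tAr (C.one x) (rho.app y)) :=
    hΛ.cell (y, x)
  have k₁ := hK.cell (C.tOb x y) z
  have k₂ := hK.cell y z
  have i₁ := hK.inv (C.tOb x y) z
  have i₂ := hK.inv y z
  refine i₁.inv.cancel_left (by grind) (by grind) ?_
  change C.vcomp (C.inv (K (C.tOb x y, z))) (C.vcomp (C.tCell (Λ (y, x)) (C.two (C.one z)))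
    (C.tCell (C.two (C.one x)) (K (y, z)))) = C.vcomp (C.inv (K (C.tOb x y, z))) (K (C.tOb x y, z))
  rw [← C.vcomp_assoc _ _ _ (by grind) (by grind), e',
    C.tCell_vcomp (by grind) (by grind), i₂.inv_spec.2.2.2, i₁.inv_spec.2.2.2] <;> grind

theorem exists_weakUnit (h : C.IsIdempotent I α) (hl : C.IsLeftConstraint I α lam L)
    (hr : C.IsRightConstraint I α rho R) (hle : ∀ x, C.IsEqui (lam.app x))
    (hre : ∀ x, C.IsEqui (rho.app x)) :
    ∃ W : WeakUnit C, W.I = I ∧ W.lam = lam ∧ W.rho = rho := by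
  obtain ⟨K, hK, hK'⟩ := exists_isMiddle h hl hr hre
  exact ⟨⟨I, lam, rho, K, hl.pseudonatural, hle, hr.pseudonatural, hre, hK',
    hK.left_cocycle h hl hr hre, hK.right_cocycle h hl hr hle⟩, rfl, rfl, rfl⟩

end SMon2Cat

theorem TransfData.IsInvModification.whisker_left {C D : TwoCat.{u}} {F G H : TwoFunctor C D}
    {s t t' : TransfData C D} {m : C.Ob → D.Cell} (hm : IsInvModification G H t t' m)
    (hs : s.IsPseudonatural F G) (ht : t.IsPseudonatural G H) (ht' : t'.IsPseudonatural G H) :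
    IsInvModification F H (s.comp t) (s.comp t')
      (fun x => D.hcomp (D.two (s.app x)) (m x)) where
  cell x := by
    have := hm.cell x
    have := hs.app_ar x
    have := ht.app_ar x
    simp only [TransfData.comp]
    grind
  inv x := (D.isInv_two _).hcomp (hm.inv x) (by
    have := hm.cell x
    have := hs.app_ar x
    have := ht.app_ar x
    grind)
  natural f := by
    have n := hm.natural f
    have := hm.cell (C.src f)
    have := hm.cell (C.tgt f)
    have := hs.app_ar (C.src f)
    have := hs.app_ar (C.tgt f)
    have := ht.app_ar (C.src f)
    have := ht.app_ar (C.tgt f)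
    have := ht'.app_ar (C.src f)
    have := ht'.app_ar (C.tgt f)
    have := hs.nat_cell f
    have := ht.nat_cell f
    have := ht'.nat_cell f
    simp only [TransfData.comp]
    have e₁ : D.vcomp (D.hcomp (D.two (s.app (C.src f))) (t.nat f))
        (D.hcomp (D.hcomp (D.two (s.app (C.src f))) (m (C.src f))) (D.two (H.ar f))) =
        D.vcomp (D.hcomp (D.two (s.app (C.src f))) (D.hcomp (D.two (G.ar f)) (m (C.tgt f))))
          (D.hcomp (D.two (s.app (C.src f))) (t'.nat f)) := by
      rw [D.hcomp_assoc, ← D.two_hcomp_vcomp, n, D.two_hcomp_vcomp] <;> grind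
    have e₂ : D.vcomp (D.hcomp (s.nat f) (D.two (t.app (C.tgt f))))
        (D.hcomp (D.two (s.app (C.src f))) (D.hcomp (D.two (G.ar f)) (m (C.tgt f)))) =
        D.vcomp (D.hcomp (D.two (F.ar f)) (D.hcomp (D.two (s.app (C.tgt f))) (m (C.tgt f))))
          (D.hcomp (s.nat f) (D.two (t'.app (C.tgt f)))) := by
      rw [← D.hcomp_assoc, D.hcomp_two, ← D.hcomp_assoc, D.hcomp_two,
        D.hcomp_eq_right_left, D.hcomp_eq_left_right] <;> grind
    rw [D.vcomp_assoc _ _ _ (by grind) (by grind), e₁, ← D.vcomp_assoc _ _ _ (by grind) (by grind), e₂,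
      D.vcomp_assoc] <;> grind

namespace SMon2Cat

theorem isInvModification_arLeft {D : SMon2Cat.{u}} {A : TwoCat.{u}} {F : TwoFunctor A D.toTwoCat}
    {I J : D.Ob} {f g : D.Ar} {a : D.Cell} (hf : D.IsAr f I J) (ha : D.IsCell a f g)
    (hi : D.IsInv a) : TransfData.IsInvModification (F.comp (D.tensorLeft I))
      (F.comp (D.tensorLeft J)) (D.arLeft f F) (D.arLeft g F)
      (fun x => D.tCell a (D.two (D.one (F.ob x)))) where
  cell x := by grind
  inv x := isInv_tCell hi (D.isInv_two _)
  natural k := by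
    change D.vcomp (D.two (D.tAr f (F.ar k))) (D.hcomp (D.tCell a (D.two (D.one (F.ob (A.src k)))))
      (D.two (D.tAr (D.one J) (F.ar k)))) = D.vcomp (D.hcomp (D.two (D.tAr (D.one I) (F.ar k)))
      (D.tCell a (D.two (D.one (F.ob (A.tgt k)))))) (D.two (D.tAr g (F.ar k)))
    simp only [← D.tCell_two]
    simp (disch := grind) only [D.tCell_hcomp, D.tCell_vcomp]
    congr 1 <;> grind

theorem isInvModification_arRight {D : SMon2Cat.{u}} {A : TwoCat.{u}}
    {F : TwoFunctor A D.toTwoCat}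
    {I J : D.Ob} {f g : D.Ar} {a : D.Cell} (hf : D.IsAr f I J) (ha : D.IsCell a f g)
    (hi : D.IsInv a) : TransfData.IsInvModification (F.comp (D.tensorRight I))
      (F.comp (D.tensorRight J)) (D.arRight F f) (D.arRight F g)
      (fun x => D.tCell (D.two (D.one (F.ob x))) a) :=
  isInvModification_arLeft (D := D.rev) hf ha hi

end SMon2Cat

/-! ### The idempotent underlying a weak unit -/

namespace WeakUnit

variable {C : SMon2Cat.{u}} (W : WeakUnit C)

theorem isEqui2_tensorLeft : (C.tensorLeft W.I).IsEqui2 :=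
  W.lam_nat.isEqui2 W.lam_equi (TwoFunctor.isEqui2_id _)

theorem isEqui2_tensorRight : (C.tensorRight W.I).IsEqui2 :=
  W.rho_nat.isEqui2 W.rho_equi (TwoFunctor.isEqui2_id _)

theorem lam_ar (x : C.Ob) : C.IsAr (W.lam.app x) (C.tOb W.I x) x := W.lam_nat.app_ar x

theorem rho_ar (x : C.Ob) : C.IsAr (W.rho.app x) (C.tOb x W.I) x := W.rho_nat.app_ar x

theorem K_cell (x y : C.Ob) : C.IsCell (W.K (x, y)) (C.tAr (W.rho.app x) (C.one y))
    (C.tAr (C.one x) (W.lam.app y)) := W.K_mod.cell (x, y)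

/-- `I ⊗ λ_X ≅ λ_{I ⊗ X} ≅ λ_I ⊗ X`. -/
theorem iso_left (x : C.Ob) : C.Iso (C.tAr (C.one W.I) (W.lam.app x))
    (C.tAr (W.lam.app W.I) (C.one x)) := by
  obtain ⟨Λ, hΛ, -⟩ := W.left_cocycle
  have h₁ := W.lam_ar x
  have h₂ := W.lam_ar (C.tOb W.I x)
  have n := W.lam_nat.nat_cell (W.lam.app x)
  have ni := W.lam_nat.nat_inv (W.lam.app x)
  -- The naturality square of `λ` at the arrow `λ_X` has `λ_X` as last factor on both sides, and
  -- this equiarrow is then cancelled.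
  have i₁ : C.Iso (C.comp (C.tAr (C.one W.I) (W.lam.app x)) (W.lam.app x))
      (C.comp (W.lam.app (C.tOb W.I x)) (W.lam.app x)) := ⟨_, by
        rw [h₁.1, h₁.2] at n
        exact n, ni⟩
  have i₂ := (W.lam_equi x).iso_of_comp_right (by grind) (by grind) (by grind) i₁
  exact i₂.trans ⟨Λ (W.I, x), hΛ.cell (W.I, x), hΛ.inv _⟩

/-- `K_{I,I}` followed by `iso_left` gives `ρ_I ⊗ I ≅ I ⊗ λ_I ≅ λ_I ⊗ I`, and `- ⊗ I` is cancelled.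
-/
theorem iso_lam_rho : C.Iso (W.rho.app W.I) (W.lam.app W.I) := by
  have h₁ := W.lam_ar W.I
  have h₂ := W.rho_ar W.I
  exact W.isEqui2_tensorRight.iso_reflect (by grind) (by grind)
    (TwoCat.Iso.trans ⟨W.K (W.I, W.I), W.K_cell _ _, W.K_mod.inv _⟩ (W.iso_left W.I))

theorem isIdempotent : C.IsIdempotent W.I (W.lam.app W.I) where
  left := W.isEqui2_tensorLeft
  right := W.isEqui2_tensorRight
  ar := W.lam_ar W.I
  equi := W.lam_equi W.I
  iso := W.iso_left W.I

theorem isRightConstraint : C.IsRightConstraint W.I (W.lam.app W.I) W.rho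
    (fun x => W.K (x, W.I)) where
  pseudonatural := W.rho_nat
  modification := (W.K_mod.precomp
    (TwoFunctor.pair (TwoFunctor.id _) (TwoFunctor.const _ W.I))).congr (fun _ => rfl)
    (fun _ => rfl) (fun _ => rfl) (fun _ => rfl) (fun _ => rfl) (fun f => by
      change C.tCell (C.two f) (W.lam.nat (C.one W.I)) = C.two (C.tAr f (W.lam.app W.I))
      rw [W.lam_nat.nat_one, C.tCell_two]) (fun _ => rfl)

/-- On this side `K_{I,X}` relates `I ⊗ λ_X` to `ρ_I ⊗ X` rather than to `λ_I ⊗ X`, so it is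
corrected by an isomorphism `ρ_I ≅ λ_I`. -/
theorem exists_isLeftConstraint : ∃ L, C.IsLeftConstraint W.I (W.lam.app W.I) W.lam L := by
  obtain ⟨θ, hθ, hθi⟩ := W.iso_lam_rho
  have h₁ := W.lam_ar W.I
  have h₂ := W.rho_ar W.I
  have m₁ : TransfData.IsInvModification ((C.tensorLeft W.I).comp (C.tensorLeft W.I))
      (C.tensorLeft W.I) (C.arLeft (W.rho.app W.I) (TwoFunctor.id _))
      (W.lam.postcomp (C.tensorLeft W.I)) (fun x => W.K (W.I, x)) :=
    (W.K_mod.precomp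
    (TwoFunctor.pair (TwoFunctor.const _ W.I) (TwoFunctor.id _))).congr (fun f => by
      change C.tAr (C.tAr (C.one W.I) (C.one W.I)) f = C.tAr (C.one W.I) (C.tAr (C.one W.I) f)
      grind)
    (fun _ => rfl) (fun _ => rfl) (fun f => by
      change C.tCell (W.rho.nat (C.one W.I)) (C.two f) = C.two (C.tAr (W.rho.app W.I) f)
      rw [W.rho_nat.nat_one, C.tCell_two]) (fun _ => rfl) (fun _ => rfl) (fun _ => rfl)
  have p₁ : (C.arLeft (W.rho.app W.I) (TwoFunctor.id _)).IsPseudonatural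
      ((C.tensorLeft W.I).comp (C.tensorLeft W.I)) (C.tensorLeft W.I) :=
    SMon2Cat.isPseudonatural_arLeft_id h₂
  have p₂ : (C.arLeft (W.lam.app W.I) (TwoFunctor.id _)).IsPseudonatural
      ((C.tensorLeft W.I).comp (C.tensorLeft W.I)) (C.tensorLeft W.I) :=
    SMon2Cat.isPseudonatural_arLeft_id h₁
  have m₂ := SMon2Cat.isInvModification_arLeft (F := TwoFunctor.id C.toTwoCat) h₂ hθ hθi
  have m₃ : TransfData.IsInvModification ((C.tensorLeft W.I).comp (C.tensorLeft W.I))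
      (C.tensorLeft W.I) (C.arLeft (W.rho.app W.I) (TwoFunctor.id _))
      (C.arLeft (W.lam.app W.I) (TwoFunctor.id _))
      (fun x => C.tCell θ (C.two (C.one x))) := by
    rw [SMon2Cat.tensorLeft_comp_tensorLeft]
    exact m₂
  exact ⟨_, W.lam_nat, (m₁.symm p₁ (W.lam_nat.postcomp _)).trans m₃
    (W.lam_nat.postcomp _) p₁ p₂⟩

theorem comesFrom : W.ComesFrom W.I (W.lam.app W.I) :=
  ⟨rfl, W.exists_isLeftConstraint, _, W.isRightConstraint⟩

/-- If `W` comes from `α` then `α ≅ λ_I`. -/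
theorem ComesFrom.iso {W : WeakUnit C} {I : C.Ob} {α : C.Ar} (h : W.ComesFrom I α)
    (hα : C.IsIdempotent I α) : C.Iso (W.lam.app W.I) α := by
  obtain ⟨rfl, ⟨L, hL⟩, -⟩ := h
  have h₁ := W.lam_ar W.I
  have h₂ := hα.ar
  exact W.isEqui2_tensorLeft.iso_reflect (by grind) (by grind)
    (TwoCat.Iso.trans ⟨L W.I, hL.cell _, hL.modification.inv _⟩ hα.iso.symm)

end WeakUnit

/-! ### Transport of right constraints along an equiarrow -/

namespace SMon2Cat

section Transport

variable {D : SMon2Cat.{u}} {B : TwoCat.{u}} {G : TwoFunctor B D.toTwoCat} {I J : D.Ob}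
  {a b φ : D.Ar} {σ : D.Cell} {r : TransfData B D.toTwoCat} {R : B.Ob → D.Cell}

theorem isPseudonatural_transport (hr : r.IsPseudonatural (G.comp (D.tensorRight J)) G)
    (hφ : D.IsAr φ I J) :
    ((D.arRight G φ).comp r).IsPseudonatural (G.comp (D.tensorRight I)) G :=
  (isPseudonatural_arRight hφ).comp hr

theorem transport_app (hr : r.IsPseudonatural (G.comp (D.tensorRight J)) G)
    (hφ : D.IsAr φ I J) (x : B.Ob) :
    D.comp (D.tAr (D.comp (D.tAr (D.one (G.ob x)) φ) (r.app x)) (D.one I))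
      (D.tAr (D.one (G.ob x)) φ) =
    D.comp (D.tAr (D.one (G.ob x)) (D.tAr φ φ)) (D.tAr (r.app x) (D.one J)) := by
  have h : D.IsAr (r.app x) (D.tOb (G.ob x) J) (G.ob x) := hr.app_ar x
  rw [D.tAr_comp, ← D.tAr_assoc, D.tAr_comp] <;> grind

/-- The second copy of `φ` acts on a tensor factor that `r` does not touch, so it may be applied
before or after `r`. Both naturality cells are that of `r` whiskered with the first `φ`, tensored
with the second `φ`. -/
theorem transport_nat (hr : r.IsPseudonatural (G.comp (D.tensorRight J)) G)
    (hφ : D.IsAr φ I J) (f : B.Ar) :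
    ((((D.arRight G φ).comp r).postcomp (D.tensorRight I)).comp (D.arRight G φ)).nat f =
    ((D.arRight G (D.tAr φ φ)).comp (r.postcomp (D.tensorRight J))).nat f := by
  have h₁ : D.IsAr (r.app (B.src f)) (D.tOb (G.ob (B.src f)) J) (G.ob (B.src f)) := hr.app_ar _
  have h₂ : D.IsAr (r.app (B.tgt f)) (D.tOb (G.ob (B.tgt f)) J) (G.ob (B.tgt f)) := hr.app_ar _
  have n : D.IsCell (r.nat f) (D.comp (D.tAr (G.ar f) (D.one J)) (r.app (B.tgt f)))
    (D.comp (r.app (B.src f)) (G.ar f)) := hr.nat_cell f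
  have q : D.comp (D.tAr (D.one (G.ob (B.src f))) φ)
      (D.comp (D.tAr (G.ar f) (D.one J)) (r.app (B.tgt f))) =
      D.comp (D.tAr (G.ar f) φ) (r.app (B.tgt f)) := by
    rw [← D.comp_assoc, D.tAr_comp] <;> grind
  have k : D.IsCell (D.hcomp (D.two (D.tAr (D.one (G.ob (B.src f))) φ)) (r.nat f))
      (D.comp (D.tAr (G.ar f) φ) (r.app (B.tgt f)))
      (D.comp (D.tAr (D.one (G.ob (B.src f))) φ) (D.comp (r.app (B.src f)) (G.ar f))) := by grind
  have e : D.vcomp (D.hcomp (D.two (D.tAr (G.ar f) φ)) (D.two (r.app (B.tgt f))))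
      (D.hcomp (D.two (D.tAr (D.one (G.ob (B.src f))) φ)) (r.nat f)) =
      D.hcomp (D.two (D.tAr (D.one (G.ob (B.src f))) φ)) (r.nat f) := by
    rw [D.hcomp_two, D.two_vcomp_of] <;> grind
  trans D.tCell (D.hcomp (D.two (D.tAr (D.one (G.ob (B.src f))) φ)) (r.nat f)) (D.two φ)
  · change D.vcomp (D.hcomp (D.tCell (D.vcomp (D.hcomp (D.two (D.tAr (G.ar f) φ))
        (D.two (r.app (B.tgt f)))) (D.hcomp (D.two (D.tAr (D.one (G.ob (B.src f))) φ)) (r.nat f)))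
        (D.two (D.one I))) (D.two (D.tAr (D.one (G.ob (B.tgt f))) φ)))
      (D.hcomp (D.two (D.tAr (D.comp (D.tAr (D.one (G.ob (B.src f))) φ) (r.app (B.src f)))
        (D.one I))) (D.two (D.tAr (G.ar f) φ))) = _
    rw [e]
    generalize D.hcomp (D.two (D.tAr (D.one (G.ob (B.src f))) φ)) (r.nat f) = c at k
    clear e n q
    have q₁ : D.comp (D.tAr (D.comp (D.tAr (D.one (G.ob (B.src f))) φ)
        (D.comp (r.app (B.src f)) (G.ar f))) (D.one I)) (D.tAr (D.one (G.ob (B.tgt f))) φ) =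
        D.comp (D.tAr (D.comp (D.tAr (D.one (G.ob (B.src f))) φ) (r.app (B.src f))) (D.one I))
          (D.tAr (G.ar f) φ) := by
      rw [D.tAr_comp, D.tAr_comp, D.one_comp_of, D.comp_one_of, D.comp_assoc]
        <;> grind
    rw [D.hcomp_two, D.vcomp_two_of, ← D.tCell_two (D.one (G.ob (B.tgt f))), D.tCell_hcomp]
      <;> grind
  · change _ = D.vcomp (D.hcomp (D.two (D.tAr (G.ar f) (D.tAr φ φ)))
        (D.two (D.tAr (r.app (B.tgt f)) (D.one J))))
      (D.hcomp (D.two (D.tAr (D.one (G.ob (B.src f))) (D.tAr φ φ)))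
        (D.tCell (r.nat f) (D.two (D.one J))))
    have e' : D.hcomp (D.two (D.tAr (D.one (G.ob (B.src f))) (D.tAr φ φ)))
        (D.tCell (r.nat f) (D.two (D.one J))) =
        D.tCell (D.hcomp (D.two (D.tAr (D.one (G.ob (B.src f))) φ)) (r.nat f)) (D.two φ) := by
      rw [← D.tAr_assoc, ← D.tCell_two, D.tCell_hcomp, D.hcomp_one_of] <;> grind
    have q₂ : D.comp (D.tAr (G.ar f) (D.tAr φ φ)) (D.tAr (r.app (B.tgt f)) (D.one J)) =
        D.tAr (D.comp (D.tAr (G.ar f) φ) (r.app (B.tgt f))) φ := by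
      rw [← D.tAr_assoc, D.tAr_comp] <;> grind
    rw [e', D.hcomp_two, D.two_vcomp_of] <;> grind

/-- Transport of a right constraint along an equiarrow `φ : I ⟶ J`. -/
theorem exists_transport (hr : r.IsPseudonatural (G.comp (D.tensorRight J)) G)
    (hR : TransfData.IsInvModification ((G.comp (D.tensorRight J)).comp (D.tensorRight J))
      (G.comp (D.tensorRight J)) (r.postcomp (D.tensorRight J)) (D.arRight G a) R)
    (ha : D.IsAr a (D.tOb J J) J) (hb : D.IsAr b (D.tOb I I) I) (hφ : D.IsAr φ I J)
    (he : D.IsEqui φ) (hσ : D.IsCell σ (D.comp b φ) (D.comp (D.tAr φ φ) a)) (hσi : D.IsInv σ) :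
    ∃ R' : B.Ob → D.Cell, TransfData.IsInvModification
      ((G.comp (D.tensorRight I)).comp (D.tensorRight I)) (G.comp (D.tensorRight I))
      (((D.arRight G φ).comp r).postcomp (D.tensorRight I)) (D.arRight G b) R' ∧
      ∀ x, D.vcomp (D.hcomp (R' x) (D.two (D.tAr (D.one (G.ob x)) φ)))
        (D.tCell (D.two (D.one (G.ob x))) σ) =
        D.hcomp (D.two (D.tAr (D.one (G.ob x)) (D.tAr φ φ))) (R x) := by
  have q : ∀ K : D.Ob, (G.comp (D.tensorRight K)).comp (D.tensorRight K) =
      G.comp (D.tensorRight (D.tOb K K)) := fun K => by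
    have := tensorLeft_comp_tensorLeft (C := D.rev) K K
    exact congrArg (TwoFunctor.comp G) this
  have pφ := isPseudonatural_arRight (F := G) hφ
  have pφφ := isPseudonatural_arRight (F := G) (φ := D.tAr φ φ) (I := D.tOb I I)
    (J := D.tOb J J) (by grind)
  have pa := isPseudonatural_arRight (F := G) ha
  have pb := isPseudonatural_arRight (F := G) hb
  have pr := hr.postcomp (D.tensorRight J)
  have ps := (isPseudonatural_transport hr hφ).postcomp (D.tensorRight I)
  rw [q] at hR pr ps
  -- Whiskering `R` with `φ ⊗ φ` and correcting by the inverse of `σ` gives what should be `R'`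
  -- whiskered with `φ`. Since `φ` is an equiarrow, `R'` can be extracted from it.
  have m₁ := hR.whisker_left pφφ pr pa
  have m₂ := isInvModification_arRight (F := G) (a := σ) (I := D.tOb I I) (J := J) (by grind) hσ hσi
  have m₂' := m₂.symm (isPseudonatural_arRight (by grind)) (isPseudonatural_arRight (by grind))
  have m₁' := m₁.congr (s' := (((D.arRight G φ).comp r).postcomp (D.tensorRight I)).comp
    (D.arRight G φ)) (t' := D.arRight G (D.comp (D.tAr φ φ) a)) (m' := fun x =>
    D.hcomp (D.two (D.tAr (D.one (G.ob x)) (D.tAr φ φ))) (R x)) (fun _ => rfl) (fun _ => rfl)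
    (fun x => (transport_app hr hφ x).symm) (fun f => (transport_nat hr hφ f).symm)
    (fun x => by grind) (fun f => by
      change D.vcomp (D.hcomp (D.two (D.tAr (G.ar f) (D.tAr φ φ))) (D.two (D.tAr _ a)))
        (D.hcomp (D.two (D.tAr _ (D.tAr φ φ))) (D.two (D.tAr (G.ar f) a))) = D.two (D.tAr _ _)
      rw [D.hcomp_two, D.hcomp_two, D.two_vcomp_of] <;> grind) (fun x => rfl)
  have m₃ := m₁'.trans m₂' (ps.comp pφ) (isPseudonatural_arRight (by grind))
    (isPseudonatural_arRight (by grind))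
  have ex : ∀ x, ∃ c, D.IsCell c ((((D.arRight G φ).comp r).postcomp (D.tensorRight I)).app x)
      ((D.arRight G b).app x) ∧ D.hcomp c (D.two (D.tAr (D.one (G.ob x)) φ)) =
      D.vcomp (D.hcomp (D.two (D.tAr (D.one (G.ob x)) (D.tAr φ φ))) (R x))
        (D.inv (D.tCell (D.two (D.one (G.ob x))) σ)) := fun x => by
    have c := m₃.cell x
    have h₁ := ps.app_ar x
    have h₂ := pb.app_ar x
    have e : (D.arRight G (D.comp b φ)).app x =
        D.comp ((D.arRight G b).app x) (D.tAr (D.one (G.ob x)) φ) := by grind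
    rw [e] at c
    exact (isEqui_tAr (D.isEqui_one _) he).whisker_right_full (h₁.1.trans h₂.1.symm)
      (h₁.2.trans h₂.2.symm) (by rw [h₁.2]; grind) c
  choose R' hR₁ hR₂ using ex
  refine ⟨R', ?_, fun x => ?_⟩
  · rw [q]
    refine TransfData.IsInvModification.of_whisker_right ps pb pφ
      (fun x => isEqui_tAr (D.isEqui_one _) he) hR₁ ?_
    refine m₃.congr (fun _ => rfl) (fun _ => rfl) (fun _ => rfl) (fun _ => rfl)
      (fun x => by grind) (fun f => ?_) (fun x => (hR₂ x).symm)
    change D.two (D.tAr _ _) = D.vcomp (D.hcomp (D.two (D.tAr (G.ar f) b)) (D.two (D.tAr _ φ)))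
        (D.hcomp (D.two (D.tAr _ b)) (D.two (D.tAr (G.ar f) φ)))
    rw [D.hcomp_two, D.hcomp_two, D.two_vcomp_of] <;> grind
  · have c : D.IsCell (D.hcomp (D.two (D.tAr (D.one (G.ob x)) (D.tAr φ φ))) (R x)) _
      (D.tAr (D.one (G.ob x)) (D.comp (D.tAr φ φ) a)) := m₁'.cell x
    have i := m₂.inv x
    have c₂ := m₂.cell x
    rw [hR₂, D.vcomp_assoc, i.inv_spec.2.2.2, D.vcomp_two_of] <;> grind

end Transport

end SMon2Cat

theorem SMonFunctor.tensorRight_comp {C D : SMon2Cat.{u}} (F : SMonFunctor C D) (I : C.Ob) :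
    (C.tensorRight I).comp F.toTwoFunctor = F.toTwoFunctor.comp (D.tensorRight (F.ob I)) := by
  apply TwoFunctor.ext <;> funext x
  · exact F.map_tOb _ _
  · change F.ar (C.tAr x (C.one I)) = D.tAr (F.ar x) (D.one (F.ob I))
    grind
  · change F.cell (C.tCell x (C.two (C.one I))) = D.tCell (F.cell x) (D.two (D.one (F.ob I)))
    grind

theorem SMonFunctor.tensorLeft_comp {C D : SMon2Cat.{u}} (F : SMonFunctor C D) (I : C.Ob) :
    (C.tensorLeft I).comp F.toTwoFunctor = F.toTwoFunctor.comp (D.tensorLeft (F.ob I)) :=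
  F.rev.tensorRight_comp I

/-- Transport preserves the compatibility with `P` that a right cocycle condition expresses. After
whiskering with the equiarrow `X ⊗ Y ⊗ φ` and composing with the invertible `σ`, the equations `e`
and `e'` that determine the transported cells reduce the claim to `q`. -/
theorem SMon2Cat.transport_tensor {D : SMon2Cat.{u}} {X Y I J : D.Ob} {φ a b r s : D.Ar}
    {σ P R R' k k' : D.Cell} (hφ : D.IsAr φ I J) (he : D.IsEqui φ)
    (ha : D.IsAr a (D.tOb J J) J) (hb : D.IsAr b (D.tOb I I) I)
    (hr : D.IsAr r (D.tOb (D.tOb X Y) J) (D.tOb X Y)) (hs : D.IsAr s (D.tOb Y J) Y)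
    (hσ : D.IsCell σ (D.comp b φ) (D.comp (D.tAr φ φ) a)) (hσi : D.IsInv σ)
    (hP : D.IsCell P r (D.tAr (D.one X) s))
    (hR : D.IsCell R (D.tAr (D.comp (D.tAr (D.one Y) φ) s) (D.one I)) (D.tAr (D.one Y) b))
    (hR' : D.IsCell R' (D.tAr (D.comp (D.tAr (D.one (D.tOb X Y)) φ) r) (D.one I))
      (D.tAr (D.one (D.tOb X Y)) b))
    (hk : D.IsCell k (D.tAr s (D.one J)) (D.tAr (D.one Y) a))
    (e : D.vcomp (D.hcomp R (D.two (D.tAr (D.one Y) φ))) (D.tCell (D.two (D.one Y)) σ) =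
      D.hcomp (D.two (D.tAr (D.one Y) (D.tAr φ φ))) k)
    (e' : D.vcomp (D.hcomp R' (D.two (D.tAr (D.one (D.tOb X Y)) φ)))
      (D.tCell (D.two (D.one (D.tOb X Y))) σ) =
      D.hcomp (D.two (D.tAr (D.one (D.tOb X Y)) (D.tAr φ φ))) k')
    (q : D.vcomp (D.tCell P (D.two (D.one J))) (D.tCell (D.two (D.one X)) k) = k') :
    D.vcomp (D.tCell (D.hcomp (D.two (D.tAr (D.one (D.tOb X Y)) φ)) P) (D.two (D.one I)))
      (D.tCell (D.two (D.one X)) R) = R' := by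
  have q₁ : D.comp (D.tAr (D.one (D.tOb X Y)) φ) (D.tAr (D.one X) s) =
      D.tAr (D.one X) (D.comp (D.tAr (D.one Y) φ) s) := by
    rw [← D.tAr_one, D.tAr_assoc, D.tAr_comp] <;> grind
  have c₁ : D.IsCell (D.hcomp (D.two (D.tAr (D.one (D.tOb X Y)) φ)) P)
      (D.comp (D.tAr (D.one (D.tOb X Y)) φ) r)
      (D.tAr (D.one X) (D.comp (D.tAr (D.one Y) φ) s)) := by grind
  have c₂ : D.IsCell (D.tCell (D.two (D.one X)) R)
      (D.tAr (D.tAr (D.one X) (D.comp (D.tAr (D.one Y) φ) s)) (D.one I))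
      (D.tAr (D.one (D.tOb X Y)) b) := by grind
  have c₃ : D.IsCell (D.tCell (D.hcomp (D.two (D.tAr (D.one (D.tOb X Y)) φ)) P) (D.two (D.one I)))
      (D.tAr (D.comp (D.tAr (D.one (D.tOb X Y)) φ) r) (D.one I))
      (D.tAr (D.tAr (D.one X) (D.comp (D.tAr (D.one Y) φ) s)) (D.one I)) := by grind
  have t₁ : D.hcomp (D.tCell (D.hcomp (D.two (D.tAr (D.one (D.tOb X Y)) φ)) P) (D.two (D.one I)))
      (D.two (D.tAr (D.one (D.tOb X Y)) φ)) =
      D.hcomp (D.two (D.tAr (D.one (D.tOb X Y)) (D.tAr φ φ))) (D.tCell P (D.two (D.one J))) := by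
    trans D.tCell (D.hcomp (D.two (D.tAr (D.one (D.tOb X Y)) φ)) P) (D.two φ)
    · rw [← D.tCell_two _ φ, D.tCell_hcomp, D.hcomp_one_of] <;> grind
    · rw [← D.tAr_assoc, ← D.tCell_two (D.tAr (D.one (D.tOb X Y)) φ) φ, D.tCell_hcomp] <;> grind
  have t₂ : D.hcomp (D.tCell (D.two (D.one X)) R) (D.two (D.tAr (D.one (D.tOb X Y)) φ)) =
      D.tCell (D.two (D.one X)) (D.hcomp R (D.two (D.tAr (D.one Y) φ))) := by
    rw [← D.tAr_one, D.tAr_assoc, ← D.tCell_two (D.one X), D.tCell_hcomp] <;> grind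
  have t₃ : D.tCell (D.two (D.one X)) (D.hcomp (D.two (D.tAr (D.one Y) (D.tAr φ φ))) k) =
      D.hcomp (D.two (D.tAr (D.one (D.tOb X Y)) (D.tAr φ φ))) (D.tCell (D.two (D.one X)) k) := by
    rw [← D.tAr_one, D.tAr_assoc, ← D.tCell_two (D.one X), D.tCell_hcomp] <;> grind
  have t₄ : D.tCell (D.two (D.one (D.tOb X Y))) σ =
      D.tCell (D.two (D.one X)) (D.tCell (D.two (D.one Y)) σ) := by
    rw [← D.tCell_assoc, D.tCell_two, D.tAr_one]
  have hi : D.IsInv (D.tCell (D.two (D.one (D.tOb X Y))) σ) := isInv_tCell (D.isInv_two _) hσi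
  have q₂ : D.comp (D.tAr (D.one (D.tOb X Y)) b) (D.tAr (D.one (D.tOb X Y)) φ) =
      D.tAr (D.one (D.tOb X Y)) (D.comp b φ) := by
    rw [D.tAr_comp] <;> grind
  refine (isEqui_tAr (D.isEqui_one (D.tOb X Y)) he).whisker_right_cancel (by grind) (by grind)
    (by grind) ?_
  refine hi.cancel_right (by grind) (by grind) ?_
  rw [e', D.vcomp_hcomp_two (by grind) (by grind), D.vcomp_assoc _ _ _ (by grind) (by grind), t₄,
    t₂, D.tCell_vcomp (by grind) (by grind), e, D.two_vcomp_of (by grind), t₃, t₁,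
    ← D.two_hcomp_vcomp (by grind) (by grind), q]

/-! ### Extending an equiarrow compatible with `λ_I` to a comparison of weak units -/

/-- An equiarrow `φ : I' ⟶ F I` with `σ : λ'_{I'} ; φ ≅ (φ ⊗ φ) ; F λ_I`, and the invertible
modification `δ` that it determines. -/
structure IsRightComparison {C D : SMon2Cat.{u}} (F : SMonFunctor C D) (W : WeakUnit C)
    (V : WeakUnit D) (φ : D.Ar) (σ : D.Cell) (δ R : C.Ob → D.Cell) : Prop where
  φ_ar : D.IsAr φ V.I (F.ob W.I)
  φ_equi : D.IsEqui φ
  σ_cell : D.IsCell σ (D.comp (V.lam.app V.I) φ) (D.comp (D.tAr φ φ) (F.ar (W.lam.app W.I)))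
  σ_inv : D.IsInv σ
  δ_mod : TransfData.IsInvModification
    (F.toTwoFunctor.comp (D.tensorRight V.I)) F.toTwoFunctor
    (V.rho.precomp F.toTwoFunctor)
    ((D.arRight F.toTwoFunctor φ).comp (W.rho.postcomp F.toTwoFunctor)) δ
  δ_cell : ∀ x, D.IsCell (δ x) (V.rho.app (F.ob x))
    (D.comp (D.tAr (D.one (F.ob x)) φ) (F.ar (W.rho.app x)))
  R_cell : ∀ x, D.IsCell (R x) (D.tAr (D.comp (D.tAr (D.one (F.ob x)) φ) (F.ar (W.rho.app x)))
    (D.one V.I)) (D.tAr (D.one (F.ob x)) (V.lam.app V.I))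
  R_inv : ∀ x, D.IsInv (R x)
  R_eq : ∀ x, D.vcomp (D.hcomp (R x) (D.two (D.tAr (D.one (F.ob x)) φ)))
    (D.tCell (D.two (D.one (F.ob x))) σ) =
    D.hcomp (D.two (D.tAr (D.one (F.ob x)) (D.tAr φ φ))) (F.cell (W.K (x, W.I)))
  δ_eq : ∀ x, D.vcomp (D.tCell (δ x) (D.two (D.one V.I))) (R x) = V.K (F.ob x, V.I)

namespace IsRightComparison

variable {C D : SMon2Cat.{u}} {F : SMonFunctor C D} {W : WeakUnit C} {V : WeakUnit D}
  {φ : D.Ar} {σ : D.Cell} {δ R : C.Ob → D.Cell}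

theorem isPseudonatural_rho (F : SMonFunctor C D) (W : WeakUnit C) :
    (W.rho.postcomp F.toTwoFunctor).IsPseudonatural
      (F.toTwoFunctor.comp (D.tensorRight (F.ob W.I))) F.toTwoFunctor := by
  rw [← F.tensorRight_comp]
  exact W.rho_nat.postcomp F.toTwoFunctor

/-- The right constraint of `W`, taken to `D` by `F` and transported along `φ` and `σ`, becomes one
for the unit of `V`, with `R` as its modification. Both this constraint and `ρ'` restricted along
`F` are then lifts of `F - ⊗ λ'_{I'}` along `- ⊗ I'`, and `δ` is their unique comparison. -/
theorem exists_of_iso (hφ : D.IsAr φ V.I (F.ob W.I)) (he : D.IsEqui φ)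
    (hσ : D.IsCell σ (D.comp (V.lam.app V.I) φ) (D.comp (D.tAr φ φ) (F.ar (W.lam.app W.I))))
    (hσi : D.IsInv σ) : ∃ δ R, IsRightComparison F W V φ σ δ R := by
  have q : (F.toTwoFunctor.comp (D.tensorRight V.I)).comp (D.tensorRight V.I) =
      F.toTwoFunctor.comp (D.tensorRight (D.tOb V.I V.I)) := by
    have := SMon2Cat.tensorLeft_comp_tensorLeft (C := D.rev) V.I V.I
    exact congrArg (TwoFunctor.comp F.toTwoFunctor) this
  have hr := isPseudonatural_rho F W
  have wl := W.lam_ar W.I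
  have vl := V.lam_ar V.I
  have hα : (C.arRight (TwoFunctor.id _) (W.lam.app W.I)).IsPseudonatural
      ((C.tensorRight W.I).comp (C.tensorRight W.I)) (C.tensorRight W.I) :=
    SMon2Cat.isPseudonatural_arLeft_id (C := C.rev) wl
  have m := W.isRightConstraint.modification.postcomp (W.rho_nat.postcomp _) hα F.toTwoFunctor
  have m' : TransfData.IsInvModification ((F.toTwoFunctor.comp (D.tensorRight (F.ob W.I))).comp
      (D.tensorRight (F.ob W.I))) (F.toTwoFunctor.comp (D.tensorRight (F.ob W.I)))
      ((W.rho.postcomp F.toTwoFunctor).postcomp (D.tensorRight (F.ob W.I)))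
      (D.arRight F.toTwoFunctor (F.ar (W.lam.app W.I))) (fun x => F.cell (W.K (x, W.I))) := by
    refine m.congr (fun f => ?_) (fun f => ?_) (fun x => ?_) (fun f => ?_) (fun x => ?_)
      (fun f => ?_) (fun _ => rfl)
    · change F.ar (C.tAr (C.tAr f (C.one W.I)) (C.one W.I)) =
        D.tAr (D.tAr (F.ar f) (D.one (F.ob W.I))) (D.one (F.ob W.I))
      grind
    · change F.ar (C.tAr f (C.one W.I)) = D.tAr (F.ar f) (D.one (F.ob W.I))
      grind
    · change F.ar (C.tAr (W.rho.app x) (C.one W.I)) = D.tAr (F.ar (W.rho.app x)) (D.one (F.ob W.I))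
      grind
    · change F.cell (C.tCell (W.rho.nat f) (C.two (C.one W.I))) =
        D.tCell (F.cell (W.rho.nat f)) (D.two (D.one (F.ob W.I)))
      grind
    · change F.ar (C.tAr (C.one x) (W.lam.app W.I)) = D.tAr (D.one (F.ob x)) (F.ar (W.lam.app W.I))
      grind
    · change F.cell (C.two (C.tAr f (W.lam.app W.I))) = D.two (D.tAr (F.ar f) (F.ar (W.lam.app W.I)))
      grind
  obtain ⟨R, hR, hR'⟩ := SMon2Cat.exists_transport hr m' (by grind) vl hφ he hσ hσi
  have pt : (D.arRight F.toTwoFunctor (V.lam.app V.I)).IsPseudonatural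
      ((F.toTwoFunctor.comp (D.tensorRight V.I)).comp (D.tensorRight V.I))
      (F.toTwoFunctor.comp (D.tensorRight V.I)) := by
    rw [q]
    exact SMon2Cat.isPseudonatural_arRight vl
  obtain ⟨δ, ⟨hδ, hδ'⟩, -⟩ := TransfData.existsUnique_modification V.isEqui2_tensorRight pt
    (V.rho_nat.precomp F.toTwoFunctor) (SMon2Cat.isPseudonatural_transport hr hφ)
    (V.isRightConstraint.modification.precomp F.toTwoFunctor) hR
  exact ⟨δ, R, hφ, he, hσ, hσi, hδ, hδ.cell, hR.cell, hR.inv, hR', hδ'⟩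

theorem R_tensor (h : IsRightComparison F W V φ σ δ R) {x y : C.Ob} {P : C.Cell}
    (hP : C.IsCell P (W.rho.app (C.tOb x y)) (C.tAr (C.one x) (W.rho.app y)))
    (e : C.vcomp (C.tCell P (C.two (C.one W.I))) (C.tCell (C.two (C.one x)) (W.K (y, W.I))) =
      W.K (C.tOb x y, W.I)) :
    D.vcomp (D.tCell (D.hcomp (D.two (D.tAr (D.one (D.tOb (F.ob x) (F.ob y))) φ)) (F.cell P))
      (D.two (D.one V.I))) (D.tCell (D.two (D.one (F.ob x))) (R y)) = R (C.tOb x y) := by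
  have wr := W.rho_ar (C.tOb x y)
  have wr' := W.rho_ar y
  have wl := W.lam_ar W.I
  have k := W.K_cell y W.I
  have c₁ := h.R_cell (C.tOb x y)
  have q₁ := h.R_eq (C.tOb x y)
  rw [F.map_tOb] at c₁ q₁
  refine SMon2Cat.transport_tensor h.φ_ar h.φ_equi (a := F.ar (W.lam.app W.I)) (by grind)
    (V.lam_ar V.I) (r := F.ar (W.rho.app (C.tOb x y))) (s := F.ar (W.rho.app y)) (by grind)
    (by grind) h.σ_cell h.σ_inv (by grind) (h.R_cell y) c₁ (k := F.cell (W.K (y, W.I)))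
    (by grind) (h.R_eq y) q₁ ?_
  rw [← e, F.map_vcomp _ _ (by grind)]
  grind

/-- The compatibility of `δ` with `P` and `P'`. -/
theorem δ_tensor (h : IsRightComparison F W V φ σ δ R) {x y : C.Ob} {P : C.Cell} {P' : D.Cell}
    (hP : C.IsCell P (W.rho.app (C.tOb x y)) (C.tAr (C.one x) (W.rho.app y)))
    (e : C.vcomp (C.tCell P (C.two (C.one W.I))) (C.tCell (C.two (C.one x)) (W.K (y, W.I))) =
      W.K (C.tOb x y, W.I))
    (hP' : D.IsCell P' (V.rho.app (D.tOb (F.ob x) (F.ob y)))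
      (D.tAr (D.one (F.ob x)) (V.rho.app (F.ob y))))
    (e' : D.vcomp (D.tCell P' (D.two (D.one V.I)))
      (D.tCell (D.two (D.one (F.ob x))) (V.K (F.ob y, V.I))) =
      V.K (D.tOb (F.ob x) (F.ob y), V.I)) :
    D.vcomp (δ (C.tOb x y))
      (D.hcomp (D.two (D.tAr (D.one (D.tOb (F.ob x) (F.ob y))) φ)) (F.cell P)) =
    D.vcomp P' (D.tCell (D.two (D.one (F.ob x))) (δ y)) := by
  have wr := W.rho_ar (C.tOb x y)
  have wr' := W.rho_ar y
  have vr := V.rho_ar (F.ob (C.tOb x y))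
  have vr' := V.rho_ar (F.ob y)
  have hφ := h.φ_ar
  have c₁ := h.δ_cell (C.tOb x y)
  have c₂ := h.δ_cell y
  have c₃ := h.R_cell y
  have q₁ := h.R_tensor hP e
  have q₂ := h.δ_eq (C.tOb x y)
  have q₃ := h.δ_eq y
  have hi : D.IsInv (D.tCell (D.two (D.one (F.ob x))) (R y)) :=
    SMon2Cat.isInv_tCell (D.isInv_two _) (h.R_inv y)
  rw [F.map_tOb] at vr c₁ q₂
  have q : D.comp (D.tAr (D.one (D.tOb (F.ob x) (F.ob y))) φ)
      (D.tAr (D.one (F.ob x)) (F.ar (W.rho.app y))) =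
      D.tAr (D.one (F.ob x)) (D.comp (D.tAr (D.one (F.ob y)) φ) (F.ar (W.rho.app y))) := by
    rw [← D.tAr_one, D.tAr_assoc, D.tAr_comp] <;> grind
  have c₄ : D.IsCell (D.hcomp (D.two (D.tAr (D.one (D.tOb (F.ob x) (F.ob y))) φ)) (F.cell P))
      (D.comp (D.tAr (D.one (D.tOb (F.ob x) (F.ob y))) φ) (F.ar (W.rho.app (C.tOb x y))))
      (D.tAr (D.one (F.ob x)) (D.comp (D.tAr (D.one (F.ob y)) φ) (F.ar (W.rho.app y)))) := by
    grind
  -- After `- ⊗ I'` and composition with `R`, each `δ` combines with `R` to a value of `K'`. The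
  -- equation becomes the right cocycle condition `e'`.
  refine V.isEqui2_tensorRight.cell_ext (by grind) (by grind) ?_
  rw [SMon2Cat.tensorRight_cell, SMon2Cat.tensorRight_cell]
  refine hi.cancel_right (by grind) (by grind) ?_
  generalize D.hcomp (D.two (D.tAr (D.one (D.tOb (F.ob x) (F.ob y))) φ)) (F.cell P) = c at *
  have s : ∀ a b : D.Cell, D.cod a = D.dom b → D.tCell (D.vcomp a b) (D.two (D.one V.I)) =
      D.vcomp (D.tCell a (D.two (D.one V.I))) (D.tCell b (D.two (D.one V.I))) := fun a b hab => by
    rw [D.tCell_vcomp, D.two_vcomp_of] <;> grind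
  rw [s _ _ (by grind), s _ _ (by grind), D.vcomp_assoc _ _ _ (by grind) (by grind), q₁, q₂,
    D.vcomp_assoc _ _ _ (by grind) (by grind), D.tCell_assoc, D.tCell_vcomp (by grind) (by grind),
    q₃, D.two_vcomp_of (by grind), e']

end IsRightComparison

namespace IsRightComparison

variable {C D : SMon2Cat.{u}} {F : SMonFunctor C D} {W : WeakUnit C} {V : WeakUnit D}
  {φ : D.Ar} {σ : D.Cell} {δ R : C.Ob → D.Cell}

/-- The 2-cell `F X ⊗ λ'_{F Y} ⇒ F X ⊗ ((φ ⊗ F Y) ; F λ_Y)` that compares `K'` with `K`. -/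
noncomputable def compare (F : SMonFunctor C D) (W : WeakUnit C) (V : WeakUnit D) (φ : D.Ar)
    (δ : C.Ob → D.Cell) (x y : C.Ob) : D.Cell :=
  D.vcomp (D.inv (V.K (F.ob x, F.ob y))) (D.vcomp (D.tCell (δ x) (D.two (D.one (F.ob y))))
    (D.hcomp (D.two (D.tAr (D.tAr (D.one (F.ob x)) φ) (D.one (F.ob y)))) (F.cell (W.K (x, y)))))

theorem isPseudonatural_lam (F : SMonFunctor C D) (W : WeakUnit C) :
    (W.lam.postcomp F.toTwoFunctor).IsPseudonatural
      (F.toTwoFunctor.comp (D.tensorLeft (F.ob W.I))) F.toTwoFunctor := by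
  rw [← F.tensorLeft_comp]
  exact W.lam_nat.postcomp F.toTwoFunctor

theorem isPseudonatural_left (hφ : D.IsAr φ V.I (F.ob W.I)) :
    ((D.arLeft φ F.toTwoFunctor).comp (W.lam.postcomp F.toTwoFunctor)).IsPseudonatural
      (F.toTwoFunctor.comp (D.tensorLeft V.I)) F.toTwoFunctor :=
  (SMon2Cat.isPseudonatural_arLeft hφ).comp (isPseudonatural_lam F W)

theorem isPseudonatural_right (hφ : D.IsAr φ V.I (F.ob W.I)) :
    ((D.arRight F.toTwoFunctor φ).comp (W.rho.postcomp F.toTwoFunctor)).IsPseudonatural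
      (F.toTwoFunctor.comp (D.tensorRight V.I)) F.toTwoFunctor :=
  SMon2Cat.isPseudonatural_transport (isPseudonatural_rho F W) hφ

theorem tensor_arRight_comp_rho (hφ : D.IsAr φ V.I (F.ob W.I)) (f g : C.Ar) :
    ((D.tensorTransf (D.arRight F.toTwoFunctor φ) (TransfData.ident F.toTwoFunctor)).comp
      ((C.tensorTransf W.rho (TransfData.ident (TwoFunctor.id _))).postcomp F.toTwoFunctor)).nat
      (f, g) =
    (D.tensorTransf ((D.arRight F.toTwoFunctor φ).comp (W.rho.postcomp F.toTwoFunctor))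
      (TransfData.ident F.toTwoFunctor)).nat (f, g) := by
  change D.vcomp (D.hcomp (D.tCell (D.two (D.tAr (F.ar f) φ)) (D.two (F.ar g)))
      (D.two (F.ar (C.tAr (W.rho.app (C.tgt f)) (C.one (C.tgt g))))))
    (D.hcomp (D.two (D.tAr (D.tAr (D.one (F.ob (C.src f))) φ) (D.one (F.ob (C.src g)))))
      (F.cell (C.tCell (W.rho.nat f) (C.two g)))) =
    D.tCell (D.vcomp (D.hcomp (D.two (D.tAr (F.ar f) φ)) (D.two (F.ar (W.rho.app (C.tgt f)))))
      (D.hcomp (D.two (D.tAr (D.one (F.ob (C.src f))) φ)) (F.cell (W.rho.nat f)))) (D.two (F.ar g))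
  have h₁ := W.rho_ar (C.src f)
  have h₂ := W.rho_ar (C.tgt f)
  have n : C.IsCell (W.rho.nat f) (C.comp (C.tAr f (C.one W.I)) (W.rho.app (C.tgt f)))
    (C.comp (W.rho.app (C.src f)) f) := W.rho_nat.nat_cell f
  have q : D.comp (D.tAr (D.one (F.ob (C.src f))) φ)
      (F.ar (C.comp (C.tAr f (C.one W.I)) (W.rho.app (C.tgt f)))) =
      D.comp (D.tAr (F.ar f) φ) (F.ar (W.rho.app (C.tgt f))) := by
    rw [F.map_comp, ← D.comp_assoc, F.map_tAr, D.tAr_comp] <;> grind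
  have e : D.hcomp (D.two (D.tAr (D.tAr (D.one (F.ob (C.src f))) φ) (D.one (F.ob (C.src g)))))
      (F.cell (C.tCell (W.rho.nat f) (C.two g))) =
      D.tCell (D.hcomp (D.two (D.tAr (D.one (F.ob (C.src f))) φ)) (F.cell (W.rho.nat f)))
        (D.two (F.ar g)) := by
    rw [F.map_tCell, F.map_two, ← D.tCell_two _ (D.one (F.ob (C.src g))), D.tCell_hcomp,
      D.one_hcomp_of] <;> grind
  have e' : D.hcomp (D.tCell (D.two (D.tAr (F.ar f) φ)) (D.two (F.ar g)))
      (D.two (F.ar (C.tAr (W.rho.app (C.tgt f)) (C.one (C.tgt g))))) =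
      D.tCell (D.hcomp (D.two (D.tAr (F.ar f) φ)) (D.two (F.ar (W.rho.app (C.tgt f)))))
        (D.two (F.ar g)) := by
    rw [F.map_tAr, F.map_one, ← D.tCell_two _ (D.one (F.ob (C.tgt g))), D.tCell_hcomp,
      D.hcomp_one_of] <;> grind
  have d : D.dom (D.hcomp (D.two (D.tAr (D.one (F.ob (C.src f))) φ)) (F.cell (W.rho.nat f))) =
      D.comp (D.tAr (F.ar f) φ) (F.ar (W.rho.app (C.tgt f))) := by
    rw [D.dom_hcomp, D.dom_two, F.map_dom, n.1, q] <;> grind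
  clear q n
  rw [e, e', D.tCell_vcomp, D.two_vcomp_of] <;> grind

theorem tensor_arRight_comp_lam (hφ : D.IsAr φ V.I (F.ob W.I)) (f g : C.Ar) :
    ((D.tensorTransf (D.arRight F.toTwoFunctor φ) (TransfData.ident F.toTwoFunctor)).comp
      ((C.tensorTransf (TransfData.ident (TwoFunctor.id _)) W.lam).postcomp F.toTwoFunctor)).nat
      (f, g) =
    (D.tensorTransf (TransfData.ident F.toTwoFunctor)
      ((D.arLeft φ F.toTwoFunctor).comp (W.lam.postcomp F.toTwoFunctor))).nat (f, g) := by
  change D.vcomp (D.hcomp (D.tCell (D.two (D.tAr (F.ar f) φ)) (D.two (F.ar g)))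
      (D.two (F.ar (C.tAr (C.one (C.tgt f)) (W.lam.app (C.tgt g))))))
    (D.hcomp (D.two (D.tAr (D.tAr (D.one (F.ob (C.src f))) φ) (D.one (F.ob (C.src g)))))
      (F.cell (C.tCell (C.two f) (W.lam.nat g)))) =
    D.tCell (D.two (F.ar f)) (D.vcomp (D.hcomp (D.two (D.tAr φ (F.ar g)))
      (D.two (F.ar (W.lam.app (C.tgt g)))))
      (D.hcomp (D.two (D.tAr φ (D.one (F.ob (C.src g))))) (F.cell (W.lam.nat g))))
  have h₁ := W.lam_ar (C.src g)
  have h₂ := W.lam_ar (C.tgt g)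
  have n : C.IsCell (W.lam.nat g) (C.comp (C.tAr (C.one W.I) g) (W.lam.app (C.tgt g)))
    (C.comp (W.lam.app (C.src g)) g) := W.lam_nat.nat_cell g
  have q : D.comp (D.tAr φ (D.one (F.ob (C.src g))))
      (F.ar (C.comp (C.tAr (C.one W.I) g) (W.lam.app (C.tgt g)))) =
      D.comp (D.tAr φ (F.ar g)) (F.ar (W.lam.app (C.tgt g))) := by
    rw [F.map_comp, ← D.comp_assoc, F.map_tAr, D.tAr_comp] <;> grind
  have e : D.hcomp (D.two (D.tAr (D.tAr (D.one (F.ob (C.src f))) φ) (D.one (F.ob (C.src g)))))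
      (F.cell (C.tCell (C.two f) (W.lam.nat g))) =
      D.tCell (D.two (F.ar f))
        (D.hcomp (D.two (D.tAr φ (D.one (F.ob (C.src g))))) (F.cell (W.lam.nat g))) := by
    rw [F.map_tCell, F.map_two, D.tAr_assoc, ← D.tCell_two (D.one (F.ob (C.src f))), D.tCell_hcomp,
      D.one_hcomp_of] <;> grind
  have e' : D.hcomp (D.tCell (D.two (D.tAr (F.ar f) φ)) (D.two (F.ar g)))
      (D.two (F.ar (C.tAr (C.one (C.tgt f)) (W.lam.app (C.tgt g))))) =
      D.tCell (D.two (F.ar f))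
        (D.hcomp (D.two (D.tAr φ (F.ar g))) (D.two (F.ar (W.lam.app (C.tgt g))))) := by
    rw [F.map_tAr, F.map_one, D.tCell_two, D.tAr_assoc, ← D.tCell_two (F.ar f),
      ← D.tCell_two (D.one (F.ob (C.tgt f))), D.tCell_hcomp, D.hcomp_one_of] <;> grind
  have d : D.dom (D.hcomp (D.two (D.tAr φ (D.one (F.ob (C.src g))))) (F.cell (W.lam.nat g))) =
      D.comp (D.tAr φ (F.ar g)) (F.ar (W.lam.app (C.tgt g))) := by
    rw [D.dom_hcomp, D.dom_two, F.map_dom, n.1, q] <;> grind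
  clear q n
  rw [e, e', D.tCell_vcomp, D.two_vcomp_of] <;> grind

theorem isInvModification_compare (h : IsRightComparison F W V φ σ δ R) :
    TransfData.IsInvModification
      (((F.toTwoFunctor.comp (D.tensorRight V.I)).prodMap F.toTwoFunctor).comp D.tensor)
      ((F.toTwoFunctor.prodMap F.toTwoFunctor).comp D.tensor)
      (D.tensorTransf (TransfData.ident F.toTwoFunctor) (V.lam.precomp F.toTwoFunctor))
      (D.tensorTransf (TransfData.ident F.toTwoFunctor)
        ((D.arLeft φ F.toTwoFunctor).comp (W.lam.postcomp F.toTwoFunctor)))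
      (fun x => compare F W V φ δ x.1 x.2) := by
  have hφ := h.φ_ar
  have hid := SMon2Cat.isPseudonatural_ident F.toTwoFunctor
  have hid' := SMon2Cat.isPseudonatural_ident (TwoFunctor.id C.toTwoCat)
  have pr := SMon2Cat.isPseudonatural_tensorTransf (V.rho_nat.precomp F.toTwoFunctor) hid
  have qr := SMon2Cat.isPseudonatural_tensorTransf (isPseudonatural_right hφ) hid
  have pl := SMon2Cat.isPseudonatural_tensorTransf hid (V.lam_nat.precomp F.toTwoFunctor)
  have ql := SMon2Cat.isPseudonatural_tensorTransf hid (isPseudonatural_left (V := V) hφ)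
  have E : (F.toTwoFunctor.prodMap (F.toTwoFunctor.comp (D.tensorLeft V.I))).comp D.tensor =
      ((F.toTwoFunctor.comp (D.tensorRight V.I)).prodMap F.toTwoFunctor).comp D.tensor := by
    apply TwoFunctor.ext <;> funext x
    · exact (D.assoc_ob _ _ _).symm
    · exact (D.assoc_ar _ _ _).symm
    · exact (D.assoc_cell _ _ _).symm
  have m₁ := V.K_mod.precomp (F.toTwoFunctor.prodMap F.toTwoFunctor)
  have m₂ := SMon2Cat.isInvModification_tensor h.δ_mod (SMon2Cat.isInvModification_refl hid)
    (V.rho_nat.precomp F.toTwoFunctor) hid (isPseudonatural_right hφ) hid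
  have wr := SMon2Cat.isPseudonatural_tensorTransf W.rho_nat hid'
  have wl := SMon2Cat.isPseudonatural_tensorTransf hid' W.lam_nat
  rw [SMon2Cat.prodMap_tensorLeft_id] at wl
  have m₃ := W.K_mod.postcomp wr wl F.toTwoFunctor
  rw [E] at pl ql
  have E' : (((C.tensorRight W.I).prodMap (TwoFunctor.id C.toTwoCat)).comp C.tensor).comp
      F.toTwoFunctor =
      ((F.toTwoFunctor.comp (D.tensorRight (F.ob W.I))).prodMap F.toTwoFunctor).comp D.tensor := by
    apply TwoFunctor.ext <;> funext x
    · change F.ob (C.tOb (C.tOb x.1 W.I) x.2) = D.tOb (D.tOb (F.ob x.1) (F.ob W.I)) (F.ob x.2)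
      rw [F.map_tOb, F.map_tOb]
    · change F.ar (C.tAr (C.tAr x.1 (C.one W.I)) x.2) =
        D.tAr (D.tAr (F.ar x.1) (D.one (F.ob W.I))) (F.ar x.2)
      rw [F.map_tAr, F.map_tAr, F.map_one]
    · change F.cell (C.tCell (C.tCell x.1 (C.two (C.one W.I))) x.2) =
        D.tCell (D.tCell (F.cell x.1) (D.two (D.one (F.ob W.I)))) (F.cell x.2)
      rw [F.map_tCell, F.map_tCell, F.map_two, F.map_one]
  have E'' : C.tensor.comp F.toTwoFunctor =
      (F.toTwoFunctor.prodMap F.toTwoFunctor).comp D.tensor := by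
    apply TwoFunctor.ext <;> funext x
    · exact F.map_tOb _ _
    · exact F.map_tAr _ _
    · exact F.map_tCell _ _
  have wr' := wr.postcomp F.toTwoFunctor
  have wl' := wl.postcomp F.toTwoFunctor
  change TransfData.IsPseudonatural _ (C.tensor.comp F.toTwoFunctor) _ at wr' wl'
  rw [E', E''] at m₃ wr' wl'
  have pφ := SMon2Cat.isPseudonatural_tensorTransf
    (SMon2Cat.isPseudonatural_arRight (F := F.toTwoFunctor) hφ) hid
  have m₄ := (m₃.whisker_left pφ wr' wl').congr (fun _ => rfl) (fun _ => rfl)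
    (s' := D.tensorTransf ((D.arRight F.toTwoFunctor φ).comp (W.rho.postcomp F.toTwoFunctor))
      (TransfData.ident F.toTwoFunctor))
    (t' := D.tensorTransf (TransfData.ident F.toTwoFunctor)
        ((D.arLeft φ F.toTwoFunctor).comp (W.lam.postcomp F.toTwoFunctor)))
    (m' := fun x => D.hcomp (D.two (D.tAr (D.tAr (D.one (F.ob x.1)) φ) (D.one (F.ob x.2))))
      (F.cell (W.K x)))
    (fun x => by
      have := W.rho_ar x.1
      change D.comp (D.tAr (D.tAr (D.one (F.ob x.1)) φ) (D.one (F.ob x.2)))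
        (F.ar (C.tAr (W.rho.app x.1) (C.one x.2))) = D.tAr (D.comp (D.tAr (D.one (F.ob x.1)) φ)
          (F.ar (W.rho.app x.1))) (D.one (F.ob x.2))
      rw [F.map_tAr, D.tAr_comp] <;> grind)
    (fun x => tensor_arRight_comp_rho hφ x.1 x.2) (fun x => by
      have := W.lam_ar x.2
      change D.comp (D.tAr (D.tAr (D.one (F.ob x.1)) φ) (D.one (F.ob x.2)))
        (F.ar (C.tAr (C.one x.1) (W.lam.app x.2))) = D.tAr (D.one (F.ob x.1))
          (D.comp (D.tAr φ (D.one (F.ob x.2))) (F.ar (W.lam.app x.2)))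
      rw [F.map_tAr, D.tAr_assoc, D.tAr_comp] <;> grind)
    (fun x => tensor_arRight_comp_lam hφ x.1 x.2) (fun _ => rfl)
  exact (m₁.symm pr pl).trans (m₂.trans m₄ pr qr ql) pl pr ql

theorem compare_cell (h : IsRightComparison F W V φ σ δ R) (x y : C.Ob) :
    D.IsCell (compare F W V φ δ x y) (D.tAr (D.one (F.ob x)) (V.lam.app (F.ob y)))
      (D.tAr (D.one (F.ob x)) (D.comp (D.tAr φ (D.one (F.ob y))) (F.ar (W.lam.app y)))) :=
  h.isInvModification_compare.cell (x, y)

theorem K_vcomp_compare (h : IsRightComparison F W V φ σ δ R) (x y : C.Ob) :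
    D.vcomp (V.K (F.ob x, F.ob y)) (compare F W V φ δ x y) =
      D.vcomp (D.tCell (δ x) (D.two (D.one (F.ob y)))) (D.hcomp (D.two (D.tAr (D.tAr
        (D.one (F.ob x)) φ) (D.one (F.ob y)))) (F.cell (W.K (x, y)))) := by
  have k := V.K_cell (F.ob x) (F.ob y)
  have ki := V.K_mod.inv (F.ob x, F.ob y)
  have k' := W.K_cell x y
  have c := h.δ_cell x
  have hφ := h.φ_ar
  have r := W.rho_ar x
  have q : D.comp (D.tAr (D.tAr (D.one (F.ob x)) φ) (D.one (F.ob y)))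
      (D.tAr (F.ar (W.rho.app x)) (D.one (F.ob y))) =
      D.tAr (D.comp (D.tAr (D.one (F.ob x)) φ) (F.ar (W.rho.app x))) (D.one (F.ob y)) := by
    rw [D.tAr_comp] <;> grind
  have d : D.dom (D.hcomp (D.two (D.tAr (D.tAr (D.one (F.ob x)) φ) (D.one (F.ob y))))
      (F.cell (W.K (x, y)))) =
      D.tAr (D.comp (D.tAr (D.one (F.ob x)) φ) (F.ar (W.rho.app x))) (D.one (F.ob y)) := by
    rw [D.dom_hcomp, D.dom_two, F.map_dom, k'.1, F.map_tAr, F.map_one, q] <;> grind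
  rw [compare, TwoCat.vcomp_inv_cancel ki]
  grind

/-- The computation behind `compare_tensor`, with the cells as variables. The right cocycle
conditions `e₄` and `e₅` express the cells at `X ⊗ Y` by those at `Y`, and `e₃` moves `P` past `δ`.
The invertible `k₁'` is cancelled. -/
theorem compare_tensor_aux {X Y Z I J : D.Ob} {φ r r' s s' l l' : D.Ar}
    {P P' d₁ d₂ k₁ k₂ k₁' k₂' E₁ E₂ : D.Cell} (hφ : D.IsAr φ I J)
    (hr : D.IsAr r (D.tOb (D.tOb X Y) J) (D.tOb X Y)) (hs : D.IsAr s (D.tOb Y J) Y)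
    (hP : D.IsCell P r (D.tAr (D.one X) s)) (hP' : D.IsCell P' r' (D.tAr (D.one X) s'))
    (hd₁ : D.IsCell d₁ r' (D.comp (D.tAr (D.one (D.tOb X Y)) φ) r))
    (hd₂ : D.IsCell d₂ s' (D.comp (D.tAr (D.one Y) φ) s))
    (hk₁' : D.IsCell k₁' (D.tAr r' (D.one Z)) (D.tAr (D.one (D.tOb X Y)) l'))
    (hk₂ : D.IsCell k₂ (D.tAr s (D.one Z)) (D.tAr (D.one Y) l))
    (hk₂' : D.IsCell k₂' (D.tAr s' (D.one Z)) (D.tAr (D.one Y) l'))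
    (hi : D.IsInv k₁') (hE₁ : D.IsCell E₁ (D.tAr (D.one (D.tOb X Y)) l')
      (D.tAr (D.one (D.tOb X Y)) (D.comp (D.tAr φ (D.one Z)) l)))
    (hE₂ : D.IsCell E₂ (D.tAr (D.one Y) l') (D.tAr (D.one Y) (D.comp (D.tAr φ (D.one Z)) l)))
    (e₁ : D.vcomp k₁' E₁ = D.vcomp (D.tCell d₁ (D.two (D.one Z)))
      (D.hcomp (D.two (D.tAr (D.tAr (D.one (D.tOb X Y)) φ) (D.one Z))) k₁))
    (e₂ : D.vcomp k₂' E₂ = D.vcomp (D.tCell d₂ (D.two (D.one Z)))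
      (D.hcomp (D.two (D.tAr (D.tAr (D.one Y) φ) (D.one Z))) k₂))
    (e₃ : D.vcomp d₁ (D.hcomp (D.two (D.tAr (D.one (D.tOb X Y)) φ)) P) =
      D.vcomp P' (D.tCell (D.two (D.one X)) d₂))
    (e₄ : D.vcomp (D.tCell P' (D.two (D.one Z))) (D.tCell (D.two (D.one X)) k₂') = k₁')
    (e₅ : D.vcomp (D.tCell P (D.two (D.one Z))) (D.tCell (D.two (D.one X)) k₂) = k₁) :
    E₁ = D.tCell (D.two (D.one X)) E₂ := by
  have q₁ : D.comp (D.tAr (D.one (D.tOb X Y)) φ) (D.tAr (D.one X) s) =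
      D.tAr (D.one X) (D.comp (D.tAr (D.one Y) φ) s) := by
    rw [← D.tAr_one, D.tAr_assoc, D.tAr_comp] <;> grind
  have c₁ : D.IsCell (D.hcomp (D.two (D.tAr (D.one (D.tOb X Y)) φ)) P)
      (D.comp (D.tAr (D.one (D.tOb X Y)) φ) r)
      (D.tAr (D.one X) (D.comp (D.tAr (D.one Y) φ) s)) := by grind
  have q₂ : D.comp (D.tAr (D.tAr (D.one Y) φ) (D.one Z)) (D.tAr s (D.one Z)) =
      D.tAr (D.comp (D.tAr (D.one Y) φ) s) (D.one Z) := by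
    rw [D.tAr_comp] <;> grind
  have c₂ : D.dom (D.hcomp (D.two (D.tAr (D.tAr (D.one Y) φ) (D.one Z))) k₂) =
      D.tAr (D.comp (D.tAr (D.one Y) φ) s) (D.one Z) := by grind
  have s₁ : ∀ a b : D.Cell, D.cod a = D.dom b → D.tCell (D.vcomp a b) (D.two (D.one Z)) =
      D.vcomp (D.tCell a (D.two (D.one Z))) (D.tCell b (D.two (D.one Z))) := fun a b hab => by
    rw [D.tCell_vcomp, D.two_vcomp_of] <;> grind
  have s₂ : ∀ a b : D.Cell, D.cod a = D.dom b → D.tCell (D.two (D.one X)) (D.vcomp a b) =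
      D.vcomp (D.tCell (D.two (D.one X)) a) (D.tCell (D.two (D.one X)) b) := fun a b hab => by
    rw [D.tCell_vcomp, D.two_vcomp_of] <;> grind
  have t₁ : D.hcomp (D.two (D.tAr (D.tAr (D.one (D.tOb X Y)) φ) (D.one Z)))
      (D.tCell P (D.two (D.one Z))) =
      D.tCell (D.hcomp (D.two (D.tAr (D.one (D.tOb X Y)) φ)) P) (D.two (D.one Z)) := by
    clear e₁ e₂ e₃ e₄ e₅ hE₁ hE₂ hk₁' hk₂' hd₁ hd₂ hi hP' s₁ s₂ c₁ c₂ q₁ q₂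
    rw [← D.tCell_two _ (D.one Z), D.tCell_hcomp, D.hcomp_two] <;> grind
  have t₂ : D.hcomp (D.two (D.tAr (D.tAr (D.one (D.tOb X Y)) φ) (D.one Z)))
      (D.tCell (D.two (D.one X)) k₂) = D.tCell (D.two (D.one X))
      (D.hcomp (D.two (D.tAr (D.tAr (D.one Y) φ) (D.one Z))) k₂) := by
    clear e₁ e₂ e₃ e₄ e₅ hE₁ hE₂ hk₁' hk₂' hd₁ hd₂ hi hP' s₁ s₂ c₁ c₂ q₁ q₂
    rw [← D.tAr_one, D.tAr_assoc (D.one X), D.tAr_assoc (D.one X), ← D.tCell_two (D.one X),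
      D.tCell_hcomp, D.hcomp_two] <;> grind
  refine hi.cancel_left (by grind) (by grind) ?_
  rw [e₁, ← e₅, D.two_hcomp_vcomp (by grind) (by grind), t₁, t₂]
  generalize D.hcomp (D.two (D.tAr (D.one (D.tOb X Y)) φ)) P = c at *
  generalize D.hcomp (D.two (D.tAr (D.tAr (D.one Y) φ) (D.one Z))) k₂ = c' at *
  clear t₁ t₂ q₁ q₂ hP hφ hr hs
  have t₃ : D.vcomp (D.tCell d₁ (D.two (D.one Z))) (D.tCell c (D.two (D.one Z))) =
      D.vcomp (D.tCell P' (D.two (D.one Z)))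
        (D.tCell (D.two (D.one X)) (D.tCell d₂ (D.two (D.one Z)))) := by
    rw [← s₁ _ _ (by grind), e₃, s₁ _ _ (by grind), D.tCell_assoc]
  have u₁ : D.IsCell (D.tCell P' (D.two (D.one Z))) (D.tAr r' (D.one Z))
      (D.tAr (D.one X) (D.tAr s' (D.one Z))) :=
    ⟨by rw [D.dom_tCell, hP'.1, D.dom_two], by rw [D.cod_tCell, hP'.2, D.cod_two, D.tAr_assoc]⟩
  have u₂ : D.IsCell (D.tCell (D.two (D.one X)) (D.tCell d₂ (D.two (D.one Z))))
      (D.tAr (D.one X) (D.tAr s' (D.one Z)))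
      (D.tAr (D.one X) (D.tAr (D.comp (D.tAr (D.one Y) φ) s) (D.one Z))) :=
    ⟨by rw [D.dom_tCell, D.dom_tCell, hd₂.1, D.dom_two, D.dom_two],
      by rw [D.cod_tCell, D.cod_tCell, hd₂.2, D.cod_two, D.cod_two]⟩
  have u₃ : D.dom (D.tCell (D.two (D.one X)) c') =
      (D.tAr (D.one X) (D.tAr (D.comp (D.tAr (D.one Y) φ) s) (D.one Z))) := by grind
  rw [← D.vcomp_assoc _ _ _ (by grind) (by grind), t₃, D.vcomp_assoc _ _ _ (by grind) (by grind),
    ← s₂ _ _ (by grind), ← e₂, s₂ _ _ (by grind), ← D.vcomp_assoc _ _ _ (by grind) (by grind), e₄]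

/-- A tensor factor on the left splits off because `K`, `K'` and `δ` are all compatible with `P` and
`P'`. This is what makes `compare` of the form `F X ⊗ γ_Y`. -/
theorem compare_tensor (h : IsRightComparison F W V φ σ δ R) (x y z : C.Ob) :
    compare F W V φ δ (C.tOb x y) z =
      D.tCell (D.two (D.one (F.ob x))) (compare F W V φ δ y z) := by
  obtain ⟨P, hP, eP⟩ := W.right_cocycle
  obtain ⟨P', hP', eP'⟩ := V.right_cocycle
  have c₁ := h.compare_cell (C.tOb x y) z
  have c₂ := h.compare_cell y z
  have e₁ := h.K_vcomp_compare (C.tOb x y) z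
  have e₂ := h.K_vcomp_compare y z
  have p : C.IsCell (P (x, y)) (W.rho.app (C.tOb x y)) (C.tAr (C.one x) (W.rho.app y)) :=
    hP.cell (x, y)
  have p' : D.IsCell (P' (F.ob x, F.ob y)) (V.rho.app (D.tOb (F.ob x) (F.ob y)))
      (D.tAr (D.one (F.ob x)) (V.rho.app (F.ob y))) := hP'.cell (F.ob x, F.ob y)
  have e₃ := h.δ_tensor p (eP x y W.I) p' (eP' _ _ _)
  have e₄ : D.vcomp (D.tCell (P' (F.ob x, F.ob y)) (D.two (D.one (F.ob z))))
    (D.tCell (D.two (D.one (F.ob x))) (V.K (F.ob y, F.ob z))) =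
    V.K (D.tOb (F.ob x) (F.ob y), F.ob z) := eP' _ _ _
  have e₅ : C.vcomp (C.tCell (P (x, y)) (C.two (C.one z)))
    (C.tCell (C.two (C.one x)) (W.K (y, z))) = W.K (C.tOb x y, z) := eP _ _ _
  have w₁ := W.rho_ar (C.tOb x y)
  have w₂ := W.rho_ar y
  have d := h.δ_cell (C.tOb x y)
  have k := W.K_cell y z
  rw [F.map_tOb] at c₁ e₁ d
  refine compare_tensor_aux (P := F.cell (P (x, y))) (r := F.ar (W.rho.app (C.tOb x y)))
    (s := F.ar (W.rho.app y)) (k₂ := F.cell (W.K (y, z))) h.φ_ar (by grind) (by grind) (by grind)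
    p' d (h.δ_cell y) (V.K_cell _ _) (by grind) (V.K_cell _ _) (V.K_mod.inv _) c₁ c₂ e₁ e₂ e₃ e₄ ?_
  rw [← e₅, F.map_vcomp _ _ (by grind)]
  grind

/-- The modification axiom at the pair of `f` and an identity arrow, where the naturality cells of
both transformations are identities. -/
theorem compare_natural (h : IsRightComparison F W V φ σ δ R) {x x' : C.Ob} {f : C.Ar}
    (hf : C.IsAr f x x') (y : C.Ob) :
    D.hcomp (compare F W V φ δ x y) (D.two (D.tAr (F.ar f) (D.one (F.ob y)))) =
      D.hcomp (D.two (D.tAr (F.ar f) (D.one (D.tOb V.I (F.ob y))))) (compare F W V φ δ x' y) := by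
  have n := h.isInvModification_compare.natural (f, C.one y)
  have p₁ : V.lam.nat (F.ar (C.one y)) = D.two (V.lam.app (F.ob y)) :=
    (V.lam_nat.precomp F.toTwoFunctor).nat_one y
  have p₂ := (isPseudonatural_left (V := V) h.φ_ar).nat_one y
  have c₁ := h.compare_cell x y
  have c₂ := h.compare_cell x' y
  have hφ := h.φ_ar
  have l := V.lam_ar (F.ob y)
  have w := W.lam_ar y
  change D.vcomp (D.tCell (D.two (F.ar f)) (V.lam.nat (F.ar (C.one y))))
    (D.hcomp (compare F W V φ δ (C.src f) (C.src (C.one y)))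
      (D.two (D.tAr (F.ar f) (F.ar (C.one y))))) =
    D.vcomp (D.hcomp (D.two (D.tAr (D.tAr (F.ar f) (D.one V.I)) (F.ar (C.one y))))
      (compare F W V φ δ (C.tgt f) (C.tgt (C.one y))))
    (D.tCell (D.two (F.ar f)) (((D.arLeft φ F.toTwoFunctor).comp
      (W.lam.postcomp F.toTwoFunctor)).nat (C.one y))) at n
  have p₃ : ((D.arLeft φ F.toTwoFunctor).comp (W.lam.postcomp F.toTwoFunctor)).app y =
    D.comp (D.tAr φ (D.one (F.ob y))) (F.ar (W.lam.app y)) := rfl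
  rw [p₁, p₂, p₃, C.src_one, C.tgt_one, hf.1, hf.2, F.map_one, D.tCell_two, D.tCell_two, D.tAr_assoc,
    D.tAr_one] at n
  rw [D.two_vcomp_of, D.vcomp_two_of] at n
  · exact n
  · rw [D.cod_hcomp, c₂.2, D.cod_two, D.tAr_comp] <;> grind
  · rw [D.dom_hcomp, c₁.1, D.dom_two, D.tAr_comp] <;> grind

/-- A pseudo-inverse of `φ` makes `J ⊗ -` pseudo-naturally equivalent to `I ⊗ -`. -/
theorem isEqui2_tensorLeft_of_equi {I J : D.Ob} (hφ : D.IsAr φ I J) (he : D.IsEqui φ)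
    (hI : (D.tensorLeft I).IsEqui2) : (D.tensorLeft J).IsEqui2 := by
  obtain ⟨ψ, hψ, -, -, hψe⟩ := he.exists_inverse
  refine (SMon2Cat.isPseudonatural_arLeft (F := TwoFunctor.id D.toTwoCat) (φ := ψ)
    (I := J) (J := I) (by grind)).isEqui2 (fun x => SMon2Cat.isEqui_tAr hψe (D.isEqui_one _)) hI

/-- What is left to find is `γ` with `F X ⊗ γ_Y` equal to `compare` at `(X, Y)`. At `X = I` this
equation defines `γ`, since `F I ⊗ -` is an equi-2-functor. For general `X`, naturality along `ρ_X :
X ⊗ I ⟶ X` relates the value at `X` to the value at `X ⊗ I`, which `compare_tensor` reduces to the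
value at `I`; the image of `ρ_X` is an equiarrow and cancels. -/
theorem nonempty_unitComparison (h : IsRightComparison F W V φ σ δ R) :
    Nonempty (UnitComparison F W V) := by
  have hφ := h.φ_ar
  have hJ : (D.tensorLeft (F.ob W.I)).IsEqui2 :=
    isEqui2_tensorLeft_of_equi hφ h.φ_equi V.isEqui2_tensorLeft
  have ex : ∀ y, ∃ c, D.IsCell c (V.lam.app (F.ob y))
      (D.comp (D.tAr φ (D.one (F.ob y))) (F.ar (W.lam.app y))) ∧
      D.tCell (D.two (D.one (F.ob W.I))) c = compare F W V φ δ W.I y := fun y => by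
    have l := V.lam_ar (F.ob y)
    have w := W.lam_ar y
    exact hJ.exists_cell (by grind) (by grind) (h.compare_cell W.I y)
  choose γ hγ hγ' using ex
  have key : ∀ x y, compare F W V φ δ x y = D.tCell (D.two (D.one (F.ob x))) (γ y) := fun x y => by
    have l := V.lam_ar (F.ob y)
    have w := W.lam_ar y
    have r := W.rho_ar x
    have g := hγ y
    have c := h.compare_cell x y
    have n := h.compare_natural r y
    refine (SMon2Cat.isEqui_tAr (F.map_isEqui (W.rho_equi x))
      (D.isEqui_one (D.tOb V.I (F.ob y)))).whisker_left_cancel (by grind) (by grind) (by grind) ?_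
    rw [← n, h.compare_tensor, ← hγ', ← D.tCell_assoc, D.tCell_two, ← D.tCell_two _ (D.one (F.ob y)),
      ← D.tCell_two _ (D.one (D.tOb V.I (F.ob y))), D.tCell_hcomp, D.tCell_hcomp] <;> grind
  refine ⟨⟨φ, γ, δ, hφ, h.φ_equi, ?_, h.δ_mod, fun x y => ?_⟩⟩
  · refine TransfData.IsInvModification.of_postcomp hJ (V.lam_nat.precomp F.toTwoFunctor)
      (isPseudonatural_left hφ) hγ ?_
    refine (h.isInvModification_compare.precomp (TwoFunctor.pair (TwoFunctor.const _ W.I)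
      (TwoFunctor.id _))).congr (fun f => ?_) (fun f => ?_) (fun x => rfl) (fun f => ?_)
      (fun x => rfl) (fun f => ?_) (fun x => (hγ' x).symm)
    · change D.tAr (D.tAr (F.ar (C.one W.I)) (D.one V.I)) (F.ar f) =
        D.tAr (D.one (F.ob W.I)) (D.tAr (D.one V.I) (F.ar f))
      grind
    · change D.tAr (F.ar (C.one W.I)) (F.ar f) = D.tAr (D.one (F.ob W.I)) (F.ar f)
      grind
    · change D.tCell (D.two (F.ar (C.one W.I))) _ = D.tCell (D.two (D.one (F.ob W.I))) _
      rw [F.map_one]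
      rfl
    · change D.tCell (D.two (F.ar (C.one W.I))) _ = D.tCell (D.two (D.one (F.ob W.I))) _
      rw [F.map_one]
      rfl
  · rw [SMon2Cat.obCell, ← key, h.K_vcomp_compare]
    rfl

end IsRightComparison

/-- A semi-monoidal 2-functor and an equiarrow `φ : I' ⟶ F I` compatible with `λ_I` and `λ'_{I'}` up
to isomorphism underlie a monoidal 2-functor. -/
theorem nonempty_unitComparison {C D : SMon2Cat.{u}} {F : SMonFunctor C D} {W : WeakUnit C}
    {V : WeakUnit D} {φ : D.Ar} (hφ : D.IsAr φ V.I (F.ob W.I)) (he : D.IsEqui φ)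
    (h : D.Iso (D.comp (V.lam.app V.I) φ) (D.comp (D.tAr φ φ) (F.ar (W.lam.app W.I)))) :
    Nonempty (UnitComparison F W V) := by
  obtain ⟨σ, hσ, hσi⟩ := h
  obtain ⟨δ, R, h⟩ := IsRightComparison.exists_of_iso hφ he hσ hσi
  exact h.nonempty_unitComparison

/-! ### The free semi-monoidal 2-category as a term model -/

namespace FreeUnit

/-- Terms for objects. -/
inductive ObTerm : Type u
  | I : ObTerm
  | tensor : ObTerm → ObTerm → ObTerm

/-- Terms for arrows, not necessarily well formed. -/
inductive ArTerm : Type u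
  | α : ArTerm
  | β : ArTerm
  | one : ObTerm.{u} → ArTerm
  | comp : ArTerm → ArTerm → ArTerm
  | tensor : ArTerm → ArTerm → ArTerm

/-- Terms for 2-cells, not necessarily well formed. -/
inductive CellTerm : Type u
  | A : CellTerm
  | A' : CellTerm
  | η : CellTerm
  | η' : CellTerm
  | ε : CellTerm
  | ε' : CellTerm
  | two : ArTerm.{u} → CellTerm
  | vcomp : CellTerm → CellTerm → CellTerm
  | hcomp : CellTerm → CellTerm → CellTerm
  | tensor : CellTerm → CellTerm → CellTerm

/-- The interpretation of a term. -/
def ObTerm.eval {D : SMon2Cat.{u}} (d : UnitData D) : ObTerm.{u} → D.Ob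
  | I => d.I
  | tensor x y => D.tOb (x.eval d) (y.eval d)

/-- The interpretation of a term. -/
def ArTerm.eval {D : SMon2Cat.{u}} (d : UnitData D) : ArTerm.{u} → D.Ar
  | α => d.α
  | β => d.β
  | one x => D.one (x.eval d)
  | comp f g => D.comp (f.eval d) (g.eval d)
  | tensor f g => D.tAr (f.eval d) (g.eval d)

/-- The interpretation of a term. -/
noncomputable def CellTerm.eval {D : SMon2Cat.{u}} (d : UnitData D) : CellTerm.{u} → D.Cell
  | A => d.A
  | A' => D.inv d.A
  | η => d.η
  | η' => D.inv d.η
  | ε => d.ε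
  | ε' => D.inv d.ε
  | two f => D.two (f.eval d)
  | vcomp a b => D.vcomp (a.eval d) (b.eval d)
  | hcomp a b => D.hcomp (a.eval d) (b.eval d)
  | tensor a b => D.tCell (a.eval d) (b.eval d)

/-- Terms are identified if they have the same interpretation everywhere. -/
instance ObTerm.setoid : Setoid ObTerm.{u} where
  r x y := ∀ (D : SMon2Cat.{u}) (d : UnitData D), x.eval d = y.eval d
  iseqv := ⟨fun _ _ _ => rfl, fun h D d => (h D d).symm, fun h h' D d => (h D d).trans (h' D d)⟩

/-- The source of an arrow term. -/
def ArTerm.src : ArTerm.{u} → ObTerm.{u}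
  | α => .tensor .I .I
  | β => .I
  | one x => x
  | comp f _ => f.src
  | tensor f g => .tensor f.src g.src

/-- The target of an arrow term. -/
def ArTerm.tgt : ArTerm.{u} → ObTerm.{u}
  | α => .I
  | β => .tensor .I .I
  | one x => x
  | comp _ g => g.tgt
  | tensor f g => .tensor f.tgt g.tgt

/-- The composites in an arrow term are composites of composable arrows. -/
def ArTerm.WellFormed : ArTerm.{u} → Prop
  | α => True
  | β => True
  | one _ => True
  | comp f g => f.WellFormed ∧ g.WellFormed ∧ f.tgt ≈ g.src
  | tensor f g => f.WellFormed ∧ g.WellFormed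

/-- The domain of a cell term. -/
def CellTerm.dom : CellTerm.{u} → ArTerm.{u}
  | A => .tensor (.one .I) .α
  | A' => .tensor .α (.one .I)
  | η => .one (.tensor .I .I)
  | η' => .comp .α .β
  | ε => .comp .β .α
  | ε' => .one .I
  | two f => f
  | vcomp a _ => a.dom
  | hcomp a b => .comp a.dom b.dom
  | tensor a b => .tensor a.dom b.dom

/-- The codomain of a cell term. -/
def CellTerm.cod : CellTerm.{u} → ArTerm.{u}
  | A => .tensor .α (.one .I)
  | A' => .tensor (.one .I) .α
  | η => .comp .α .β
  | η' => .one (.tensor .I .I)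
  | ε => .one .I
  | ε' => .comp .β .α
  | two f => f
  | vcomp _ b => b.cod
  | hcomp a b => .comp a.cod b.cod
  | tensor a b => .tensor a.cod b.cod

/-- The composites in a cell term are composites of composable cells. -/
def CellTerm.WellFormed : CellTerm.{u} → Prop
  | A => True
  | A' => True
  | η => True
  | η' => True
  | ε => True
  | ε' => True
  | two f => f.WellFormed
  | vcomp a b => a.WellFormed ∧ b.WellFormed ∧
      ∀ (D : SMon2Cat.{u}) (d : UnitData D), a.cod.eval d = b.dom.eval d
  | hcomp a b => a.WellFormed ∧ b.WellFormed ∧ a.dom.tgt ≈ b.dom.src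
  | tensor a b => a.WellFormed ∧ b.WellFormed

attribute [grind =] ObTerm.eval ArTerm.eval CellTerm.eval ArTerm.src ArTerm.tgt ArTerm.WellFormed
  CellTerm.dom CellTerm.cod CellTerm.WellFormed

variable {D : SMon2Cat.{u}} (d : UnitData D)

theorem ArTerm.WellFormed.src_tgt {f : ArTerm.{u}} (h : f.WellFormed) :
    D.src (f.eval d) = f.src.eval d ∧ D.tgt (f.eval d) = f.tgt.eval d := by
  induction f with
  | α => exact d.α_ar
  | β => exact ⟨d.adj.right_ar.1.trans d.α_ar.2, d.adj.right_ar.2.trans d.α_ar.1⟩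
  | one x => grind
  | comp f g ihf ihg =>
    have e : f.tgt.eval d = g.src.eval d := h.2.2 D d
    have := ihf h.1
    have := ihg h.2.1
    grind
  | tensor f g ihf ihg =>
    have := ihf h.1
    have := ihg h.2
    grind

/-- All interpretations are handled inside one induction: the codomain of a horizontal composite is
a well formed term only because, in every interpretation, codomains have the same ends as domains.
-/
theorem CellTerm.WellFormed.dom_cod {a : CellTerm.{u}} (h : a.WellFormed) :
    a.dom.WellFormed ∧ a.cod.WellFormed ∧ ∀ (D : SMon2Cat.{u}) (d : UnitData D),
      D.dom (a.eval d) = a.dom.eval d ∧ D.cod (a.eval d) = a.cod.eval d := by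
  induction a with
  | A =>
    refine ⟨by grind, by grind, fun D d => ?_⟩
    have h := d.assoc.cell
    grind
  | A' =>
    refine ⟨by grind, by grind, fun D d => ?_⟩
    have h := d.assoc.cell
    have hi := d.assoc.inv
    grind
  | η =>
    refine ⟨by grind, ⟨trivial, trivial, Setoid.refl _⟩, fun D d => ?_⟩
    have h := d.adj.unit_cell
    have h' := d.α_ar
    grind
  | η' =>
    refine ⟨⟨trivial, trivial, Setoid.refl _⟩, by grind, fun D d => ?_⟩
    have h := d.adj.unit_cell
    have h' := d.α_ar
    have hi := d.η_inv
    grind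
  | ε =>
    refine ⟨⟨trivial, trivial, Setoid.refl _⟩, by grind, fun D d => ?_⟩
    have h := d.adj.counit_cell
    have h' := d.α_ar
    grind
  | ε' =>
    refine ⟨by grind, ⟨trivial, trivial, Setoid.refl _⟩, fun D d => ?_⟩
    have h := d.adj.counit_cell
    have h' := d.α_ar
    have hi := d.ε_inv
    grind
  | two f => exact ⟨h, h, fun D d => by grind⟩
  | vcomp a b iha ihb =>
    have ha := iha h.1
    have hb := ihb h.2.1
    refine ⟨ha.1, hb.2.1, fun D d => ?_⟩
    have := h.2.2 D d
    have := ha.2.2 D d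
    have := hb.2.2 D d
    grind
  | hcomp a b iha ihb =>
    obtain ⟨ha₁, ha₂, ha⟩ := iha h.1
    obtain ⟨hb₁, hb₂, hb⟩ := ihb h.2.1
    refine ⟨⟨ha₁, hb₁, h.2.2⟩, ⟨ha₂, hb₂, fun D d => ?_⟩, fun D d => ?_⟩
    all_goals
      have := h.2.2 D d
      have := ha D d
      have := hb D d
      have := ha₁.src_tgt d
      have := ha₂.src_tgt d
      have := hb₁.src_tgt d
      have := hb₂.src_tgt d
      have := D.src_cod (b.eval d)
      have := D.tgt_cod (a.eval d)
      grind
  | tensor a b iha ihb =>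
    obtain ⟨ha₁, ha₂, ha⟩ := iha h.1
    obtain ⟨hb₁, hb₂, hb⟩ := ihb h.2
    refine ⟨⟨ha₁, hb₁⟩, ⟨ha₂, hb₂⟩, fun D d => ?_⟩
    have := ha D d
    have := hb D d
    grind

/-- Well formed arrow terms, identified if they have the same interpretation everywhere. -/
instance arSetoid : Setoid {f : ArTerm.{u} // f.WellFormed} where
  r f g := ∀ (D : SMon2Cat.{u}) (d : UnitData D), f.1.eval d = g.1.eval d
  iseqv := ⟨fun _ _ _ => rfl, fun h D d => (h D d).symm, fun h h' D d => (h D d).trans (h' D d)⟩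

/-- Well formed cell terms, identified if they have the same interpretation everywhere. -/
instance cellSetoid : Setoid {a : CellTerm.{u} // a.WellFormed} where
  r a b := ∀ (D : SMon2Cat.{u}) (d : UnitData D), a.1.eval d = b.1.eval d
  iseqv := ⟨fun _ _ _ => rfl, fun h D d => (h D d).symm, fun h h' D d => (h D d).trans (h' D d)⟩

/-- Objects of the free semi-monoidal 2-category. -/
def Ob : Type u := Quotient ObTerm.setoid.{u}

/-- Arrows of the free semi-monoidal 2-category. -/
def Ar : Type u := Quotient arSetoid.{u}

/-- 2-cells of the free semi-monoidal 2-category. -/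
def Cell : Type u := Quotient cellSetoid.{u}

/-- The interpretation of an object. -/
def evOb (x : Ob.{u}) : D.Ob := Quotient.lift (s := ObTerm.setoid) (ObTerm.eval d) (fun _ _ h => h D d) x

/-- The interpretation of an arrow. -/
def evAr (f : Ar.{u}) : D.Ar :=
  Quotient.lift (s := arSetoid) (fun f => f.1.eval d) (fun _ _ h => h D d) f

/-- The interpretation of a 2-cell. -/
noncomputable def evCell (a : Cell.{u}) : D.Cell :=
  Quotient.lift (s := cellSetoid) (fun a => a.1.eval d) (fun _ _ h => h D d) a

/-- By construction of the quotient the interpretations are jointly injective. Each law of the term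
model hence follows from the same law in every `D`. -/
theorem ob_ext {x y : Ob.{u}} (h : ∀ (D : SMon2Cat.{u}) (d : UnitData D), evOb d x = evOb d y) :
    x = y := by
  induction x using Quotient.ind
  induction y using Quotient.ind
  exact Quotient.sound h

theorem ar_ext {x y : Ar.{u}} (h : ∀ (D : SMon2Cat.{u}) (d : UnitData D), evAr d x = evAr d y) :
    x = y := by
  induction x using Quotient.ind
  induction y using Quotient.ind
  exact Quotient.sound h

theorem cell_ext {x y : Cell.{u}}
    (h : ∀ (D : SMon2Cat.{u}) (d : UnitData D), evCell d x = evCell d y) : x = y := by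
  induction x using Quotient.ind
  induction y using Quotient.ind
  exact Quotient.sound h

/-- The source of an arrow. -/
def src : Ar.{u} → Ob.{u} := Quotient.lift (fun f => (Quotient.mk _ f.1.src : Ob.{u}))
  (fun f g h => Quotient.sound fun D d => by
    rw [← (f.2.src_tgt d).1, ← (g.2.src_tgt d).1, h D d])

/-- The target of an arrow. -/
def tgt : Ar.{u} → Ob.{u} := Quotient.lift (fun f => (Quotient.mk _ f.1.tgt : Ob.{u}))
  (fun f g h => Quotient.sound fun D d => by
    rw [← (f.2.src_tgt d).2, ← (g.2.src_tgt d).2, h D d])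

/-- The domain of a 2-cell. -/
def dom : Cell.{u} → Ar.{u} :=
  Quotient.lift (fun a => (Quotient.mk _ ⟨a.1.dom, a.2.dom_cod.1⟩ : Ar.{u}))
  (fun f g h => Quotient.sound fun D d => by
    rw [← (f.2.dom_cod.2.2 D d).1, ← (g.2.dom_cod.2.2 D d).1, h D d])

/-- The codomain of a 2-cell. -/
def cod : Cell.{u} → Ar.{u} :=
  Quotient.lift (fun a => (Quotient.mk _ ⟨a.1.cod, a.2.dom_cod.2.1⟩ : Ar.{u}))
  (fun f g h => Quotient.sound fun D d => by
    rw [← (f.2.dom_cod.2.2 D d).2, ← (g.2.dom_cod.2.2 D d).2, h D d])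

theorem evOb_src (f : Ar.{u}) : evOb d (src f) = D.src (evAr d f) := by
  induction f using Quotient.ind with | _ f => exact (f.2.src_tgt d).1.symm

theorem evOb_tgt (f : Ar.{u}) : evOb d (tgt f) = D.tgt (evAr d f) := by
  induction f using Quotient.ind with | _ f => exact (f.2.src_tgt d).2.symm

theorem evAr_dom (a : Cell.{u}) : evAr d (dom a) = D.dom (evCell d a) := by
  induction a using Quotient.ind with | _ a => exact (a.2.dom_cod.2.2 D d).1.symm

theorem evAr_cod (a : Cell.{u}) : evAr d (cod a) = D.cod (evCell d a) := by
  induction a using Quotient.ind with | _ a => exact (a.2.dom_cod.2.2 D d).2.symm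

/-- Identity arrows. -/
def one : Ob.{u} → Ar.{u} := Quotient.lift (fun x => (Quotient.mk _ ⟨.one x, trivial⟩ : Ar.{u}))
  (fun x y h => Quotient.sound fun D d => congrArg D.one (h D d))

/-- Identity 2-cells. -/
def two : Ar.{u} → Cell.{u} := Quotient.lift (fun f => (Quotient.mk _ ⟨.two f.1, f.2⟩ : Cell.{u}))
  (fun x y h => Quotient.sound fun D d => congrArg D.two (h D d))

theorem evAr_one (x : Ob.{u}) : evAr d (one x) = D.one (evOb d x) := by
  induction x using Quotient.ind with | _ x => rfl

theorem evCell_two (f : Ar.{u}) : evCell d (two f) = D.two (evAr d f) := by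
  induction f using Quotient.ind with | _ f => rfl

/-- Tensor product of objects. -/
def tOb : Ob.{u} → Ob.{u} → Ob.{u} := Quotient.map₂ ObTerm.tensor
  (fun x y h x' y' h' D d => by simp only [ObTerm.eval, h D d, h' D d])

/-- Tensor product of arrows. -/
def tAr : Ar.{u} → Ar.{u} → Ar.{u} := Quotient.map₂ (fun f g => ⟨.tensor f.1 g.1, f.2, g.2⟩)
  (fun x y h x' y' h' D d => by simp only [ArTerm.eval, h D d, h' D d])

/-- Tensor product of 2-cells. -/
def tCell : Cell.{u} → Cell.{u} → Cell.{u} :=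
  Quotient.map₂ (fun f g => ⟨.tensor f.1 g.1, f.2, g.2⟩)
  (fun x y h x' y' h' D d => by simp only [CellTerm.eval, h D d, h' D d])

theorem evOb_tOb (x y : Ob.{u}) : evOb d (tOb x y) = D.tOb (evOb d x) (evOb d y) := by
  induction x using Quotient.ind
  induction y using Quotient.ind
  rfl

theorem evAr_tAr (x y : Ar.{u}) : evAr d (tAr x y) = D.tAr (evAr d x) (evAr d y) := by
  induction x using Quotient.ind
  induction y using Quotient.ind
  rfl

theorem evCell_tCell (x y : Cell.{u}) :
    evCell d (tCell x y) = D.tCell (evCell d x) (evCell d y) := by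
  induction x using Quotient.ind
  induction y using Quotient.ind
  rfl

/-- Equality of classes of objects is equality of all interpretations, which is exactly the
composability that well formed terms require. The composite of any representatives therefore
represents the composite. -/
theorem exists_comp (f g : Ar.{u}) (h : tgt f = src g) :
    ∃ k : Ar.{u}, ∀ (D : SMon2Cat.{u}) (d : UnitData D),
      evAr d k = D.comp (evAr d f) (evAr d g) := by
  induction f using Quotient.ind with | _ f
  induction g using Quotient.ind with | _ g
  exact ⟨Quotient.mk _ ⟨.comp f.1 g.1, f.2, g.2, Quotient.exact h⟩, fun D d => rfl⟩

theorem exists_vcomp (f g : Cell.{u}) (h : cod f = dom g) :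
    ∃ k : Cell.{u}, ∀ (D : SMon2Cat.{u}) (d : UnitData D),
      evCell d k = D.vcomp (evCell d f) (evCell d g) := by
  induction f using Quotient.ind with | _ f
  induction g using Quotient.ind with | _ g
  exact ⟨Quotient.mk _ ⟨.vcomp f.1 g.1, f.2, g.2, Quotient.exact h⟩, fun D d => rfl⟩

theorem exists_hcomp (f g : Cell.{u}) (h : tgt (dom f) = src (dom g)) :
    ∃ k : Cell.{u}, ∀ (D : SMon2Cat.{u}) (d : UnitData D),
      evCell d k = D.hcomp (evCell d f) (evCell d g) := by
  induction f using Quotient.ind with | _ f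
  induction g using Quotient.ind with | _ g
  exact ⟨Quotient.mk _ ⟨.hcomp f.1 g.1, f.2, g.2, Quotient.exact h⟩, fun D d => rfl⟩

open Classical in
/-- Composition of arrows. -/
noncomputable def comp (f g : Ar.{u}) : Ar.{u} :=
  if h : tgt f = src g then (exists_comp f g h).choose else f

open Classical in
/-- Vertical composition. -/
noncomputable def vcomp (a b : Cell.{u}) : Cell.{u} :=
  if h : cod a = dom b then (exists_vcomp a b h).choose else a

open Classical in
/-- Horizontal composition. -/
noncomputable def hcomp (a b : Cell.{u}) : Cell.{u} :=
  if h : tgt (dom a) = src (dom b) then (exists_hcomp a b h).choose else a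

theorem evAr_comp {f g : Ar.{u}} (h : tgt f = src g) :
    evAr d (comp f g) = D.comp (evAr d f) (evAr d g) := by
  rw [comp, dif_pos h]
  exact (exists_comp f g h).choose_spec D d

theorem evCell_vcomp {a b : Cell.{u}} (h : cod a = dom b) :
    evCell d (vcomp a b) = D.vcomp (evCell d a) (evCell d b) := by
  rw [vcomp, dif_pos h]
  exact (exists_vcomp a b h).choose_spec D d

theorem evCell_hcomp {a b : Cell.{u}} (h : tgt (dom a) = src (dom b)) :
    evCell d (hcomp a b) = D.hcomp (evCell d a) (evCell d b) := by
  rw [hcomp, dif_pos h]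
  exact (exists_hcomp a b h).choose_spec D d

end FreeUnit

theorem SMonFunctor.map_pentagonLeft {C D : SMon2Cat.{u}} (F : SMonFunctor C D) {I : C.Ob}
    {α : C.Ar} {A : C.Cell} (hα : C.IsAr α (C.tOb I I) I)
    (hA : C.IsCell A (C.obAr I α) (C.arOb α I)) :
    F.cell (C.pentagonLeft I α A) = D.pentagonLeft (F.ob I) (F.ar α) (F.cell A) := by
  have e : C.comp (C.obAr (C.tOb I I) α) (C.comp (C.arOb α I) α) =
      C.comp (C.arOb α (C.tOb I I)) (C.comp (C.obAr I α) α) := by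
    rw [← C.comp_assoc, ← C.comp_assoc] <;> grind
  have k : C.IsCell (C.hcomp A (C.two α)) (C.comp (C.obAr I α) α) (C.comp (C.arOb α I) α) := by
    grind
  have m : F.cell (C.hcomp A (C.two α)) = D.hcomp (F.cell A) (D.two (F.ar α)) := by grind
  rw [SMon2Cat.pentagonLeft, SMon2Cat.pentagonLeft, ← m]
  generalize C.hcomp A (C.two α) = B at k
  clear m hA
  rw [F.map_vcomp, F.map_hcomp, F.map_hcomp] <;> grind

theorem SMonFunctor.map_pentagonRight {C D : SMon2Cat.{u}} (F : SMonFunctor C D) {I : C.Ob}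
    {α : C.Ar} {A : C.Cell} (hα : C.IsAr α (C.tOb I I) I)
    (hA : C.IsCell A (C.obAr I α) (C.arOb α I)) :
    F.cell (C.pentagonRight I α A) = D.pentagonRight (F.ob I) (F.ar α) (F.cell A) := by
  have k : C.IsCell (C.hcomp A (C.two α)) (C.comp (C.obAr I α) α) (C.comp (C.arOb α I) α) := by
    grind
  have m : F.cell (C.hcomp A (C.two α)) = D.hcomp (F.cell A) (D.two (F.ar α)) := by grind
  rw [SMon2Cat.pentagonRight, SMon2Cat.pentagonRight, ← m]
  generalize C.hcomp A (C.two α) = B at k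
  clear m
  rw [F.map_vcomp, F.map_vcomp, F.map_hcomp, F.map_hcomp, F.map_hcomp] <;> grind

/-! ### Laws, generators and universal property of the term model -/

namespace FreeUnit

variable {D : SMon2Cat.{u}} (d : UnitData D)

theorem tgt_evAr {f g : Ar.{u}} (h : tgt f = src g) : D.tgt (evAr d f) = D.src (evAr d g) := by
  rw [← evOb_tgt, h, evOb_src]

theorem cod_evCell {a b : Cell.{u}} (h : cod a = dom b) :
    D.cod (evCell d a) = D.dom (evCell d b) := by
  rw [← evAr_cod, h, evAr_dom]

theorem tgt_dom_evCell {a b : Cell.{u}} (h : tgt (dom a) = src (dom b)) :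
    D.tgt (D.dom (evCell d a)) = D.src (D.dom (evCell d b)) := by
  rw [← evAr_dom, ← evAr_dom, tgt_evAr d h]

theorem src_cod (a : Cell.{u}) : src (cod a) = src (dom a) := ob_ext fun D d => by
  rw [evOb_src, evOb_src, evAr_cod, evAr_dom, D.src_cod]

theorem tgt_cod (a : Cell.{u}) : tgt (cod a) = tgt (dom a) := ob_ext fun D d => by
  rw [evOb_tgt, evOb_tgt, evAr_cod, evAr_dom, D.tgt_cod]

theorem src_comp {f g : Ar.{u}} (h : tgt f = src g) : src (comp f g) = src f :=
  ob_ext fun D d => by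
    rw [evOb_src, evOb_src, evAr_comp d h, D.src_comp _ _ (tgt_evAr d h)]

theorem tgt_comp {f g : Ar.{u}} (h : tgt f = src g) : tgt (comp f g) = tgt g :=
  ob_ext fun D d => by
    rw [evOb_tgt, evOb_tgt, evAr_comp d h, D.tgt_comp _ _ (tgt_evAr d h)]

theorem dom_vcomp {a b : Cell.{u}} (h : cod a = dom b) : dom (vcomp a b) = dom a :=
  ar_ext fun D d => by
    rw [evAr_dom, evAr_dom, evCell_vcomp d h, D.dom_vcomp _ _ (cod_evCell d h)]

theorem cod_vcomp {a b : Cell.{u}} (h : cod a = dom b) : cod (vcomp a b) = cod b :=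
  ar_ext fun D d => by
    rw [evAr_cod, evAr_cod, evCell_vcomp d h, D.cod_vcomp _ _ (cod_evCell d h)]

theorem dom_hcomp {a b : Cell.{u}} (h : tgt (dom a) = src (dom b)) :
    dom (hcomp a b) = comp (dom a) (dom b) :=
  ar_ext fun D d => by
    rw [evAr_comp d h, evAr_dom, evAr_dom, evAr_dom, evCell_hcomp d h,
      D.dom_hcomp _ _ (tgt_dom_evCell d h)]

theorem cod_hcomp {a b : Cell.{u}} (h : tgt (dom a) = src (dom b)) :
    cod (hcomp a b) = comp (cod a) (cod b) :=
  ar_ext fun D d => by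
    rw [evAr_comp d (by rw [tgt_cod, src_cod, h]), evAr_cod, evAr_cod, evAr_cod, evCell_hcomp d h,
      D.cod_hcomp _ _ (tgt_dom_evCell d h)]

theorem src_one (x : Ob.{u}) : src (one x) = x := ob_ext fun D d => by
  rw [evOb_src, evAr_one, D.src_one]

theorem tgt_one (x : Ob.{u}) : tgt (one x) = x := ob_ext fun D d => by
  rw [evOb_tgt, evAr_one, D.tgt_one]

theorem dom_two (f : Ar.{u}) : dom (two f) = f := ar_ext fun D d => by
  rw [evAr_dom, evCell_two, D.dom_two]

theorem cod_two (f : Ar.{u}) : cod (two f) = f := ar_ext fun D d => by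
  rw [evAr_cod, evCell_two, D.cod_two]

/-- The 2-category underlying the free semi-monoidal 2-category. -/
noncomputable def twoCat : TwoCat.{u} where
  Ob := Ob
  Ar := Ar
  Cell := Cell
  src := src
  tgt := tgt
  dom := dom
  cod := cod
  one := one
  two := two
  comp := comp
  vcomp := vcomp
  hcomp := hcomp
  src_cod := src_cod
  tgt_cod := tgt_cod
  src_one := src_one
  tgt_one := tgt_one
  src_comp _ _ h := src_comp h
  tgt_comp _ _ h := tgt_comp h
  one_comp f := ar_ext fun D d => by
    rw [evAr_comp d (tgt_one _), evAr_one, evOb_src, D.one_comp]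
  comp_one f := ar_ext fun D d => by
    rw [evAr_comp d (src_one _).symm, evAr_one, evOb_tgt, D.comp_one]
  comp_assoc f g h p q := ar_ext fun D d => by
    rw [evAr_comp d (by rw [tgt_comp p, q]), evAr_comp d p, evAr_comp d (by rw [src_comp q, p]),
      evAr_comp d q, D.comp_assoc _ _ _ (tgt_evAr d p) (tgt_evAr d q)]
  dom_two := dom_two
  cod_two := cod_two
  dom_vcomp _ _ h := dom_vcomp h
  cod_vcomp _ _ h := cod_vcomp h
  two_vcomp a := cell_ext fun D d => by
    rw [evCell_vcomp d (cod_two _), evCell_two, evAr_dom, D.two_vcomp]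
  vcomp_two a := cell_ext fun D d => by
    rw [evCell_vcomp d (dom_two _).symm, evCell_two, evAr_cod, D.vcomp_two]
  vcomp_assoc f g h p q := cell_ext fun D d => by
    rw [evCell_vcomp d (by rw [cod_vcomp p, q]), evCell_vcomp d p,
      evCell_vcomp d (by rw [dom_vcomp q, p]), evCell_vcomp d q,
      D.vcomp_assoc _ _ _ (cod_evCell d p) (cod_evCell d q)]
  dom_hcomp _ _ h := dom_hcomp h
  cod_hcomp _ _ h := cod_hcomp h
  one_hcomp a := cell_ext fun D d => by
    rw [evCell_hcomp d (by rw [dom_two, tgt_one]), evCell_two, evAr_one, evOb_src, evAr_dom,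
      D.one_hcomp]
  hcomp_one a := cell_ext fun D d => by
    rw [evCell_hcomp d (by rw [dom_two, src_one]), evCell_two, evAr_one, evOb_tgt, evAr_dom,
      D.hcomp_one]
  hcomp_assoc f g h p q := cell_ext fun D d => by
    rw [evCell_hcomp d (by rw [dom_hcomp p, tgt_comp p, q]), evCell_hcomp d p,
      evCell_hcomp d (by rw [dom_hcomp q, src_comp q, p]), evCell_hcomp d q,
      D.hcomp_assoc _ _ _ (tgt_dom_evCell d p) (tgt_dom_evCell d q)]
  hcomp_two f g h := cell_ext fun D d => by
    rw [evCell_hcomp d (by rw [dom_two, dom_two, h]), evCell_two, evCell_two, evCell_two,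
      evAr_comp d h, D.hcomp_two _ _ (tgt_evAr d h)]
  interchange a a' b b' p q r := cell_ext fun D d => by
    have r' : tgt (dom a') = src (dom b') := by rw [← p, ← q, tgt_cod, src_cod, r]
    have s : cod (hcomp a b) = dom (hcomp a' b') := by rw [cod_hcomp r, dom_hcomp r', p, q]
    rw [evCell_hcomp d (by rw [dom_vcomp p, dom_vcomp q, r]), evCell_vcomp d p, evCell_vcomp d q,
      evCell_vcomp d s, evCell_hcomp d r, evCell_hcomp d r',
      D.interchange _ _ _ _ (cod_evCell d p) (cod_evCell d q) (tgt_dom_evCell d r)]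

theorem src_tAr (f g : Ar.{u}) : src (tAr f g) = tOb (src f) (src g) := ob_ext fun D d => by
  rw [evOb_src, evAr_tAr, evOb_tOb, evOb_src, evOb_src, D.src_tAr]

theorem tgt_tAr (f g : Ar.{u}) : tgt (tAr f g) = tOb (tgt f) (tgt g) := ob_ext fun D d => by
  rw [evOb_tgt, evAr_tAr, evOb_tOb, evOb_tgt, evOb_tgt, D.tgt_tAr]

theorem dom_tCell (f g : Cell.{u}) : dom (tCell f g) = tAr (dom f) (dom g) :=
  ar_ext fun D d => by
    rw [evAr_dom, evCell_tCell, evAr_tAr, evAr_dom, evAr_dom, D.dom_tCell]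

theorem cod_tCell (f g : Cell.{u}) : cod (tCell f g) = tAr (cod f) (cod g) :=
  ar_ext fun D d => by
    rw [evAr_cod, evCell_tCell, evAr_tAr, evAr_cod, evAr_cod, D.cod_tCell]

theorem tAr_one (x y : Ob.{u}) : tAr (one x) (one y) = one (tOb x y) := ar_ext fun D d => by
  rw [evAr_tAr, evAr_one, evAr_one, evAr_one, evOb_tOb, D.tAr_one]

theorem tCell_two (f g : Ar.{u}) : tCell (two f) (two g) = two (tAr f g) :=
  cell_ext fun D d => by
    rw [evCell_tCell, evCell_two, evCell_two, evCell_two, evAr_tAr, D.tCell_two]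

theorem tAr_comp {f f' g g' : Ar.{u}} (h₁ : tgt f = src g) (h₂ : tgt f' = src g') :
    tAr (comp f g) (comp f' g') = comp (tAr f f') (tAr g g') := ar_ext fun D d => by
  rw [evAr_tAr, evAr_comp d h₁, evAr_comp d h₂, evAr_comp d (by rw [tgt_tAr, src_tAr, h₁, h₂]),
    evAr_tAr, evAr_tAr, D.tAr_comp (tgt_evAr d h₁) (tgt_evAr d h₂)]

theorem tCell_vcomp {f f' g g' : Cell.{u}} (h₁ : cod f = dom g) (h₂ : cod f' = dom g') :
    tCell (vcomp f g) (vcomp f' g') = vcomp (tCell f f') (tCell g g') := cell_ext fun D d => by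
  rw [evCell_tCell, evCell_vcomp d h₁, evCell_vcomp d h₂,
    evCell_vcomp d (by rw [cod_tCell, dom_tCell, h₁, h₂]), evCell_tCell, evCell_tCell,
    D.tCell_vcomp (cod_evCell d h₁) (cod_evCell d h₂)]

theorem tCell_hcomp {f f' g g' : Cell.{u}} (h₁ : tgt (dom f) = src (dom g))
    (h₂ : tgt (dom f') = src (dom g')) :
    tCell (hcomp f g) (hcomp f' g') = hcomp (tCell f f') (tCell g g') := cell_ext fun D d => by
  rw [evCell_tCell, evCell_hcomp d h₁, evCell_hcomp d h₂,
    evCell_hcomp d (by rw [dom_tCell, dom_tCell, tgt_tAr, src_tAr, h₁, h₂]), evCell_tCell,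
    evCell_tCell, D.tCell_hcomp (tgt_dom_evCell d h₁) (tgt_dom_evCell d h₂)]

theorem tOb_assoc (x y z : Ob.{u}) : tOb (tOb x y) z = tOb x (tOb y z) := ob_ext fun D d => by
  rw [evOb_tOb, evOb_tOb, evOb_tOb, evOb_tOb, D.tOb_assoc]

theorem tAr_assoc (x y z : Ar.{u}) : tAr (tAr x y) z = tAr x (tAr y z) := ar_ext fun D d => by
  rw [evAr_tAr, evAr_tAr, evAr_tAr, evAr_tAr, D.tAr_assoc]

theorem tCell_assoc (x y z : Cell.{u}) : tCell (tCell x y) z = tCell x (tCell y z) :=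
  cell_ext fun D d => by
    rw [evCell_tCell, evCell_tCell, evCell_tCell, evCell_tCell, D.tCell_assoc]

/-- The free semi-monoidal 2-category on an object `I`, an arrow `α : I ⊗ I ⟶ I` with a right adjoint
`β` with invertible unit `η` and counit `ε`, and an associator `A` for `α`. -/
noncomputable def free : SMon2Cat.{u} where
  toTwoCat := twoCat
  tensor :=
    { ob := fun x => tOb x.1 x.2
      ar := fun f => tAr f.1 f.2
      cell := fun a => tCell a.1 a.2
      map_src := fun f => src_tAr _ _
      map_tgt := fun f => tgt_tAr _ _
      map_dom := fun f => dom_tCell _ _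
      map_cod := fun f => cod_tCell _ _
      map_one := fun x => tAr_one _ _
      map_two := fun x => tCell_two _ _
      map_comp := fun f g h => tAr_comp (congrArg Prod.fst h) (congrArg Prod.snd h)
      map_vcomp := fun f g h => tCell_vcomp (congrArg Prod.fst h) (congrArg Prod.snd h)
      map_hcomp := fun f g h => tCell_hcomp (congrArg Prod.fst h) (congrArg Prod.snd h) }
  assoc_ob := tOb_assoc
  assoc_ar := tAr_assoc
  assoc_cell := tCell_assoc

/-- The 2-functor that interprets the free semi-monoidal 2-category. -/
noncomputable def interpret : SMonFunctor free.{u} D where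
  ob := evOb d
  ar := evAr d
  cell := evCell d
  map_src f := (evOb_src d f).symm
  map_tgt f := (evOb_tgt d f).symm
  map_dom f := (evAr_dom d f).symm
  map_cod f := (evAr_cod d f).symm
  map_one x := evAr_one d x
  map_two x := evCell_two d x
  map_comp _ _ h := evAr_comp d h
  map_vcomp _ _ h := evCell_vcomp d h
  map_hcomp _ _ h := evCell_hcomp d h
  map_tOb x y := evOb_tOb d x y
  map_tAr x y := evAr_tAr d x y
  map_tCell x y := evCell_tCell d x y

theorem cell_ext' {a b : free.{u}.Cell} (h : ∀ (D : SMon2Cat.{u}) (d : UnitData D),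
    (interpret d).cell a = (interpret d).cell b) : a = b := cell_ext h

theorem ar_ext' {a b : free.{u}.Ar} (h : ∀ (D : SMon2Cat.{u}) (d : UnitData D),
    (interpret d).ar a = (interpret d).ar b) : a = b := ar_ext h

theorem ob_ext' {a b : free.{u}.Ob} (h : ∀ (D : SMon2Cat.{u}) (d : UnitData D),
    (interpret d).ob a = (interpret d).ob b) : a = b := ob_ext h

theorem isCell_mk {a : free.{u}.Cell} {f g : free.{u}.Ar}
    (h : ∀ (D : SMon2Cat.{u}) (d : UnitData D), D.IsCell ((interpret d).cell a)
      ((interpret d).ar f) ((interpret d).ar g)) : free.IsCell a f g :=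
  ⟨ar_ext' fun D d => by rw [← (interpret d).map_dom, (h D d).1],
    ar_ext' fun D d => by rw [← (interpret d).map_cod, (h D d).2]⟩

theorem isAr_mk {f : free.{u}.Ar} {x y : free.{u}.Ob}
    (h : ∀ (D : SMon2Cat.{u}) (d : UnitData D), D.IsAr ((interpret d).ar f)
      ((interpret d).ob x) ((interpret d).ob y)) : free.IsAr f x y :=
  ⟨ob_ext' fun D d => by rw [← (interpret d).map_src, (h D d).1],
    ob_ext' fun D d => by rw [← (interpret d).map_tgt, (h D d).2]⟩

/-- Both inverse laws can be tested in each interpretation. This identifies the terms added as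
formal inverses of `A`, `η` and `ε`. -/
theorem isInv_mk {a b : free.{u}.Cell} (h : ∀ (D : SMon2Cat.{u}) (d : UnitData D),
    D.IsInv ((interpret d).cell a) ∧ (interpret d).cell b = D.inv ((interpret d).cell a)) :
    free.IsInv a ∧ b = free.inv a := by
  have hb : free.IsCell b (free.cod a) (free.dom a) := isCell_mk fun D d => by
    have := h D d
    grind
  have e₁ : free.vcomp a b = free.two (free.dom a) := cell_ext' fun D d => by
    have := h D d
    rw [(interpret d).map_vcomp _ _ (by grind)]
    grind
  have e₂ : free.vcomp b a = free.two (free.cod a) := cell_ext' fun D d => by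
    have := h D d
    rw [(interpret d).map_vcomp _ _ (by grind)]
    grind
  have hi : free.IsInv a := ⟨b, hb, e₁, e₂⟩
  refine ⟨hi, ?_⟩
  refine hi.cancel_left (by grind) (by grind) ?_
  grind

/-- The generating object. -/
def genI : free.{u}.Ob := Quotient.mk ObTerm.setoid .I
/-- The generating arrow `I ⊗ I ⟶ I`. -/
def genα : free.{u}.Ar := Quotient.mk arSetoid ⟨.α, trivial⟩
/-- The generating arrow `I ⟶ I ⊗ I`. -/
def genβ : free.{u}.Ar := Quotient.mk arSetoid ⟨.β, trivial⟩
/-- The generating associator. -/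
def genA : free.{u}.Cell := Quotient.mk cellSetoid ⟨.A, trivial⟩
/-- The generating unit. -/
def genη : free.{u}.Cell := Quotient.mk cellSetoid ⟨.η, trivial⟩
/-- The generating counit. -/
def genε : free.{u}.Cell := Quotient.mk cellSetoid ⟨.ε, trivial⟩
/-- The inverse of the generating associator. -/
def genA' : free.{u}.Cell := Quotient.mk cellSetoid ⟨.A', trivial⟩
/-- The inverse of the generating unit. -/
def genη' : free.{u}.Cell := Quotient.mk cellSetoid ⟨.η', trivial⟩
/-- The inverse of the generating counit. -/
def genε' : free.{u}.Cell := Quotient.mk cellSetoid ⟨.ε', trivial⟩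

theorem interpret_I : (interpret d).ob genI = d.I := rfl
theorem interpret_α : (interpret d).ar genα = d.α := rfl
theorem interpret_β : (interpret d).ar genβ = d.β := rfl
theorem interpret_A : (interpret d).cell genA = d.A := rfl
theorem interpret_η : (interpret d).cell genη = d.η := rfl
theorem interpret_ε : (interpret d).cell genε = d.ε := rfl

attribute [grind =] interpret_I interpret_α interpret_β interpret_A interpret_η interpret_ε

theorem isAr_genα : free.{u}.IsAr genα (free.tOb genI genI) genI := isAr_mk fun D d => by
  have := d.α_ar
  grind

theorem isAr_genβ : free.{u}.IsAr genβ genI (free.tOb genI genI) := isAr_mk fun D d => by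
  have := d.α_ar
  have := d.adj.right_ar
  grind

theorem isCell_genA : free.{u}.IsCell genA (free.tAr (free.one genI) genα)
    (free.tAr genα (free.one genI)) := isCell_mk fun D d => by
  have := d.assoc.cell
  grind

theorem isCell_genη : free.{u}.IsCell genη (free.one (free.tOb genI genI))
    (free.comp genα genβ) := isCell_mk fun D d => by
  have := d.adj.unit_cell
  have := d.α_ar
  have h := isAr_genα.{u}
  have h' := isAr_genβ.{u}
  rw [(interpret d).map_comp _ _ (by grind)]
  grind

theorem isCell_genε : free.{u}.IsCell genε (free.comp genβ genα) (free.one genI) :=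
  isCell_mk fun D d => by
  have := d.adj.counit_cell
  have := d.α_ar
  have h := isAr_genα.{u}
  have h' := isAr_genβ.{u}
  rw [(interpret d).map_comp _ _ (by grind)]
  grind

theorem isInv_genA : free.{u}.IsInv genA ∧ genA' = free.{u}.inv genA := isInv_mk fun D d =>
  ⟨d.assoc.inv, rfl⟩

theorem isInv_genη : free.{u}.IsInv genη ∧ genη' = free.{u}.inv genη := isInv_mk fun D d =>
  ⟨d.η_inv, rfl⟩

theorem isInv_genε : free.{u}.IsInv genε ∧ genε' = free.{u}.inv genε := isInv_mk fun D d =>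
  ⟨d.ε_inv, rfl⟩

theorem adjunction_gen : free.{u}.IsAdjunction genα genβ genη genε where
  right_ar := by
    have h := isAr_genα.{u}
    have h' := isAr_genβ.{u}
    grind
  unit_cell := by
    have h := isAr_genα.{u}
    have h' := isCell_genη.{u}
    grind
  counit_cell := by
    have h := isAr_genα.{u}
    have h' := isCell_genε.{u}
    grind
  left_triangle := cell_ext' fun D d => by
    have h := isAr_genα.{u}
    have h' := isAr_genβ.{u}
    have hη := isCell_genη.{u}
    have hε := isCell_genε.{u}
    rw [(interpret d).map_vcomp, (interpret d).map_hcomp, (interpret d).map_hcomp,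
      (interpret d).map_two]
    · exact d.adj.left_triangle
    all_goals grind
  right_triangle := cell_ext' fun D d => by
    have h := isAr_genα.{u}
    have h' := isAr_genβ.{u}
    have hη := isCell_genη.{u}
    have hε := isCell_genε.{u}
    rw [(interpret d).map_vcomp, (interpret d).map_hcomp, (interpret d).map_hcomp,
      (interpret d).map_two]
    · exact d.adj.right_triangle
    all_goals grind

/-- The generating data of the free semi-monoidal 2-category. -/
noncomputable def gen : UnitData free.{u} where
  I := genI
  α := genα
  β := genβ
  A := genA
  η := genη
  ε := genε
  α_ar := isAr_genα
  adj := adjunction_gen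
  η_inv := isInv_genη.1
  ε_inv := isInv_genε.1
  assoc :=
    { cell := isCell_genA
      inv := isInv_genA.1
      pentagon := cell_ext' fun D d => by
        have e := d.assoc.pentagon
        have e₁ := (interpret d).map_pentagonLeft isAr_genα isCell_genA
        have e₂ := (interpret d).map_pentagonRight isAr_genα isCell_genA
        exact e₁.trans (e.trans e₂.symm) }

theorem carries_interpret : (interpret d).Carries gen d :=
  ⟨rfl, rfl, rfl, rfl, rfl, rfl⟩

section Uniqueness

variable {d} {J : SMonFunctor free.{u} D} (h : J.Carries gen d)

theorem Carries.ob_eq (h : J.Carries gen d) (x : free.{u}.Ob) : J.ob x = (interpret d).ob x := by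
  induction x using Quotient.ind with | _ x
  induction x with
  | I => exact h.map_I
  | tensor x y hx hy =>
    exact (J.map_tOb (Quotient.mk _ x) (Quotient.mk _ y)).trans (congrArg₂ D.tOb hx hy)

theorem Carries.ar_eq (h : J.Carries gen d) (f : free.{u}.Ar) : J.ar f = (interpret d).ar f := by
  induction f using Quotient.ind with | _ f
  obtain ⟨f, hf⟩ := f
  induction f with
  | α => exact h.map_α
  | β => exact h.map_β
  | one x => exact (J.map_one (Quotient.mk _ x)).trans (congrArg D.one (Carries.ob_eq h _))
  | comp f g ihf ihg =>
    have hc : free.tgt (Quotient.mk arSetoid ⟨f, hf.1⟩) =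
        free.src (Quotient.mk arSetoid ⟨g, hf.2.1⟩) := Quotient.sound hf.2.2
    have e : (Quotient.mk arSetoid ⟨.comp f g, hf⟩ : free.{u}.Ar) =
        free.comp (Quotient.mk arSetoid ⟨f, hf.1⟩) (Quotient.mk arSetoid ⟨g, hf.2.1⟩) :=
      ar_ext' fun D d => ((interpret d).map_comp _ _ hc).symm
    rw [e, J.map_comp _ _ hc, (interpret d).map_comp _ _ hc, ihf, ihg]
  | tensor f g ihf ihg =>
    exact (J.map_tAr (Quotient.mk _ ⟨f, hf.1⟩) (Quotient.mk _ ⟨g, hf.2⟩)).trans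
      (congrArg₂ D.tAr (ihf _) (ihg _))

theorem Carries.cell_eq (h : J.Carries gen d) (a : free.{u}.Cell) :
    J.cell a = (interpret d).cell a := by
  induction a using Quotient.ind with | _ a
  obtain ⟨a, ha⟩ := a
  induction a with
  | A => exact h.map_A
  | η => exact h.map_η
  | ε => exact h.map_ε
  -- Values on the formal inverses are not part of `Carries` but are forced, because 2-functors
  -- preserve inverses.
  | A' =>
    change J.cell genA' = D.inv d.A
    rw [isInv_genA.2, J.map_inv isInv_genA.1]
    exact congrArg D.inv h.map_A
  | η' =>
    change J.cell genη' = D.inv d.η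
    rw [isInv_genη.2, J.map_inv isInv_genη.1]
    exact congrArg D.inv h.map_η
  | ε' =>
    change J.cell genε' = D.inv d.ε
    rw [isInv_genε.2, J.map_inv isInv_genε.1]
    exact congrArg D.inv h.map_ε
  | two f => exact (J.map_two (Quotient.mk _ ⟨f, ha⟩)).trans (congrArg D.two (Carries.ar_eq h _))
  | vcomp f g ihf ihg =>
    have hc : free.cod (Quotient.mk cellSetoid ⟨f, ha.1⟩) =
        free.dom (Quotient.mk cellSetoid ⟨g, ha.2.1⟩) := Quotient.sound ha.2.2
    have e : (Quotient.mk cellSetoid ⟨.vcomp f g, ha⟩ : free.{u}.Cell) =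
        free.vcomp (Quotient.mk cellSetoid ⟨f, ha.1⟩) (Quotient.mk cellSetoid ⟨g, ha.2.1⟩) :=
      cell_ext' fun D d => ((interpret d).map_vcomp _ _ hc).symm
    rw [e, J.map_vcomp _ _ hc, (interpret d).map_vcomp _ _ hc, ihf, ihg]
  | hcomp f g ihf ihg =>
    have hc : free.tgt (free.dom (Quotient.mk cellSetoid ⟨f, ha.1⟩)) =
        free.src (free.dom (Quotient.mk cellSetoid ⟨g, ha.2.1⟩)) := Quotient.sound ha.2.2
    have e : (Quotient.mk cellSetoid ⟨.hcomp f g, ha⟩ : free.{u}.Cell) =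
        free.hcomp (Quotient.mk cellSetoid ⟨f, ha.1⟩) (Quotient.mk cellSetoid ⟨g, ha.2.1⟩) :=
      cell_ext' fun D d => ((interpret d).map_hcomp _ _ hc).symm
    rw [e, J.map_hcomp _ _ hc, (interpret d).map_hcomp _ _ hc, ihf, ihg]
  | tensor f g ihf ihg =>
    exact (J.map_tCell (Quotient.mk _ ⟨f, ha.1⟩) (Quotient.mk _ ⟨g, ha.2⟩)).trans
      (congrArg₂ D.tCell (ihf _) (ihg _))

end Uniqueness

theorem isFree_gen : gen.{u}.IsFree := fun D d =>
  ⟨interpret d, carries_interpret d, fun J h => by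
    apply SMonFunctor.ext
    · exact funext (Carries.ob_eq h)
    · exact funext (Carries.ar_eq h)
    · exact funext (Carries.cell_eq h)⟩

end FreeUnit

/-- The image of unit data under a semi-monoidal 2-functor. -/
def UnitData.map {C D : SMon2Cat.{u}} (F : SMonFunctor C D) (d : UnitData C) : UnitData D where
  I := F.ob d.I
  α := F.ar d.α
  β := F.ar d.β
  A := F.cell d.A
  η := F.cell d.η
  ε := F.cell d.ε
  α_ar := by
    have := d.α_ar
    grind
  adj := by
    have h₁ := d.α_ar
    have h₂ := d.adj.right_ar
    have h₃ := d.adj.unit_cell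
    have h₄ := d.adj.counit_cell
    refine ⟨by grind, by grind, by grind, ?_, ?_⟩
    · rw [← F.map_two, ← F.map_hcomp, ← F.map_hcomp, ← F.map_vcomp, d.adj.left_triangle] <;> grind
    · rw [← F.map_two, ← F.map_hcomp, ← F.map_hcomp, ← F.map_vcomp, d.adj.right_triangle] <;> grind
  η_inv := F.map_isInv d.η_inv
  ε_inv := F.map_isInv d.ε_inv
  assoc :=
    { cell := by
        have := d.assoc.cell
        grind
      inv := F.map_isInv d.assoc.inv
      pentagon := by
        rw [SMon2Cat.pentagon_iff, ← F.map_pentagonLeft d.α_ar d.assoc.cell,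
          ← F.map_pentagonRight d.α_ar d.assoc.cell]
        exact congrArg F.cell d.assoc.pentagon }

/-! ### Pseudo-inserters and their universal property -/

section Squares

variable {D : TwoCat.{u}}

/-- Pasting two compatible squares along `v`, by repeated interchange. It supplies the condition on
horizontal composites of 2-cells in the pseudo-inserter. -/
theorem TwoCat.square_comp {p p' q q' r r' s s' t v w : D.Ar} {a a' b b' κ κ' μ μ' : D.Cell}
    (hp : D.tgt p = D.src v) (hr : D.tgt r = D.src w) (ht : D.tgt t = D.src q)
    (hv : D.tgt v = D.src s) (hpr : D.tgt p = D.src r) (hqs : D.tgt q = D.src s)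
    (ha : D.IsCell a p p') (hb : D.IsCell b r r') (ha' : D.IsCell a' q q')
    (hb' : D.IsCell b' s s') (hκ : D.IsCell κ (D.comp p v) (D.comp t q))
    (hκ' : D.IsCell κ' (D.comp p' v) (D.comp t q')) (hμ : D.IsCell μ (D.comp r w) (D.comp v s))
    (hμ' : D.IsCell μ' (D.comp r' w) (D.comp v s'))
    (e : D.vcomp (D.hcomp a (D.two v)) κ' = D.vcomp κ (D.hcomp (D.two t) a'))
    (e' : D.vcomp (D.hcomp b (D.two w)) μ' = D.vcomp μ (D.hcomp (D.two v) b')) :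
    D.vcomp (D.hcomp (D.hcomp a b) (D.two w))
      (D.vcomp (D.hcomp (D.two p') μ') (D.hcomp κ' (D.two s'))) =
    D.vcomp (D.vcomp (D.hcomp (D.two p) μ) (D.hcomp κ (D.two s)))
      (D.hcomp (D.two t) (D.hcomp a' b')) := by
  have i₁ : D.vcomp (D.hcomp a (D.hcomp b (D.two w))) (D.hcomp (D.two p') μ') =
      D.hcomp a (D.vcomp (D.hcomp b (D.two w)) μ') := by
    rw [← D.interchange, D.vcomp_two_of] <;> grind
  have i₂ : D.hcomp a (D.vcomp μ (D.hcomp (D.two v) b')) =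
      D.vcomp (D.hcomp (D.two p) μ) (D.hcomp (D.hcomp a (D.two v)) b') := by
    rw [D.hcomp_assoc, ← D.interchange, D.two_vcomp_of] <;> grind
  have i₃ : D.vcomp (D.hcomp (D.hcomp a (D.two v)) b') (D.hcomp κ' (D.two s')) =
      D.hcomp (D.vcomp (D.hcomp a (D.two v)) κ') b' := by
    rw [← D.interchange, D.vcomp_two_of] <;> grind
  have i₄ : D.hcomp (D.vcomp κ (D.hcomp (D.two t) a')) b' =
      D.vcomp (D.hcomp κ (D.two s)) (D.hcomp (D.two t) (D.hcomp a' b')) := by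
    rw [← D.hcomp_assoc, ← D.interchange, D.two_vcomp_of] <;> grind
  have h₁ : D.cod (D.hcomp (D.two p') μ') = D.dom (D.hcomp κ' (D.two s')) := by grind
  have h₂ : D.cod (D.hcomp a (D.hcomp b (D.two w))) = D.dom (D.hcomp (D.two p') μ') := by grind
  have h₃ : D.cod (D.hcomp (D.two p) μ) = D.dom (D.hcomp (D.hcomp a (D.two v)) b') := by grind
  have h₄ : D.cod (D.hcomp (D.hcomp a (D.two v)) b') = D.dom (D.hcomp κ' (D.two s')) := by grind
  have h₅ : D.cod (D.hcomp (D.two p) μ) = D.dom (D.hcomp κ (D.two s)) := by grind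
  have h₆ : D.cod (D.hcomp κ (D.two s)) = D.dom (D.hcomp (D.two t) (D.hcomp a' b')) := by grind
  rw [D.hcomp_assoc _ _ _ (by grind) (by grind), ← D.vcomp_assoc _ _ _ h₂ h₁, i₁, e', i₂,
    D.vcomp_assoc _ _ _ h₃ h₄, i₃, e, i₄, D.vcomp_assoc _ _ _ h₅ h₆]

end Squares

namespace Ins

variable {B D : TwoCat.{u}} (F G : TwoFunctor B D)

/-- Objects of the pseudo-inserter of `F` and `G`: an object `x` with an equiarrow `F x ⟶ G x`. -/
@[ext]
structure Ob : Type u where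
  ob : B.Ob
  ar : D.Ar
  isAr : D.IsAr ar (F.ob ob) (G.ob ob)
  isEqui : D.IsEqui ar

variable {F G} in
/-- Arrows of the pseudo-inserter. -/
@[ext]
structure Ar : Type u where
  src : Ob F G
  tgt : Ob F G
  ar : B.Ar
  cell : D.Cell
  isAr : B.IsAr ar src.ob tgt.ob
  isCell : D.IsCell cell (D.comp (F.ar ar) tgt.ar) (D.comp src.ar (G.ar ar))
  isInv : D.IsInv cell

variable {F G} in
/-- 2-cells of the pseudo-inserter. -/
@[ext]
structure Cell : Type u where
  dom : Ar (F := F) (G := G)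
  cod : Ar (F := F) (G := G)
  cell : B.Cell
  src_eq : cod.src = dom.src
  tgt_eq : cod.tgt = dom.tgt
  isCell : B.IsCell cell dom.ar cod.ar
  square : D.vcomp (D.hcomp (F.cell cell) (D.two dom.tgt.ar)) cod.cell =
    D.vcomp dom.cell (D.hcomp (D.two dom.src.ar) (G.cell cell))

variable {F G}

/-- Identity arrows. -/
def one (x : Ob F G) : Ar (F := F) (G := G) where
  src := x
  tgt := x
  ar := B.one x.ob
  cell := D.two x.ar
  isAr := by grind
  isCell := by
    have := x.isAr
    grind
  isInv := D.isInv_two _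

/-- Identity 2-cells. -/
def two (f : Ar (F := F) (G := G)) : Cell (F := F) (G := G) where
  dom := f
  cod := f
  cell := B.two f.ar
  src_eq := rfl
  tgt_eq := rfl
  isCell := by grind
  square := by
    have := f.isAr
    have := f.isCell
    have := f.src.isAr
    have := f.tgt.isAr
    grind

open Classical in
/-- Composition of arrows. -/
noncomputable def comp (f g : Ar (F := F) (G := G)) : Ar (F := F) (G := G) :=
  if h : f.tgt = g.src then
  { src := f.src
    tgt := g.tgt
    ar := B.comp f.ar g.ar
    cell := D.vcomp (D.hcomp (D.two (F.ar f.ar)) g.cell) (D.hcomp f.cell (D.two (G.ar g.ar)))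
    isAr := by
      have := f.isAr
      have := g.isAr
      grind
    isCell := by
      have := f.isAr
      have := g.isAr
      have := f.isCell
      have := g.isCell
      have := f.src.isAr
      have := f.tgt.isAr
      have := g.tgt.isAr
      grind
    isInv := by
      have := f.isAr
      have := g.isAr
      have := f.isCell
      have := g.isCell
      have := f.src.isAr
      have := f.tgt.isAr
      have := g.tgt.isAr
      exact ((D.isInv_two _).hcomp g.isInv (by grind)).vcomp (f.isInv.hcomp (D.isInv_two _)
        (by grind)) (by grind) }
  else f

section

variable {f g : Ar (F := F) (G := G)}

@[grind =] theorem comp_src (h : f.tgt = g.src) : (comp f g).src = f.src := by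
  rw [comp, dif_pos h]

@[grind =] theorem comp_tgt (h : f.tgt = g.src) : (comp f g).tgt = g.tgt := by
  rw [comp, dif_pos h]

@[grind =] theorem comp_ar (h : f.tgt = g.src) : (comp f g).ar = B.comp f.ar g.ar := by
  rw [comp, dif_pos h]

@[grind =] theorem comp_cell (h : f.tgt = g.src) : (comp f g).cell =
    D.vcomp (D.hcomp (D.two (F.ar f.ar)) g.cell) (D.hcomp f.cell (D.two (G.ar g.ar))) := by
  rw [comp, dif_pos h]

end

open Classical in
/-- Vertical composition. -/
noncomputable def vcomp (a b : Cell (F := F) (G := G)) : Cell (F := F) (G := G) :=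
  if h : a.cod = b.dom then
  { dom := a.dom
    cod := b.cod
    cell := B.vcomp a.cell b.cell
    src_eq := by rw [b.src_eq, ← h, a.src_eq]
    tgt_eq := by rw [b.tgt_eq, ← h, a.tgt_eq]
    isCell := by
      have := a.isCell
      have := b.isCell
      grind
    square := by
      have ha := a.isCell
      have hb := b.isCell
      have e₁ := a.square
      have e₂ := b.square
      have := a.src_eq
      have := a.tgt_eq
      have h₁ := a.dom.isAr
      have h₂ := a.dom.isCell
      have h₃ := a.cod.isCell
      have h₄ := b.cod.isCell
      have := b.src_eq
      have := b.tgt_eq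
      have h₅ := a.dom.src.isAr
      have h₆ := a.dom.tgt.isAr
      rw [← h] at e₂ hb
      rw [F.map_vcomp _ _ (by grind), G.map_vcomp _ _ (by grind), D.vcomp_hcomp_two (by grind)
        (by grind), D.two_hcomp_vcomp (by grind) (by grind), D.vcomp_assoc _ _ _ (by grind)
        (by grind)]
      have e₃ : a.dom.tgt.ar = a.cod.tgt.ar := by rw [a.tgt_eq]
      have e₄ : a.dom.src.ar = a.cod.src.ar := by rw [a.src_eq]
      rw [e₃, e₂, ← D.vcomp_assoc _ _ _ (by grind) (by grind), ← e₃, e₁,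
        D.vcomp_assoc _ _ _ (by grind) (by grind), ← e₄] }
  else a

section

variable {a b : Cell (F := F) (G := G)}

theorem vcomp_dom (h : a.cod = b.dom) : (vcomp a b).dom = a.dom := by
  rw [vcomp, dif_pos h]

theorem vcomp_cod (h : a.cod = b.dom) : (vcomp a b).cod = b.cod := by
  rw [vcomp, dif_pos h]

theorem vcomp_cell (h : a.cod = b.dom) : (vcomp a b).cell = B.vcomp a.cell b.cell := by
  rw [vcomp, dif_pos h]

end

open Classical in
/-- Horizontal composition. -/
noncomputable def hcomp (a b : Cell (F := F) (G := G)) : Cell (F := F) (G := G) :=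
  if h : a.dom.tgt = b.dom.src then
  have h' : a.cod.tgt = b.cod.src := by rw [a.tgt_eq, h, b.src_eq]
  { dom := comp a.dom b.dom
    cod := comp a.cod b.cod
    cell := B.hcomp a.cell b.cell
    src_eq := by rw [comp_src h, comp_src h', a.src_eq]
    tgt_eq := by rw [comp_tgt h, comp_tgt h', b.tgt_eq]
    isCell := by
      have := a.isCell
      have := b.isCell
      have := a.dom.isAr
      have := b.dom.isAr
      rw [comp_ar h, comp_ar h']
      grind
    square := by
      have ha := a.isCell
      have hb := b.isCell
      have h₁ := a.dom.isAr
      have h₂ := b.dom.isAr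
      have k₁ := a.dom.isCell
      have k₂ := b.dom.isCell
      have k₃ := a.cod.isCell
      have k₄ := b.cod.isCell
      have l₁ := a.dom.src.isAr
      have l₂ := a.dom.tgt.isAr
      have l₃ := b.dom.tgt.isAr
      have e₁ := a.square
      have e₂ := b.square
      rw [comp_src h, comp_tgt h, comp_cell h, comp_cell h', F.map_hcomp _ _ (by grind),
        G.map_hcomp _ _ (by grind)]
      rw [a.src_eq, a.tgt_eq] at k₃
      rw [b.src_eq, b.tgt_eq, ← h] at k₄
      rw [← h] at k₂ h₂ e₂
      exact D.square_comp (by grind) (by grind) (by grind) (by grind) (by grind) (by grind)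
        (by grind) (by grind) (by grind) (by grind) k₁ k₃ k₂ k₄ e₁ e₂ }
  else a

section

variable {a b : Cell (F := F) (G := G)}

theorem hcomp_dom (h : a.dom.tgt = b.dom.src) : (hcomp a b).dom = comp a.dom b.dom := by
  rw [hcomp, dif_pos h]

theorem hcomp_cod (h : a.dom.tgt = b.dom.src) : (hcomp a b).cod = comp a.cod b.cod := by
  rw [hcomp, dif_pos h]

theorem hcomp_cell (h : a.dom.tgt = b.dom.src) : (hcomp a b).cell = B.hcomp a.cell b.cell := by
  rw [hcomp, dif_pos h]

end

end Ins

namespace Ins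

variable {B D : TwoCat.{u}} {F G : TwoFunctor B D}

theorem comp_assoc (f g h : Ar (F := F) (G := G)) (p : f.tgt = g.src) (q : g.tgt = h.src) :
    comp (comp f g) h = comp f (comp g h) := by
  have p' : (comp f g).tgt = h.src := by rw [comp_tgt p, q]
  have q' : f.tgt = (comp g h).src := by rw [comp_src q, p]
  have h₁ := f.isAr
  have h₂ := g.isAr
  have h₃ := h.isAr
  apply Ar.ext
  · rw [comp_src p', comp_src p, comp_src q']
  · rw [comp_tgt p', comp_tgt q', comp_tgt q]
  · rw [comp_ar p', comp_ar p, comp_ar q', comp_ar q, B.comp_assoc _ _ _ (by grind) (by grind)]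
  · have k₁ := f.isCell
    have k₂ := g.isCell
    have k₃ := h.isCell
    have l₁ := f.src.isAr
    have l₂ := f.tgt.isAr
    have l₃ := g.tgt.isAr
    have l₄ := h.tgt.isAr
    rw [← p] at k₂ h₂
    rw [← q] at k₃ h₃
    have e₁ : D.hcomp (D.two (F.ar (B.comp f.ar g.ar))) h.cell =
        D.hcomp (D.two (F.ar f.ar)) (D.hcomp (D.two (F.ar g.ar)) h.cell) := by
      rw [← D.hcomp_assoc, D.hcomp_two, F.map_comp] <;> grind
    have e₂ : D.hcomp f.cell (D.two (G.ar (B.comp g.ar h.ar))) =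
        D.hcomp (D.hcomp f.cell (D.two (G.ar g.ar))) (D.two (G.ar h.ar)) := by
      rw [D.hcomp_assoc, D.hcomp_two, G.map_comp] <;> grind
    have e₃ : D.hcomp (D.hcomp (D.two (F.ar f.ar)) g.cell) (D.two (G.ar h.ar)) =
        D.hcomp (D.two (F.ar f.ar)) (D.hcomp g.cell (D.two (G.ar h.ar))) := by
      rw [D.hcomp_assoc] <;> grind
    have c₁ : D.cod (D.hcomp (D.two (F.ar f.ar)) (D.hcomp (D.two (F.ar g.ar)) h.cell)) =
        D.dom (D.hcomp (D.two (F.ar f.ar)) (D.hcomp g.cell (D.two (G.ar h.ar)))) := by grind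
    have c₂ : D.cod (D.hcomp (D.hcomp (D.two (F.ar f.ar)) g.cell) (D.two (G.ar h.ar))) =
        D.dom (D.hcomp (D.hcomp f.cell (D.two (G.ar g.ar))) (D.two (G.ar h.ar))) := by grind
    rw [e₃] at c₂
    rw [comp_cell p', comp_cell q', comp_cell p, comp_cell q, comp_ar p, comp_ar q, e₁, e₂,
      D.vcomp_hcomp_two (by grind) (by grind), D.two_hcomp_vcomp (by grind) (by grind), e₃,
      D.vcomp_assoc _ _ _ c₁ c₂]

theorem one_comp (f : Ar (F := F) (G := G)) : comp (one f.src) f = f := by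
  have h : (one f.src).tgt = f.src := rfl
  have h₁ := f.isAr
  have h₂ := f.isCell
  have h₃ := f.src.isAr
  have h₄ := f.tgt.isAr
  apply Ar.ext
  · rw [comp_src h]; rfl
  · rw [comp_tgt h]
  · rw [comp_ar h]
    simp only [one]
    grind
  · rw [comp_cell h]
    simp only [one]
    grind

theorem comp_one (f : Ar (F := F) (G := G)) : comp f (one f.tgt) = f := by
  have h : f.tgt = (one f.tgt).src := rfl
  have h₁ := f.isAr
  have h₂ := f.isCell
  have h₃ := f.src.isAr
  have h₄ := f.tgt.isAr
  apply Ar.ext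
  · rw [comp_src h]
  · rw [comp_tgt h]; rfl
  · rw [comp_ar h]
    simp only [one]
    grind
  · rw [comp_cell h]
    simp only [one]
    grind

variable (F G) in
/-- The pseudo-inserter of `F` and `G`. -/
noncomputable def _root_.TwoCat.inserter : TwoCat.{u} where
  Ob := Ob F G
  Ar := Ar (F := F) (G := G)
  Cell := Cell (F := F) (G := G)
  src := Ar.src
  tgt := Ar.tgt
  dom := Cell.dom
  cod := Cell.cod
  one := one
  two := two
  comp := comp
  vcomp := vcomp
  hcomp := hcomp
  src_cod a := a.src_eq
  tgt_cod a := a.tgt_eq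
  src_one x := rfl
  tgt_one x := rfl
  src_comp _ _ h := comp_src h
  tgt_comp _ _ h := comp_tgt h
  one_comp := one_comp
  comp_one := comp_one
  comp_assoc := comp_assoc
  dom_two f := rfl
  cod_two f := rfl
  dom_vcomp a b h := vcomp_dom h
  cod_vcomp a b h := vcomp_cod h
  two_vcomp a := by
    have h : (two a.dom).cod = a.dom := rfl
    have := a.isCell
    apply Cell.ext
    · rw [vcomp_dom h]; rfl
    · rw [vcomp_cod h]
    · rw [vcomp_cell h]
      simp only [two]
      grind
  vcomp_two a := by
    have h : a.cod = (two a.cod).dom := rfl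
    have := a.isCell
    apply Cell.ext
    · rw [vcomp_dom h]
    · rw [vcomp_cod h]; rfl
    · rw [vcomp_cell h]
      simp only [two]
      grind
  vcomp_assoc a b c p q := by
    have p' : (vcomp a b).cod = c.dom := by rw [vcomp_cod p, q]
    have q' : a.cod = (vcomp b c).dom := by rw [vcomp_dom q, p]
    have h₁ := a.isCell
    have h₂ := b.isCell
    have h₃ := c.isCell
    apply Cell.ext
    · rw [vcomp_dom p', vcomp_dom q', vcomp_dom p]
    · rw [vcomp_cod p', vcomp_cod q', vcomp_cod q]
    · rw [vcomp_cell p', vcomp_cell q', vcomp_cell p, vcomp_cell q,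
        B.vcomp_assoc _ _ _ (by grind) (by grind)]
  dom_hcomp a b h := hcomp_dom h
  cod_hcomp a b h := hcomp_cod h
  one_hcomp a := by
    have h : (two (one a.dom.src)).dom.tgt = a.dom.src := rfl
    have h₁ := a.isCell
    have h₂ := a.dom.isAr
    apply Cell.ext
    · rw [hcomp_dom h]
      exact one_comp _
    · rw [hcomp_cod h]
      change comp (one a.dom.src) a.cod = a.cod
      rw [← a.src_eq, one_comp]
    · rw [hcomp_cell h]
      change B.hcomp (B.two (B.one a.dom.src.ob)) a.cell = a.cell
      grind
  hcomp_one a := by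
    have h : a.dom.tgt = (two (one a.dom.tgt)).dom.src := rfl
    have h₁ := a.isCell
    have h₂ := a.dom.isAr
    apply Cell.ext
    · rw [hcomp_dom h]
      exact comp_one _
    · rw [hcomp_cod h]
      change comp a.cod (one a.dom.tgt) = a.cod
      rw [← a.tgt_eq, comp_one]
    · rw [hcomp_cell h]
      change B.hcomp a.cell (B.two (B.one a.dom.tgt.ob)) = a.cell
      grind
  hcomp_assoc a b c p q := by
    have p' : (hcomp a b).dom.tgt = c.dom.src := by rw [hcomp_dom p, comp_tgt p, q]
    have q' : a.dom.tgt = (hcomp b c).dom.src := by rw [hcomp_dom q, comp_src q, p]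
    have h₁ := a.isCell
    have h₂ := b.isCell
    have h₃ := c.isCell
    have k₁ := a.dom.isAr
    have k₂ := b.dom.isAr
    have k₃ := c.dom.isAr
    apply Cell.ext
    · rw [hcomp_dom p', hcomp_dom q', hcomp_dom p, hcomp_dom q, comp_assoc _ _ _ p q]
    · rw [hcomp_cod p', hcomp_cod q', hcomp_cod p, hcomp_cod q, comp_assoc]
      · rw [a.tgt_eq, b.src_eq, p]
      · rw [b.tgt_eq, c.src_eq, q]
    · rw [hcomp_cell p', hcomp_cell q', hcomp_cell p, hcomp_cell q,
        B.hcomp_assoc _ _ _ (by grind) (by grind)]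
  hcomp_two f g h := by
    have h' : (two f).dom.tgt = (two g).dom.src := h
    have h₁ := f.isAr
    have h₂ := g.isAr
    apply Cell.ext
    · exact hcomp_dom h'
    · exact hcomp_cod h'
    · rw [hcomp_cell h']
      simp only [two]
      rw [comp_ar h, B.hcomp_two _ _ (by grind)]
  interchange a a' b b' p q r := by
    have h₁ : (vcomp a a').dom.tgt = (vcomp b b').dom.src := by rw [vcomp_dom p, vcomp_dom q, r]
    have h₂ : a'.dom.tgt = b'.dom.src := by rw [← p, ← q, a.tgt_eq, b.src_eq, r]
    have h₃ : (hcomp a b).cod = (hcomp a' b').dom := by rw [hcomp_cod r, hcomp_dom h₂, p, q]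
    have k₁ := a.isCell
    have k₂ := b.isCell
    have k₃ := a'.isCell
    have k₄ := b'.isCell
    have k₅ := a.dom.isAr
    have k₆ := b.dom.isAr
    apply Cell.ext
    · rw [hcomp_dom h₁, vcomp_dom p, vcomp_dom q, vcomp_dom h₃, hcomp_dom r]
    · rw [hcomp_cod h₁, vcomp_cod p, vcomp_cod q, vcomp_cod h₃, hcomp_cod h₂]
    · rw [hcomp_cell h₁, vcomp_cell p, vcomp_cell q, vcomp_cell h₃, hcomp_cell r, hcomp_cell h₂,
        B.interchange _ _ _ _ (by grind) (by grind) (by grind)]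

variable (F G) in
/-- The projection from the pseudo-inserter. -/
noncomputable def proj : TwoFunctor (TwoCat.inserter F G) B where
  ob := Ob.ob
  ar := Ar.ar
  cell := Cell.cell
  map_src f := f.isAr.1
  map_tgt f := f.isAr.2
  map_dom a := a.isCell.1
  map_cod a := a.isCell.2
  map_one x := rfl
  map_two f := rfl
  map_comp f g h := comp_ar h
  map_vcomp a b h := vcomp_cell h
  map_hcomp a b h := hcomp_cell h

variable (F G) in
/-- The universal transformation. -/
noncomputable def transf : TransfData (TwoCat.inserter F G) D where
  app := Ob.ar
  nat := Ar.cell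

theorem isPseudonatural_transf :
    (transf F G).IsPseudonatural ((proj F G).comp F) ((proj F G).comp G) where
  app_ar x := x.isAr
  nat_cell f := f.isCell
  nat_inv f := f.isInv
  nat_one x := rfl
  nat_comp f g h := comp_cell h
  nat_nat a := a.square

theorem isEqui_transf (x : (TwoCat.inserter F G).Ob) : D.IsEqui ((transf F G).app x) := x.isEqui

section Lift

variable {E : TwoCat.{u}} (H : TwoFunctor E B) (t : TransfData E D)
  (ht : t.IsPseudonatural (H.comp F) (H.comp G)) (he : ∀ x, D.IsEqui (t.app x))

/-- The object of the pseudo-inserter given by a pseudo-natural transformation. -/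
noncomputable def liftOb (x : E.Ob) : Ob F G := ⟨H.ob x, t.app x, ht.app_ar x, he x⟩

/-- The arrow of the pseudo-inserter given by a pseudo-natural transformation. -/
noncomputable def liftAr (f : E.Ar) : Ar (F := F) (G := G) where
  src := liftOb H t ht he (E.src f)
  tgt := liftOb H t ht he (E.tgt f)
  ar := H.ar f
  cell := t.nat f
  isAr := ⟨H.map_src f, H.map_tgt f⟩
  isCell := ht.nat_cell f
  isInv := ht.nat_inv f

/-- The 2-cell of the pseudo-inserter given by a pseudo-natural transformation. -/
noncomputable def liftCell (a : E.Cell) : Cell (F := F) (G := G) where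
  dom := liftAr H t ht he (E.dom a)
  cod := liftAr H t ht he (E.cod a)
  cell := H.cell a
  src_eq := congrArg (liftOb H t ht he) (E.src_cod a)
  tgt_eq := congrArg (liftOb H t ht he) (E.tgt_cod a)
  isCell := ⟨H.map_dom a, H.map_cod a⟩
  square := ht.nat_nat a

theorem liftAr_comp (f g : E.Ar) (h : E.tgt f = E.src g) : liftAr H t ht he (E.comp f g) =
    comp (liftAr H t ht he f) (liftAr H t ht he g) := by
  have h' : (liftAr H t ht he f).tgt = (liftAr H t ht he g).src := congrArg (liftOb H t ht he) h
  apply Ar.ext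
  · exact (congrArg (liftOb H t ht he) (E.src_comp f g h)).trans (comp_src h').symm
  · exact (congrArg (liftOb H t ht he) (E.tgt_comp f g h)).trans (comp_tgt h').symm
  · exact (H.map_comp f g h).trans (comp_ar h').symm
  · exact (ht.nat_comp f g h).trans (comp_cell h').symm

/-- The universal property of the pseudo-inserter. -/
noncomputable def lift : TwoFunctor E (TwoCat.inserter F G) where
  ob := liftOb H t ht he
  ar := liftAr H t ht he
  cell := liftCell H t ht he
  map_src f := rfl
  map_tgt f := rfl
  map_dom a := rfl
  map_cod a := rfl
  map_one x := by
    apply Ar.ext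
    · exact congrArg (liftOb H t ht he) (E.src_one x)
    · exact congrArg (liftOb H t ht he) (E.tgt_one x)
    · exact H.map_one x
    · exact ht.nat_one x
  map_two f := by
    apply Cell.ext
    · exact congrArg (liftAr H t ht he) (E.dom_two f)
    · exact congrArg (liftAr H t ht he) (E.cod_two f)
    · exact H.map_two f
  map_comp := liftAr_comp H t ht he
  map_vcomp a b h := by
    have h' : (liftCell H t ht he a).cod = (liftCell H t ht he b).dom :=
      congrArg (liftAr H t ht he) h
    apply Cell.ext
    · exact (congrArg (liftAr H t ht he) (E.dom_vcomp a b h)).trans (vcomp_dom h').symm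
    · exact (congrArg (liftAr H t ht he) (E.cod_vcomp a b h)).trans (vcomp_cod h').symm
    · exact (H.map_vcomp a b h).trans (vcomp_cell h').symm
  map_hcomp a b h := by
    have h' : (liftCell H t ht he a).dom.tgt = (liftCell H t ht he b).dom.src :=
      congrArg (liftOb H t ht he) h
    apply Cell.ext
    · exact ((congrArg (liftAr H t ht he) (E.dom_hcomp a b h)).trans (liftAr_comp H t ht he _ _ h)).trans
        (hcomp_dom h').symm
    · exact ((congrArg (liftAr H t ht he) (E.cod_hcomp a b h)).trans
        (liftAr_comp H t ht he _ _ (by rw [E.tgt_cod, E.src_cod, h]))).trans (hcomp_cod h').symm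
    · exact (H.map_hcomp a b h).trans (hcomp_cell h').symm

end Lift

section Tensor

variable {B : SMon2Cat.{u}} {F G : TwoFunctor B.toTwoCat D}

/-- The tensor product of the underlying objects, arrows and 2-cells. -/
noncomputable abbrev projTensor (F G : TwoFunctor B.toTwoCat D) :
    TwoFunctor ((TwoCat.inserter F G).prod (TwoCat.inserter F G)) B.toTwoCat :=
  ((proj F G).prodMap (proj F G)).comp B.tensor

/-- A tensor product on the pseudo-inserter is given by a transformation in two variables. -/
noncomputable def smon (t : TransfData ((TwoCat.inserter F G).prod (TwoCat.inserter F G)) D)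
    (ht : t.IsPseudonatural ((projTensor F G).comp F) ((projTensor F G).comp G))
    (he : ∀ x, D.IsEqui (t.app x))
    (hob : ∀ x y z, t.app (liftOb (projTensor F G) t ht he (x, y), z) =
      t.app (x, liftOb (projTensor F G) t ht he (y, z)))
    (har : ∀ x y z, t.nat (liftAr (projTensor F G) t ht he (x, y), z) =
      t.nat (x, liftAr (projTensor F G) t ht he (y, z))) : SMon2Cat.{u} where
  toTwoCat := TwoCat.inserter F G
  tensor := lift (projTensor F G) t ht he
  assoc_ob x y z := Ob.ext (B.assoc_ob _ _ _) (hob x y z)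
  assoc_ar x y z := Ar.ext (Ob.ext (B.assoc_ob _ _ _) (hob _ _ _))
    (Ob.ext (B.assoc_ob _ _ _) (hob _ _ _)) (B.assoc_ar _ _ _) (har x y z)
  -- No further hypothesis is needed for 2-cells: a 2-cell of the pseudo-inserter with given
  -- boundary is a 2-cell of `B` subject to a condition.
  assoc_cell x y z := Cell.ext
    (Ar.ext (Ob.ext (B.assoc_ob _ _ _) (hob _ _ _)) (Ob.ext (B.assoc_ob _ _ _) (hob _ _ _))
      (B.assoc_ar _ _ _) (har _ _ _))
    (Ar.ext (Ob.ext (B.assoc_ob _ _ _) (hob _ _ _)) (Ob.ext (B.assoc_ob _ _ _) (hob _ _ _))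
      (B.assoc_ar _ _ _) (har _ _ _))
    (B.assoc_cell _ _ _)

variable {t : TransfData ((TwoCat.inserter F G).prod (TwoCat.inserter F G)) D}
    {ht : t.IsPseudonatural ((projTensor F G).comp F) ((projTensor F G).comp G)}
    {he : ∀ x, D.IsEqui (t.app x)}
    {hob : ∀ x y z, t.app (liftOb (projTensor F G) t ht he (x, y), z) =
      t.app (x, liftOb (projTensor F G) t ht he (y, z))}
    {har : ∀ x y z, t.nat (liftAr (projTensor F G) t ht he (x, y), z) =
      t.nat (x, liftAr (projTensor F G) t ht he (y, z))}

variable (t ht he hob har) in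
/-- The projection from the pseudo-inserter, as a semi-monoidal 2-functor. -/
noncomputable def smonProj : SMonFunctor (smon t ht he hob har) B where
  toTwoFunctor := proj F G
  map_tOb _ _ := rfl
  map_tAr _ _ := rfl
  map_tCell _ _ := rfl

end Tensor

end Ins

/-! ### Mates, and lifting unit data to a pseudo-inserter -/

namespace TwoCat

variable {D : TwoCat.{u}} {p p' q q' s t : D.Ar} {η₀ ε₀ η₁ ε₁ κ : D.Cell}

/-- The mate of an invertible square along adjoint equivalences. -/
theorem exists_mate (h₀ : D.IsAdjunction p p' η₀ ε₀) (h₁ : D.IsAdjunction q q' η₁ ε₁)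
    (hε₁ : D.IsInv ε₁) (hε₀ : D.IsInv ε₀) (hq : D.IsEqui q)
    (ht : D.IsAr t (D.src p) (D.src q)) (hs : D.IsAr s (D.tgt p) (D.tgt q))
    (hκ : D.IsCell κ (D.comp p s) (D.comp t q)) (hκi : D.IsInv κ) :
    ∃ κ', D.IsCell κ' (D.comp p' t) (D.comp s q') ∧ D.IsInv κ' ∧
      D.vcomp (D.vcomp (D.hcomp (D.two p') κ) (D.hcomp κ' (D.two q))) (D.hcomp (D.two s) ε₁) =
        D.hcomp ε₀ (D.two s) := by
  have a₀ := h₀.right_ar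
  have a₁ := h₁.right_ar
  have e₀ := h₀.counit_cell
  have e₁ := h₁.counit_cell
  have i₁ : D.IsInv (D.hcomp (D.two p') κ) := (D.isInv_two _).hcomp hκi (by grind)
  have i₂ : D.IsInv (D.hcomp (D.two s) ε₁) := (D.isInv_two _).hcomp hε₁ (by grind)
  have i₃ : D.IsInv (D.hcomp ε₀ (D.two s)) := hε₀.hcomp (D.isInv_two _) (by grind)
  have c₁ : D.IsCell (D.hcomp (D.two p') κ) (D.comp p' (D.comp p s))
    (D.comp (D.comp p' t) q) := by grind
  have c₂ : D.IsCell (D.hcomp (D.two s) ε₁) (D.comp (D.comp s q') q) s := by grind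
  have c₃ : D.IsCell (D.hcomp ε₀ (D.two s)) (D.comp p' (D.comp p s)) s := by grind
  have c : D.IsCell (D.vcomp (D.inv (D.hcomp (D.two p') κ))
      (D.vcomp (D.hcomp ε₀ (D.two s)) (D.inv (D.hcomp (D.two s) ε₁))))
      (D.comp (D.comp p' t) q) (D.comp (D.comp s q') q) := by grind
  obtain ⟨κ', hκ', e⟩ := hq.whisker_right_full (by grind) (by grind) (by grind) c
  have ci : D.IsInv (D.hcomp κ' (D.two q)) := by
    rw [e]
    exact i₁.inv.vcomp (i₃.vcomp i₂.inv (by grind)) (by grind)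
  refine ⟨κ', hκ', hq.whisker_right_isInv (by grind) ci, ?_⟩
  rw [e, vcomp_inv_cancel i₁ (by grind), D.vcomp_assoc _ _ _ (by grind) (by grind),
    i₂.inv_spec.2.2.2, D.vcomp_two_of (by grind)]

/-- The mate is determined by its compatibility with the counits, and compatibility with the units
follows. Once the equation is whiskered with `q`, composed with `ε₁` and preceded by `κ`, the counit
equation and the left triangle identities of both adjunctions reduce both sides to `κ`. -/
theorem mate_unit (h₀ : D.IsAdjunction p p' η₀ ε₀) (h₁ : D.IsAdjunction q q' η₁ ε₁)
    (hε₁ : D.IsInv ε₁) (hq : D.IsEqui q)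
    (ht : D.IsAr t (D.src p) (D.src q)) (hs : D.IsAr s (D.tgt p) (D.tgt q))
    (hκ : D.IsCell κ (D.comp p s) (D.comp t q)) (hκi : D.IsInv κ) {κ' : D.Cell}
    (hκ' : D.IsCell κ' (D.comp p' t) (D.comp s q'))
    (e : D.vcomp (D.vcomp (D.hcomp (D.two p') κ) (D.hcomp κ' (D.two q))) (D.hcomp (D.two s) ε₁) =
        D.hcomp ε₀ (D.two s)) :
    D.vcomp (D.hcomp η₀ (D.two t)) (D.vcomp (D.hcomp (D.two p) κ') (D.hcomp κ (D.two q'))) =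
      D.hcomp (D.two t) η₁ := by
  have a₀ := h₀.right_ar
  have a₁ := h₁.right_ar
  have c₀ := h₀.counit_cell
  have c₁ := h₁.counit_cell
  have u₀ := h₀.unit_cell
  have u₁ := h₁.unit_cell
  have k₁ : D.IsCell (D.hcomp (D.two p') κ) (D.comp p' (D.comp p s)) (D.comp p' (D.comp t q)) := by
    grind
  have k₂ : D.IsCell (D.hcomp κ' (D.two q)) (D.comp p' (D.comp t q)) (D.comp s (D.comp q' q)) := by
    grind
  have k₃ : D.IsCell (D.hcomp (D.two s) ε₁) (D.comp s (D.comp q' q)) s := by grind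
  have k₄ : D.IsCell (D.hcomp η₀ (D.two t)) t (D.comp p (D.comp p' t)) := by grind
  have k₅ : D.IsCell (D.hcomp (D.two p) κ') (D.comp p (D.comp p' t)) (D.comp p (D.comp s q')) := by
    grind
  have k₆ : D.IsCell (D.hcomp κ (D.two q')) (D.comp p (D.comp s q')) (D.comp t (D.comp q q')) := by
    grind
  have k₇ : D.IsCell (D.hcomp (D.two t) η₁) t (D.comp t (D.comp q q')) := by grind
  have k₈ : D.IsCell (D.hcomp (D.two (D.comp t q)) ε₁) (D.comp t (D.comp q (D.comp q' q)))
    (D.comp t q) := by grind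
  have i : D.IsInv (D.hcomp (D.two (D.comp t q)) ε₁) := (D.isInv_two _).hcomp hε₁ (by grind)
  have s₁ : D.vcomp (D.hcomp (D.hcomp (D.two t) η₁) (D.two q)) (D.hcomp (D.two (D.comp t q)) ε₁) =
      D.two (D.comp t q) := by
    have := h₁.left_triangle
    rw [D.two_comp_hcomp, D.hcomp_assoc, ← D.two_hcomp_vcomp, this, D.hcomp_two] <;> grind
  have s₂ : D.vcomp (D.hcomp (D.hcomp κ (D.two q')) (D.two q)) (D.hcomp (D.two (D.comp t q)) ε₁) =
      D.vcomp (D.hcomp (D.two p) (D.hcomp (D.two s) ε₁)) κ := by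
    have r₁ := D.hcomp_eq_right_left (a := κ) (b := ε₁) c₁.1 hκ.2 (by grind)
    have r₂ := D.hcomp_eq_left_right (a := κ) (b := ε₁) hκ.1 c₁.2 (by grind)
    rw [D.hcomp_assoc, D.hcomp_two, r₁, ← r₂, D.hcomp_one_of, D.two_comp_hcomp] <;> grind
  have s₃ : D.vcomp κ (D.hcomp (D.hcomp η₀ (D.two t)) (D.two q)) =
      D.vcomp (D.hcomp (D.hcomp η₀ (D.two p)) (D.two s))
        (D.hcomp (D.two p) (D.hcomp (D.two p') κ)) := by
    have r₁ := D.hcomp_eq_right_left (a := η₀) (b := κ) hκ.1 u₀.2 (by grind)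
    have r₂ := D.hcomp_eq_left_right (a := η₀) (b := κ) u₀.1 hκ.2 (by grind)
    rw [D.one_hcomp_of (by grind)] at r₂
    rw [D.hcomp_assoc _ _ _ (by grind) (by grind), D.hcomp_two _ _ (by grind), r₂, ← r₁,
      D.hcomp_assoc _ _ _ (by grind) (by grind), D.hcomp_two _ _ (by grind),
      ← D.hcomp_assoc _ _ _ (by grind) (by grind), D.hcomp_two _ _ (by grind)]
  have s₄ : D.vcomp (D.hcomp (D.hcomp η₀ (D.two p)) (D.two s))
      (D.hcomp (D.two p) (D.hcomp ε₀ (D.two s))) = D.two (D.comp p s) := by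
    have := h₀.left_triangle
    rw [← D.hcomp_assoc, ← D.vcomp_hcomp_two, this, D.hcomp_two] <;> grind
  have m₁ : D.IsCell (D.hcomp (D.hcomp η₀ (D.two t)) (D.two q)) (D.comp t q)
    (D.comp p (D.comp p' (D.comp t q))) := by grind
  have m₂ : D.IsCell (D.hcomp (D.hcomp (D.two p) κ') (D.two q)) (D.comp p (D.comp p' (D.comp t q)))
    (D.comp p (D.comp s (D.comp q' q))) := by grind
  have m₃ : D.IsCell (D.hcomp (D.hcomp κ (D.two q')) (D.two q)) (D.comp p (D.comp s (D.comp q' q)))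
    (D.comp t (D.comp q (D.comp q' q))) := by grind
  have m₄ : D.IsCell (D.hcomp (D.two p) (D.hcomp (D.two s) ε₁)) (D.comp p (D.comp s (D.comp q' q)))
    (D.comp p s) := by grind
  have m₅ : D.IsCell (D.hcomp (D.hcomp η₀ (D.two p)) (D.two s)) (D.comp p s)
    (D.comp p (D.comp p' (D.comp p s))) := by grind
  have m₆ : D.IsCell (D.hcomp (D.two p) (D.hcomp (D.two p') κ))
    (D.comp p (D.comp p' (D.comp p s))) (D.comp p (D.comp p' (D.comp t q))) := by grind
  have s₅ : D.vcomp (D.hcomp (D.two p) (D.hcomp (D.two p') κ))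
      (D.vcomp (D.hcomp (D.hcomp (D.two p) κ') (D.two q))
        (D.hcomp (D.two p) (D.hcomp (D.two s) ε₁))) =
      D.hcomp (D.two p) (D.hcomp ε₀ (D.two s)) := by
    rw [D.hcomp_assoc (D.two p) κ' _ (by grind) (by grind), ← D.two_hcomp_vcomp (by grind) (by grind),
      ← D.two_hcomp_vcomp (by grind) (by grind), ← D.vcomp_assoc _ _ _ (by grind) (by grind), e]
  refine hq.whisker_right_cancel (by grind) (by grind) (by grind) ?_
  refine i.cancel_right (by grind) (by grind) ?_
  refine hκi.cancel_left (by grind) (by grind) ?_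
  rw [s₁, D.vcomp_two_of hκ.2, D.vcomp_hcomp_two (by grind) (by grind),
    D.vcomp_hcomp_two (by grind) (by grind), D.vcomp_assoc _ _ _ (by grind) (by grind),
    D.vcomp_assoc _ _ _ (by grind) (by grind), s₂, ← D.vcomp_assoc _ _ _ (by grind) (by grind), s₃,
    D.vcomp_assoc _ _ _ (by grind) (by grind)]
  clear s₁ s₂ s₃ e k₁ k₂ k₃ k₄ k₅ k₆ k₇ k₈ i
  generalize D.hcomp (D.hcomp η₀ (D.two p)) (D.two s) = X₁ at *
  generalize D.hcomp (D.two p) (D.hcomp (D.two p') κ) = X₂ at *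
  generalize D.hcomp (D.hcomp (D.two p) κ') (D.two q) = X₃ at *
  generalize D.hcomp (D.two p) (D.hcomp (D.two s) ε₁) = X₄ at *
  rw [← D.vcomp_assoc X₃ _ _ (by grind) (by grind), ← D.vcomp_assoc X₂ _ _ (by grind) (by grind), s₅,
    ← D.vcomp_assoc X₁ _ _ (by grind) (by grind), s₄, D.two_vcomp_of (by grind)]

end TwoCat

theorem TwoFunctor.map_isAdjunction {C D : TwoCat.{u}} (F : TwoFunctor C D) {α β : C.Ar}
    {η ε : C.Cell} (h : C.IsAdjunction α β η ε) :
    D.IsAdjunction (F.ar α) (F.ar β) (F.cell η) (F.cell ε) := by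
  have h₂ := h.right_ar
  have h₃ := h.unit_cell
  have h₄ := h.counit_cell
  refine ⟨by grind, by grind, by grind, ?_, ?_⟩
  · rw [← F.map_two, ← F.map_hcomp, ← F.map_hcomp, ← F.map_vcomp, h.left_triangle] <;> grind
  · rw [← F.map_two, ← F.map_hcomp, ← F.map_hcomp, ← F.map_vcomp, h.right_triangle] <;> grind

/-- Unit data can be lifted along a locally faithful semi-monoidal 2-functor that reflects
invertibility as soon as its constituents can. -/
theorem UnitData.exists_lift {S B : SMon2Cat.{u}} (P : SMonFunctor S B) (d : UnitData B)
    (hP : ∀ a b, S.dom a = S.dom b → S.cod a = S.cod b → P.cell a = P.cell b → a = b)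
    (hi : ∀ a, B.IsInv (P.cell a) → S.IsInv a)
    {x : S.Ob} {α β : S.Ar} {A η ε : S.Cell} (hx : P.ob x = d.I) (hα : P.ar α = d.α)
    (hβ : P.ar β = d.β) (hA : P.cell A = d.A) (hη : P.cell η = d.η) (hε : P.cell ε = d.ε)
    (tα : S.IsAr α (S.tOb x x) x) (tβ : S.IsAr β x (S.tOb x x))
    (tA : S.IsCell A (S.obAr x α) (S.arOb α x))
    (tη : S.IsCell η (S.one (S.tOb x x)) (S.comp α β))
    (tε : S.IsCell ε (S.comp β α) (S.one x)) :
    ∃ d' : UnitData S, P.Carries d' d ∧ d'.I = x ∧ d'.α = α := by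
  refine ⟨⟨x, α, β, A, η, ε, tα, ⟨by grind, by grind, by grind, ?_, ?_⟩,
    hi _ (hη ▸ d.η_inv), hi _ (hε ▸ d.ε_inv), ⟨tA, hi _ (hA ▸ d.assoc.inv), ?_⟩⟩,
    ⟨hx, hα, hβ, hA, hη, hε⟩, rfl, rfl⟩
  · have e := d.adj.left_triangle
    apply hP
    · grind
    · grind
    · rw [P.map_vcomp, P.map_hcomp, P.map_hcomp, P.map_two, hη, hα, hε] <;> grind
  · have e := d.adj.right_triangle
    apply hP
    · grind
    · grind
    · rw [P.map_vcomp, P.map_hcomp, P.map_hcomp, P.map_two, hη, hβ, hε] <;> grind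
  · have h₁ := SMon2Cat.isCell_pentagonLeft tα tA
    have h₂ := SMon2Cat.isCell_pentagonRight tα tA
    have e := d.assoc.pentagon
    refine hP _ _ (h₁.1.trans h₂.1.symm) (h₁.2.trans h₂.2.symm) ?_
    have e₁ := P.map_pentagonLeft tα tA
    have e₂ := P.map_pentagonRight tα tA
    rw [hx, hα, hA] at e₁ e₂
    exact e₁.trans (e.trans e₂.symm)

namespace Ins

variable {B D : TwoCat.{u}} {F G : TwoFunctor B D}

theorem _root_.TwoCat.square_inv {D : TwoCat.{u}} {p p' q q' v t : D.Ar} {a a' κ κ' : D.Cell}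
    (hp : D.tgt p = D.src v) (ht : D.tgt t = D.src q) (ha : D.IsCell a p p')
    (ha' : D.IsCell a' q q') (hκ : D.IsCell κ (D.comp p v) (D.comp t q))
    (hκ' : D.IsCell κ' (D.comp p' v) (D.comp t q')) (hi : D.IsInv a) (hi' : D.IsInv a')
    (e : D.vcomp (D.hcomp a (D.two v)) κ' = D.vcomp κ (D.hcomp (D.two t) a')) :
    D.vcomp (D.hcomp (D.inv a) (D.two v)) κ = D.vcomp κ' (D.hcomp (D.two t) (D.inv a')) := by
  have i : D.IsInv (D.hcomp a (D.two v)) := hi.hcomp (D.isInv_two _) (by grind)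
  have i' : D.IsInv (D.hcomp (D.two t) a') := (D.isInv_two _).hcomp hi' (by grind)
  have e₁ : D.vcomp (D.hcomp a (D.two v)) (D.hcomp (D.inv a) (D.two v)) = D.two (D.comp p v) := by
    rw [← D.vcomp_hcomp_two, hi.inv_spec.2.2.1, D.hcomp_two] <;> grind
  have e₂ : D.vcomp (D.hcomp (D.two t) (D.inv a')) (D.hcomp (D.two t) a') =
      D.two (D.comp t q') := by
    rw [← D.two_hcomp_vcomp, hi'.inv_spec.2.2.2, D.hcomp_two] <;> grind
  refine i.cancel_left (by grind) (by grind) ?_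
  refine i'.cancel_right (by grind) (by grind) ?_
  rw [← D.vcomp_assoc _ _ κ (by grind) (by grind), e₁, D.two_vcomp_of (by grind), ← e,
    D.vcomp_assoc _ _ _ (by grind) (by grind), D.vcomp_assoc _ _ _ (by grind) (by grind), e₂,
    D.vcomp_two_of (by grind)]

/-- The inverse in `B` satisfies the inverted square condition, so it is a 2-cell of the
pseudo-inserter. -/
theorem isInv_of_proj (a : Cell (F := F) (G := G)) (h : B.IsInv a.cell) :
    (TwoCat.inserter F G).IsInv a := by
  have h₁ := a.isCell
  have h₂ := a.dom.isAr
  have h₃ := a.dom.isCell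
  have h₄ := a.cod.isCell
  have h₅ := a.dom.src.isAr
  have h₆ := a.dom.tgt.isAr
  have e := a.square
  rw [a.src_eq, a.tgt_eq] at h₄
  let b : Cell (F := F) (G := G) :=
    { dom := a.cod
      cod := a.dom
      cell := B.inv a.cell
      src_eq := a.src_eq.symm
      tgt_eq := a.tgt_eq.symm
      isCell := by grind
      square := by
        rw [F.map_inv h, G.map_inv h, a.src_eq, a.tgt_eq]
        exact D.square_inv (by grind) (by grind) (by grind) (by grind) h₃ h₄ (F.map_isInv h)
          (G.map_isInv h) e }
  refine ⟨b, ⟨rfl, rfl⟩, ?_, ?_⟩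
  · have h' : a.cod = b.dom := rfl
    apply Cell.ext
    · exact vcomp_dom h'
    · exact vcomp_cod h'
    · refine (vcomp_cell h').trans (h.inv_spec.2.2.1.trans ?_)
      rw [h₁.1]; rfl
  · have h' : b.cod = a.dom := rfl
    apply Cell.ext
    · exact vcomp_dom h'
    · exact vcomp_cod h'
    · refine (vcomp_cell h').trans (h.inv_spec.2.2.2.trans ?_)
      rw [h₁.2]; rfl

/-- An adjoint equivalence can be lifted to the pseudo-inserter as soon as its left adjoint can. -/
theorem exists_adjoint {x y : Ob F G} {f : Ar (F := F) (G := G)} (hs : f.src = x) (ht : f.tgt = y)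
    {β : B.Ar} {η ε : B.Cell} (h : B.IsAdjunction f.ar β η ε) (hf : B.IsEqui f.ar)
    (hη : B.IsInv η) (hε : B.IsInv ε) :
    ∃ (g : Ar (F := F) (G := G)) (u v : Cell (F := F) (G := G)), g.src = y ∧ g.tgt = x ∧
      g.ar = β ∧ u.cell = η ∧ v.cell = ε ∧ u.dom = one x ∧ u.cod = comp f g ∧
      v.dom = comp g f ∧ v.cod = one y := by
  subst hs ht
  have h₀ := F.map_isAdjunction h
  have h₁ := G.map_isAdjunction h
  have k₁ := f.isAr
  have k₂ := f.isCell
  have k₃ := f.src.isAr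
  have k₄ := f.tgt.isAr
  have k₅ := h.right_ar
  have k₆ := h.unit_cell
  have k₇ := h.counit_cell
  -- The right adjoint is equipped with the mate of the 2-cell of `f`. Compatibility of mates with
  -- counits and units is the square condition for `ε` and `η`.
  obtain ⟨κ, hκ, hκi, e⟩ := D.exists_mate h₀ h₁ (G.map_isInv hε) (F.map_isInv hε)
    (G.map_isEqui hf) (t := f.src.ar) (s := f.tgt.ar) (by grind) (by grind) f.isCell f.isInv
  have e' := D.mate_unit h₀ h₁ (G.map_isInv hε) (G.map_isEqui hf) (by grind) (by grind) f.isCell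
    f.isInv hκ e
  let g : Ar (F := F) (G := G) := ⟨f.tgt, f.src, β, κ, by grind, hκ, hκi⟩
  have p : f.tgt = g.src := rfl
  have q : g.tgt = f.src := rfl
  refine ⟨g, ⟨one f.src, comp f g, η, ?_, ?_, ?_, ?_⟩, ⟨comp g f, one f.tgt, ε, ?_, ?_, ?_, ?_⟩,
    rfl, rfl, rfl, rfl, rfl, rfl, rfl, rfl, rfl⟩
  · exact comp_src p
  · exact comp_tgt p
  · rw [comp_ar p]
    exact ⟨k₆.1.trans (congrArg B.one k₁.1), k₆.2⟩
  · rw [comp_cell p]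
    refine e'.trans ?_
    change _ = D.vcomp (D.two f.src.ar) (D.hcomp (D.two f.src.ar) (G.cell η))
    rw [D.two_vcomp_of]
    grind
  · exact (comp_src q).symm
  · exact (comp_tgt q).symm
  · rw [comp_ar q]
    exact ⟨k₇.1, k₇.2.trans (congrArg B.one k₁.2)⟩
  · rw [comp_cell q, comp_src q, comp_tgt q]
    refine Eq.trans ?_ e.symm
    change D.vcomp (D.hcomp (F.cell ε) (D.two f.tgt.ar)) (D.two f.tgt.ar) = _
    rw [D.vcomp_two_of]
    grind

section Tensor

variable {B : SMon2Cat.{u}} {F G : TwoFunctor B.toTwoCat D}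
variable {t : TransfData ((TwoCat.inserter F G).prod (TwoCat.inserter F G)) D}
    {ht : t.IsPseudonatural ((projTensor F G).comp F) ((projTensor F G).comp G)}
    {he : ∀ x, D.IsEqui (t.app x)}
    {hob : ∀ x y z, t.app (liftOb (projTensor F G) t ht he (x, y), z) =
      t.app (x, liftOb (projTensor F G) t ht he (y, z))}
    {har : ∀ x y z, t.nat (liftAr (projTensor F G) t ht he (x, y), z) =
      t.nat (x, liftAr (projTensor F G) t ht he (y, z))}

theorem _root_.UnitData.isEqui_α {D : SMon2Cat.{u}} (d : UnitData D) : D.IsEqui d.α := by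
  have h₁ := d.adj.unit_cell
  refine ⟨d.β, d.adj.right_ar, ⟨D.inv d.η, ?_, d.η_inv.inv⟩, ⟨d.ε, d.adj.counit_cell, d.ε_inv⟩⟩
  have := d.η_inv
  grind

/-- Unit data can be lifted to the pseudo-inserter as soon as `I`, `α` and `A` can: it suffices
that `A` is compatible with the chosen 2-cells. -/
theorem exists_unitData (d : UnitData B) {u : D.Ar} {κ : D.Cell}
    (hu : D.IsAr u (F.ob d.I) (G.ob d.I)) (hue : D.IsEqui u)
    (hκ : D.IsCell κ (D.comp (F.ar d.α) u)
      (D.comp (t.app ((⟨d.I, u, hu, hue⟩ : Ob F G), (⟨d.I, u, hu, hue⟩ : Ob F G))) (G.ar d.α)))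
    (hκi : D.IsInv κ)
    (hA : ∀ (x : Ob F G) (f : Ar (F := F) (G := G)), x.ob = d.I → x.ar = u → f.ar = d.α →
      f.cell = κ → f.src = (smon t ht he hob har).tOb x x → f.tgt = x →
      D.vcomp (D.hcomp (F.cell d.A) (D.two (t.app (x, x)))) (t.nat (f, one x)) =
      D.vcomp (t.nat (one x, f))
        (D.hcomp (D.two (t.app (x, (smon t ht he hob har).tOb x x))) (G.cell d.A))) :
    ∃ d' : UnitData (smon t ht he hob har),
      (smonProj t ht he hob har).Carries d' d ∧ d'.I.ar = u := by
  let x : Ob F G := ⟨d.I, u, hu, hue⟩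
  let f : Ar (F := F) (G := G) :=
    { src := (smon t ht he hob har).tOb x x
      tgt := x
      ar := d.α
      cell := κ
      isAr := d.α_ar
      isCell := hκ
      isInv := hκi }
  obtain ⟨g, v, w, h₁, h₂, h₃, h₄, h₅, h₆, h₇, h₈, h₉⟩ := exists_adjoint (f := f) rfl rfl d.adj
    d.isEqui_α d.η_inv d.ε_inv
  let A : Cell (F := F) (G := G) :=
    { dom := (smon t ht he hob har).obAr x f
      cod := (smon t ht he hob har).arOb f x
      cell := d.A
      src_eq := (smon t ht he hob har).assoc_ob x x x
      tgt_eq := rfl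
      isCell := d.assoc.cell
      square := hA x f rfl rfl rfl rfl rfl rfl }
  -- The triangle identities and the pentagon are inherited from `B`, as parallel 2-cells of the
  -- pseudo-inserter are equal as soon as their projections are.
  obtain ⟨d', hd, hI, _⟩ := UnitData.exists_lift (smonProj t ht he hob har) d
    (fun a b p q r => Cell.ext p q r) isInv_of_proj (x := x) (α := f) (β := g) (A := A) (η := v)
    (ε := w) rfl rfl h₃ rfl h₄ h₅ ⟨rfl, rfl⟩ ⟨h₁, h₂⟩ ⟨rfl, rfl⟩ ⟨h₆, h₇⟩ ⟨h₈, h₉⟩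
  exact ⟨d', hd, by rw [hI]⟩

end Tensor

end Ins

/-! ### The pentagon and the objects with an action of `I` on the right -/

namespace SMon2Cat

variable {C : SMon2Cat.{u}} {I : C.Ob} {α : C.Ar} {A : C.Cell}

/-- The pentagon equation with its redundant factors cancelled. -/
theorem IsAssociator.square (h : C.IsAssociator I α A) (hα : C.IsAr α (C.tOb I I) I)
    (he : C.IsEqui α) :
    C.vcomp (C.hcomp (C.obCell I A) (C.two (C.obAr I α)))
      (C.hcomp (C.cellOb A I) (C.two (C.obAr I α))) =
      C.hcomp (C.two (C.obAr (C.tOb I I) α)) A := by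
  have hA := h.cell
  have e := h.pentagon
  have k₁ : C.comp (C.obAr (C.tOb I I) α) (C.arOb α I) =
    C.comp (C.arOb α (C.tOb I I)) (C.obAr I α) := by grind
  have t₁ : C.IsCell (C.obCell I A) (C.obAr (C.tOb I I) α) (C.arOb (C.obAr I α) I) := by grind
  have t₂ : C.IsCell (C.cellOb A I) (C.arOb (C.obAr I α) I) (C.arOb α (C.tOb I I)) := by grind
  have a₁ : C.IsAr (C.obAr (C.tOb I I) α) (C.tOb I (C.tOb I (C.tOb I I))) (C.tOb I (C.tOb I I)) := by
    grind
  have a₂ : C.IsAr (C.arOb (C.obAr I α) I) (C.tOb I (C.tOb I (C.tOb I I))) (C.tOb I (C.tOb I I)) := by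
    grind
  have a₃ : C.IsAr (C.arOb α (C.tOb I I)) (C.tOb I (C.tOb I (C.tOb I I))) (C.tOb I (C.tOb I I)) := by
    grind
  have a₄ : C.IsAr (C.obAr I α) (C.tOb I (C.tOb I I)) (C.tOb I I) := by grind
  have a₅ : C.IsAr (C.arOb α I) (C.tOb I (C.tOb I I)) (C.tOb I I) := by grind
  have e' : C.obAr I (C.arOb α I) = C.arOb (C.obAr I α) I := by grind
  rw [Pentagon, e'] at e
  have i : C.IsInv (C.hcomp (C.two (C.arOb α (C.tOb I I))) (C.hcomp A (C.two α))) :=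
    (C.isInv_two _).hcomp (h.inv.hcomp (C.isInv_two _) (by grind)) (by grind)
  clear e'
  generalize C.obCell I A = P at *
  generalize C.cellOb A I = Q at *
  generalize C.obAr (C.tOb I I) α = p at *
  generalize C.arOb (C.obAr I α) I = q at *
  generalize C.arOb α (C.tOb I I) = r at *
  generalize C.obAr I α = s at *
  generalize C.arOb α I = t at *
  -- Interchanging `A ⊗ I` with `A` makes both sides of the pentagon end in the same invertible
  -- factor. That factor is cancelled, and then the equiarrow `α`.
  have j₁ : C.vcomp (C.hcomp (C.two q) (C.hcomp A (C.two α))) (C.hcomp Q (C.two (C.comp t α))) =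
      C.vcomp (C.hcomp Q (C.two (C.comp s α))) (C.hcomp (C.two r) (C.hcomp A (C.two α))) := by
    rw [C.hcomp_eq_left_right, C.hcomp_eq_right_left] <;> grind
  refine he.whisker_right_cancel (by grind) (by grind) (by grind) ?_
  refine i.cancel_right (by grind) (by grind) ?_
  rw [j₁] at e
  rw [C.hcomp_assoc _ A _ (by grind) (by grind), e, C.vcomp_hcomp_two (by grind) (by grind),
    C.vcomp_assoc _ _ _ (by grind) (by grind), C.hcomp_assoc P _ _ (by grind) (by grind),
    C.hcomp_assoc Q _ _ (by grind) (by grind), C.hcomp_two _ _ (by grind)]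

/-- This is the shape in which the pentagon becomes the square condition on `A` when `α` carries the
2-cell `A⁻¹ ; α`. -/
theorem IsAssociator.square_inv (h : C.IsAssociator I α A) (hα : C.IsAr α (C.tOb I I) I)
    (he : C.IsEqui α) :
    C.vcomp (C.hcomp (C.obCell I (C.inv A)) (C.two (C.obAr I α)))
      (C.hcomp (C.two (C.obAr (C.tOb I I) α)) A) =
      C.hcomp (C.cellOb A I) (C.two (C.obAr I α)) := by
  have hA := h.cell
  have hi := h.inv
  have e : C.vcomp (C.hcomp (C.obCell I (C.inv A)) (C.two (C.obAr I α)))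
      (C.hcomp (C.obCell I A) (C.two (C.obAr I α))) =
      C.two (C.comp (C.obAr I (C.arOb α I)) (C.obAr I α)) := by
    rw [← C.vcomp_hcomp_two (by grind) (by grind)]
    simp only [obCell]
    rw [C.tCell_vcomp (by grind) (by grind), hi.inv_spec.2.2.2]
    grind
  rw [← h.square hα he, ← C.vcomp_assoc _ _ _ (by grind) (by grind), e, C.two_vcomp_of (by grind)]

end SMon2Cat

namespace Ins

variable {B : SMon2Cat.{u}} (I : B.Ob)

/-- The tensor product of objects with an action of `I` on the right. -/
noncomputable abbrev rightTransf : TransfData ((TwoCat.inserter (B.tensorRight I)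
    (TwoFunctor.id B.toTwoCat)).prod (TwoCat.inserter (B.tensorRight I) (TwoFunctor.id _)))
    B.toTwoCat :=
  B.tensorTransf (TransfData.ident (proj _ _)) (transf _ _)

theorem isPseudonatural_rightTransf : (rightTransf I).IsPseudonatural
    ((projTensor _ _).comp (B.tensorRight I)) ((projTensor _ _).comp (TwoFunctor.id _)) := by
  have h := B.isPseudonatural_tensorTransf (SMon2Cat.isPseudonatural_ident
    (proj (B.tensorRight I) (TwoFunctor.id B.toTwoCat))) (isPseudonatural_transf
      (F := B.tensorRight I) (G := TwoFunctor.id B.toTwoCat))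
  have e : ((proj (B.tensorRight I) (TwoFunctor.id B.toTwoCat)).prodMap
      ((proj (B.tensorRight I) (TwoFunctor.id B.toTwoCat)).comp (B.tensorRight I))).comp B.tensor =
      (projTensor _ _).comp (B.tensorRight I) := by
    apply TwoFunctor.ext
    · funext x; exact (B.assoc_ob _ _ _).symm
    · funext x; exact (B.assoc_ar _ _ _).symm
    · funext x; exact (B.assoc_cell _ _ _).symm
  rw [e] at h
  exact h

theorem isEqui_rightTransf (x) : B.IsEqui ((rightTransf I).app x) :=
  SMon2Cat.isEqui_tAr (B.isEqui_one _) x.2.isEqui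

theorem rightTransf_app_assoc (x y z) : (rightTransf I).app (liftOb (projTensor _ _) (rightTransf I)
      (isPseudonatural_rightTransf I) (isEqui_rightTransf I) (x, y), z) =
    (rightTransf I).app (x, liftOb (projTensor _ _) (rightTransf I)
      (isPseudonatural_rightTransf I) (isEqui_rightTransf I) (y, z)) :=
  B.one_tOb_tAr x.ob y.ob z.ar

theorem rightTransf_nat_assoc (f g h) : (rightTransf I).nat (liftAr (projTensor _ _) (rightTransf I)
      (isPseudonatural_rightTransf I) (isEqui_rightTransf I) (f, g), h) =
    (rightTransf I).nat (f, liftAr (projTensor _ _) (rightTransf I)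
      (isPseudonatural_rightTransf I) (isEqui_rightTransf I) (g, h)) := by
  change B.tCell (B.two (B.tAr f.ar g.ar)) h.cell =
    B.tCell (B.two f.ar) (B.tCell (B.two g.ar) h.cell)
  rw [← B.tCell_two, B.tCell_assoc]

/-- The objects of `B` with an action of `I` on the right. -/
noncomputable def rightSMon : SMon2Cat.{u} :=
  smon (rightTransf I) (isPseudonatural_rightTransf I) (isEqui_rightTransf I)
    (rightTransf_app_assoc I) (rightTransf_nat_assoc I)

/-- The object `I` carries the action `α`, and `A⁻¹ ; α` makes `α` compatible with the actions on `I
⊗ I` and `I`. The remaining condition, on `A`, is the pentagon. For the free object the lift extends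
to a section, that is, to a pseudo-natural family of equiarrows `x ⊗ I ⟶ x` on all objects. -/
theorem exists_right_section (d : UnitData B) :
    ∃ d' : UnitData (rightSMon d.I), SMonFunctor.Carries (U := rightSMon d.I) (D := B)
      (smonProj _ _ _ _ _) d' d := by
  have hA := d.assoc.cell
  have hα := d.α_ar
  have hi := d.assoc.inv
  have e := d.assoc.square_inv hα d.isEqui_α
  obtain ⟨d', hd, _⟩ := exists_unitData (t := rightTransf d.I)
    (ht := isPseudonatural_rightTransf d.I) (he := isEqui_rightTransf d.I)
    (hob := rightTransf_app_assoc d.I) (har := rightTransf_nat_assoc d.I) d (u := d.α)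
    (κ := B.hcomp (B.inv d.A) (B.two d.α)) d.α_ar d.isEqui_α
    (by
      change B.IsCell _ (B.comp (B.arOb d.α d.I) d.α) (B.comp (B.obAr d.I d.α) d.α)
      grind)
    (hi.inv.hcomp (B.isInv_two _) (by grind))
    (by
      rintro ⟨x, u, hu, hue⟩ ⟨s, t, f, κ, hf, hκ, hκi⟩ h₁ h₂ h₃ h₄ h₅ h₆
      dsimp only at h₁ h₂ h₃ h₄ h₅ h₆
      subst h₁ h₂ h₃ h₄ h₅ h₆
      change B.vcomp (B.hcomp (B.cellOb d.A d.I) (B.two (B.obAr d.I d.α)))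
        (B.tCell (B.two d.α) (B.two d.α)) =
        B.vcomp (B.tCell (B.two (B.one d.I)) (B.hcomp (B.inv d.A) (B.two d.α)))
          (B.hcomp (B.two (B.obAr d.I (B.obAr d.I d.α))) d.A)
      have e₁ : B.tCell (B.two (B.one d.I)) (B.hcomp (B.inv d.A) (B.two d.α)) =
          B.hcomp (B.obCell d.I (B.inv d.A)) (B.two (B.obAr d.I d.α)) := by
        simp only [SMon2Cat.obCell, SMon2Cat.obAr]
        rw [← SMon2Cat.tCell_two, B.tCell_hcomp (by grind) (by grind), B.one_hcomp_of]
        grind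
      have e₂ : B.obAr d.I (B.obAr d.I d.α) = B.obAr (B.tOb d.I d.I) d.α := by grind
      rw [e₁, e₂, e, SMon2Cat.tCell_two, B.vcomp_two_of]
      grind)
  exact ⟨d', hd⟩

end Ins

namespace TwoCat

/-- The first projection. -/
def fst (C D : TwoCat.{u}) : TwoFunctor (C.prod D) C where
  ob x := x.1
  ar f := f.1
  cell a := a.1
  map_src _ := rfl
  map_tgt _ := rfl
  map_dom _ := rfl
  map_cod _ := rfl
  map_one _ := rfl
  map_two _ := rfl
  map_comp _ _ _ := rfl
  map_vcomp _ _ _ := rfl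
  map_hcomp _ _ _ := rfl

/-- A retract of a contractible 2-category is contractible. -/
theorem IsContractible.of_retract {C D : TwoCat.{u}} (hD : D.IsContractible) (F : TwoFunctor C D)
    (G : TwoFunctor D C) (h : F.comp G = TwoFunctor.id C) : C.IsContractible := by
  have h₀ : ∀ x, G.ob (F.ob x) = x := fun x => congrFun (congrArg TwoFunctor.ob h) x
  have h₁ : ∀ x, G.ar (F.ar x) = x := fun x => congrFun (congrArg TwoFunctor.ar h) x
  have h₂ : ∀ x, G.cell (F.cell x) = x := fun x => congrFun (congrArg TwoFunctor.cell h) x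
  refine isContractible_of (hD.nonempty.map G.ob) (fun x y => ?_) (fun f g hs ht => ?_)
  · obtain ⟨f, hf⟩ := hD.exists_ar (F.ob x) (F.ob y)
    exact ⟨G.ar f, by grind⟩
  · obtain ⟨a, ha⟩ := hD.exists_cell (f := F.ar f) (g := F.ar g) (by grind) (by grind)
    refine ⟨G.cell a, by grind, fun b hb => ?_⟩
    rw [← h₂ b, hD.cell_ext (a := F.cell b) (b := a) (by grind) (by grind)]

end TwoCat

/-! ### Objects with an equiarrow `x ⊗ I ⟶ I` -/

namespace Ins

variable {B : SMon2Cat.{u}} (I : B.Ob)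

/-- The tensor product of objects `x` with an equiarrow `x ⊗ I ⟶ I`. -/
noncomputable abbrev augTransf : TransfData ((TwoCat.inserter (B.tensorRight I)
    (TwoFunctor.const B.toTwoCat I)).prod (TwoCat.inserter (B.tensorRight I)
      (TwoFunctor.const _ I))) B.toTwoCat :=
  (B.tensorTransf (TransfData.ident (proj _ _)) (transf _ _)).comp
    ((transf _ _).precomp (TwoCat.fst _ _))

theorem isPseudonatural_augTransf : (augTransf I).IsPseudonatural
    ((projTensor _ _).comp (B.tensorRight I)) ((projTensor _ _).comp (TwoFunctor.const _ I)) := by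
  have h := B.isPseudonatural_tensorTransf (SMon2Cat.isPseudonatural_ident
    (proj (B.tensorRight I) (TwoFunctor.const B.toTwoCat I))) (isPseudonatural_transf
      (F := B.tensorRight I) (G := TwoFunctor.const B.toTwoCat I))
  have e : ((proj (B.tensorRight I) (TwoFunctor.const B.toTwoCat I)).prodMap
      ((proj (B.tensorRight I) (TwoFunctor.const B.toTwoCat I)).comp (B.tensorRight I))).comp
        B.tensor = (projTensor _ _).comp (B.tensorRight I) := by
    apply TwoFunctor.ext
    · funext x; exact (B.assoc_ob _ _ _).symm
    · funext x; exact (B.assoc_ar _ _ _).symm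
    · funext x; exact (B.assoc_cell _ _ _).symm
  rw [e] at h
  exact h.comp (isPseudonatural_transf.precomp (TwoCat.fst _ _))

theorem isEqui_augTransf (x) : B.IsEqui ((augTransf I).app x) := by
  have h₁ := x.1.isAr
  have h₂ := x.2.isAr
  refine (SMon2Cat.isEqui_tAr (B.isEqui_one _) x.2.isEqui).comp x.1.isEqui ?_
  change B.tgt (B.tAr (B.one x.1.ob) x.2.ar) = B.src x.1.ar
  rw [h₁.1, B.tgt_tAr, h₂.2, B.tgt_one]
  rfl

theorem augTransf_app_assoc (x y z) : (augTransf I).app (liftOb (projTensor _ _) (augTransf I)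
      (isPseudonatural_augTransf I) (isEqui_augTransf I) (x, y), z) =
    (augTransf I).app (x, liftOb (projTensor _ _) (augTransf I)
      (isPseudonatural_augTransf I) (isEqui_augTransf I) (y, z)) := by
  have h₁ : B.IsAr x.ar (B.tOb x.ob I) I := x.isAr
  have h₂ : B.IsAr y.ar (B.tOb y.ob I) I := y.isAr
  have h₃ : B.IsAr z.ar (B.tOb z.ob I) I := z.isAr
  change B.comp (B.tAr (B.one (B.tOb x.ob y.ob)) z.ar) (B.comp (B.tAr (B.one x.ob) y.ar) x.ar) =
    B.comp (B.tAr (B.one x.ob) (B.comp (B.tAr (B.one y.ob) z.ar) y.ar)) x.ar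
  rw [← B.comp_assoc _ _ _ (by grind) (by grind), B.one_tOb_tAr, B.tAr_comp (by grind) (by grind),
    B.one_comp_of (by grind)]

/-- Both sides are the pasting of the squares `m`, `l` and `k`, in this order, and differ only by
regrouping with interchange. It is the associativity on arrows of the tensor product of augmented
objects. -/
theorem aug_assoc_cell {x x' y y' z z' : B.Ob} {u u' v v' w w' f g h : B.Ar} {k l m : B.Cell}
    (hu : B.IsAr u (B.tOb x I) I) (hu' : B.IsAr u' (B.tOb x' I) I)
    (hv : B.IsAr v (B.tOb y I) I) (hv' : B.IsAr v' (B.tOb y' I) I)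
    (hw : B.IsAr w (B.tOb z I) I) (hw' : B.IsAr w' (B.tOb z' I) I)
    (hf : B.IsAr f x x') (hg : B.IsAr g y y') (hh : B.IsAr h z z')
    (hk : B.IsCell k (B.comp (B.arOb f I) u') (B.comp u (B.one I)))
    (hl : B.IsCell l (B.comp (B.arOb g I) v') (B.comp v (B.one I)))
    (hm : B.IsCell m (B.comp (B.arOb h I) w') (B.comp w (B.one I))) :
    B.vcomp (B.hcomp (B.tCell (B.two (B.tAr f g)) m) (B.two (B.comp (B.tAr (B.one x') v') u')))
      (B.hcomp (B.two (B.tAr (B.one (B.tOb x y)) w))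
        (B.vcomp (B.hcomp (B.tCell (B.two f) l) (B.two u'))
          (B.hcomp (B.two (B.tAr (B.one x) v)) k))) =
    B.vcomp (B.hcomp (B.tCell (B.two f) (B.vcomp (B.hcomp (B.tCell (B.two g) m) (B.two v'))
        (B.hcomp (B.two (B.tAr (B.one y) w)) l))) (B.two u'))
      (B.hcomp (B.two (B.tAr (B.one x) (B.comp (B.tAr (B.one y) w) v))) k) := by
  have q₁ : B.tAr f v = B.comp (B.tAr (B.one x) v) (B.arOb f I) := by
    simp only [SMon2Cat.arOb]
    rw [B.tAr_comp (by grind) (by grind), B.one_comp_of (by grind), B.comp_one_of (by grind)]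
  have q₂ : B.comp (B.tAr (B.one y) w) (B.comp (B.arOb g I) v') =
      B.comp (B.tAr g (B.comp w (B.one I))) v' := by
    simp only [SMon2Cat.arOb]
    rw [← B.comp_assoc _ _ _ (by grind) (by grind), B.tAr_comp (by grind) (by grind),
      B.one_comp_of (by grind)]
  have e₁ : B.hcomp (B.tCell (B.two (B.tAr f g)) m) (B.two (B.comp (B.tAr (B.one x') v') u')) =
      B.hcomp (B.tCell (B.two f) (B.hcomp (B.tCell (B.two g) m) (B.two v'))) (B.two u') := by
    rw [← B.hcomp_two _ _ (by grind), ← B.hcomp_assoc _ _ _ (by grind) (by grind), ← B.tCell_two f g,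
      B.tCell_assoc, ← B.tCell_two (B.one x') v', B.tCell_hcomp (by grind) (by grind),
      B.hcomp_one_of (by grind)]
  have e₂ : B.hcomp (B.two (B.tAr (B.one (B.tOb x y)) w)) (B.tCell (B.two f) l) =
      B.tCell (B.two f) (B.hcomp (B.two (B.tAr (B.one y) w)) l) := by
    rw [B.one_tOb_tAr, ← B.tCell_two (B.one x), B.tCell_hcomp (by grind) (by grind),
      B.one_hcomp_of (by grind)]
  have e₃ : B.two (B.tAr (B.one x) (B.comp (B.tAr (B.one y) w) v)) =
      B.hcomp (B.two (B.tAr (B.one (B.tOb x y)) w)) (B.two (B.tAr (B.one x) v)) := by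
    rw [B.hcomp_two] <;> grind
  have t₁ : B.IsCell (B.tCell (B.two f) (B.hcomp (B.tCell (B.two g) m) (B.two v')))
      (B.tAr f (B.comp (B.tAr g (B.comp (B.arOb h I) w')) v'))
      (B.tAr f (B.comp (B.tAr g (B.comp w (B.one I))) v')) := by grind
  have t₂ : B.IsCell (B.tCell (B.two f) (B.hcomp (B.two (B.tAr (B.one y) w)) l))
      (B.tAr f (B.comp (B.tAr g (B.comp w (B.one I))) v'))
      (B.tAr f (B.comp (B.tAr (B.one y) w) v)) := by grind
  have t₃ : B.IsCell (B.hcomp (B.two (B.tAr (B.one x) v)) k)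
      (B.comp (B.tAr f v) u') (B.comp (B.tAr (B.one x) v) u) := by grind
  have e₄ : B.tCell (B.two f) (B.vcomp (B.hcomp (B.tCell (B.two g) m) (B.two v'))
        (B.hcomp (B.two (B.tAr (B.one y) w)) l)) =
      B.vcomp (B.tCell (B.two f) (B.hcomp (B.tCell (B.two g) m) (B.two v')))
        (B.tCell (B.two f) (B.hcomp (B.two (B.tAr (B.one y) w)) l)) := by
    rw [B.tCell_vcomp (by grind) (by grind), B.two_vcomp_of (by grind)]
  have a₁ : B.IsAr (B.tAr (B.one (B.tOb x y)) w) (B.tOb (B.tOb x y) (B.tOb z I))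
    (B.tOb x (B.tOb y I)) := by grind
  have t₄ : B.IsCell (B.tCell (B.two f) l) (B.tAr f (B.comp (B.arOb g I) v')) (B.tAr f v) := by
    grind
  have a₂ : B.IsAr (B.tAr f (B.comp (B.arOb g I) v')) (B.tOb x (B.tOb y I)) (B.tOb x' I) := by
    grind
  rw [e₁, e₄, e₃, B.two_hcomp_vcomp (by grind) (by grind), ← B.hcomp_assoc _ _ (B.two u') (by grind)
    (by grind), e₂, B.vcomp_hcomp_two (by grind) (by grind), B.hcomp_assoc _ _ k (by grind)
    (by grind), B.vcomp_assoc _ _ _ (by grind) (by grind)]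

theorem augTransf_nat_assoc (f g h) : (augTransf I).nat (liftAr (projTensor _ _) (augTransf I)
      (isPseudonatural_augTransf I) (isEqui_augTransf I) (f, g), h) =
    (augTransf I).nat (f, liftAr (projTensor _ _) (augTransf I)
      (isPseudonatural_augTransf I) (isEqui_augTransf I) (g, h)) :=
  aug_assoc_cell I f.src.isAr f.tgt.isAr g.src.isAr g.tgt.isAr h.src.isAr h.tgt.isAr f.isAr g.isAr
    h.isAr f.isCell g.isCell h.isCell

/-- The objects `x` of `B` with an equiarrow `x ⊗ I ⟶ I`. -/
noncomputable def augSMon : SMon2Cat.{u} :=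
  smon (augTransf I) (isPseudonatural_augTransf I) (isEqui_augTransf I)
    (augTransf_app_assoc I) (augTransf_nat_assoc I)

/-- This pseudo-inserter is the homotopy fibre over `I` of the equi-2-functor `- ⊗ I`, and `(I, α)`
lies in it. Given `u : x ⊗ I ⟶ I` and `v : y ⊗ I ⟶ I`, an arrow between them lifts `u` followed by a
pseudo-inverse of `v`. The square condition prescribes a 2-cell after applying `- ⊗ I` and
whiskering with `v`, and both operations are bijective on 2-cells. -/
theorem isContractible_aug {α : B.Ar} (hα : B.IsAr α (B.tOb I I) I) (he : B.IsEqui α)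
    (hI : (B.tensorRight I).IsEqui2) :
    (TwoCat.inserter (B.tensorRight I) (TwoFunctor.const B.toTwoCat I)).IsContractible := by
  refine TwoCat.isContractible_of ⟨(⟨I, α, hα, he⟩ : Ob _ _)⟩ (fun x y => ?_) (fun f g hs ht => ?_)
  · have h₁ : B.IsAr x.ar (B.tOb x.ob I) I := x.isAr
    have h₂ : B.IsAr y.ar (B.tOb y.ob I) I := y.isAr
    obtain ⟨s, hs, hs₁, hs₂, -⟩ := y.isEqui.exists_inverse
    obtain ⟨f, hf, i⟩ := hI.exists_iso (x := x.ob) (x' := y.ob) (g := B.comp x.ar s)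
      ⟨by rw [B.src_comp] <;> grind, by rw [B.tgt_comp] <;> grind⟩
    have j : B.Iso (B.comp ((B.tensorRight I).ar f) y.ar) (B.comp x.ar (B.one I)) := by
      have i' := TwoCat.Iso.comp (by
        change B.tgt (B.tAr f (B.one I)) = _
        grind) i (TwoCat.Iso.refl y.ar)
      rw [B.comp_assoc _ _ _ (by grind) (by grind)] at i'
      refine i'.trans (TwoCat.Iso.comp (by grind) (TwoCat.Iso.refl x.ar) ?_)
      rwa [h₂.2] at hs₂
    obtain ⟨a, ha, hai⟩ := j
    exact ⟨(⟨x, y, f, a, hf, ha, hai⟩ : Ar), rfl, rfl⟩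
  · have hs : f.src = g.src := hs
    have ht : f.tgt = g.tgt := ht
    have k₁ : B.IsCell f.cell (B.comp ((B.tensorRight I).ar f.ar) f.tgt.ar)
      (B.comp f.src.ar (B.one I)) := f.isCell
    have k₂ : B.IsCell g.cell (B.comp ((B.tensorRight I).ar g.ar) g.tgt.ar)
      (B.comp g.src.ar (B.one I)) := g.isCell
    have l₁ : B.IsAr f.src.ar (B.tOb f.src.ob I) I := f.src.isAr
    have l₂ : B.IsAr f.tgt.ar (B.tOb f.tgt.ob I) I := f.tgt.isAr
    have m₁ := f.isAr
    have m₂ := g.isAr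
    have n₁ := f.isInv
    have n₂ := g.isInv
    have n₃ := f.tgt.isEqui
    rw [← hs, ← ht] at k₂ m₂
    have o₁ : B.IsAr ((B.tensorRight I).ar f.ar) (B.tOb f.src.ob I) (B.tOb f.tgt.ob I) := by
      rw [SMon2Cat.tensorRight_ar]
      grind
    have o₂ : B.IsAr ((B.tensorRight I).ar g.ar) (B.tOb f.src.ob I) (B.tOb f.tgt.ob I) := by
      rw [SMon2Cat.tensorRight_ar]
      grind
    -- The square condition solved for the factor that contains `c`.
    have key : ∀ c, B.IsCell c f.ar g.ar → (B.vcomp (B.hcomp ((B.tensorRight I).cell c)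
        (B.two f.tgt.ar)) g.cell = B.vcomp f.cell (B.hcomp (B.two f.src.ar) (B.two (B.one I))) ↔
        B.hcomp ((B.tensorRight I).cell c) (B.two f.tgt.ar) = B.vcomp f.cell (B.inv g.cell)) := by
      intro c hc
      have p₁ : B.hcomp (B.two f.src.ar) (B.two (B.one I)) = B.two f.src.ar := by grind
      rw [p₁, B.vcomp_two_of (by grind)]
      have p₂ : B.cod (B.hcomp ((B.tensorRight I).cell c) (B.two f.tgt.ar)) = B.dom g.cell := by
        grind
      constructor
      · intro h
        rw [← h, B.vcomp_assoc _ _ _ p₂ (by grind), n₂.inv_spec.2.2.1, B.vcomp_two_of p₂]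
      · intro h
        rw [h, B.vcomp_assoc _ _ _ (by grind) (by grind), n₂.inv_spec.2.2.2,
          B.vcomp_two_of (by grind)]
    obtain ⟨b, hb, hb'⟩ := n₃.whisker_right_full (f := (B.tensorRight I).ar f.ar)
      (f' := (B.tensorRight I).ar g.ar) (c := B.vcomp f.cell (B.inv g.cell)) (by grind) (by grind)
      (by grind) (by grind)
    obtain ⟨c, ⟨hc, rfl⟩, -⟩ := hI.hom_fully_faithful f.ar g.ar (by grind) (by grind) b hb
    refine ⟨(⟨f, g, c, hs.symm, ht.symm, hc, (key c hc).2 hb'⟩ : Cell), ⟨rfl, rfl⟩, ?_⟩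
    rintro a ⟨ha₁, ha₂⟩
    have ha₁ : a.dom = f := ha₁
    have ha₂ : a.cod = g := ha₂
    subst ha₁ ha₂
    have ha := a.isCell
    refine Cell.ext rfl rfl (hI.cell_ext (a := a.cell) (b := c) (by grind) (by grind) ?_)
    refine n₃.whisker_right_cancel (by grind) (by grind) (by grind) ?_
    rw [hb']
    exact (key _ ha).1 a.square

/-- Here `α` is the augmentation of `I`, and `I ⊗ I` is augmented by `(I ⊗ α) ; α`. The same 2-cell
`A⁻¹ ; α` makes `α` an arrow of augmented objects, and the condition on `A` is again the pentagon,
after a factor `A` cancels against its inverse. -/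
theorem exists_aug_section (d : UnitData B) :
    ∃ d' : UnitData (augSMon d.I), SMonFunctor.Carries (U := augSMon d.I) (D := B)
      (smonProj _ _ _ _ _) d' d := by
  have hA := d.assoc.cell
  have hα := d.α_ar
  have hi := d.assoc.inv
  have e := d.assoc.square_inv hα d.isEqui_α
  obtain ⟨d', hd, _⟩ := exists_unitData (t := augTransf d.I)
    (ht := isPseudonatural_augTransf d.I) (he := isEqui_augTransf d.I)
    (hob := augTransf_app_assoc d.I) (har := augTransf_nat_assoc d.I) d (u := d.α)
    (κ := B.hcomp (B.inv d.A) (B.two d.α)) d.α_ar d.isEqui_α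
    (by
      change B.IsCell _ (B.comp (B.arOb d.α d.I) d.α)
        (B.comp (B.comp (B.obAr d.I d.α) d.α) (B.one d.I))
      grind)
    (hi.inv.hcomp (B.isInv_two _) (by grind))
    (by
      rintro ⟨x, u, hu, hue⟩ ⟨s, t, f, κ, hf, hκ, hκi⟩ h₁ h₂ h₃ h₄ h₅ h₆
      dsimp only at h₁ h₂ h₃ h₄ h₅ h₆
      subst h₁ h₂ h₃ h₄ h₅ h₆
      change B.vcomp (B.hcomp (B.cellOb d.A d.I) (B.two (B.comp (B.obAr d.I d.α) d.α)))
        (B.vcomp (B.hcomp (B.tCell (B.two d.α) (B.two d.α)) (B.two d.α))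
          (B.hcomp (B.two (B.tAr (B.one (B.tOb d.I d.I)) d.α))
            (B.hcomp (B.inv d.A) (B.two d.α)))) =
        B.vcomp (B.vcomp (B.hcomp (B.tCell (B.two (B.one d.I)) (B.hcomp (B.inv d.A) (B.two d.α)))
          (B.two d.α))
          (B.hcomp (B.two (B.tAr (B.one d.I) (B.comp (B.obAr d.I d.α) d.α))) (B.two d.α)))
          (B.hcomp (B.two (B.comp (B.tAr (B.one d.I) (B.comp (B.obAr d.I d.α) d.α)) d.α))
            (B.two (B.one d.I)))
      have e₁ : B.tCell (B.two (B.one d.I)) (B.hcomp (B.inv d.A) (B.two d.α)) =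
          B.hcomp (B.obCell d.I (B.inv d.A)) (B.two (B.obAr d.I d.α)) := by
        simp only [SMon2Cat.obCell, SMon2Cat.obAr]
        rw [← SMon2Cat.tCell_two, B.tCell_hcomp (by grind) (by grind), B.one_hcomp_of]
        grind
      have a₁ : B.IsAr (B.obAr (B.tOb d.I d.I) d.α) (B.tOb d.I (B.tOb d.I (B.tOb d.I d.I)))
        (B.tOb d.I (B.tOb d.I d.I)) := by grind
      have a₂ : B.IsAr (B.obAr d.I d.α) (B.tOb d.I (B.tOb d.I d.I)) (B.tOb d.I d.I) := by grind
      have a₃ : B.IsAr (B.arOb d.α d.I) (B.tOb d.I (B.tOb d.I d.I)) (B.tOb d.I d.I) := by grind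
      have k : B.tAr d.α d.α = B.comp (B.obAr (B.tOb d.I d.I) d.α) (B.arOb d.α d.I) := by grind
      have k' : B.tAr (B.one d.I) (B.comp (B.obAr d.I d.α) d.α) =
        B.comp (B.obAr (B.tOb d.I d.I) d.α) (B.obAr d.I d.α) := by grind
      have t₁ : B.IsCell (B.cellOb d.A d.I) (B.obAr d.I (B.arOb d.α d.I))
        (B.arOb d.α (B.tOb d.I d.I)) := by grind
      have t₂ : B.IsCell (B.obCell d.I (B.inv d.A)) (B.obAr d.I (B.arOb d.α d.I))
        (B.obAr (B.tOb d.I d.I) d.α) := by grind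
      have a₄ : B.IsAr (B.obAr d.I (B.arOb d.α d.I)) (B.tOb d.I (B.tOb d.I (B.tOb d.I d.I)))
        (B.tOb d.I (B.tOb d.I d.I)) := by grind
      have a₅ : B.tAr (B.one (B.tOb d.I d.I)) d.α = B.obAr (B.tOb d.I d.I) d.α := rfl
      have k'' : B.comp (B.arOb d.α (B.tOb d.I d.I)) (B.obAr d.I d.α) =
        B.comp (B.obAr (B.tOb d.I d.I) d.α) (B.arOb d.α d.I) := by grind
      rw [e₁, SMon2Cat.tCell_two, k, k', a₅, ← B.hcomp_two (B.obAr d.I d.α) _ (by grind),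
        ← B.hcomp_assoc _ _ _ (by grind) (by grind), ← e]
      clear e e₁ hκ hκi
      generalize B.cellOb d.A d.I = P at *
      generalize B.obCell d.I (B.inv d.A) = Q at *
      generalize B.obAr (B.tOb d.I d.I) d.α = p at *
      generalize B.obAr d.I (B.arOb d.α d.I) = q at *
      generalize B.arOb d.α (B.tOb d.I d.I) = r at *
      generalize B.obAr d.I d.α = s at *
      generalize B.arOb d.α d.I = t at *
      have m₁ : B.vcomp (B.hcomp (B.two p) d.A) (B.hcomp (B.two p) (B.inv d.A)) =
          B.two (B.comp p s) := by
        rw [← B.two_hcomp_vcomp, hi.inv_spec.2.2.1] <;> grind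
      rw [B.hcomp_two (B.comp p t) _ (by grind), B.two_vcomp_of (by grind),
        ← B.hcomp_assoc (B.two p) _ _ (by grind) (by grind),
        ← B.vcomp_hcomp_two (by grind) (by grind), B.vcomp_assoc _ _ _ (by grind) (by grind), m₁,
        B.vcomp_two_of (by grind), B.hcomp_two _ _ (by grind), B.hcomp_one_of (by grind),
        B.vcomp_two_of (by grind), B.vcomp_two_of (by grind)])
  exact ⟨d', hd⟩

end Ins

namespace SMonFunctor

variable {C D E : SMon2Cat.{u}}

/-- Composition of semi-monoidal 2-functors. -/
def comp (F : SMonFunctor C D) (G : SMonFunctor D E) : SMonFunctor C E where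
  toTwoFunctor := F.toTwoFunctor.comp G.toTwoFunctor
  map_tOb x y := (congrArg G.ob (F.map_tOb x y)).trans (G.map_tOb _ _)
  map_tAr x y := (congrArg G.ar (F.map_tAr x y)).trans (G.map_tAr _ _)
  map_tCell x y := (congrArg G.cell (F.map_tCell x y)).trans (G.map_tCell _ _)

theorem Carries.comp {F : SMonFunctor C D} {G : SMonFunctor D E} {c : UnitData C} {d : UnitData D}
    {e : UnitData E} (hF : F.Carries c d) (hG : G.Carries d e) : (F.comp G).Carries c e where
  map_I := (congrArg G.ob hF.map_I).trans hG.map_I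
  map_α := (congrArg G.ar hF.map_α).trans hG.map_α
  map_β := (congrArg G.ar hF.map_β).trans hG.map_β
  map_A := (congrArg G.cell hF.map_A).trans hG.map_A
  map_η := (congrArg G.cell hF.map_η).trans hG.map_η
  map_ε := (congrArg G.cell hF.map_ε).trans hG.map_ε

theorem carries_map (F : SMonFunctor C D) (d : UnitData C) : F.Carries d (d.map F) :=
  ⟨rfl, rfl, rfl, rfl, rfl, rfl⟩

theorem carries_id (d : UnitData C) : (SMonFunctor.id C).Carries d d :=
  ⟨rfl, rfl, rfl, rfl, rfl, rfl⟩

end SMonFunctor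

/-! ### Contractibility of the free semi-monoidal 2-category -/

namespace FreeUnit

theorem eq_of_carries {D : SMon2Cat.{u}} {d : UnitData D} {J J' : SMonFunctor free D}
    (h : J.Carries gen d) (h' : J'.Carries gen d) : J = J' :=
  (isFree_gen D d).unique h h'

/-- Freeness turns a lift of the generators along `P` into a strict section of `P`, because the
composite fixes the generators. -/
theorem interpret_comp_eq_id {E : SMon2Cat.{u}} {d : UnitData E} {P : SMonFunctor E free}
    (h : P.Carries d gen) :
    (interpret d).toTwoFunctor.comp P.toTwoFunctor = TwoFunctor.id free.{u}.toTwoCat :=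
  congrArg SMonFunctor.toTwoFunctor (eq_of_carries ((carries_interpret d).comp h)
    (SMonFunctor.carries_id gen))

/-- Tensoring with the generating object is an equi-2-functor, because it is equivalent to the
identity by the right constraint that the freeness provides. -/
theorem isEqui2_tensorRight_gen : (free.{u}.tensorRight gen.I).IsEqui2 := by
  obtain ⟨d, hd⟩ := Ins.exists_right_section gen.{u}
  have e := interpret_comp_eq_id hd
  have h := (Ins.isPseudonatural_transf (F := free.{u}.tensorRight gen.I)
    (G := TwoFunctor.id _)).precomp (interpret d).toTwoFunctor
  have h' : ((Ins.transf (free.{u}.tensorRight gen.I) (TwoFunctor.id _)).precomp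
      (interpret d).toTwoFunctor).IsPseudonatural
      (((interpret d).toTwoFunctor.comp (Ins.proj _ _)).comp (free.tensorRight gen.I))
      (((interpret d).toTwoFunctor.comp (Ins.proj _ _)).comp (TwoFunctor.id _)) := h
  have e' : (interpret d).toTwoFunctor.comp (Ins.proj (free.{u}.tensorRight gen.I)
    (TwoFunctor.id _)) = TwoFunctor.id free.{u}.toTwoCat := e
  rw [e'] at h'
  exact h'.isEqui2 (fun x => Ins.isEqui_transf _) (TwoFunctor.isEqui2_id _)

/-- The section that lifts the generators to augmented objects exhibits the free object as a retract
of a contractible 2-category. -/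
theorem isContractible_free : free.{u}.IsContractible := by
  obtain ⟨d, hd⟩ := Ins.exists_aug_section gen.{u}
  exact (Ins.isContractible_aug gen.{u}.I gen.α_ar gen.isEqui_α isEqui2_tensorRight_gen).of_retract
    (interpret d).toTwoFunctor _ (interpret_comp_eq_id hd)

end FreeUnit

/-! ### Products and the 2-category of equiarrows -/

namespace SMon2Cat

variable (C : SMon2Cat.{u})

/-- The product of two semi-monoidal 2-categories. -/
def prodSMon (C D : SMon2Cat.{u}) : SMon2Cat.{u} where
  toTwoCat := C.toTwoCat.prod D.toTwoCat
  tensor :=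
    { ob := fun x => (C.tensor.ob (x.1.1, x.2.1), D.tensor.ob (x.1.2, x.2.2))
      ar := fun f => (C.tensor.ar (f.1.1, f.2.1), D.tensor.ar (f.1.2, f.2.2))
      cell := fun a => (C.tensor.cell (a.1.1, a.2.1), D.tensor.cell (a.1.2, a.2.2))
      map_src := fun f => Prod.ext (C.tensor.map_src _) (D.tensor.map_src _)
      map_tgt := fun f => Prod.ext (C.tensor.map_tgt _) (D.tensor.map_tgt _)
      map_dom := fun a => Prod.ext (C.tensor.map_dom _) (D.tensor.map_dom _)
      map_cod := fun a => Prod.ext (C.tensor.map_cod _) (D.tensor.map_cod _)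
      map_one := fun x => Prod.ext (C.tensor.map_one (x.1.1, x.2.1)) (D.tensor.map_one (x.1.2, x.2.2))
      map_two := fun f => Prod.ext (C.tensor.map_two (f.1.1, f.2.1)) (D.tensor.map_two (f.1.2, f.2.2))
      map_comp := fun f g h => Prod.ext
        (C.tensor.map_comp (f.1.1, f.2.1) (g.1.1, g.2.1) (Prod.ext
          (congrArg (fun z => z.1.1) h) (congrArg (fun z => z.2.1) h)))
        (D.tensor.map_comp (f.1.2, f.2.2) (g.1.2, g.2.2) (Prod.ext
          (congrArg (fun z => z.1.2) h) (congrArg (fun z => z.2.2) h)))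
      map_vcomp := fun f g h => Prod.ext
        (C.tensor.map_vcomp (f.1.1, f.2.1) (g.1.1, g.2.1) (Prod.ext
          (congrArg (fun z => z.1.1) h) (congrArg (fun z => z.2.1) h)))
        (D.tensor.map_vcomp (f.1.2, f.2.2) (g.1.2, g.2.2) (Prod.ext
          (congrArg (fun z => z.1.2) h) (congrArg (fun z => z.2.2) h)))
      map_hcomp := fun f g h => Prod.ext
        (C.tensor.map_hcomp (f.1.1, f.2.1) (g.1.1, g.2.1) (Prod.ext
          (congrArg (fun z => z.1.1) h) (congrArg (fun z => z.2.1) h)))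
        (D.tensor.map_hcomp (f.1.2, f.2.2) (g.1.2, g.2.2) (Prod.ext
          (congrArg (fun z => z.1.2) h) (congrArg (fun z => z.2.2) h))) }
  assoc_ob x y z := Prod.ext (C.assoc_ob _ _ _) (D.assoc_ob _ _ _)
  assoc_ar x y z := Prod.ext (C.assoc_ar _ _ _) (D.assoc_ar _ _ _)
  assoc_cell x y z := Prod.ext (C.assoc_cell _ _ _) (D.assoc_cell _ _ _)

/-- The first projection, as a semi-monoidal 2-functor. -/
def fstSMon (C D : SMon2Cat.{u}) : SMonFunctor (prodSMon C D) C where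
  toTwoFunctor := TwoCat.fst C.toTwoCat D.toTwoCat
  map_tOb _ _ := rfl
  map_tAr _ _ := rfl
  map_tCell _ _ := rfl

/-- The second projection, as a semi-monoidal 2-functor. -/
def sndSMon (C D : SMon2Cat.{u}) : SMonFunctor (prodSMon C D) D where
  toTwoFunctor := TwoCat.snd C.toTwoCat D.toTwoCat
  map_tOb _ _ := rfl
  map_tAr _ _ := rfl
  map_tCell _ _ := rfl

end SMon2Cat

/-- A pair of unit data. -/
def UnitData.prod {C D : SMon2Cat.{u}} (d : UnitData C) (e : UnitData D) :
    UnitData (SMon2Cat.prodSMon C D) where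
  I := (d.I, e.I)
  α := (d.α, e.α)
  β := (d.β, e.β)
  A := (d.A, e.A)
  η := (d.η, e.η)
  ε := (d.ε, e.ε)
  α_ar := ⟨Prod.ext d.α_ar.1 e.α_ar.1, Prod.ext d.α_ar.2 e.α_ar.2⟩
  adj :=
    { right_ar := ⟨Prod.ext d.adj.right_ar.1 e.adj.right_ar.1,
        Prod.ext d.adj.right_ar.2 e.adj.right_ar.2⟩
      unit_cell := TwoCat.isCell_prod d.adj.unit_cell e.adj.unit_cell
      counit_cell := TwoCat.isCell_prod d.adj.counit_cell e.adj.counit_cell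
      left_triangle := Prod.ext d.adj.left_triangle e.adj.left_triangle
      right_triangle := Prod.ext d.adj.right_triangle e.adj.right_triangle }
  η_inv := TwoCat.isInv_prod d.η_inv e.η_inv
  ε_inv := TwoCat.isInv_prod d.ε_inv e.ε_inv
  assoc :=
    { cell := TwoCat.isCell_prod d.assoc.cell e.assoc.cell
      inv := TwoCat.isInv_prod d.assoc.inv e.assoc.inv
      pentagon := Prod.ext d.assoc.pentagon e.assoc.pentagon }

namespace Ins

variable (C : SMon2Cat.{u})

/-- The tensor product of equiarrows. -/
noncomputable abbrev pathTransf : TransfData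
    ((TwoCat.inserter (TwoCat.fst C.toTwoCat C.toTwoCat) (TwoCat.snd _ _)).prod
      (TwoCat.inserter (TwoCat.fst C.toTwoCat C.toTwoCat) (TwoCat.snd _ _))) C.toTwoCat :=
  C.tensorTransf (transf _ _) (transf _ _)

theorem isPseudonatural_pathTransf : (pathTransf C).IsPseudonatural
    ((projTensor (B := SMon2Cat.prodSMon C C) _ _).comp (TwoCat.fst _ _))
    ((projTensor (B := SMon2Cat.prodSMon C C) _ _).comp (TwoCat.snd _ _)) :=
  C.isPseudonatural_tensorTransf isPseudonatural_transf isPseudonatural_transf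

theorem isEqui_pathTransf (x) : C.IsEqui ((pathTransf C).app x) :=
  SMon2Cat.isEqui_tAr x.1.isEqui x.2.isEqui

/-- The 2-category of equiarrows of `C`. -/
noncomputable def path : SMon2Cat.{u} :=
  smon (B := SMon2Cat.prodSMon C C) (pathTransf C) (isPseudonatural_pathTransf C)
    (isEqui_pathTransf C) (fun x y z => C.assoc_ar x.ar y.ar z.ar)
    (fun f g h => C.assoc_cell f.cell g.cell h.cell)

/-- The source of an equiarrow. -/
noncomputable def pathFst : SMonFunctor (path C) C :=
  SMonFunctor.comp (smonProj (B := SMon2Cat.prodSMon C C) _ _ _ _ _) (SMon2Cat.fstSMon C C)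

/-- The target of an equiarrow. -/
noncomputable def pathSnd : SMonFunctor (path C) C :=
  SMonFunctor.comp (smonProj (B := SMon2Cat.prodSMon C C) _ _ _ _ _) (SMon2Cat.sndSMon C C)

/-- An equiarrow is determined by its target up to equivalence: a given target component of an arrow
is conjugated to a source component, and that of a 2-cell determines the source component by
cancelling the equiarrow. -/
theorem isEqui2_path_snd {C : TwoCat.{u}} :
    ((proj (TwoCat.fst C C) (TwoCat.snd C C)).comp (TwoCat.snd C C)).IsEqui2 where
  ess_surj y := by
    let x : Ob (TwoCat.fst C C) (TwoCat.snd C C) :=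
      ⟨(y, y), C.one y, ⟨C.src_one y, C.tgt_one y⟩, C.isEqui_one y⟩
    exact ⟨x, C.one y, ⟨C.src_one y, C.tgt_one y⟩, C.isEqui_one y⟩
  hom_ess_surj x x' g hg := by
    have h₁ : C.IsAr x.ar x.ob.1 x.ob.2 := x.isAr
    have h₂ : C.IsAr x'.ar x'.ob.1 x'.ob.2 := x'.isAr
    have hg : C.IsAr g x.ob.2 x'.ob.2 := hg
    obtain ⟨s, hs, hs₁, hs₂, -⟩ := x'.isEqui.exists_inverse
    rw [h₂.2] at hs₂
    have i : C.Iso (C.comp (C.comp x.ar (C.comp g s)) x'.ar) (C.comp x.ar g) := by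
      have i' := TwoCat.Iso.comp (f := C.comp x.ar g) (by grind) (TwoCat.Iso.refl _) hs₂
      have e₁ : C.comp (C.comp x.ar (C.comp g s)) x'.ar =
        C.comp (C.comp x.ar g) (C.comp s x'.ar) := by grind
      rw [C.comp_one_of (by grind)] at i'
      rwa [e₁]
    obtain ⟨a, ha, hai⟩ := i
    exact ⟨(⟨x, x', (C.comp x.ar (C.comp g s), g), a,
      TwoCat.isAr_prod_iff.2 ⟨by grind, hg⟩, ha, hai⟩ : Ar), ⟨rfl, rfl⟩, TwoCat.Iso.refl (C := C) g⟩
  hom_fully_faithful f g hs ht b hb := by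
    have hs : f.src = g.src := hs
    have ht : f.tgt = g.tgt := ht
    have k₁ : C.IsCell f.cell (C.comp f.ar.1 f.tgt.ar) (C.comp f.src.ar f.ar.2) := f.isCell
    have k₂ : C.IsCell g.cell (C.comp g.ar.1 g.tgt.ar) (C.comp g.src.ar g.ar.2) := g.isCell
    have l₁ : C.IsAr f.src.ar f.src.ob.1 f.src.ob.2 := f.src.isAr
    have l₂ : C.IsAr f.tgt.ar f.tgt.ob.1 f.tgt.ob.2 := f.tgt.isAr
    have m₁ := TwoCat.isAr_prod_iff.1 f.isAr
    have m₂ := TwoCat.isAr_prod_iff.1 g.isAr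
    have n₂ := g.isInv
    have n₃ := f.tgt.isEqui
    rw [← hs, ← ht] at k₂ m₂
    have hb : C.IsCell b f.ar.2 g.ar.2 := hb
    have key : ∀ c, C.IsCell c f.ar.1 g.ar.1 → (C.vcomp (C.hcomp c
        (C.two f.tgt.ar)) g.cell = C.vcomp f.cell (C.hcomp (C.two f.src.ar) b) ↔
        C.hcomp c (C.two f.tgt.ar) = C.vcomp (C.vcomp f.cell (C.hcomp (C.two f.src.ar) b))
          (C.inv g.cell)) := by
      intro c hc
      have p₂ : C.cod (C.hcomp c (C.two f.tgt.ar)) = C.dom g.cell := by grind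
      constructor
      · intro h
        rw [← h, C.vcomp_assoc _ _ _ p₂ (by grind), n₂.inv_spec.2.2.1, C.vcomp_two_of p₂]
      · intro h
        rw [h, C.vcomp_assoc _ _ _ (by grind) (by grind), n₂.inv_spec.2.2.2,
          C.vcomp_two_of (by grind)]
    obtain ⟨c, hc, hc'⟩ := n₃.whisker_right_full (f := f.ar.1) (f' := g.ar.1)
      (c := C.vcomp (C.vcomp f.cell (C.hcomp (C.two f.src.ar) b)) (C.inv g.cell)) (by grind)
      (by grind) (by grind) (by grind)
    refine ⟨(⟨f, g, (c, b), hs.symm, ht.symm, TwoCat.isCell_prod hc hb, (key c hc).2 hc'⟩ : Cell),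
      ⟨⟨rfl, rfl⟩, rfl⟩, ?_⟩
    rintro a ⟨⟨ha₁, ha₂⟩, ha₃⟩
    have ha₁ : a.dom = f := ha₁
    have ha₂ : a.cod = g := ha₂
    have ha₃ : a.cell.2 = b := ha₃
    subst ha₁ ha₂ ha₃
    have ha := TwoCat.isCell_prod_iff.1 a.isCell
    refine Cell.ext rfl rfl (Prod.ext ?_ rfl)
    change a.cell.1 = c
    refine n₃.whisker_right_cancel (by grind) (by grind) (by grind) ?_
    rw [hc']
    exact (key _ ha.1).1 a.square

theorem isEqui2_pathSnd : (pathSnd C).IsEqui2 := isEqui2_path_snd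

/-- The universal transformation is a pseudo-natural equivalence from the source projection to the
target projection. -/
theorem isEqui2_pathFst : (pathFst C).IsEqui2 :=
  (isPseudonatural_transf (F := TwoCat.fst C.toTwoCat C.toTwoCat)
    (G := TwoCat.snd C.toTwoCat C.toTwoCat)).isEqui2 (fun x => x.isEqui) isEqui2_path_snd

variable {C}

/-- Two unit data whose underlying idempotents are equivalent are the images of unit data on the
2-category of equiarrows. -/
theorem exists_path {d e : UnitData C} (hd : C.IsIdempotent d.I d.α) {φ : C.Ar}
    (hφ : C.IsAr φ d.I e.I) (hφe : C.IsEqui φ)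
    (hσ : C.Iso (C.comp d.α φ) (C.comp (C.tAr φ φ) e.α)) :
    ∃ p : UnitData (path C), (pathFst C).Carries p d ∧ (pathSnd C).Carries p e := by
  obtain ⟨σ, hσ, hσi⟩ := hσ
  let x : Ob (TwoCat.fst C.toTwoCat C.toTwoCat) (TwoCat.snd _ _) := ⟨(d.I, e.I), φ, hφ, hφe⟩
  let f : Ar (F := TwoCat.fst C.toTwoCat C.toTwoCat) (G := TwoCat.snd _ _) :=
    { src := (path C).tOb x x
      tgt := x
      ar := (d.α, e.α)
      cell := σ
      isAr := (d.prod e).α_ar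
      isCell := hσ
      isInv := hσi }
  have hf : (path C).IsAr f ((path C).tOb x x) x := ⟨rfl, rfl⟩
  -- The associator of `e` lifts along the target projection to an associator for the equiarrow. Its
  -- source component is an associator for `d.α`, hence equal to `d.A` by uniqueness. The 2-cell `σ`
  -- can thus be arbitrary.
  obtain ⟨A, hA, hA'⟩ := (isEqui2_pathSnd C).exists_cell (f := (path C).obAr x f)
    (f' := (path C).arOb f x) ((path C).assoc_ob x x x).symm rfl (b := e.A) e.assoc.cell
  have hAs : (path C).IsAssociator x f A :=
    { cell := hA
      inv := (isEqui2_pathSnd C).isInv_reflect (by rw [hA']; exact e.assoc.inv)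
      pentagon := by
        have h₁ := SMon2Cat.isCell_pentagonLeft hf hA
        have h₂ := SMon2Cat.isCell_pentagonRight hf hA
        have e₁ := (pathSnd C).map_pentagonLeft hf hA
        have e₂ := (pathSnd C).map_pentagonRight hf hA
        rw [hA'] at e₁ e₂
        exact (isEqui2_pathSnd C).cell_ext (h₁.1.trans h₂.1.symm) (h₁.2.trans h₂.2.symm)
          (e₁.trans (Eq.trans e.assoc.pentagon e₂.symm)) }
  have hA₁ : (pathFst C).cell A = d.A := by
    refine hd.associator_unique ⟨?_, (pathFst C).map_isInv hAs.inv, ?_⟩ d.assoc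
    · have h₁ := (pathFst C).map_dom A
      have h₂ := (pathFst C).map_cod A
      rw [hA.1] at h₁
      rw [hA.2] at h₂
      exact ⟨h₁, h₂⟩
    · have e₁ := (pathFst C).map_pentagonLeft hf hA
      have e₂ := (pathFst C).map_pentagonRight hf hA
      exact e₁.symm.trans (Eq.trans (congrArg (pathFst C).cell hAs.pentagon) e₂)
  obtain ⟨p, hp, -⟩ := exists_unitData (B := SMon2Cat.prodSMon C C) (t := pathTransf C)
    (ht := isPseudonatural_pathTransf C) (he := isEqui_pathTransf C)
    (hob := fun x y z => C.assoc_ar x.ar y.ar z.ar)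
    (har := fun f g h => C.assoc_cell f.cell g.cell h.cell) (d.prod e) (u := φ) (κ := σ) hφ hφe hσ
    hσi (by
      rintro ⟨y, u, hu, hue⟩ ⟨s, t, g, κ, hg, hκ, hκi⟩ h₁ h₂ h₃ h₄ h₅ h₆
      dsimp only at h₁ h₂ h₃ h₄ h₅ h₆
      subst h₁ h₂ h₃ h₄ h₅ h₆
      clear hAs
      obtain ⟨A₁, A₂, ⟨A₃, A₄⟩, p₁, p₂, p₃, p₄⟩ := A
      have q₁ : A₁ = (path C).obAr x f := hA.1
      have q₂ : A₂ = (path C).arOb f x := hA.2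
      have q₃ : A₃ = d.A := hA₁
      have q₄ : A₄ = e.A := hA'
      subst q₁ q₂ q₃ q₄
      exact p₄)
  exact ⟨p, hp.comp (G := SMon2Cat.fstSMon C C) (e := d) ⟨rfl, rfl, rfl, rfl, rfl, rfl⟩,
    hp.comp (G := SMon2Cat.sndSMon C C) (e := e) ⟨rfl, rfl, rfl, rfl, rfl, rfl⟩⟩

end Ins

/-! ### Fair monoids obtained by interpreting the free object -/

namespace SMonFunctor

variable {C D : SMon2Cat.{u}}

theorem isEqui2_tensorLeft_reflect {F : SMonFunctor C D} (hF : F.IsEqui2) {x : C.Ob}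
    (h : (D.tensorLeft (F.ob x)).IsEqui2) : (C.tensorLeft x).IsEqui2 := by
  refine TwoFunctor.IsEqui2.of_comp (G := F.toTwoFunctor) ?_ hF
  rw [F.tensorLeft_comp]
  exact hF.comp h

theorem isEqui2_tensorRight_reflect {F : SMonFunctor C D} (hF : F.IsEqui2) {x : C.Ob}
    (h : (D.tensorRight (F.ob x)).IsEqui2) : (C.tensorRight x).IsEqui2 :=
  isEqui2_tensorLeft_reflect (F := F.rev) hF h

end SMonFunctor

theorem SMon2Cat.IsIdempotent.exists_unitData {C : SMon2Cat.{u}} {I : C.Ob} {α : C.Ar}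
    (h : C.IsIdempotent I α) : ∃ d : UnitData C, d.I = I ∧ d.α = α := by
  obtain ⟨A, hA⟩ := h.exists_associator
  obtain ⟨β, η, ε, hadj, hη, hε⟩ := h.equi.exists_adjunction
  exact ⟨⟨I, α, β, A, η, ε, h.ar, hadj, hη, hε, hA⟩, rfl, rfl⟩

theorem UnitData.IsFor.isIdempotent {C : SMon2Cat.{u}} {d : UnitData C} {W : WeakUnit C}
    (h : d.IsFor W) : C.IsIdempotent d.I d.α := by
  rw [h.1, h.2]
  exact W.isIdempotent

theorem WeakUnit.exists_isFor {C : SMon2Cat.{u}} (W : WeakUnit C) :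
    ∃ d : UnitData C, d.IsFor W := W.isIdempotent.exists_unitData

namespace FreeUnit

variable {C : SMon2Cat.{u}}

theorem isFairMonoid {J : SMonFunctor free C} {d : UnitData C} (hJ : J.Carries gen d)
    (hl : (C.tensorLeft d.I).IsEqui2) (hr : (C.tensorRight d.I).IsEqui2) : IsFairMonoid J :=
  isFairMonoid_of_cancellable isContractible_free J gen.I (by rw [hJ.map_I]; exact hl)
    (by rw [hJ.map_I]; exact hr)

/-- Equivalent idempotents give equivalent fair monoids. -/
theorem equivalent_of_iso {d e : UnitData C} {J K : SMonFunctor free C} (hJ : J.Carries gen d)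
    (hK : K.Carries gen e) (j : IsFairMonoid J) (k : IsFairMonoid K) {φ : C.Ar}
    (hφ : C.IsAr φ d.I e.I) (hφe : C.IsEqui φ)
    (hσ : C.Iso (C.comp d.α φ) (C.comp (C.tAr φ φ) e.α)) :
    (FairMonoid.mk free C J j).Equivalent (FairMonoid.mk free C K k) := by
  have hd : C.IsIdempotent d.I d.α := by
    have := j.isIdempotent gen.α_ar
    rwa [hJ.map_I, hJ.map_α] at this
  -- By freeness `J` and `K` factor through the interpretation of `p` in the equiarrows of `C`,
  -- followed by source and target. These projections are equi-2-functors and form the zigzag; the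
  -- source projection also reflects the cancellability of the unit.
  obtain ⟨p, hp, hq⟩ := Ins.exists_path hd hφ hφe hσ
  have m : IsFairMonoid (interpret p) := isFairMonoid (carries_interpret p)
    (SMonFunctor.isEqui2_tensorLeft_reflect (Ins.isEqui2_pathFst C) (by rw [hp.map_I]; exact hd.left))
    (SMonFunctor.isEqui2_tensorRight_reflect (Ins.isEqui2_pathFst C)
      (by rw [hp.map_I]; exact hd.right))
  have e₁ := eq_of_carries ((carries_interpret p).comp hp) hJ
  have e₂ := eq_of_carries ((carries_interpret p).comp hq) hK
  refine .trans _ (FairMonoid.mk free (Ins.path C) (interpret p) m) _ (.symm _ _ (.rel _ _ ?_))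
    (.rel _ _ ?_)
  · exact ⟨SMonFunctor.id _, Ins.pathFst C, congrArg SMonFunctor.toTwoFunctor e₁,
      TwoFunctor.isEqui2_id _, Ins.isEqui2_pathFst C⟩
  · exact ⟨SMonFunctor.id _, Ins.pathSnd C, congrArg SMonFunctor.toTwoFunctor e₂,
      TwoFunctor.isEqui2_id _, Ins.isEqui2_pathSnd C⟩

/-- A fair monoid that induces a weak unit is equivalent to the one interpreting the generators of
the free semi-monoidal 2-category by data for the weak unit. -/
theorem equivalent_of_induces {W : WeakUnit C} {d : UnitData C} (hd : d.IsFor W)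
    {J : SMonFunctor free C} (hJ : J.Carries gen d) (j : IsFairMonoid J) {U : SMon2Cat.{u}}
    {K : SMonFunctor U C} (k : IsFairMonoid K) (h : (FairMonoid.mk U C K k).Induces W) :
    (FairMonoid.mk free C J j).Equivalent (FairMonoid.mk U C K k) := by
  obtain ⟨I, α, hα, hW⟩ := h
  have hα : U.IsAr α (U.tOb I I) I := hα
  have hW : W.ComesFrom (K.ob I) (K.ar α) := hW
  have hi := k.isIdempotent hα
  -- The given `α` extends to unit data in `U`, so there is a map from the free object to `U`, an
  -- equimorphism because both are contractible. The composite to `C` is then compared with `J`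
  -- through `φ = 1` and `λ_I ≅ α`.
  obtain ⟨p, rfl, rfl⟩ :=
    (SMon2Cat.isIdempotent_of_contractible k.contractible hα).exists_unitData
  have m : IsFairMonoid ((interpret p).comp K) :=
    isFairMonoid ((carries_interpret p).comp (K.carries_map p)) hi.left hi.right
  refine .trans _ (FairMonoid.mk free C ((interpret p).comp K) m) _ ?_ (.rel _ _ ?_)
  · have e := hW.iso hi
    have e₁ : d.I = K.ob p.I := hd.1.trans hW.1
    have a₁ := d.α_ar
    have a₂ := hi.ar
    refine equivalent_of_iso hJ ((carries_interpret p).comp (K.carries_map p)) j m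
      (φ := C.one d.I) ?_ (C.isEqui_one _) ?_
    · change C.IsAr _ _ (K.ob p.I)
      grind
    · change C.Iso _ (C.comp _ (K.ar p.α))
      rw [C.comp_one_of (by grind), C.tAr_one, C.one_comp_of (by grind), hd.2]
      exact e
  · exact ⟨interpret p, SMonFunctor.id C, rfl,
      isContractible_free.isEqui2 k.contractible _, TwoFunctor.isEqui2_id _⟩

end FreeUnit

/-! ### Equivalence of fair monoids and equivalence of weak units -/

namespace FairMonoid

theorem exists_induces (X : FairMonoid.{u}) : ∃ W, X.Induces W := by
  obtain ⟨I⟩ := X.isFair.contractible.nonempty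
  obtain ⟨α, hα⟩ := X.isFair.contractible.exists_ar (X.U.tOb I I) I
  have hi := X.isFair.isIdempotent hα
  choose l L h using SMon2Cat.exists_left hi.left hi.ar
  choose r R h' using SMon2Cat.exists_left (C := X.C.rev) hi.right hi.ar
  obtain ⟨n, hn, -⟩ := SMon2Cat.existsUnique_leftConstraint hi.left hi.ar h
  obtain ⟨m, hm, -⟩ := SMon2Cat.existsUnique_leftConstraint (C := X.C.rev) hi.right hi.ar h'
  obtain ⟨W, h₁, h₂, h₃⟩ := SMon2Cat.exists_weakUnit hi hn (SMon2Cat.isLeftConstraint_rev.1 hm)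
    (hn.isEqui hi.left hi.equi) (hm.isEqui hi.right hi.equi)
  exact ⟨W, I, α, hα, h₁, ⟨L, by rw [h₂]; exact hn⟩, R,
    by rw [h₃]; exact SMon2Cat.isLeftConstraint_rev.1 hm⟩

/-- A morphism of fair monoids is compatible with the weak units that they induce. -/
theorem nonempty_unitComparison {X Y : FairMonoid.{u}} {W : WeakUnit X.C} {V : WeakUnit Y.C}
    (hW : X.Induces W) (hV : Y.Induces V) (e : SMonFunctor X.U Y.U) (F : SMonFunctor X.C Y.C)
    (h : X.J.toTwoFunctor.comp F.toTwoFunctor = e.toTwoFunctor.comp Y.J.toTwoFunctor) :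
    Nonempty (UnitComparison F W V) := by
  obtain ⟨I, α, hα, hW⟩ := hW
  obtain ⟨I', α', hα', hV⟩ := hV
  have h₁ : ∀ x, F.ob (X.J.ob x) = Y.J.ob (e.ob x) := congrFun (congrArg TwoFunctor.ob h)
  have h₂ : ∀ f, F.ar (X.J.ar f) = Y.J.ar (e.ar f) := congrFun (congrArg TwoFunctor.ar h)
  have hY := Y.isFair.contractible
  have i₁ := hW.iso (X.isFair.isIdempotent hα)
  have i₂ := hV.iso (Y.isFair.isIdempotent hα')
  have k₁ := hW.1
  have k₂ := hV.1
  -- Contractibility of `Y.U` supplies both ingredients: an equiarrow between the two units, and an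
  -- isomorphism between the two arrows from `I' ⊗ I'` to the image of `I`.
  obtain ⟨f, hf⟩ := hY.exists_ar I' (e.ob I)
  have a₁ := V.lam_ar V.I
  have a₂ := W.lam_ar W.I
  have a₃ : Y.U.IsAr (e.ar α) (Y.U.tOb (e.ob I) (e.ob I)) (e.ob I) := by grind
  have a₄ : Y.C.IsAr (Y.J.ar f) V.I (F.ob W.I) := by grind
  have c : Y.U.Iso (Y.U.comp α' f) (Y.U.comp (Y.U.tAr f f) (e.ar α)) :=
    hY.iso (by grind) (by grind)
  have c' := Y.J.map_iso c
  have e₁ : Y.J.ar (Y.U.comp α' f) = Y.C.comp (Y.J.ar α') (Y.J.ar f) := by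
    rw [Y.J.map_comp]; grind
  have e₂ : Y.J.ar (Y.U.comp (Y.U.tAr f f) (e.ar α)) =
      Y.C.comp (Y.C.tAr (Y.J.ar f) (Y.J.ar f)) (F.ar (X.J.ar α)) := by
    rw [Y.J.map_comp, Y.J.map_tAr, h₂]; grind
  rw [e₁, e₂] at c'
  refine _root_.nonempty_unitComparison (φ := Y.J.ar f) a₄ (Y.J.map_isEqui (hY.isEqui f)) ?_
  refine (TwoCat.Iso.comp (by grind) i₂ (TwoCat.Iso.refl _)).trans (c'.trans ?_)
  refine (TwoCat.Iso.comp (by grind) (TwoCat.Iso.refl _) (F.map_iso i₁)).symm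

/-- Induction on the zigzag, with the induced weak units at both ends left arbitrary; at an
intermediate fair monoid some induced weak unit is chosen. The reflexive case is not trivial, as it
compares two weak units induced by the same fair monoid. -/
theorem equivalent_of_equivalent {X Y : FairMonoid.{u}} (h : X.Equivalent Y) :
    ∀ {W : WeakUnit X.C} {V : WeakUnit Y.C}, X.Induces W → Y.Induces V →
      (Mon2Cat.mk X.C W).Equivalent (Mon2Cat.mk Y.C V) := by
  induction h with
  | rel X Y h =>
    intro W V hW hV
    obtain ⟨e, F, h, -, hF⟩ := h
    exact .rel _ _ ⟨F, hF, nonempty_unitComparison hW hV e F h⟩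
  | refl X =>
    intro W V hW hV
    exact .rel _ _ ⟨SMonFunctor.id _, TwoFunctor.isEqui2_id _,
      nonempty_unitComparison hW hV (SMonFunctor.id _) (SMonFunctor.id _) rfl⟩
  | symm X Y _ ih =>
    intro W V hW hV
    exact .symm _ _ (ih hV hW)
  | trans X Y Z _ _ ih₁ ih₂ =>
    intro W V hW hV
    obtain ⟨T, hT⟩ := Y.exists_induces
    exact .trans _ _ _ (ih₁ hW hT) (ih₂ hT hV)

end FairMonoid

namespace UnitComparison

variable {C D : SMon2Cat.{u}} {F : SMonFunctor C D} {W : WeakUnit C} {V : WeakUnit D}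

/-- `λ'_{I'} ; φ ≅ (φ ⊗ φ) ; F λ_I`. -/
theorem iso (c : UnitComparison F W V) : D.Iso (D.comp (V.lam.app V.I) c.φ)
    (D.comp (D.tAr c.φ c.φ) (F.ar (W.lam.app W.I))) := by
  have h₁ := c.φ_ar
  have h₂ := V.lam_ar V.I
  have h₃ := V.lam_ar (F.ob W.I)
  have h₄ := W.lam_ar W.I
  have i₁ : D.Iso (D.comp (D.tAr (D.one V.I) c.φ) (V.lam.app (F.ob W.I)))
      (D.comp (V.lam.app V.I) c.φ) := by
    have n := V.lam_nat.nat_cell c.φ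
    rw [h₁.1, h₁.2] at n
    exact ⟨_, n, V.lam_nat.nat_inv _⟩
  have i₂ : D.Iso (V.lam.app (F.ob W.I)) (D.comp (D.tAr c.φ (D.one (F.ob W.I)))
      (F.ar (W.lam.app W.I))) := ⟨_, c.γ_mod.cell W.I, c.γ_mod.inv _⟩
  have e : D.comp (D.tAr (D.one V.I) c.φ) (D.comp (D.tAr c.φ (D.one (F.ob W.I)))
      (F.ar (W.lam.app W.I))) = D.comp (D.tAr c.φ c.φ) (F.ar (W.lam.app W.I)) := by
    rw [← D.comp_assoc _ _ _ (by grind) (by grind), D.tAr_comp (by grind) (by grind),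
      D.one_comp_of (by grind), D.comp_one_of (by grind)]
  rw [← e]
  exact i₁.symm.trans (TwoCat.Iso.comp (by grind) (TwoCat.Iso.refl _) i₂)

end UnitComparison

-- Induction on the zigzag, with the data at both ends left arbitrary. For a monoidal equi-2-functor
-- `F`, the fair monoids `J` and `J ; F` are equimorphic over the identity of the free object, and
-- the equiarrow `φ` of the comparison relates `J ; F` to `K` by `UnitComparison.iso`. At an
-- intermediate stage some unit data for the weak unit are chosen.
open FreeUnit in
theorem Mon2Cat.Equivalent.interpret {M N : Mon2Cat.{u}} (h : M.Equivalent N) :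
    ∀ {d : UnitData M.C} {e : UnitData N.C} {J : SMonFunctor free M.C} {K : SMonFunctor free N.C}
      (j : IsFairMonoid J) (k : IsFairMonoid K), J.Carries gen d → K.Carries gen e →
      d.IsFor M.unit → e.IsFor N.unit →
      (FairMonoid.mk free M.C J j).Equivalent (FairMonoid.mk free N.C K k) := by
  induction h with
  | rel M N h =>
    intro d e J K j k hJ hK hd he
    obtain ⟨F, hF, ⟨c⟩⟩ := h
    have c₁ := c.φ_ar
    have hl : (N.C.tensorLeft (F.ob M.unit.I)).IsEqui2 :=
      IsRightComparison.isEqui2_tensorLeft_of_equi c₁ c.φ_equi N.unit.isEqui2_tensorLeft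
    have hr : (N.C.tensorRight (F.ob M.unit.I)).IsEqui2 :=
      IsRightComparison.isEqui2_tensorLeft_of_equi (D := N.C.rev) c₁ c.φ_equi
        N.unit.isEqui2_tensorRight
    have hJF := hJ.comp (F.carries_map d)
    have m : IsFairMonoid (J.comp F) := FreeUnit.isFairMonoid hJF
      (by change (N.C.tensorLeft (F.ob d.I)).IsEqui2; rw [hd.1]; exact hl)
      (by change (N.C.tensorRight (F.ob d.I)).IsEqui2; rw [hd.1]; exact hr)
    refine .trans _ (FairMonoid.mk free N.C (J.comp F) m) _ (.rel _ _ ?_) (.symm _ _ ?_)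
    · exact ⟨SMonFunctor.id _, F, rfl, TwoFunctor.isEqui2_id _, hF⟩
    · refine equivalent_of_iso hK hJF k m (φ := c.φ) ?_ c.φ_equi ?_
      · change N.C.IsAr _ _ (F.ob d.I)
        rw [hd.1, he.1]
        exact c₁
      · change N.C.Iso _ (N.C.comp _ (F.ar d.α))
        rw [hd.2, he.2]
        exact c.iso
  | refl M =>
    intro d e J K j k hJ hK hd he
    have h₁ : e.I = d.I := he.1.trans hd.1.symm
    have h₂ : e.α = d.α := he.2.trans hd.2.symm
    have a := d.α_ar
    refine equivalent_of_iso hJ hK j k (φ := M.C.one d.I) (by grind) (M.C.isEqui_one _) ?_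
    rw [h₂, M.C.comp_one_of (by grind), M.C.tAr_one, M.C.one_comp_of (by grind)]
    exact .refl _
  | symm M N _ ih =>
    intro d e J K j k hJ hK hd he
    exact .symm _ _ (ih k j hK hJ he hd)
  | trans M N L _ _ ih₁ ih₂ =>
    intro d e J K j k hJ hK hd he
    obtain ⟨p, hp⟩ := N.unit.exists_isFor
    have hi := hp.isIdempotent
    have m := FreeUnit.isFairMonoid (carries_interpret p) hi.left hi.right
    exact .trans _ _ _ (ih₁ j m hJ (carries_interpret p) hd hp)
      (ih₂ m k (carries_interpret p) hK hp he)

-- For the reverse implication, each fair monoid is replaced by the interpretation of the free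
-- object at data for its weak unit, to which it is equivalent. The zigzag of weak units then gives
-- a zigzag of these interpretations.
open FreeUnit in
theorem FairMonoid.equivalent_iff {X Y : FairMonoid.{u}} {W : WeakUnit X.C} {V : WeakUnit Y.C}
    (hW : X.Induces W) (hV : Y.Induces V) :
    X.Equivalent Y ↔ (Mon2Cat.mk X.C W).Equivalent (Mon2Cat.mk Y.C V) := by
  refine ⟨fun h => equivalent_of_equivalent h hW hV, fun h => ?_⟩
  obtain ⟨d, hd⟩ := W.exists_isFor
  obtain ⟨e, he⟩ := V.exists_isFor
  have j := FreeUnit.isFairMonoid (carries_interpret d) hd.isIdempotent.left hd.isIdempotent.right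
  have k := FreeUnit.isFairMonoid (carries_interpret e) he.isIdempotent.left he.isIdempotent.right
  exact .trans _ _ _ (.symm _ _ (equivalent_of_induces hd (carries_interpret d) j X.isFair hW))
    (.trans _ _ _ (h.interpret j k (carries_interpret d) (carries_interpret e) hd he)
      (equivalent_of_induces he (carries_interpret e) k Y.isFair hV))

theorem proposition6p1 :
    -- From fair monoids to weak units.
    (∀ (X : FairMonoid.{u}) (I : X.U.Ob),
      -- there is an arrow `α : I ⊗ I ⟶ I` in `U`, and for each such arrow:
      (∃ α, X.U.IsAr α (X.U.tOb I I) I) ∧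
      ∀ α, X.U.IsAr α (X.U.tOb I I) I →
        -- it is an equiarrow, uniquely isomorphic to any other one,
        X.U.IsEqui α ∧
        (∀ α', X.U.IsAr α' (X.U.tOb I I) I →
          ∃ a, X.U.IsCell a α α' ∧ X.U.IsInv a ∧ ∀ b, X.U.IsCell b α α' → b = a) ∧
        -- it has a unique associator, satisfying the pentagon equation,
        (∃! A, X.U.IsAssociator I α A) ∧
        -- the left constraints exist, are natural, and are unique up to unique isomorphism,
        (∀ x, ∃ l L, X.C.IsAr l (X.C.tOb (X.J.ob I) x) x ∧
          X.C.IsCell L (X.C.obAr (X.J.ob I) l) (X.C.arOb (X.J.ar α) x) ∧ X.C.IsInv L) ∧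
        (∀ (l : X.C.Ob → X.C.Ar) (L : X.C.Ob → X.C.Cell),
          (∀ x, X.C.IsAr (l x) (X.C.tOb (X.J.ob I) x) x ∧
            X.C.IsCell (L x) (X.C.obAr (X.J.ob I) (l x)) (X.C.arOb (X.J.ar α) x) ∧
            X.C.IsInv (L x)) →
          (∀ x, X.C.IsEqui (l x)) ∧
          ∃! n : X.C.Ar → X.C.Cell, X.C.IsLeftConstraint (X.J.ob I) (X.J.ar α) ⟨l, n⟩ L) ∧
        (∀ lam L lam' L', X.C.IsLeftConstraint (X.J.ob I) (X.J.ar α) lam L →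
          X.C.IsLeftConstraint (X.J.ob I) (X.J.ar α) lam' L' →
          ∃! m : X.C.Ob → X.C.Cell,
            TransfData.IsInvModification (X.C.tensorLeft (X.J.ob I)) (TwoFunctor.id _)
              lam lam' m ∧
            ∀ x, X.C.vcomp (X.C.obCell (X.J.ob I) (m x)) (L' x) = L x) ∧
        -- and so do and are the right constraints,
        (∀ x, ∃ r R, X.C.IsAr r (X.C.tOb x (X.J.ob I)) x ∧
          X.C.IsCell R (X.C.arOb r (X.J.ob I)) (X.C.obAr x (X.J.ar α)) ∧ X.C.IsInv R) ∧
        (∀ (r : X.C.Ob → X.C.Ar) (R : X.C.Ob → X.C.Cell),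
          (∀ x, X.C.IsAr (r x) (X.C.tOb x (X.J.ob I)) x ∧
            X.C.IsCell (R x) (X.C.arOb (r x) (X.J.ob I)) (X.C.obAr x (X.J.ar α)) ∧
            X.C.IsInv (R x)) →
          (∀ x, X.C.IsEqui (r x)) ∧
          ∃! n : X.C.Ar → X.C.Cell, X.C.IsRightConstraint (X.J.ob I) (X.J.ar α) ⟨r, n⟩ R) ∧
        (∀ rho R rho' R', X.C.IsRightConstraint (X.J.ob I) (X.J.ar α) rho R →
          X.C.IsRightConstraint (X.J.ob I) (X.J.ar α) rho' R' →
          ∃! m : X.C.Ob → X.C.Cell,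
            TransfData.IsInvModification (X.C.tensorRight (X.J.ob I)) (TwoFunctor.id _)
              rho rho' m ∧
            ∀ x, X.C.vcomp (X.C.cellOb (m x) (X.J.ob I)) (R' x) = R x) ∧
        -- and any choice of left and right constraints extends to a weak unit.
        (∀ lam L rho R, X.C.IsLeftConstraint (X.J.ob I) (X.J.ar α) lam L →
          X.C.IsRightConstraint (X.J.ob I) (X.J.ar α) rho R →
          ∃ W : WeakUnit X.C, W.I = X.J.ob I ∧ W.lam = lam ∧ W.rho = rho)) ∧
    -- Every fair monoid induces a weak unit, and all choices lead to equivalent results.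
    (∀ X : FairMonoid.{u}, (∃ W, X.Induces W) ∧
      ∀ W W', X.Induces W → X.Induces W' →
        Nonempty (UnitComparison (SMonFunctor.id X.C) W W')) ∧
    -- From weak units to fair monoids, through the free semi-monoidal 2-category `𝔽`.
    (∃ (𝔽 : SMon2Cat.{u}) (g : UnitData 𝔽), g.IsFree ∧ 𝔽.IsContractible ∧
      (∀ (C : SMon2Cat.{u}) (W : WeakUnit C),
        (C.tensorLeft W.I).IsEqui2 ∧ (C.tensorRight W.I).IsEqui2 ∧
        (∃! A, C.IsAssociator W.I (W.lam.app W.I) A) ∧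
        (∃ d : UnitData C, d.IsFor W) ∧
        ∀ d : UnitData C, d.IsFor W → ∀ J : SMonFunctor 𝔽 C, J.Carries g d →
          ∃ h : IsFairMonoid J,
            -- one gets back the given weak unit,
            (FairMonoid.mk 𝔽 C J h).Induces W ∧
            -- and any fair monoid that induces it.
            ∀ (U : SMon2Cat.{u}) (J' : SMonFunctor U C) (h' : IsFairMonoid J'),
              (FairMonoid.mk U C J' h').Induces W →
              (FairMonoid.mk 𝔽 C J h).Equivalent (FairMonoid.mk U C J' h'))) ∧
    -- The correspondence respects and reflects equivalence.
    (∀ (X Y : FairMonoid.{u}) (W : WeakUnit X.C) (V : WeakUnit Y.C),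
      X.Induces W → Y.Induces V →
        (X.Equivalent Y ↔ (Mon2Cat.mk X.C W).Equivalent (Mon2Cat.mk Y.C V))) := by
  refine ⟨fun X I => ?_, fun X => ⟨X.exists_induces, fun W W' hW hW' =>
    FairMonoid.nonempty_unitComparison hW hW' (SMonFunctor.id _) (SMonFunctor.id _) rfl⟩,
    ⟨FreeUnit.free, FreeUnit.gen, FreeUnit.isFree_gen, FreeUnit.isContractible_free,
      fun C W => ⟨W.isEqui2_tensorLeft, W.isEqui2_tensorRight,
        W.isIdempotent.existsUnique_associator, W.exists_isFor, fun d hd J hJ => ?_⟩⟩,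
    fun X Y W V hW hV => FairMonoid.equivalent_iff hW hV⟩
  · have hU := X.isFair.contractible
    refine ⟨hU.exists_ar _ _, fun α hα => ?_⟩
    have hi := X.isFair.isIdempotent hα
    refine ⟨hU.isEqui α, fun α' hα' => ?_,
      (SMon2Cat.isIdempotent_of_contractible hU hα).existsUnique_associator,
      SMon2Cat.exists_left hi.left hi.ar,
      fun l L h => ⟨fun x => SMon2Cat.isEqui_left hi.left hi.equi (h x).2.1 (h x).2.2,
        SMon2Cat.existsUnique_leftConstraint hi.left hi.ar h⟩,
      fun lam L lam' L' h h' => SMon2Cat.existsUnique_leftModification hi.left hi.ar h h',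
      -- The statements on right constraints are those on left constraints for the reversed tensor
      -- product.
      SMon2Cat.exists_left (C := X.C.rev) hi.right hi.ar,
      fun r R h => ⟨fun x => SMon2Cat.isEqui_left (C := X.C.rev) hi.right hi.equi (h x).2.1 (h x).2.2,
        ?_⟩,
      fun rho R rho' R' h h' => SMon2Cat.existsUnique_leftModification (C := X.C.rev) hi.right hi.ar
        (SMon2Cat.isLeftConstraint_rev.2 h) (SMon2Cat.isLeftConstraint_rev.2 h'),
      fun lam L rho R hl hr => SMon2Cat.exists_weakUnit hi hl hr (hl.isEqui hi.left hi.equi)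
        ((SMon2Cat.isLeftConstraint_rev.2 hr).isEqui hi.right hi.equi)⟩
    · obtain ⟨a, ha⟩ := hU.exists_cell (f := α) (g := α') (by grind) (by grind)
      exact ⟨a, ha, hU.isInv a, fun b hb => hU.cell_ext (by grind) (by grind)⟩
    · obtain ⟨n, hn, hu⟩ := SMon2Cat.existsUnique_leftConstraint (C := X.C.rev) hi.right hi.ar h
      exact ⟨n, SMon2Cat.isLeftConstraint_rev.1 hn,
        fun m hm => hu m (SMon2Cat.isLeftConstraint_rev.2 hm)⟩
  · have hi := hd.isIdempotent
    have j : IsFairMonoid J := FreeUnit.isFairMonoid hJ hi.left hi.right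
    refine ⟨j, ⟨FreeUnit.gen.I, FreeUnit.gen.α, FreeUnit.gen.α_ar, ?_⟩,
      fun U J' h' hW => FreeUnit.equivalent_of_induces hd hJ j h' hW⟩
    have e₁ : J.ob FreeUnit.gen.I = W.I := hJ.map_I.trans hd.1
    have e₂ : J.ar FreeUnit.gen.α = W.lam.app W.I := hJ.map_α.trans hd.2
    change W.ComesFrom (J.ob FreeUnit.gen.I) (J.ar FreeUnit.gen.α)
    rw [e₁, e₂]
    exact W.comesFrom
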